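/- **Setting.** For each $N$ let $W=W^*\in\mathbb C^{N\times N}$ be a Wigner matrix: the entries $w_{ij}$, $i\le j$, are independent, $w_{ij}\overset{d}{=}N^{-1/2}\chi_{\rm od}$ for $i<j$ and $w_{jj}\overset{d}{=}N^{-1/2}\chi_{\rm d}$, where $\chi_{\rm d}$ is real, $\chi_{\rm od}$ is real or complex, both are centered, $\mathbf E|\chi_{\rm od}|^2=1$, and $\mathbf E|\chi_{\rm d}|^p+\mathbf E|\chi_{\rm od}|^p\le C_p$ for all integers $p\ge 1$. Let $H_0=H_0^{(N)}$ be deterministic, self-adjoint, $\|H_0\|\le C_{H_0}$. Let $\rho_0:\mathbb R\to[0,\infty)$ be measurable, compactly supported, $\int\rho_0=1$, with Stieltjes transform $m_0(z)=\int\rho_0(x)(x-z)^{-1}\,dx$, and let $\epsilon_0(N),\eta_0(N)>0$ be sequences tending to $0$ such that $\frac1N\operatorname{Tr}(H_0-z)^{-1}=m_0(z)+\mathcal O(\epsilon_0(N))$ uniformly in $|\operatorname{Im}z|\ge\eta_0(N)$. Let $E_0\in\operatorname{supp}\rho_0$ be such that, for some $\kappa_0,c_0>0$, $\inf_{|y-E_0|\le\kappa_0}\rho_0(y)>c_0$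 and $\rho_0\in C^{1,1}$ on $J=[E_0-\kappa_0,E_0+\kappa_0]$ with $\|\rho_0\|_{C^{1,1}(J)}\le 1/c_0$. Let $0<\Delta<\kappa_0/2$ and let $\psi_0\in\mathbb C^N$ satisfy $\|\psi_0\|=1$, $\langle\psi_0,H_0\psi_0\rangle=E_0$ and $\mathbf 1_{[E_0-\Delta,E_0+\Delta]}(H_0)\psi_0=\psi_0$. For $\lambda\in\mathbb R$, $t\ge0$ set $H_\lambda=H_0+\lambda W$ and $$\mathfrak M(t)=\big|\langle\psi_0,e^{itH_\lambda}e^{-itH_0}\psi_0\rangle\big|^2 .$$ Here $X\prec Y$ (also $X=\mathcal O_\prec(Y)$), for families of non-negative random variables depending on $N$ and on a parameter $u$, means: for all $\xi,D>0$ there is $N_0(\xi,D)$ such that $\mathbf P[X>N^{\xi}Y]\le N^{-D}$ for all $N\ge N_0(\xi,D)$ and all $u$. A relation $X=a+\mathcal O(b)+\mathcal O_\prec(Y)$ means $(|X-a|-Kb)_+\prec Y$ for some constant $K$ (the implicit constant). **Theorem (Loschmidt echo with a single deformation).** (i) (Short-time parabolic decay.) As $t\to0$, $$\mathfrak M(t)=1-\lambda^2t^2+\mathcal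 O(\lambda^2t^3)+\mathcal O_\prec(N^{-1/2}),$$ where the implicit constant $K$ and the thresholds $N_0(\xi,D)$ depend only on $C_{H_0}$ and the $C_p$. More precisely, for every $L>0$ there is $t_0>0$, depending only on $L$, $C_{H_0}$ and the $C_p$, such that this holds with the same $K,N_0$ for all $0\le t\le t_0$ and $|\lambda|\le L$. (ii) (Intermediate-time asymptotic decay.) For all $t\ge0$, $$\mathfrak M(t)=e^{-2\pi\rho_0(E_0)\lambda^2t}+\mathcal O(\mathcal E)+\mathcal O_\prec\big(C(t,\lambda)/\sqrt N\big),$$ where $C(t,\lambda)>0$ depends only on $t$ and $\lambda$, and $$\mathcal E=\mathcal E(\lambda,t,\Delta,N)=\lambda^2t\,\Delta+|\lambda|(1+\lambda^2t)+\frac{|\lambda|}{\Delta}\Big(1+\frac{|\lambda|}{\Delta}\Big)+\lambda^2t\,\epsilon_0(N).$$ The implicit constant in $\mathcal O(\mathcal E)$ depends only on $C_{H_0},\kappa_0,c_0$ and the $C_p$; the thresholds $N_0(\xi,D)$ in $\mathcal O_\prec$ do not depend on $t$, on the matrices $H_0$, on the state $\psi_0$ or on the law of $W$ within the given bounds, but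 may depend on $\lambda$ and on $\Delta,E_0,\rho_0$, the sequences $\epsilon_0,\eta_0$, the implicit constant in the assumption on $\operatorname{Tr}(H_0-z)^{-1}$, and on $C_{H_0},\kappa_0,c_0,C_p$. For every fixed $T>0$, $$\lim_{\Delta\to0}\ \lim_{\substack{t\to\infty,\ \lambda\to0\\ \lambda^2t\le T}}\ \lim_{N\to\infty}\mathcal E=0,$$ in the sense that for every $\varepsilon>0$, for all sufficiently small $\Delta>0$, then for all sufficiently large $t$ and sufficiently small $\lambda\ne0$ with $\lambda^2t\le T$, then for all sufficiently large $N$, one has $|\mathcal E|<\varepsilon$. -/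

import Mathlib

open MeasureTheory ProbabilityTheory Filter Topology

noncomputable section

namespace Echo

/-! ### Wigner matrices -/

/-- The laws `μod` (off-diagonal, real or complex) and `μd` (diagonal, real) of the single entry
random variables of a Wigner matrix, with absolute moments controlled by `Cp`.
The real symmetric case is the one where `μod` is carried by the real axis. -/
structure IsEntryLaw (Cp : ℕ → ℝ) (μod : Measure ℂ) (μd : Measure ℝ) : Prop where
  prob_od : IsProbabilityMeasure μod
  prob_d : IsProbabilityMeasure μd
  integrable_od : ∀ p : ℕ, Integrable (fun z : ℂ => ‖z‖ ^ p) μod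
  integrable_d : ∀ p : ℕ, Integrable (fun x : ℝ => |x| ^ p) μd
  mean_od : ∫ z, z ∂μod = 0
  mean_d : ∫ x, x ∂μd = 0
  var_od : ∫ z, ‖z‖ ^ 2 ∂μod = 1
  moments : ∀ p : ℕ, 1 ≤ p → ∫ x, |x| ^ p ∂μd + ∫ z, ‖z‖ ^ p ∂μod ≤ Cp p

/-- `W` is an `N × N` Wigner matrix: Hermitian, with independent entries on and above the diagonal,
`W i j` distributed as `N ^ (-1/2) χ_od` for `i < j` and `W i i` as `N ^ (-1/2) χ_d`. -/
structure IsWigner {N : ℕ} {Ω : Type*} [MeasurableSpace Ω] (μod : Measure ℂ) (μd : Measure ℝ)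
    (P : Measure Ω) (W : Ω → Matrix (Fin N) (Fin N) ℂ) : Prop where
  hermitian : ∀ ω, (W ω).IsHermitian
  measurable : ∀ i j, Measurable (fun ω => W ω i j)
  indep : iIndepFun (fun (p : {p : Fin N × Fin N // p.1 ≤ p.2}) ω => W ω p.1.1 p.1.2) P
  law_od : ∀ i j, i < j →
    P.map (fun ω => W ω i j) = μod.map (fun z : ℂ => ((Real.sqrt N)⁻¹ : ℂ) * z)
  law_d : ∀ i,
    P.map (fun ω => W ω i i) = μd.map (fun x : ℝ => ((Real.sqrt N)⁻¹ : ℂ) * (x : ℂ))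

/-! ### Stochastic domination -/

/-- Stochastic domination `X ≺ Y`, uniformly over the parameter set `U N`, for random variables
defined for each `N` on a probability space `(Ω N, P N)`; the function `N₀` records the
threshold from which on the tail bound with exponents `ξ`, `D` holds. -/
def StochDom (N₀ : ℝ → ℝ → ℕ) {Ω : ℕ → Type*} [∀ N, MeasurableSpace (Ω N)]
    (P : ∀ N, Measure (Ω N)) {α : ℕ → Type*} (U : ∀ N, Set (α N))
    (X Y : ∀ N, α N → Ω N → ℝ) : Prop :=
  ∀ ξ : ℝ, 0 < ξ → ∀ D : ℝ, 0 < D → ∀ N : ℕ, N₀ ξ D ≤ N → ∀ u ∈ U N,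
    P N {ω | (N : ℝ) ^ ξ * Y N u ω < X N u ω} ≤ ENNReal.ofReal ((N : ℝ) ^ (-D))

/-! ### The unperturbed Hamiltonian -/

/-- The normalized trace `⟨A⟩ = N⁻¹ Tr A`. -/
def ntrace {N : ℕ} (A : Matrix (Fin N) (Fin N) ℂ) : ℂ := (N : ℂ)⁻¹ * A.trace

/-- The Stieltjes transform of `ρ`. -/
def stieltjes (ρ : ℝ → ℝ) (z : ℂ) : ℂ := ∫ x : ℝ, (ρ x : ℂ) / ((x : ℂ) - z)

/-- A compactly supported measurable probability density on `ℝ`. -/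
structure IsDensity (ρ : ℝ → ℝ) : Prop where
  measurable : Measurable ρ
  nonneg : ∀ x, 0 ≤ ρ x
  compact : HasCompactSupport ρ
  total : ∫ x, ρ x = 1

/-- A positive sequence converging to zero. -/
structure IsErrorSeq (e : ℕ → ℝ) : Prop where
  pos : ∀ N, 0 < e N
  tendsto : Tendsto e atTop (𝓝 0)

/-- The deterministic self-adjoint matrices `H N` are bounded by `CH` in operator norm, and the
normalized trace of the resolvent is `m₀(z) + O(ε₀)`, uniformly in `|Im z| ≥ η₀`, where `m₀` is
the Stieltjes transform of `ρ` and `A` is the implicit constant. -/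
structure HasLimitingDensity (CH : ℝ) (ρ : ℝ → ℝ) (A : ℝ) (ε₀ η₀ : ℕ → ℝ)
    (H : ∀ N, Matrix (Fin N) (Fin N) ℂ) : Prop where
  hermitian : ∀ N, (H N).IsHermitian
  bounded : ∀ N, ‖Matrix.toEuclideanCLM (𝕜 := ℂ) (H N)‖ ≤ CH
  approx : ∀ N, 1 ≤ N → ∀ z : ℂ, η₀ N ≤ |z.im| →
    ‖ntrace ((H N - z • (1 : Matrix (Fin N) (Fin N) ℂ))⁻¹) - stieltjes ρ z‖ ≤ A * ε₀ N

/-- The `C^{1,1}` norm on `J`: the suprema of `|f|` and `|f'|` plus the Lipschitz seminorm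
of `f'`. -/
def c11Norm (f : ℝ → ℝ) (J : Set ℝ) : ENNReal :=
  (⨆ x ∈ J, ‖f x‖ₑ) + (⨆ x ∈ J, ‖derivWithin f J x‖ₑ)
    + ⨆ x ∈ J, ⨆ y ∈ J, ⨆ _ : x ≠ y,
        ‖derivWithin f J x - derivWithin f J y‖ₑ / ‖x - y‖ₑ

/-- The set of admissible energies with parameters `κ`, `c`. -/
def admissible (ρ : ℝ → ℝ) (κ c : ℝ) : Set ℝ :=
  {x | x ∈ tsupport ρ ∧ c < sInf (ρ '' Set.Icc (x - κ) (x + κ)) ∧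
    ContDiffOn ℝ 1 ρ (Set.Icc (x - κ) (x + κ)) ∧
    c11Norm ρ (Set.Icc (x - κ) (x + κ)) ≤ ENNReal.ofReal (1 / c)}

/-! ### The initial state and the echo -/

/-- The spectral projection `1_I(H)` of a Hermitian matrix. -/
def specProj {N : ℕ} (H : Matrix (Fin N) (Fin N) ℂ) (I : Set ℝ) : Matrix (Fin N) (Fin N) ℂ :=
  cfc (I.indicator (fun _ => (1 : ℝ))) H

/-- `ψ` is normalized, has energy `E₀` and is localized in `[E₀ - Δ, E₀ + Δ]`. -/
structure IsLocalState {N : ℕ} (H : Matrix (Fin N) (Fin N) ℂ) (E₀ Δ : ℝ)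
    (ψ : EuclideanSpace ℂ (Fin N)) : Prop where
  normalized : ‖ψ‖ = 1
  energy : inner ℂ ψ (Matrix.toEuclideanCLM (𝕜 := ℂ) H ψ) = (E₀ : ℂ)
  localized : Matrix.toEuclideanCLM (𝕜 := ℂ) (specProj H (Set.Icc (E₀ - Δ) (E₀ + Δ))) ψ = ψ

/-- The Loschmidt echo `|⟨ψ, e^{i t H₂} e^{-i t H₁} ψ⟩|²`. -/
def echo {N : ℕ} (H₁ H₂ : Matrix (Fin N) (Fin N) ℂ) (ψ : EuclideanSpace ℂ (Fin N)) (t : ℝ) : ℝ :=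
  ‖inner ℂ ψ (Matrix.toEuclideanCLM (𝕜 := ℂ)
    (NormedSpace.exp ((Complex.I * (t : ℂ)) • H₂) *
      NormedSpace.exp ((-(Complex.I * (t : ℂ))) • H₁)) ψ)‖ ^ 2

/-- The error term of the intermediate-time asymptotics (`e` stands for `ε₀(N)`). -/
def errorTerm (lam t Δ e : ℝ) : ℝ :=
  lam ^ 2 * t * Δ + |lam| * (1 + lam ^ 2 * t) + |lam| / Δ * (1 + |lam| / Δ) + lam ^ 2 * t * e

end Echo

end

/-! The amplitude `⟨ψ₀, e^{itH_λ} e^{-itH₀} ψ₀⟩` concentrates around its average over the noise, and the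
averaged propagator solves a closed equation up to errors that vanish as `N → ∞`. Both parts of the
theorem are then statements about the solution of that equation.

*Reduction to the average.* Truncating the entries of `W` at `N^{-1/2+s}` changes nothing outside an
event of probability `N^{-D}` (`exists_isNearWigner`). For bounded entries, resampling one entry at a
time changes the amplitude by amounts whose squares sum to order `N^{-1+4s}` up to powers of `|λ| t`
(`sum_sq_increments_le`), so a moment version of the Efron–Stein inequality
(`integral_norm_sub_integral_pow_le`) bounds the fluctuations (`exists_echo_concentration`).

*The self-consistent equation.* Writing `U_t` for the average of `e^{itH_λ}`, a second order cumulant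
expansion gives `E W e^{itH_λ} ≈ iλ ∫₀ᵗ u_s U_{t-s} ds` with the normalized trace `u` of `U`
(`norm_meanNoise_sub_le`). The error is of order `N^{-1/2+3s}` with a cubic polynomial in `|λ| t`.

*Short times.* In the interaction picture the averaged amplitude is `1` minus `λ²` times a double time
integral of `1 + O(t)` (`abs_norm_sq_inner_meanProp_sub_le`).

*Intermediate times.* Under the Laplace transform the equation says that the averaged resolvent at `p`
is the free one at the shifted parameter `p + λ² û(p)` (`norm_meanResol_sub_resol_le`). As `λ` is fixed
while `N → ∞`, this is only needed at real part at least `η = |λ|³`, where all `N`-dependent errors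
are eventually below `λ² / 2`. Near the energy `E₀` the regularity of `ρ₀` bounds its transform up to
the real axis, and a continuity argument carries the bound over to `û`
(`IsCloseTo.norm_meanStieltjes_le`). Hence the shift may be frozen at each eigenvalue
(`norm_inv_sub_inv_le`), so that on the energy shell the averaged density of states is a superposition
of Lorentzians, up to an error of order `|λ|` after integration. Away from the shell nothing is known about
`ρ₀`; there the densities are controlled by positivity, since they have the same total mass
(`norm_integral_mul_sub_le`). Fourier inversion turns the Lorentzians into decaying exponentials
(`norm_inner_meanProp_sub_sum_le`), whose rates are `π ρ₀(E₀) λ²` up to errors of relative order `Δ`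
and `|λ|` (`abs_norm_sq_inner_meanProp_sub_exp_le`). The regularization costs a factor `e^{-ηt}`,
which is harmless for `|λ|³ t ≤ 1`; for later times, and for couplings that are not weak, the error
term of the theorem exceeds a constant and there is nothing to prove (`exists_intermediate_time`).
-/

noncomputable section

namespace Echo

/-! ### Unitary propagators -/

section Propagator

variable {E : Type*} [NormedAddCommGroup E] [InnerProductSpace ℂ E]

/-- The matrix element `T ↦ ⟨x, T y⟩` as a continuous linear functional on operators. -/
def matEl (x y : E) : (E →L[ℂ] E) →L[ℂ] ℂ :=
  (innerSL ℂ x) ∘L (ContinuousLinearMap.apply ℂ E y)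

@[simp] lemma matEl_apply (x y : E) (T : E →L[ℂ] E) : matEl x y T = inner ℂ x (T y) := rfl

lemma hasDerivAt_clm {F : Type*} [NormedAddCommGroup F] [NormedSpace ℂ F]
    (L : (E →L[ℂ] E) →L[ℂ] F) {T : ℝ → E →L[ℂ] E} {T' : E →L[ℂ] E} {s : ℝ}
    (h : HasDerivAt T T' s) : HasDerivAt (fun s => L (T s)) (L T') s :=
  (L.restrictScalars ℝ).hasFDerivAt.comp_hasDerivAt s h

variable [CompleteSpace E]

/-- The propagator `e^{i t A}` of a bounded operator `A`. -/
def prop (A : E →L[ℂ] E) (t : ℝ) : E →L[ℂ] E := NormedSpace.exp ((Complex.I * (t : ℂ)) • A)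

@[simp] lemma prop_zero (A : E →L[ℂ] E) : prop A 0 = 1 := by simp [prop]

lemma continuous_prop : Continuous fun p : (E →L[ℂ] E) × ℝ => prop p.1 p.2 := by
  unfold prop
  let _ : NormedAlgebra ℚ (E →L[ℂ] E) := NormedAlgebra.restrictScalars ℚ ℂ _
  exact (NormedSpace.exp_continuous).comp (by fun_prop)

lemma hasDerivAt_prop (A : E →L[ℂ] E) (t : ℝ) :
    HasDerivAt (prop A) (Complex.I • (A * prop A t)) t := by
  have h := (hasDerivAt_exp_smul_const' (𝕂 := ℂ) (Complex.I • A) (t : ℂ)).scomp t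
    (Complex.ofRealCLM.hasDerivAt (x := t))
  refine (h.congr_deriv ?_).congr_of_eventuallyEq ?_
  · simp [prop, smul_smul, mul_comm]
  · refine Eventually.of_forall fun s => ?_
    simp [prop, smul_smul, mul_comm, Function.comp]

lemma continuous_prop_right (A : E →L[ℂ] E) : Continuous (prop A) :=
  continuous_iff_continuousAt.2 fun t => (hasDerivAt_prop A t).continuousAt

lemma commute_prop (A : E →L[ℂ] E) (t : ℝ) : A * prop A t = prop A t * A := by
  have : Commute A (prop A t) := ((Commute.refl A).smul_right _).exp_right
  exact this

lemma star_prop {A : E →L[ℂ] E} (hA : IsSelfAdjoint A) (t : ℝ) :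
    star (prop A t) = prop A (-t) := by
  unfold prop
  rw [NormedSpace.star_exp]
  congr 1
  simp [star_smul, hA.star_eq]

lemma prop_add (A : E →L[ℂ] E) (s t : ℝ) : prop A (s + t) = prop A s * prop A t := by
  unfold prop
  let _ : NormedAlgebra ℚ (E →L[ℂ] E) := NormedAlgebra.restrictScalars ℚ ℂ _
  rw [← NormedSpace.exp_add_of_commute]
  · rw [← add_smul]; push_cast; ring_nf
  · exact ((Commute.refl A).smul_right _).smul_left _

lemma norm_prop_apply {A : E →L[ℂ] E} (hA : IsSelfAdjoint A) (t : ℝ) (x : E) :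
    ‖prop A t x‖ = ‖x‖ := by
  have h1 : star (prop A t) * prop A t = 1 := by
    rw [star_prop hA, ← prop_add]; simp
  have h2 : inner ℂ (prop A t x) (prop A t x) = inner ℂ x x := by
    rw [← ContinuousLinearMap.adjoint_inner_right, ← ContinuousLinearMap.star_eq_adjoint,
      ← mul_apply_eq_comp, h1]; rfl
  rw [inner_self_eq_norm_sq_to_K, inner_self_eq_norm_sq_to_K] at h2
  have h3 : ‖prop A t x‖ ^ 2 = ‖x‖ ^ 2 := by exact_mod_cast h2
  exact (pow_left_inj₀ (norm_nonneg _) (norm_nonneg _) two_ne_zero).1 h3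

lemma norm_prop_le {A : E →L[ℂ] E} (hA : IsSelfAdjoint A) (t : ℝ) : ‖prop A t‖ ≤ 1 :=
  ContinuousLinearMap.opNorm_le_bound _ zero_le_one fun x => by rw [norm_prop_apply hA, one_mul]

lemma norm_inner_prop_le {A : E →L[ℂ] E} (hA : IsSelfAdjoint A) (t : ℝ) (x y : E) :
    ‖inner ℂ x (prop A t y)‖ ≤ ‖x‖ * ‖y‖ := by
  refine (norm_inner_le_norm _ _).trans ?_
  rw [norm_prop_apply hA]

/-- The interpolation between two propagators underlying Duhamel's formula. -/
lemma hasDerivAt_prop_mul_prop (A B : E →L[ℂ] E) (t s : ℝ) :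
    HasDerivAt (fun s => prop A s * prop B (t - s))
      (Complex.I • (prop A s * (A - B) * prop B (t - s))) s := by
  have h1 := hasDerivAt_prop A s
  have h2 : HasDerivAt (fun s => prop B (t - s)) (-(Complex.I • (B * prop B (t - s)))) s := by
    exact ((hasDerivAt_prop B (t - s)).scomp s ((hasDerivAt_id s).const_sub t)).congr_deriv
      (by simp)
  refine (h1.mul h2).congr_deriv ?_
  rw [commute_prop A]
  simp only [smul_mul_assoc, mul_neg, mul_smul_comm, mul_sub, sub_mul, smul_sub, mul_assoc]
  abel

lemma norm_prop_sub_prop_le {A B : E →L[ℂ] E} (hA : IsSelfAdjoint A) (hB : IsSelfAdjoint B)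
    {t : ℝ} (ht : 0 ≤ t) : ‖prop A t - prop B t‖ ≤ t * ‖A - B‖ := by
  have h := norm_image_sub_le_of_norm_deriv_le_segment' (a := 0) (b := t)
    (f := fun s => prop A s * prop B (t - s)) (C := ‖A - B‖)
    (fun s _ => (hasDerivAt_prop_mul_prop A B t s).hasDerivWithinAt)
    (fun s _ => by
      rw [norm_smul, Complex.norm_I, one_mul]
      calc _ ≤ ‖prop A s‖ * ‖A - B‖ * ‖prop B (t - s)‖ :=
            (norm_mul_le _ _).trans (by gcongr; exact norm_mul_le _ _)
        _ ≤ 1 * ‖A - B‖ * 1 := by gcongr <;> exact norm_prop_le ‹_› _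
        _ = _ := by ring)
    t ⟨ht, le_rfl⟩
  simpa [mul_comm] using h

/-- Duhamel's formula in `ℓ²` form: a bound on the square sum of the first order responses of a
family of matrix elements bounds the square sum of their increments. -/
lemma sum_sq_inner_prop_sub_prop_le {ι : Type*} [Fintype ι] {A : E →L[ℂ] E}
    {B : ι → E →L[ℂ] E} {t : ℝ} (ht : 0 ≤ t) (p : ι → E) (y : E) {C : ℝ} (hC : 0 ≤ C)
    (h : ∀ s ∈ Set.Icc 0 t,
      ∑ k, ‖inner ℂ (p k) (prop (B k) s ((B k - A) (prop A (t - s) y)))‖ ^ 2 ≤ C ^ 2) :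
    ∑ k, ‖inner ℂ (p k) (prop (B k) t y - prop A t y)‖ ^ 2 ≤ (t * C) ^ 2 := by
  set f : ℝ → EuclideanSpace ℂ ι := fun s => WithLp.toLp 2
    fun k => inner ℂ (p k) ((prop (B k) s * prop A (t - s)) y) with hf
  set f' : ℝ → EuclideanSpace ℂ ι := fun s => WithLp.toLp 2
    fun k => inner ℂ (p k)
      ((Complex.I • (prop (B k) s * (B k - A) * prop A (t - s))) y) with hf'
  have hd : ∀ s, HasDerivAt f (f' s) s := by
    intro s
    have hp : HasDerivAt (fun s k => inner ℂ (p k) ((prop (B k) s * prop A (t - s)) y))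
        (fun k => inner ℂ (p k) ((Complex.I • (prop (B k) s * (B k - A) * prop A (t - s))) y))
        s := by
      refine hasDerivAt_pi.2 fun k => ?_
      exact hasDerivAt_clm (matEl (p k) y) (hasDerivAt_prop_mul_prop (B k) A t s)
    exact (PiLp.hasFDerivAt_toLp (𝕜 := ℝ) (E := fun _ : ι => ℂ) 2 _).comp_hasDerivAt s hp
  have h3 := norm_image_sub_le_of_norm_deriv_le_segment' (a := 0) (b := t)
    (f := f) (f' := f') (C := C) (fun s _ => (hd s).hasDerivWithinAt)
    (fun s hs => by
      have := h s ⟨hs.1, hs.2.le⟩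
      rw [EuclideanSpace.norm_eq]
      refine Real.sqrt_le_iff.2 ⟨hC, le_trans (le_of_eq ?_) this⟩
      simp [hf'])
    t ⟨ht, le_rfl⟩
  rw [sub_zero, EuclideanSpace.norm_eq, Real.sqrt_le_iff] at h3
  refine le_trans (le_of_eq ?_) (h3.2.trans_eq (by ring))
  simp [hf]

end Propagator

/-! ### The Efron–Stein inequality and its moment version -/

section EfronStein

lemma integrable_of_bdd {α : Type*} [MeasurableSpace α] {μ : Measure α} [IsFiniteMeasure μ]
    {F : Type*} [NormedAddCommGroup F] [MeasurableSpace F] [BorelSpace F]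
    [SecondCountableTopology F] {f : α → F} (hf : Measurable f) {B : ℝ} (hB : ∀ x, ‖f x‖ ≤ B) :
    Integrable f μ :=
  Integrable.of_bound hf.aestronglyMeasurable B (Eventually.of_forall hB)

lemma measurable_integral_snd {α β : Type*} [MeasurableSpace α] [MeasurableSpace β]
    {ν : Measure β} [SFinite ν] {F : Type*} [NormedAddCommGroup F] [NormedSpace ℝ F]
    [MeasurableSpace F] [BorelSpace F] [SecondCountableTopology F] {f : α → β → F}
    (hf : Measurable (Function.uncurry f)) : Measurable fun x => ∫ y, f x y ∂ν :=
  (hf.stronglyMeasurable.integral_prod_right (f := f)).measurable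

lemma norm_integral_le_of_bdd {α : Type*} [MeasurableSpace α] {μ : Measure α}
    [IsProbabilityMeasure μ] {F : Type*} [NormedAddCommGroup F] [NormedSpace ℝ F]
    {f : α → F} {B : ℝ} (hB : ∀ x, ‖f x‖ ≤ B) : ‖∫ x, f x ∂μ‖ ≤ B := by
  simpa using norm_integral_le_of_norm_le_const (μ := μ) (Eventually.of_forall hB)

variable {α β : Type*} [MeasurableSpace α] [MeasurableSpace β] (μ : Measure α) (ν : Measure β)
  [IsProbabilityMeasure μ] [IsProbabilityMeasure ν]

lemma integral_norm_sub_integral_sq_eq {f : α → ℂ} (hf : Measurable f) {B : ℝ}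
    (hB : ∀ x, ‖f x‖ ≤ B) :
    ∫ x, ‖f x - ∫ y, f y ∂μ‖ ^ 2 ∂μ = ∫ x, ‖f x‖ ^ 2 ∂μ - ‖∫ x, f x ∂μ‖ ^ 2 := by
  set m := ∫ y, f y ∂μ with hm
  have hi : Integrable f μ := integrable_of_bdd hf hB
  have hi2 : Integrable (fun x => ‖f x‖ ^ 2) μ :=
    integrable_of_bdd (B := B ^ 2) (by fun_prop) fun x => by
      simpa using pow_le_pow_left₀ (norm_nonneg _) (hB x) 2
  have h1 : ∀ x, ‖f x - m‖ ^ 2 = ‖f x‖ ^ 2 - 2 * (f x * (starRingEnd ℂ) m).re + ‖m‖ ^ 2 := by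
    intro x
    rw [← Complex.normSq_eq_norm_sq, ← Complex.normSq_eq_norm_sq, ← Complex.normSq_eq_norm_sq,
      Complex.normSq_sub]
    ring
  have hi3 : Integrable (fun x => (f x * (starRingEnd ℂ) m)) μ := hi.mul_const _
  have h2 : ∫ x, (f x * (starRingEnd ℂ) m).re ∂μ = ‖m‖ ^ 2 := by
    have : ∫ x, (f x * (starRingEnd ℂ) m).re ∂μ = (∫ x, f x * (starRingEnd ℂ) m ∂μ).re :=
      integral_re hi3
    rw [this, integral_mul_const, ← hm, Complex.mul_conj, Complex.normSq_eq_norm_sq,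
      Complex.ofReal_re]
  have hi4 : Integrable (fun x => 2 * (f x * (starRingEnd ℂ) m).re) μ := hi3.re.const_mul 2
  have hi5 : Integrable (fun x => ‖f x‖ ^ 2 - 2 * (f x * (starRingEnd ℂ) m).re) μ := hi2.sub hi4
  simp_rw [h1]
  rw [integral_add hi5 (integrable_const _), integral_sub hi2 hi4, integral_const_mul, h2]
  simp
  ring

lemma integral_integral_norm_sub_sq {f : α → ℂ} (hf : Measurable f) {B : ℝ}
    (hB : ∀ x, ‖f x‖ ≤ B) :
    ∫ x, ‖f x - ∫ y, f y ∂μ‖ ^ 2 ∂μ = (1 / 2) * ∫ x, ∫ y, ‖f x - f y‖ ^ 2 ∂μ ∂μ := by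
  have hi : Integrable f μ := integrable_of_bdd hf hB
  have hi2 : Integrable (fun x => ‖f x‖ ^ 2) μ :=
    integrable_of_bdd (B := B ^ 2) (by fun_prop) fun x => by
      simpa using pow_le_pow_left₀ (norm_nonneg _) (hB x) 2
  set m := ∫ y, f y ∂μ with hm
  have h1 : ∀ x, ∫ y, ‖f x - f y‖ ^ 2 ∂μ = ∫ y, ‖f y - m‖ ^ 2 ∂μ + ‖f x - m‖ ^ 2 := by
    intro x
    have := integral_norm_sub_integral_sq_eq μ (f := fun y => f x - f y) (by fun_prop)
      (B := B + B) fun y => (norm_sub_le _ _).trans (add_le_add (hB _) (hB _))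
    rw [integral_sub (integrable_const _) hi] at this
    simp only [integral_const, probReal_univ, one_smul, ← hm] at this
    have h3 : ∀ y, ‖f x - f y - (f x - m)‖ ^ 2 = ‖f y - m‖ ^ 2 := fun y => by
      rw [show f x - f y - (f x - m) = -(f y - m) by ring, norm_neg]
    simp_rw [h3] at this
    linarith
  simp_rw [h1]
  have hi3 : Integrable (fun x => ‖f x - m‖ ^ 2) μ :=
    integrable_of_bdd (B := (B + ‖m‖) ^ 2) (by fun_prop) fun x => by
      rw [norm_pow, norm_norm]
      exact pow_le_pow_left₀ (norm_nonneg _) ((norm_sub_le _ _).trans (by gcongr; exact hB _)) 2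
  rw [integral_add (integrable_const _) hi3]
  simp
  ring

lemma norm_pow_sub_pow_sq_le (a b : ℂ) (p : ℕ) :
    ‖a ^ p - b ^ p‖ ^ 2 ≤
      p ^ 2 * (‖a - b‖ ^ 2 * ‖a‖ ^ (2 * (p - 1)) + ‖a - b‖ ^ 2 * ‖b‖ ^ (2 * (p - 1))) := by
  have h1 : ‖a ^ p - b ^ p‖ ≤ p * (‖a - b‖ * max ‖a‖ ‖b‖ ^ (p - 1)) := by
    rw [← Commute.mul_geom_sum₂ (Commute.all a b), norm_mul]
    have : ‖∑ i ∈ Finset.range p, a ^ i * b ^ (p - 1 - i)‖ ≤ p * max ‖a‖ ‖b‖ ^ (p - 1) := by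
      refine (norm_sum_le _ _).trans ?_
      calc _ ≤ ∑ i ∈ Finset.range p, max ‖a‖ ‖b‖ ^ (p - 1) := by
            refine Finset.sum_le_sum fun i hi => ?_
            rw [norm_mul, norm_pow, norm_pow]
            calc _ ≤ max ‖a‖ ‖b‖ ^ i * max ‖a‖ ‖b‖ ^ (p - 1 - i) := by
                  gcongr
                  · exact le_max_left _ _
                  · exact le_max_right _ _
              _ = _ := by
                  rw [← pow_add]; congr 1
                  have := Finset.mem_range.1 hi; omega
        _ = _ := by simp
    calc _ ≤ ‖a - b‖ * (p * max ‖a‖ ‖b‖ ^ (p - 1)) := by gcongr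
      _ = _ := by ring
  have h2 : max ‖a‖ ‖b‖ ^ (2 * (p - 1)) ≤ ‖a‖ ^ (2 * (p - 1)) + ‖b‖ ^ (2 * (p - 1)) := by
    rcases max_cases ‖a‖ ‖b‖ with ⟨h, _⟩ | ⟨h, _⟩ <;> rw [h]
    · linarith [pow_nonneg (norm_nonneg b) (2 * (p - 1))]
    · linarith [pow_nonneg (norm_nonneg a) (2 * (p - 1))]
  calc _ ≤ (p * (‖a - b‖ * max ‖a‖ ‖b‖ ^ (p - 1))) ^ 2 := by gcongr
    _ = p ^ 2 * ‖a - b‖ ^ 2 * max ‖a‖ ‖b‖ ^ (2 * (p - 1)) := by rw [mul_comm 2, pow_mul]; ring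
    _ ≤ p ^ 2 * ‖a - b‖ ^ 2 * (‖a‖ ^ (2 * (p - 1)) + ‖b‖ ^ (2 * (p - 1))) := by gcongr
    _ = _ := by ring

/-- The single-variable step: the variance of a power in terms of resampling increments. -/
lemma variance_pow_le {f : α → ℂ} (hf : Measurable f) {B : ℝ} (hB : ∀ x, ‖f x‖ ≤ B) (p : ℕ) :
    ∫ x, ‖f x ^ p - ∫ y, f y ^ p ∂μ‖ ^ 2 ∂μ ≤
      p ^ 2 * ∫ x, ∫ y, ‖f x - f y‖ ^ 2 * ‖f x‖ ^ (2 * (p - 1)) ∂μ ∂μ := by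
  have hBp : ∀ x, ‖f x ^ p‖ ≤ B ^ p := fun x => by
    rw [norm_pow]; exact pow_le_pow_left₀ (norm_nonneg _) (hB x) p
  rw [integral_integral_norm_sub_sq μ (hf.pow_const p) hBp]
  set G : α → α → ℝ := fun x y => ‖f x - f y‖ ^ 2 * ‖f x‖ ^ (2 * (p - 1)) with hG
  have hGm : Measurable (Function.uncurry G) := by
    unfold Function.uncurry; simp only [hG]; fun_prop
  have hGm' : Measurable (Function.uncurry fun x y => G y x) := by
    unfold Function.uncurry; simp only [hG]; fun_prop
  have hGB : ∀ x y, ‖G x y‖ ≤ (B + B) ^ 2 * B ^ (2 * (p - 1)) := by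
    intro x y
    have h0 : 0 ≤ B := (norm_nonneg _).trans (hB x)
    simp only [hG, norm_mul, norm_pow, norm_norm]
    gcongr
    · exact (norm_sub_le _ _).trans (add_le_add (hB _) (hB _))
    · exact hB _
  have hI : Integrable (Function.uncurry G) (μ.prod μ) :=
    integrable_of_bdd hGm fun p => hGB p.1 p.2
  have hI' : Integrable (Function.uncurry fun x y => G y x) (μ.prod μ) :=
    integrable_of_bdd hGm' fun p => hGB p.2 p.1
  have h1 : ∫ x, ∫ y, ‖f x ^ p - f y ^ p‖ ^ 2 ∂μ ∂μ ≤
      ∫ x, ∫ y, (p : ℝ) ^ 2 * (G x y + G y x) ∂μ ∂μ := by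
    have hL : Integrable (Function.uncurry fun x y => ‖f x ^ p - f y ^ p‖ ^ 2) (μ.prod μ) := by
      refine integrable_of_bdd (B := (B ^ p + B ^ p) ^ 2)
        (by unfold Function.uncurry; fun_prop) fun q => ?_
      simp only [Function.uncurry, norm_pow, norm_norm]
      gcongr
      exact (norm_sub_le _ _).trans (add_le_add (hBp _) (hBp _))
    rw [integral_integral hL, integral_integral (f := fun x y => (p : ℝ) ^ 2 * (G x y + G y x))
      ((hI.add hI').const_mul _)]
    refine integral_mono hL ((hI.add hI').const_mul _) fun q => ?_
    have := norm_pow_sub_pow_sq_le (f q.1) (f q.2) p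
    simp only [hG]
    rwa [norm_sub_rev (f q.2) (f q.1)]
  have h2 : ∫ x, ∫ y, (p : ℝ) ^ 2 * (G x y + G y x) ∂μ ∂μ =
      2 * (p ^ 2 * ∫ x, ∫ y, G x y ∂μ ∂μ) := by
    simp_rw [integral_const_mul]
    have b1 : ∀ x, Integrable (fun y => G x y) μ := fun x =>
      integrable_of_bdd (f := fun y => G x y) hGm.of_uncurry_left (hGB x)
    have b2 : ∀ x, Integrable (fun y => G y x) μ := fun x =>
      integrable_of_bdd (f := fun y => G y x) hGm'.of_uncurry_left
        fun y => hGB y x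
    have h3 : ∀ x, ∫ y, G x y + G y x ∂μ = ∫ y, G x y ∂μ + ∫ y, G y x ∂μ := fun x =>
      integral_add (b1 x) (b2 x)
    simp_rw [h3]
    have a1 : Integrable (fun x => ∫ y, G x y ∂μ) μ := hI.integral_prod_left
    have a2 : Integrable (fun x => ∫ y, G y x ∂μ) μ := hI'.integral_prod_left
    rw [integral_add a1 a2, integral_integral_swap (f := fun x y => G y x) hI']
    ring
  linarith

/-- The Efron–Stein inequality for two independent variables: the variance is at most the sum of the
averages of the two conditional variances. -/
lemma variance_prod_le {f : α × β → ℂ} (hf : Measurable f) {B : ℝ} (hB : ∀ x, ‖f x‖ ≤ B) :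
    ∫ p, ‖f p - ∫ q, f q ∂(μ.prod ν)‖ ^ 2 ∂(μ.prod ν)
      ≤ ∫ y, ∫ x, ‖f (x, y) - ∫ z, f (z, y) ∂μ‖ ^ 2 ∂μ ∂ν
        + ∫ x, ∫ y, ‖f (x, y) - ∫ z, f (x, z) ∂ν‖ ^ 2 ∂ν ∂μ := by
  have hfx : ∀ x, Measurable fun y => f (x, y) := fun x => hf.comp measurable_prodMk_left
  have hfy : ∀ y, Measurable fun x => f (x, y) := fun y => hf.comp measurable_prodMk_right
  have hI : Integrable f (μ.prod ν) := integrable_of_bdd hf hB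
  have hsq : ∀ x, ‖‖f x‖ ^ 2‖ ≤ B ^ 2 := fun x => by
    simpa using pow_le_pow_left₀ (norm_nonneg _) (hB x) 2
  have hI2 : Integrable (fun p => ‖f p‖ ^ 2) (μ.prod ν) := integrable_of_bdd (by fun_prop) hsq
  set g : α → ℂ := fun x => ∫ y, f (x, y) ∂ν with hg
  set h : β → ℂ := fun y => ∫ x, f (x, y) ∂μ with hh
  have hgm : Measurable g := measurable_integral_snd (f := fun x y => f (x, y)) hf
  have hhm : Measurable h := measurable_integral_snd (f := fun y x => f (x, y))
    (hf.comp measurable_swap)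
  have hgB : ∀ x, ‖g x‖ ≤ B := fun x => norm_integral_le_of_bdd fun y => hB _
  have hhB : ∀ y, ‖h y‖ ≤ B := fun y => norm_integral_le_of_bdd fun x => hB _
  have hg2 : Integrable (fun x => ‖g x‖ ^ 2) μ := integrable_of_bdd (B := B ^ 2) (by fun_prop)
    fun x => by simpa using pow_le_pow_left₀ (norm_nonneg _) (hgB x) 2
  have hh2 : Integrable (fun x => ‖h x‖ ^ 2) ν := integrable_of_bdd (B := B ^ 2) (by fun_prop)
    fun x => by simpa using pow_le_pow_left₀ (norm_nonneg _) (hhB x) 2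
  set m := ∫ q, f q ∂(μ.prod ν) with hm
  have hmg : m = ∫ x, g x ∂μ := integral_prod _ hI
  have hmh : m = ∫ y, h y ∂ν := integral_prod_symm _ hI
  rw [integral_norm_sub_integral_sq_eq _ hf hB]
  have e1 : ∀ y, ∫ x, ‖f (x, y) - ∫ z, f (z, y) ∂μ‖ ^ 2 ∂μ = ∫ x, ‖f (x, y)‖ ^ 2 ∂μ - ‖h y‖ ^ 2 :=
    fun y => integral_norm_sub_integral_sq_eq μ (hfy y) fun x => hB _
  have e2 : ∀ x, ∫ y, ‖f (x, y) - ∫ z, f (x, z) ∂ν‖ ^ 2 ∂ν = ∫ y, ‖f (x, y)‖ ^ 2 ∂ν - ‖g x‖ ^ 2 :=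
    fun x => integral_norm_sub_integral_sq_eq ν (hfx x) fun y => hB _
  simp_rw [e1, e2]
  rw [integral_sub hI2.integral_prod_right hh2, integral_sub hI2.integral_prod_left hg2,
    ← integral_prod (fun p => ‖f p‖ ^ 2) hI2, ← integral_prod_symm (fun p => ‖f p‖ ^ 2) hI2]
  -- it remains to expand `0 ≤ ∫ ‖h(y) - m‖ ^ 2 ≤ ∫ ‖f(x, y) - g(x)‖ ^ 2`
  have e3 : ∀ y, ‖h y - m‖ ^ 2 ≤ ∫ x, ‖f (x, y) - g x‖ ^ 2 ∂μ := by
    intro y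
    have hi : Integrable (fun x => f (x, y) - g x) μ :=
      (integrable_of_bdd (hfy y) fun x => hB _).sub (integrable_of_bdd hgm hgB)
    have : h y - m = ∫ x, (f (x, y) - g x) ∂μ := by
      rw [integral_sub (integrable_of_bdd (hfy y) fun x => hB _) (integrable_of_bdd hgm hgB), hmg]
    have h5 := integral_norm_sub_integral_sq_eq μ (f := fun x => f (x, y) - g x)
      ((hfy y).sub hgm) (B := B + B)
      fun x => (norm_sub_le _ _).trans (add_le_add (hB _) (hgB _))
    have h6 : 0 ≤ ∫ x, ‖f (x, y) - g x - ∫ z, (f (z, y) - g z) ∂μ‖ ^ 2 ∂μ :=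
      integral_nonneg fun x => by positivity
    rw [this]; linarith
  have hFm : Measurable (fun p : α × β => ‖f p - g p.1‖ ^ 2) := by fun_prop
  have hF : Integrable (fun p : α × β => ‖f p - g p.1‖ ^ 2) (μ.prod ν) :=
    integrable_of_bdd (B := (B + B) ^ 2) hFm fun p => by
      rw [norm_pow, norm_norm]
      exact pow_le_pow_left₀ (norm_nonneg _)
        ((norm_sub_le _ _).trans (add_le_add (hB _) (hgB _))) 2
  have e4 : ∫ y, ‖h y - m‖ ^ 2 ∂ν ≤ ∫ x, ∫ y, ‖f (x, y) - g x‖ ^ 2 ∂ν ∂μ := by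
    rw [← integral_prod _ hF, integral_prod_symm _ hF]
    refine integral_mono (integrable_of_bdd (B := (B + ‖m‖) ^ 2) (by fun_prop) fun y => ?_)
      hF.integral_prod_right e3
    rw [norm_pow, norm_norm]
    exact pow_le_pow_left₀ (norm_nonneg _) ((norm_sub_le _ _).trans (by gcongr; exact hhB _)) 2
  have e5 : ∫ y, ‖h y - m‖ ^ 2 ∂ν = ∫ y, ‖h y‖ ^ 2 ∂ν - ‖m‖ ^ 2 := by
    rw [hmh]; exact integral_norm_sub_integral_sq_eq ν hhm hhB
  have e2' : ∀ x, ∫ y, ‖f (x, y) - g x‖ ^ 2 ∂ν = ∫ y, ‖f (x, y)‖ ^ 2 ∂ν - ‖g x‖ ^ 2 := e2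
  simp_rw [e2'] at e4
  rw [integral_sub hI2.integral_prod_left hg2, ← integral_prod (fun p => ‖f p‖ ^ 2) hI2] at e4
  linarith

/-- The Efron–Stein inequality for powers of a function of independent variables, by induction on
the number of variables; the increments are taken under resampling one variable. -/
lemma variance_pow_pi_fin_le {𝓧 : Type*} [MeasurableSpace 𝓧] (p : ℕ) {B : ℝ} :
    ∀ {n : ℕ} (ν : Fin n → Measure 𝓧) [∀ i, IsProbabilityMeasure (ν i)] {f : (Fin n → 𝓧) → ℂ}
      (_ : Measurable f) (_ : ∀ z, ‖f z‖ ≤ B),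
    ∫ z, ‖f z ^ p - ∫ y, f y ^ p ∂(Measure.pi ν)‖ ^ 2 ∂(Measure.pi ν) ≤
      p ^ 2 * ∫ z, ∑ k, ∫ w, ‖f z - f (Function.update z k w)‖ ^ 2 * ‖f z‖ ^ (2 * (p - 1)) ∂(ν k)
        ∂(Measure.pi ν) := by
  intro n
  induction n with
  | zero =>
    intro ν _ f hf hB
    simp [Measure.pi_of_empty (x := Fin.elim0)]
  | succ n ih =>
    intro ν _ f hf hB
    set e := MeasurableEquiv.piFinSuccAbove (fun _ : Fin (n + 1) => 𝓧) 0 with he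
    have hmp := (measurePreserving_piFinSuccAbove ν 0).symm
    set ν' : Fin n → Measure 𝓧 := fun j => ν (Fin.succ j) with hν'
    change MeasurePreserving e.symm ((ν 0).prod (Measure.pi ν')) (Measure.pi ν) at hmp
    have hes : ∀ q : 𝓧 × (Fin n → 𝓧), e.symm q = Fin.cons q.1 q.2 := fun q =>
      Fin.insertNth_zero' _ _
    set g : 𝓧 × (Fin n → 𝓧) → ℂ := fun q => f (Fin.cons q.1 q.2) with hg
    have hcons : Measurable fun q : 𝓧 × (Fin n → 𝓧) =>
        (Fin.cons q.1 q.2 : Fin (n + 1) → 𝓧) := by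
      have := e.symm.measurable
      rwa [show ⇑e.symm = fun q => Fin.cons q.1 q.2 from funext hes] at this
    have hgm : Measurable g := hf.comp hcons
    have hgB : ∀ q, ‖g q‖ ≤ B := fun q => hB _
    have hgx : ∀ x, Measurable fun y => g (x, y) := fun x => hgm.comp measurable_prodMk_left
    have hgy : ∀ y, Measurable fun x => g (x, y) := fun y => hgm.comp measurable_prodMk_right
    have hgBp : ∀ x, ‖g x ^ p‖ ≤ B ^ p := fun x => by
      rw [norm_pow]; exact pow_le_pow_left₀ (norm_nonneg _) (hgB x) p
    have hF : ∀ (F : (Fin (n + 1) → 𝓧) → ℂ), ∫ z, F z ∂(Measure.pi ν) =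
        ∫ q, F (Fin.cons q.1 q.2) ∂((ν 0).prod (Measure.pi ν')) := fun F => by
      rw [← hmp.integral_comp' F]; simp_rw [hes]
    have hF' : ∀ (F : (Fin (n + 1) → 𝓧) → ℝ), ∫ z, F z ∂(Measure.pi ν) =
        ∫ q, F (Fin.cons q.1 q.2) ∂((ν 0).prod (Measure.pi ν')) := fun F => by
      rw [← hmp.integral_comp' F]; simp_rw [hes]
    rw [hF', hF', hF]
    change ∫ q, ‖g q ^ p - ∫ q, g q ^ p ∂((ν 0).prod (Measure.pi ν'))‖ ^ 2
      ∂((ν 0).prod (Measure.pi ν')) ≤ _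
    refine (variance_prod_le (ν 0) (Measure.pi ν') (hgm.pow_const p) hgBp).trans ?_
    -- the increments under resampling of the first variable and of the other ones
    set D₀ : 𝓧 × (Fin n → 𝓧) → ℝ := fun q =>
      ∫ w, ‖g q - g (w, q.2)‖ ^ 2 * ‖g q‖ ^ (2 * (p - 1)) ∂(ν 0) with hD₀
    set D₁ : 𝓧 × (Fin n → 𝓧) → ℝ := fun q => ∑ k, ∫ w, ‖g q - g (q.1, Function.update q.2 k w)‖ ^ 2
      * ‖g q‖ ^ (2 * (p - 1)) ∂(ν' k) with hD₁
    have hbd : ∀ q q', ‖‖g q - g q'‖ ^ 2 * ‖g q‖ ^ (2 * (p - 1))‖ ≤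
        (B + B) ^ 2 * B ^ (2 * (p - 1)) := by
      intro x y
      have h0 : 0 ≤ B := (norm_nonneg _).trans (hgB x)
      simp only [norm_mul, norm_pow, norm_norm]
      gcongr
      · exact (norm_sub_le _ _).trans (add_le_add (hgB _) (hgB _))
      · exact hgB _
    have hD₀m : Measurable D₀ := by
      refine measurable_integral_snd
        (f := fun q w => ‖g q - g (w, q.2)‖ ^ 2 * ‖g q‖ ^ (2 * (p - 1))) ?_
      unfold Function.uncurry
      fun_prop
    have hD₁m : Measurable D₁ := by
      refine Finset.measurable_sum _ fun k _ => ?_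
      refine measurable_integral_snd
        (f := fun q w => ‖g q - g (q.1, Function.update q.2 k w)‖ ^ 2 * ‖g q‖ ^ (2 * (p - 1))) ?_
      unfold Function.uncurry
      have hu : Measurable fun a : (𝓧 × (Fin n → 𝓧)) × 𝓧 => Function.update a.1.2 k a.2 := by
        refine measurable_pi_lambda _ fun j => ?_
        by_cases hj : j = k
        · subst hj; simpa using measurable_snd
        · simp only [Function.update_of_ne hj]; fun_prop
      fun_prop
    have hD₀i : Integrable D₀ ((ν 0).prod (Measure.pi ν')) :=
      integrable_of_bdd hD₀m fun q => norm_integral_le_of_bdd fun w => hbd _ _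
    have hD₁i : Integrable D₁ ((ν 0).prod (Measure.pi ν')) := by
      refine integrable_of_bdd hD₁m (B := ∑ _k : Fin n, (B + B) ^ 2 * B ^ (2 * (p - 1)))
        fun q => ?_
      exact (norm_sum_le _ _).trans
        (Finset.sum_le_sum fun k _ => norm_integral_le_of_bdd fun w => hbd _ _)
    have hsum : ∀ q : 𝓧 × (Fin n → 𝓧), ∑ k, ∫ w,
        ‖f (Fin.cons q.1 q.2) - f (Function.update (Fin.cons q.1 q.2 : Fin (n + 1) → 𝓧) k w)‖ ^ 2
          * ‖f (Fin.cons q.1 q.2)‖ ^ (2 * (p - 1)) ∂(ν k) = D₀ q + D₁ q := by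
      intro q
      rw [Fin.sum_univ_succ]
      simp only [Fin.update_cons_zero, ← Fin.cons_update, hD₀, hD₁, hg, hν']
    simp_rw [hsum]
    rw [integral_add hD₀i hD₁i, mul_add]
    refine add_le_add ?_ ?_
    · rw [integral_prod_symm _ hD₀i, ← integral_const_mul]
      refine integral_mono_of_nonneg (Eventually.of_forall fun y =>
        integral_nonneg fun x => by positivity) (hD₀i.integral_prod_right.const_mul _)
        (Eventually.of_forall fun y => ?_)
      exact variance_pow_le (ν 0) (hgy y) (fun x => hgB _) p
    · rw [integral_prod _ hD₁i, ← integral_const_mul]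
      refine integral_mono_of_nonneg (Eventually.of_forall fun y =>
        integral_nonneg fun x => by positivity) (hD₁i.integral_prod_left.const_mul _)
        (Eventually.of_forall fun x => ?_)
      exact ih ν' (hgx x) fun y => hgB _

/-- The moments of a function of independent variables whose square sum of increments under
resampling of single variables is bounded by `a` are at most those of a variable of size `√a`. -/
lemma integral_norm_sub_integral_pow_fin_le {𝓧 : Type*} [MeasurableSpace 𝓧] {B a : ℝ} {n : ℕ}
    (ν : Fin n → Measure 𝓧) [∀ i, IsProbabilityMeasure (ν i)] {f : (Fin n → 𝓧) → ℂ}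
    (hf : Measurable f) (hB : ∀ z, ‖f z‖ ≤ B)
    (ha : ∀ z y : Fin n → 𝓧, ∑ k, ‖f z - f (Function.update z k (y k))‖ ^ 2 ≤ a) (p : ℕ) :
    ∫ z, ‖f z - ∫ y, f y ∂(Measure.pi ν)‖ ^ (2 * p) ∂(Measure.pi ν) ≤
      (∏ k ∈ Finset.range p, (((k : ℝ) + 1) ^ 2 + 1)) * a ^ p := by
  set π := Measure.pi ν with hπ
  set m := ∫ y, f y ∂π with hm
  set F : (Fin n → 𝓧) → ℂ := fun z => f z - m with hFdef
  have hFm : Measurable F := hf.sub_const _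
  have hmB : ‖m‖ ≤ B := norm_integral_le_of_bdd hB
  have hFB : ∀ z, ‖F z‖ ≤ B + B := fun z => (norm_sub_le _ _).trans (add_le_add (hB z) hmB)
  have hB0 : 0 ≤ B := (norm_nonneg _).trans hmB
  have hi : ∀ k : ℕ, Integrable (fun z => ‖F z‖ ^ k) π := fun k =>
    integrable_of_bdd (B := (B + B) ^ k) (by fun_prop) fun z => by
      simpa using pow_le_pow_left₀ (norm_nonneg _) (hFB z) k
  have hnn : ∀ k : ℕ, 0 ≤ ∫ z, ‖F z‖ ^ k ∂π := fun k => integral_nonneg fun z => by positivity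
  have ha0 : 0 ≤ a := by
    have hne : Nonempty (Fin n → 𝓧) := by
      by_contra h
      rw [not_nonempty_iff] at h
      have := measure_univ (μ := π)
      rw [Set.univ_eq_empty_iff.2 h] at this
      simp at this
    obtain ⟨z⟩ := hne
    exact (Finset.sum_nonneg fun k _ => by positivity).trans (ha z z)
  have hS : ∀ k : ℕ, ∫ z, ‖F z ^ (k + 1) - ∫ y, F y ^ (k + 1) ∂π‖ ^ 2 ∂π ≤
      ((k : ℝ) + 1) ^ 2 * (a * ∫ z, ‖F z‖ ^ (2 * k) ∂π) := by
    intro k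
    refine (variance_pow_pi_fin_le (k + 1) ν hFm hFB).trans ?_
    push_cast
    gcongr
    rw [← integral_const_mul]
    refine integral_mono_of_nonneg (Eventually.of_forall fun z => ?_) ((hi _).const_mul _)
      (Eventually.of_forall fun z => ?_)
    · exact Finset.sum_nonneg fun j _ => integral_nonneg fun w => by positivity
    · simp only [hFdef, sub_sub_sub_cancel_right]
      have hint : ∀ j, Integrable
          (fun w => ‖f z - f (Function.update z j w)‖ ^ 2) (ν j) := fun j =>
        integrable_of_bdd (B := (B + B) ^ 2) (by
          have : Measurable fun w => f (Function.update z j w) :=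
            hf.comp (measurable_update z)
          fun_prop) fun w => by
          rw [norm_pow, norm_norm]
          exact pow_le_pow_left₀ (norm_nonneg _)
            ((norm_sub_le _ _).trans (add_le_add (hB _) (hB _))) 2
      simp_rw [integral_mul_const]
      rw [← Finset.sum_mul]
      gcongr
      -- write the single resamplings as coordinates of one independent copy
      have h1 : ∀ j, ∫ w, ‖f z - f (Function.update z j w)‖ ^ 2 ∂(ν j) =
          ∫ y, ‖f z - f (Function.update z j (y j))‖ ^ 2 ∂π := fun j =>
        by
        have hmp := measurePreserving_eval ν j
        have := integral_map (μ := π) (φ := Function.eval j)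
          (f := fun w => ‖f z - f (Function.update z j w)‖ ^ 2) hmp.measurable.aemeasurable
          (by rw [hmp.map_eq]; exact (hint j).aestronglyMeasurable)
        rwa [hmp.map_eq] at this
      simp_rw [h1]
      have h2 : ∀ j, Integrable (fun y : Fin n → 𝓧 =>
          ‖f z - f (Function.update z j (y j))‖ ^ 2) π := fun j =>
        (measurePreserving_eval ν j).integrable_comp_of_integrable (hint j)
      rw [← integral_finsetSum _ fun j _ => h2 j]
      calc _ ≤ ∫ _y, a ∂π := integral_mono (integrable_finsetSum _ fun j _ => h2 j)
            (integrable_const _) fun y => ha z y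
        _ = a := by simp
  have hvar : ∀ k : ℕ, ∫ z, ‖F z‖ ^ (2 * (k + 1)) ∂π ≤
      ((k : ℝ) + 1) ^ 2 * (a * ∫ z, ‖F z‖ ^ (2 * k) ∂π) + ‖∫ z, F z ^ (k + 1) ∂π‖ ^ 2 := by
    intro k
    have h := hS k
    rw [integral_norm_sub_integral_sq_eq π (hFm.pow_const _) (B := (B + B) ^ (k + 1))
      fun z => by rw [norm_pow]; exact pow_le_pow_left₀ (norm_nonneg _) (hFB z) _] at h
    simp_rw [norm_pow, ← pow_mul, mul_comm (k + 1) 2] at h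
    linarith
  have hm1 : ∫ z, F z ∂π = 0 := by
    simp only [hFdef]
    rw [integral_sub (integrable_of_bdd hf hB) (integrable_const _)]
    simp [hm]
  have hm2 : ∫ z, ‖F z‖ ^ 2 ∂π ≤ a := by
    have := hvar 0
    simp [hm1] at this
    exact this
  induction p with
  | zero => simp
  | succ k ih =>
    have hcs : ‖∫ z, F z ^ (k + 1) ∂π‖ ^ 2 ≤ a * ∫ z, ‖F z‖ ^ (2 * k) ∂π := by
      have h1 : ‖∫ z, F z ^ (k + 1) ∂π‖ ≤ ∫ z, ‖F z‖ ^ k * ‖F z‖ ∂π := by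
        refine (norm_integral_le_integral_norm _).trans (le_of_eq ?_)
        simp [pow_succ]
      have h2 : (∫ z, ‖F z‖ ^ k * ‖F z‖ ∂π) ^ 2 ≤
          (∫ z, ‖F z‖ ^ (2 * k) ∂π) * ∫ z, ‖F z‖ ^ 2 ∂π := by
        -- Cauchy–Schwarz through the discriminant
        have hq : ∀ s : ℝ, 0 ≤ (∫ z, ‖F z‖ ^ 2 ∂π) * (s * s)
            + (2 * ∫ z, ‖F z‖ ^ k * ‖F z‖ ∂π) * s + ∫ z, ‖F z‖ ^ (2 * k) ∂π := by
          intro s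
          have : 0 ≤ ∫ z, (‖F z‖ ^ k + s * ‖F z‖) ^ 2 ∂π := integral_nonneg fun z => by positivity
          have hk1 : Integrable (fun z => ‖F z‖ ^ k * ‖F z‖) π := by
            simpa [pow_succ] using hi (k + 1)
          have he : ∀ z, (‖F z‖ ^ k + s * ‖F z‖) ^ 2 =
              (s * s) * ‖F z‖ ^ 2 + (2 * s) * (‖F z‖ ^ k * ‖F z‖) + ‖F z‖ ^ (2 * k) := by
            intro z; rw [mul_comm 2 k, pow_mul]; ring
          simp_rw [he] at this
          have i1 : Integrable (fun z => (s * s) * ‖F z‖ ^ 2) π := (hi 2).const_mul _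
          have i2 : Integrable (fun z => (2 * s) * (‖F z‖ ^ k * ‖F z‖)) π := hk1.const_mul _
          have i3 : Integrable
              (fun z => (s * s) * ‖F z‖ ^ 2 + (2 * s) * (‖F z‖ ^ k * ‖F z‖)) π := i1.add i2
          rw [integral_add i3 (hi _), integral_add i1 i2, integral_const_mul,
            integral_const_mul] at this
          linarith
        have := discrim_le_zero hq
        unfold discrim at this
        nlinarith
      calc _ ≤ (∫ z, ‖F z‖ ^ k * ‖F z‖ ∂π) ^ 2 := by gcongr
        _ ≤ _ := h2
        _ ≤ (∫ z, ‖F z‖ ^ (2 * k) ∂π) * a := by gcongr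
        _ = _ := mul_comm _ _
    rw [Finset.prod_range_succ]
    calc _ ≤ _ := hvar k
      _ ≤ (((k : ℝ) + 1) ^ 2 + 1) * a * ∫ z, ‖F z‖ ^ (2 * k) ∂π := by linarith
      _ ≤ (((k : ℝ) + 1) ^ 2 + 1) * a *
          ((∏ j ∈ Finset.range k, (((j : ℝ) + 1) ^ 2 + 1)) * a ^ k) := by gcongr
      _ = _ := by ring

/-- The previous moment bound for an arbitrary finite index set. -/
lemma integral_norm_sub_integral_pow_le {𝓧 : Type*} [MeasurableSpace 𝓧] {B a : ℝ}
    {ι : Type*} [Fintype ι] [DecidableEq ι]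
    (ν : ι → Measure 𝓧) [∀ i, IsProbabilityMeasure (ν i)] {f : (ι → 𝓧) → ℂ}
    (hf : Measurable f) (hB : ∀ z, ‖f z‖ ≤ B)
    (ha : ∀ z y : ι → 𝓧, ∑ k, ‖f z - f (Function.update z k (y k))‖ ^ 2 ≤ a) (p : ℕ) :
    ∫ z, ‖f z - ∫ y, f y ∂(Measure.pi ν)‖ ^ (2 * p) ∂(Measure.pi ν) ≤
      (∏ k ∈ Finset.range p, (((k : ℝ) + 1) ^ 2 + 1)) * a ^ p := by
  set e := (Fintype.equivFin ι).symm with he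
  set φ := MeasurableEquiv.piCongrLeft (fun _ : ι => 𝓧) e with hφ
  have hmp := measurePreserving_piCongrLeft ν e
  have hφa : ∀ x i, φ x (e i) = x i := fun x i =>
    Equiv.piCongrLeft_apply_apply (fun _ : ι => 𝓧) e x i
  have hupd : ∀ x k w, φ (Function.update x k w) = Function.update (φ x) (e k) w := by
    intro x k w
    funext j
    obtain ⟨i, rfl⟩ := e.surjective j
    by_cases h : i = k
    · subst h; simp [hφa]
    · simp [hφa, Function.update_of_ne h, Function.update_of_ne (e.injective.ne h)]
  have h := integral_norm_sub_integral_pow_fin_le (fun i => ν (e i)) (f := fun x => f (φ x))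
    (hf.comp φ.measurable) (fun x => hB _) (a := a) (fun z y => by
      refine le_trans (le_of_eq ?_) (ha (φ z) (φ y))
      rw [← e.sum_comp]
      simp [hupd, hφa]) p
  rw [hmp.integral_comp' f] at h
  rwa [hmp.integral_comp' (fun z => ‖f z - ∫ y, f y ∂(Measure.pi ν)‖ ^ (2 * p))] at h

end EfronStein

/-! ### Hermitian matrices with independent bounded entries -/

/-- Operators on `ℂ^N` with the Euclidean norm. -/
abbrev Op (N : ℕ) := EuclideanSpace ℂ (Fin N) →L[ℂ] EuclideanSpace ℂ (Fin N)

/-- Positions on and above the diagonal. -/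
abbrev Idx (N : ℕ) := {p : Fin N × Fin N // p.1 ≤ p.2}

section Model

variable {N : ℕ}

/-- The weight that makes the two conjugate entries of a diagonal position add up correctly. -/
def diagWeight (k : Idx N) : ℂ := if k.1.1 = k.1.2 then 1 / 2 else 1

/-- The Hermitian matrix whose only entries are `w` at position `k` and its mirror image; at a
diagonal position the entry is `Re w`. -/
def entryOp (k : Idx N) (w : ℂ) : Op N := Matrix.toEuclideanCLM (𝕜 := ℂ)
  (diagWeight k • (Matrix.single k.1.1 k.1.2 w + Matrix.single k.1.2 k.1.1 (star w)))

lemma inner_toEuclideanCLM (M : Matrix (Fin N) (Fin N) ℂ) (x v : EuclideanSpace ℂ (Fin N)) :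
    inner ℂ x (Matrix.toEuclideanCLM (𝕜 := ℂ) M v) = ∑ i, star (x i) * ∑ j, M i j * v j := by
  rw [PiLp.inner_apply]
  refine Finset.sum_congr rfl fun i _ => ?_
  simp [Matrix.mulVec, dotProduct, mul_comm]

lemma inner_entryOp (k : Idx N) (w : ℂ) (x v : EuclideanSpace ℂ (Fin N)) :
    inner ℂ x (entryOp k w v) = diagWeight k *
      (w * (star (x k.1.1) * v k.1.2) + star w * (star (x k.1.2) * v k.1.1)) := by
  unfold entryOp
  rw [map_smul, map_add, _root_.smul_apply, _root_.add_apply,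
    inner_smul_right, inner_add_right, inner_toEuclideanCLM, inner_toEuclideanCLM]
  congr 2
  · rw [Finset.sum_eq_single k.1.1 (fun i _ hi => ?_) (by simp),
      Finset.sum_eq_single k.1.2 (fun j _ hj => ?_) (by simp)]
    · simp
      try ring
    · simp [Matrix.single_apply_of_col_ne _ _ hj.symm]
    · simp [Matrix.single_apply_of_row_ne hi.symm]
  · rw [Finset.sum_eq_single k.1.2 (fun i _ hi => ?_) (by simp),
      Finset.sum_eq_single k.1.1 (fun j _ hj => ?_) (by simp)]
    · simp
      try ring
    · simp [Matrix.single_apply_of_col_ne _ _ hj.symm]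
    · simp [Matrix.single_apply_of_row_ne hi.symm]

lemma norm_diagWeight_le (k : Idx N) : ‖diagWeight k‖ ≤ 1 := by
  unfold diagWeight; split_ifs <;> norm_num

lemma norm_inner_entryOp_le (k : Idx N) (w : ℂ) (x v : EuclideanSpace ℂ (Fin N)) :
    ‖inner ℂ x (entryOp k w v)‖ ≤
      ‖w‖ * (‖x k.1.1‖ * ‖v k.1.2‖ + ‖x k.1.2‖ * ‖v k.1.1‖) := by
  rw [inner_entryOp, norm_mul]
  calc _ ≤ 1 * ‖w * (star (x k.1.1) * v k.1.2) + star w * (star (x k.1.2) * v k.1.1)‖ := by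
        gcongr; exact norm_diagWeight_le k
    _ ≤ ‖w * (star (x k.1.1) * v k.1.2)‖ + ‖star w * (star (x k.1.2) * v k.1.1)‖ := by
        rw [one_mul]; exact norm_add_le _ _
    _ = _ := by simp only [norm_mul, norm_star]; ring

lemma norm_entryOp_le (k : Idx N) (w : ℂ) : ‖entryOp k w‖ ≤ 2 * ‖w‖ := by
  refine ContinuousLinearMap.opNorm_le_bound _ (by positivity) fun v => ?_
  have h := norm_inner_entryOp_le k w (entryOp k w v) v
  rw [inner_self_eq_norm_sq_to_K] at h
  set y := entryOp k w v
  have h2 : ‖y‖ ^ 2 ≤ ‖y‖ * (2 * ‖w‖ * ‖v‖) := by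
    calc ‖y‖ ^ 2 ≤ ‖w‖ * (‖y k.1.1‖ * ‖v k.1.2‖ + ‖y k.1.2‖ * ‖v k.1.1‖) := by simpa using h
      _ ≤ ‖w‖ * (‖y‖ * ‖v‖ + ‖y‖ * ‖v‖) := by gcongr <;> exact PiLp.norm_apply_le _ _
      _ = _ := by ring
  rcases (norm_nonneg y).eq_or_lt with h0 | h0
  · rw [← h0]; positivity
  · rw [pow_two] at h2; exact le_of_mul_le_mul_left h2 h0

lemma isSelfAdjoint_entryOp (k : Idx N) (w : ℂ) : IsSelfAdjoint (entryOp k w) := by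
  unfold entryOp
  refine IsSelfAdjoint.map (f := (Matrix.toEuclideanCLM (n := Fin N) (𝕜 := ℂ))) ?_
  have : star (diagWeight k) = diagWeight k := by unfold diagWeight; split_ifs <;> simp
  rw [isSelfAdjoint_iff, star_smul, this, star_add, Matrix.star_eq_conjTranspose,
    Matrix.star_eq_conjTranspose, Matrix.conjTranspose_single, Matrix.conjTranspose_single,
    star_star, add_comm]

lemma entryOp_sub (k : Idx N) (w w' : ℂ) : entryOp k (w - w') = entryOp k w - entryOp k w' := by
  unfold entryOp
  rw [← map_sub, ← smul_sub]
  congr 2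
  ext i j
  simp only [Matrix.sub_apply, Matrix.add_apply, Matrix.single_apply, star_sub]
  split_ifs <;> ring

lemma continuous_entryOp (k : Idx N) : Continuous (entryOp k) := by
  rw [continuous_iff_continuousAt]
  intro w
  rw [ContinuousAt, tendsto_iff_norm_sub_tendsto_zero]
  refine squeeze_zero (g := fun w' => 2 * ‖w' - w‖) (fun _ => norm_nonneg _)
    (fun w' => by rw [← entryOp_sub]; exact norm_entryOp_le k (w' - w)) ?_
  have : Tendsto (fun w' => 2 * ‖w' - w‖) (𝓝 w) (𝓝 (2 * ‖w - w‖)) := by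
    refine Continuous.tendsto ?_ w; fun_prop
  simpa using this

/-- A Hermitian matrix is the sum of its entries. -/
lemma sum_entryOp {M : Matrix (Fin N) (Fin N) ℂ} (hM : M.IsHermitian) :
    ∑ k : Idx N, entryOp k (M k.1.1 k.1.2) = Matrix.toEuclideanCLM (𝕜 := ℂ) M := by
  unfold entryOp
  rw [← map_sum]
  congr 1
  ext i j
  rw [Matrix.sum_apply]
  have hs : star (M j i) = M i j := hM.apply i j
  have hne : ∀ k : Idx N, ∀ a b, a ≠ k.1.1 ∨ b ≠ k.1.2 → ∀ c : ℂ,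
      Matrix.single k.1.1 k.1.2 c a b = 0 := fun k a b h c => by
    rcases h with h | h
    · exact Matrix.single_apply_of_row_ne h.symm _ _ _
    · exact Matrix.single_apply_of_col_ne _ _ h.symm _
  have hne' : ∀ k : Idx N, ∀ a b, a ≠ k.1.2 ∨ b ≠ k.1.1 → ∀ c : ℂ,
      Matrix.single k.1.2 k.1.1 c a b = 0 := fun k a b h c => by
    rcases h with h | h
    · exact Matrix.single_apply_of_row_ne h.symm _ _ _
    · exact Matrix.single_apply_of_col_ne _ _ h.symm _
  rcases lt_trichotomy i j with h | h | h
  · rw [Finset.sum_eq_single ⟨(i, j), h.le⟩ (fun k _ hk => ?_) (by simp)]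
    · simp [diagWeight, h.ne, h.ne']
    · have h1 : i ≠ k.1.1 ∨ j ≠ k.1.2 := by
        by_contra! h1; exact hk (Subtype.ext (Prod.ext h1.1.symm h1.2.symm))
      have h2 : i ≠ k.1.2 ∨ j ≠ k.1.1 := by
        by_contra! h2; have := k.2; rw [← h2.1, ← h2.2] at this; exact absurd h (not_lt.2 this)
      simp [hne k i j h1, hne' k i j h2]
  · subst h
    rw [Finset.sum_eq_single ⟨(i, i), le_rfl⟩ (fun k _ hk => ?_) (by simp)]
    · have hs' : (starRingEnd ℂ) (M i i) = M i i := hs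
      simp [diagWeight, hs']; ring
    · have h1 : i ≠ k.1.1 ∨ i ≠ k.1.2 := by
        by_contra! h1; exact hk (Subtype.ext (Prod.ext h1.1.symm h1.2.symm))
      simp [hne k i i h1, hne' k i i h1.symm]
  · rw [Finset.sum_eq_single ⟨(j, i), h.le⟩ (fun k _ hk => ?_) (by simp)]
    · have hs' : (starRingEnd ℂ) (M j i) = M i j := hs
      simp [diagWeight, h.ne, hs', h.ne']
    · have h1 : i ≠ k.1.2 ∨ j ≠ k.1.1 := by
        by_contra! h1; exact hk (Subtype.ext (Prod.ext h1.2.symm h1.1.symm))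
      have h2 : i ≠ k.1.1 ∨ j ≠ k.1.2 := by
        by_contra! h2; have := k.2; rw [← h2.1, ← h2.2] at this; exact absurd h (not_lt.2 this)
      simp [hne k i j h2, hne' k i j h1]

lemma sum_idx_le {g : Fin N → Fin N → ℝ} (hg : ∀ i j, 0 ≤ g i j) :
    ∑ k : Idx N, g k.1.1 k.1.2 ≤ ∑ i, ∑ j, g i j := by
  rw [← Finset.sum_product', ← Finset.univ_product_univ.symm]
  calc ∑ k : Idx N, g k.1.1 k.1.2
      = ∑ p ∈ Finset.univ.filter (fun p : Fin N × Fin N => p.1 ≤ p.2), g p.1 p.2 := by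
        rw [Finset.sum_subtype (p := fun p : Fin N × Fin N => p.1 ≤ p.2) _ (by simp)]
    _ ≤ _ := Finset.sum_le_sum_of_subset_of_nonneg (by simp) fun p _ _ => hg _ _

lemma sum_norm_sq_eq (v : EuclideanSpace ℂ (Fin N)) : ∑ i, ‖v i‖ ^ 2 = ‖v‖ ^ 2 :=
  (EuclideanSpace.norm_sq_eq v).symm

/-- A quadratic bound over all positions by norms of vectors. -/
lemma sum_idx_sq_le (a b : EuclideanSpace ℂ (Fin N)) :
    ∑ k : Idx N, (‖a k.1.1‖ * ‖b k.1.2‖) ^ 2 ≤ ‖a‖ ^ 2 * ‖b‖ ^ 2 := by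
  refine (sum_idx_le (g := fun i j => (‖a i‖ * ‖b j‖) ^ 2) fun i j => by positivity).trans ?_
  simp_rw [mul_pow]
  rw [← sum_norm_sq_eq a, ← sum_norm_sq_eq b, Finset.sum_mul_sum]

lemma sum_idx_fst_le (b : EuclideanSpace ℂ (Fin N)) :
    ∑ k : Idx N, ‖b k.1.1‖ ^ 2 ≤ N * ‖b‖ ^ 2 := by
  refine (sum_idx_le (g := fun i _ => ‖b i‖ ^ 2) fun i j => by positivity).trans ?_
  simp [← sum_norm_sq_eq b, Finset.mul_sum]

lemma sum_idx_snd_le (b : EuclideanSpace ℂ (Fin N)) :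
    ∑ k : Idx N, ‖b k.1.2‖ ^ 2 ≤ N * ‖b‖ ^ 2 := by
  refine (sum_idx_le (g := fun _ j => ‖b j‖ ^ 2) fun i j => by positivity).trans ?_
  simp [← sum_norm_sq_eq b]

lemma sum_idx_swap_sq_le (a b : EuclideanSpace ℂ (Fin N)) :
    ∑ k : Idx N, (‖a k.1.2‖ * ‖b k.1.1‖) ^ 2 ≤ ‖a‖ ^ 2 * ‖b‖ ^ 2 := by
  have := sum_idx_sq_le b a
  simpa [mul_comm] using this

end Model

/-! ### Concentration of matrix elements of the propagator -/

section Concentration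

variable {N : ℕ} {𝓧 : Type*}

instance : SecondCountableTopology (Op N) :=
  haveI : ProperSpace (Op N) := FiniteDimensional.proper ℂ _
  inferInstance

/-- The Hermitian noise matrix with entries `ξ (z k)`. -/
def noise (ξ : 𝓧 → ℂ) (z : Idx N → 𝓧) : Op N := ∑ k, entryOp k (ξ (z k))

/-- The perturbed Hamiltonian `H₀ + λ W`. -/
def ham (H₀ : Op N) (lam : ℝ) (ξ : 𝓧 → ℂ) (z : Idx N → 𝓧) : Op N :=
  H₀ + (lam : ℂ) • noise ξ z

lemma isSelfAdjoint_noise (ξ : 𝓧 → ℂ) (z : Idx N → 𝓧) : IsSelfAdjoint (noise ξ z) :=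
  isSelfAdjoint_sum (R := Op N) _ fun k _ => isSelfAdjoint_entryOp k _

lemma isSelfAdjoint_ham {H₀ : Op N} (hH : IsSelfAdjoint H₀) (lam : ℝ) (ξ : 𝓧 → ℂ)
    (z : Idx N → 𝓧) : IsSelfAdjoint (ham H₀ lam ξ z) := by
  refine IsSelfAdjoint.add (R := Op N) hH ?_
  have := isSelfAdjoint_noise ξ z
  rw [isSelfAdjoint_iff, star_smul, this.star_eq]
  simp

lemma noise_update (ξ : 𝓧 → ℂ) (z : Idx N → 𝓧) (k : Idx N) (w : 𝓧) :
    noise ξ (Function.update z k w) = noise ξ z + entryOp k (ξ w - ξ (z k)) := by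
  unfold noise
  rw [← Finset.add_sum_erase _ _ (Finset.mem_univ k), ← Finset.add_sum_erase _
    (fun k => entryOp k (ξ (z k))) (Finset.mem_univ k), entryOp_sub]
  have : ∑ j ∈ Finset.univ.erase k, entryOp j (ξ (Function.update z k w j)) =
      ∑ j ∈ Finset.univ.erase k, entryOp j (ξ (z j)) :=
    Finset.sum_congr rfl fun j hj => by rw [Function.update_of_ne (Finset.ne_of_mem_erase hj)]
  rw [this]
  simp
  abel

lemma ham_update_sub (H₀ : Op N) (lam : ℝ) (ξ : 𝓧 → ℂ) (z : Idx N → 𝓧) (k : Idx N) (w : 𝓧) :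
    ham H₀ lam ξ (Function.update z k w) - ham H₀ lam ξ z =
      (lam : ℂ) • entryOp k (ξ w - ξ (z k)) := by
  unfold ham
  rw [noise_update, smul_add]
  abel

lemma norm_noise_le {ξ : 𝓧 → ℂ} {r : ℝ} (hr : ∀ x, ‖ξ x‖ ≤ r) (z : Idx N → 𝓧) :
    ‖noise ξ z‖ ≤ Fintype.card (Idx N) * (2 * r) := by
  refine (norm_sum_le _ _).trans ?_
  calc _ ≤ ∑ _k : Idx N, 2 * r :=
        Finset.sum_le_sum fun k _ => (norm_entryOp_le _ _).trans (by gcongr; exact hr _)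
    _ = _ := by simp

lemma norm_noise_mul_prop_le {ξ : 𝓧 → ℂ} {r : ℝ} {H₀ : Op N} (lam : ℝ) (hH : IsSelfAdjoint H₀)
    (hr : ∀ x, ‖ξ x‖ ≤ r) (t : ℝ)
    (z : Idx N → 𝓧) :
    ‖noise ξ z * prop (ham H₀ lam ξ z) t‖ ≤ Fintype.card (Idx N) * (2 * r) := by
  refine (norm_mul_le _ _).trans ?_
  calc _ ≤ ‖noise ξ z‖ * 1 := by
        gcongr; exact norm_prop_le (isSelfAdjoint_ham hH lam ξ z) t
    _ ≤ _ := by rw [mul_one]; exact norm_noise_le hr z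

/-- The bounded-difference constant of the matrix elements of `e^{i t (H₀ + λ W)}` for entries
of size at most `r`, with `q = |λ| t r`. -/
def incrBound (N : ℕ) (q : ℝ) : ℝ := 32 * q ^ 2 * (1 + 16 * q ^ 2 * N)

/-- Resampling the entries one at a time changes a matrix element of the propagator by amounts
whose squares sum to order `r ^ 2 * (1 + r ^ 2 * N)`: to first order the response to entry `(i, j)`
is the product of two coordinates of vectors of norm at most one. -/
lemma sum_sq_increments_le {H₀ : Op N} (hH : IsSelfAdjoint H₀) (lam : ℝ) {ξ : 𝓧 → ℂ} {r : ℝ}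
    (hr : ∀ x, ‖ξ x‖ ≤ r) {t : ℝ} (ht : 0 ≤ t) {x y : EuclideanSpace ℂ (Fin N)} (hx : ‖x‖ ≤ 1)
    (hy : ‖y‖ ≤ 1) (z z' : Idx N → 𝓧) :
    ∑ k, ‖inner ℂ x (prop (ham H₀ lam ξ z) t y)
      - inner ℂ x (prop (ham H₀ lam ξ (Function.update z k (z' k))) t y)‖ ^ 2
      ≤ incrBound N (|lam| * t * r) := by
  rcases isEmpty_or_nonempty (Idx N) with hI | ⟨⟨k₀⟩⟩
  · simp only [Finset.univ_eq_empty, Finset.sum_empty]; unfold incrBound; positivity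
  have hr0 : 0 ≤ r := (norm_nonneg _).trans (hr (z k₀))
  set A := ham H₀ lam ξ z with hA
  set B : Idx N → Op N := fun k => ham H₀ lam ξ (Function.update z k (z' k)) with hB
  have hAs : IsSelfAdjoint A := isSelfAdjoint_ham hH _ _ _
  have hBs : ∀ k, IsSelfAdjoint (B k) := fun k => isSelfAdjoint_ham hH _ _ _
  set δ : Idx N → ℂ := fun k => ξ (z' k) - ξ (z k) with hδ
  have hδr : ∀ k, ‖δ k‖ ≤ 2 * r := fun k =>
    (norm_sub_le _ _).trans (by linarith [hr (z' k), hr (z k)])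
  have hBA : ∀ k, B k - A = (lam : ℂ) • entryOp k (δ k) := fun k => ham_update_sub _ _ _ _ _ _
  set ρ := t * (|lam| * (4 * r)) with hρ
  have hρ0 : 0 ≤ ρ := by positivity
  set C := Real.sqrt (lam ^ 2 * (16 * r ^ 2) * (2 + 2 * ρ ^ 2 * N)) with hC
  have hC2 : C ^ 2 = lam ^ 2 * (16 * r ^ 2) * (2 + 2 * ρ ^ 2 * N) :=
    Real.sq_sqrt (by positivity)
  have key := sum_sq_inner_prop_sub_prop_le (A := A) (B := B) ht (fun _ => x) y
    (C := C) (Real.sqrt_nonneg _) (fun s hs => by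
      rw [hC2]
      set b := prop A (t - s) y with hb
      have hb1 : ‖b‖ ≤ 1 := by rw [hb, norm_prop_apply hAs]; exact hy
      set a := star (prop A s) x with ha
      have ha1 : ‖a‖ ≤ 1 := by rw [ha, star_prop hAs, norm_prop_apply hAs]; exact hx
      have hterm : ∀ k, ‖inner ℂ x (prop (B k) s ((B k - A) b))‖ ^ 2 ≤
          lam ^ 2 * (16 * r ^ 2) * ((‖a k.1.1‖ * ‖b k.1.2‖) ^ 2 + (‖a k.1.2‖ * ‖b k.1.1‖) ^ 2
            + ρ ^ 2 * ‖b k.1.2‖ ^ 2 + ρ ^ 2 * ‖b k.1.1‖ ^ 2) := by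
        intro k
        set a' := star (prop (B k) s) x with ha'
        have e1 : inner ℂ x (prop (B k) s ((B k - A) b)) = lam * inner ℂ a' (entryOp k (δ k) b) := by
          rw [ha', ContinuousLinearMap.star_eq_adjoint, ContinuousLinearMap.adjoint_inner_left,
            hBA]
          simp only [_root_.smul_apply, map_smul, inner_smul_right]
        -- resampling a single entry moves the coordinates of the backward evolved `x` by at most `ρ`
        have ha'a : ∀ i, ‖a' i‖ ≤ ‖a i‖ + ρ := by
          intro i
          have h1 : ‖a' i - a i‖ ≤ ρ := by
            calc ‖a' i - a i‖ = ‖(a' - a) i‖ := by simp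
              _ ≤ ‖a' - a‖ := PiLp.norm_apply_le _ _
              _ = ‖star (prop (B k) s - prop A s) x‖ := by simp [ha', ha]
              _ ≤ ‖star (prop (B k) s - prop A s)‖ * ‖x‖ := ContinuousLinearMap.le_opNorm _ _
              _ ≤ (s * ‖B k - A‖) * 1 := by
                  rw [norm_star]
                  have := norm_prop_sub_prop_le (hBs k) hAs hs.1
                  exact mul_le_mul this hx (norm_nonneg _) ((norm_nonneg _).trans this)
              _ ≤ ρ := by
                  rw [mul_one, hBA, norm_smul, hρ]
                  gcongr
                  · exact hs.2
                  · simp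
                  · exact (norm_entryOp_le _ _).trans (by linarith [hδr k])
          calc ‖a' i‖ = ‖a i + (a' i - a i)‖ := by congr 1; ring
            _ ≤ _ := (norm_add_le _ _).trans (by gcongr)
        have e2 : ‖inner ℂ a' (entryOp k (δ k) b)‖ ≤ 2 * r * (‖a k.1.1‖ * ‖b k.1.2‖ +
            ‖a k.1.2‖ * ‖b k.1.1‖ + ρ * ‖b k.1.2‖ + ρ * ‖b k.1.1‖) := by
          refine (norm_inner_entryOp_le _ _ _ _).trans ?_
          calc _ ≤ 2 * r * ((‖a k.1.1‖ + ρ) * ‖b k.1.2‖ + (‖a k.1.2‖ + ρ) * ‖b k.1.1‖) := by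
                gcongr
                · exact hδr k
                · exact ha'a _
                · exact ha'a _
            _ = _ := by ring
        rw [e1, norm_mul, mul_pow, Complex.norm_real, Real.norm_eq_abs, sq_abs, mul_assoc]
        gcongr
        refine (pow_le_pow_left₀ (norm_nonneg _) e2 2).trans ?_
        set p1 := ‖a k.1.1‖ * ‖b k.1.2‖
        set p2 := ‖a k.1.2‖ * ‖b k.1.1‖
        set p3 := ρ * ‖b k.1.2‖
        set p4 := ρ * ‖b k.1.1‖
        have : (p1 + p2 + p3 + p4) ^ 2 ≤ 4 * (p1 ^ 2 + p2 ^ 2 + p3 ^ 2 + p4 ^ 2) := by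
          linarith [sq_nonneg (p1 - p2), sq_nonneg (p1 - p3), sq_nonneg (p1 - p4),
            sq_nonneg (p2 - p3), sq_nonneg (p2 - p4), sq_nonneg (p3 - p4)]
        calc (2 * r * (p1 + p2 + p3 + p4)) ^ 2 = 4 * r ^ 2 * (p1 + p2 + p3 + p4) ^ 2 := by ring
          _ ≤ 4 * r ^ 2 * (4 * (p1 ^ 2 + p2 ^ 2 + p3 ^ 2 + p4 ^ 2)) := by gcongr
          _ = _ := by simp only [p3, p4]; ring
      refine (Finset.sum_le_sum fun k _ => hterm k).trans ?_
      rw [← Finset.mul_sum]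
      gcongr
      simp_rw [Finset.sum_add_distrib, ← Finset.mul_sum]
      have g1 := sum_idx_sq_le a b
      have g2 := sum_idx_swap_sq_le a b
      have g3 := sum_idx_snd_le b
      have g4 := sum_idx_fst_le b
      have hab : ‖a‖ ^ 2 * ‖b‖ ^ 2 ≤ 1 := by
        calc ‖a‖ ^ 2 * ‖b‖ ^ 2 ≤ 1 ^ 2 * 1 ^ 2 := by gcongr
          _ = 1 := by norm_num
      have hbN : (N : ℝ) * ‖b‖ ^ 2 ≤ N := by
        calc (N : ℝ) * ‖b‖ ^ 2 ≤ (N : ℝ) * 1 ^ 2 := by gcongr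
          _ = (N : ℝ) := by norm_num
      have g3' := mul_le_mul_of_nonneg_left (g3.trans hbN) (sq_nonneg ρ)
      have g4' := mul_le_mul_of_nonneg_left (g4.trans hbN) (sq_nonneg ρ)
      linarith)
  calc _ = ∑ k, ‖inner ℂ x (prop (B k) t y - prop A t y)‖ ^ 2 := by
        refine Finset.sum_congr rfl fun k _ => ?_
        rw [inner_sub_right, norm_sub_rev]
    _ ≤ (t * C) ^ 2 := key
    _ = incrBound N (|lam| * t * r) := by
        rw [mul_pow, hC2, hρ, incrBound]
        simp only [mul_pow, sq_abs]
        ring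

variable [MeasurableSpace 𝓧]

lemma measurable_noise {ξ : 𝓧 → ℂ} (hξ : Measurable ξ) :
    Measurable fun z : Idx N → 𝓧 => noise ξ z := by
  refine Finset.measurable_sum _ fun k _ => ?_
  exact (continuous_entryOp k).measurable.comp (hξ.comp (measurable_pi_apply k))

lemma measurable_ham {ξ : 𝓧 → ℂ} (hξ : Measurable ξ) (H₀ : Op N) (lam : ℝ) :
    Measurable fun z : Idx N → 𝓧 => ham H₀ lam ξ z :=
  ((measurable_noise hξ).const_smul (lam : ℂ)).const_add H₀

lemma measurable_prop {α : Type*} [MeasurableSpace α] {A : α → Op N} {t : α → ℝ}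
    (hA : Measurable A) (ht : Measurable t) : Measurable fun a => prop (A a) (t a) :=
  continuous_prop.measurable.comp (hA.prodMk ht)

lemma measurable_inner_prop {α : Type*} [MeasurableSpace α] {A : α → Op N} (hA : Measurable A)
    (t : ℝ) (x y : EuclideanSpace ℂ (Fin N)) :
    Measurable fun a => inner ℂ x (prop (A a) t y) :=
  (matEl x y).continuous.measurable.comp (measurable_prop hA measurable_const)

variable (ν : Idx N → Measure 𝓧) [∀ k, IsProbabilityMeasure (ν k)]

lemma integral_norm_inner_prop_sub_pow_le {H₀ : Op N} (hH : IsSelfAdjoint H₀) (lam : ℝ)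
    {ξ : 𝓧 → ℂ} (hξ : Measurable ξ) {r : ℝ}
    (hr : ∀ x, ‖ξ x‖ ≤ r) {t : ℝ} (ht : 0 ≤ t) {x y : EuclideanSpace ℂ (Fin N)} (hx : ‖x‖ ≤ 1)
    (hy : ‖y‖ ≤ 1) (p : ℕ) :
    ∫ z, ‖inner ℂ x (prop (ham H₀ lam ξ z) t y)
        - ∫ z', inner ℂ x (prop (ham H₀ lam ξ z') t y) ∂(Measure.pi ν)‖ ^ (2 * p) ∂(Measure.pi ν)
      ≤ (∏ k ∈ Finset.range p, (((k : ℝ) + 1) ^ 2 + 1)) * incrBound N (|lam| * t * r) ^ p :=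
  integral_norm_sub_integral_pow_le ν
    (f := fun z => inner ℂ x (prop (ham H₀ lam ξ z) t y))
    (measurable_inner_prop (measurable_ham hξ H₀ lam) t x y) (B := 1)
    (fun _ => (norm_inner_prop_le (isSelfAdjoint_ham hH _ _ _) t x y).trans
      (mul_le_one₀ hx (norm_nonneg _) hy))
    (fun z z' => sum_sq_increments_le hH lam hr ht hx hy z z') p

end Concentration

/-! ### Integration over one coordinate, differentiation of expectations -/

section Tools

variable {𝓧 : Type*} [MeasurableSpace 𝓧] {ι : Type*} [Fintype ι] [DecidableEq ι]

lemma measurePreserving_update (ν : ι → Measure 𝓧) [∀ k, IsProbabilityMeasure (ν k)] (k : ι) :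
    MeasurePreserving (fun q : (ι → 𝓧) × 𝓧 => Function.update q.1 k q.2)
      ((Measure.pi ν).prod (ν k)) (Measure.pi ν) := by
  have hm : Measurable fun q : (ι → 𝓧) × 𝓧 => Function.update q.1 k q.2 := by
    refine measurable_pi_lambda _ fun j => ?_
    by_cases hj : j = k
    · subst hj; simpa using measurable_snd
    · simp only [Function.update_of_ne hj]; fun_prop
  refine ⟨hm, (Measure.pi_eq fun s hs => ?_).symm⟩
  rw [Measure.map_apply hm (MeasurableSet.univ_pi hs)]
  have : (fun q : (ι → 𝓧) × 𝓧 => Function.update q.1 k q.2) ⁻¹' Set.univ.pi s =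
      (Set.univ.pi (Function.update s k Set.univ)) ×ˢ (s k) := by
    ext ⟨z, w⟩
    simp only [Set.mem_preimage, Set.mem_univ_pi, Set.mem_prod]
    constructor
    · intro h
      refine ⟨fun j => ?_, by simpa using h k⟩
      by_cases hj : j = k
      · subst hj; simp
      · simpa [hj] using h j
    · rintro ⟨h1, h2⟩ j
      by_cases hj : j = k
      · subst hj; simpa using h2
      · simpa [hj] using h1 j
  rw [this, Measure.prod_prod, Measure.pi_pi, ← Finset.mul_prod_erase _ _ (Finset.mem_univ k),
    ← Finset.mul_prod_erase Finset.univ (fun i => ν i (s i)) (Finset.mem_univ k)]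
  have h2 : ∏ j ∈ Finset.univ.erase k, ν j (Function.update s k Set.univ j) =
      ∏ j ∈ Finset.univ.erase k, ν j (s j) :=
    Finset.prod_congr rfl fun j hj => by rw [Function.update_of_ne (Finset.ne_of_mem_erase hj)]
  rw [h2]
  simp [mul_comm]

/-- Integrating first over a single coordinate. -/
lemma integral_pi_update (ν : ι → Measure 𝓧) [∀ k, IsProbabilityMeasure (ν k)] (k : ι)
    {F : (ι → 𝓧) → ℂ} (hF : Measurable F) {B : ℝ} (hB : ∀ z, ‖F z‖ ≤ B) :
    ∫ z, F z ∂(Measure.pi ν) =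
      ∫ z, ∫ w, F (Function.update z k w) ∂(ν k) ∂(Measure.pi ν) := by
  have hmp := measurePreserving_update ν k
  have h := integral_map (μ := (Measure.pi ν).prod (ν k)) (f := F) hmp.measurable.aemeasurable
    hF.aestronglyMeasurable
  rw [hmp.map_eq] at h
  rw [h, integral_prod]
  exact integrable_of_bdd (hF.comp hmp.measurable) fun q => hB _

lemma hasDerivAt_integral_of_bdd {α : Type*} [MeasurableSpace α] {μ : Measure α}
    [IsFiniteMeasure μ] {F : Type*} [NormedAddCommGroup F] [NormedSpace ℝ F] [CompleteSpace F]
    [MeasurableSpace F] [BorelSpace F] [SecondCountableTopology F] {f f' : ℝ → α → F}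
    (hf : ∀ s, Measurable (f s)) (hf' : ∀ s, Measurable (f' s)) {B C : ℝ}
    (hB : ∀ s a, ‖f s a‖ ≤ B) (hC : ∀ s a, ‖f' s a‖ ≤ C)
    (hd : ∀ s a, HasDerivAt (fun s => f s a) (f' s a) s) (s : ℝ) :
    HasDerivAt (fun s => ∫ a, f s a ∂μ) (∫ a, f' s a ∂μ) s :=
  (hasDerivAt_integral_of_dominated_loc_of_deriv_le (bound := fun _ => C) (s := Set.univ)
    univ_mem (Eventually.of_forall fun s => (hf s).aestronglyMeasurable)
    (integrable_of_bdd (hf s) (hB s)) (hf' s).aestronglyMeasurable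
    (Eventually.of_forall fun a s _ => hC s a) (integrable_const _)
    (Eventually.of_forall fun a s _ => hd s a)).2

end Tools

section EntryBounds

variable {N : ℕ}

lemma norm_entryOp_apply_le (k : Idx N) (w : ℂ) (v : EuclideanSpace ℂ (Fin N)) :
    ‖entryOp k w v‖ ≤ ‖w‖ * (‖v k.1.1‖ + ‖v k.1.2‖) := by
  have h := norm_inner_entryOp_le k w (entryOp k w v) v
  rw [inner_self_eq_norm_sq_to_K] at h
  set y := entryOp k w v
  have h2 : ‖y‖ ^ 2 ≤ ‖y‖ * (‖w‖ * (‖v k.1.1‖ + ‖v k.1.2‖)) := by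
    calc ‖y‖ ^ 2 ≤ ‖w‖ * (‖y k.1.1‖ * ‖v k.1.2‖ + ‖y k.1.2‖ * ‖v k.1.1‖) := by simpa using h
      _ ≤ ‖w‖ * (‖y‖ * ‖v k.1.2‖ + ‖y‖ * ‖v k.1.1‖) := by
        gcongr <;> exact PiLp.norm_apply_le _ _
      _ = _ := by ring
  rcases (norm_nonneg y).eq_or_lt with h0 | h0
  · rw [← h0]; positivity
  · rw [pow_two] at h2; exact le_of_mul_le_mul_left h2 h0

lemma inner_entryOp_left (k : Idx N) (w : ℂ) (x v : EuclideanSpace ℂ (Fin N)) :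
    inner ℂ x (entryOp k w v) = inner ℂ (entryOp k w x) v := by
  conv_rhs => rw [← (isSelfAdjoint_entryOp k w).star_eq, ContinuousLinearMap.star_eq_adjoint,
    ContinuousLinearMap.adjoint_inner_left]

lemma norm_inner_entryOp_mul_entryOp_le (k : Idx N) (w : ℂ) {r m : ℝ} (hr : ‖w‖ ≤ r)
    {M : Op N} (hm : ‖M‖ ≤ m) (x v : EuclideanSpace ℂ (Fin N)) :
    ‖inner ℂ x (entryOp k w (M (entryOp k w v)))‖ ≤
      r ^ 2 * m * ((‖x k.1.1‖ + ‖x k.1.2‖) * (‖v k.1.1‖ + ‖v k.1.2‖)) := by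
  have hr0 : 0 ≤ r := (norm_nonneg _).trans hr
  have hm0 : 0 ≤ m := (norm_nonneg _).trans hm
  rw [inner_entryOp_left]
  calc _ ≤ ‖entryOp k w x‖ * (‖M‖ * ‖entryOp k w v‖) :=
        (norm_inner_le_norm _ _).trans (by gcongr; exact M.le_opNorm _)
    _ ≤ (r * (‖x k.1.1‖ + ‖x k.1.2‖)) * (m * (r * (‖v k.1.1‖ + ‖v k.1.2‖))) := by
        gcongr
        · exact (norm_entryOp_apply_le _ _ _).trans (by gcongr)
        · exact (norm_entryOp_apply_le _ _ _).trans (by gcongr)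
    _ = _ := by ring

lemma sum_idx_add_sq_le (x : EuclideanSpace ℂ (Fin N)) (hx : ‖x‖ ≤ 1) :
    ∑ k : Idx N, (‖x k.1.1‖ + ‖x k.1.2‖) ^ 2 ≤ 4 * N := by
  have hbN : (N : ℝ) * ‖x‖ ^ 2 ≤ N := by
    calc (N : ℝ) * ‖x‖ ^ 2 ≤ (N : ℝ) * 1 ^ 2 := by gcongr
      _ = (N : ℝ) := by norm_num
  calc ∑ k : Idx N, (‖x k.1.1‖ + ‖x k.1.2‖) ^ 2
      ≤ ∑ k : Idx N, (2 * ‖x k.1.1‖ ^ 2 + 2 * ‖x k.1.2‖ ^ 2) :=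
        Finset.sum_le_sum fun k _ => by nlinarith [sq_nonneg (‖x k.1.1‖ - ‖x k.1.2‖)]
    _ = 2 * ∑ k : Idx N, ‖x k.1.1‖ ^ 2 + 2 * ∑ k : Idx N, ‖x k.1.2‖ ^ 2 := by
        rw [Finset.sum_add_distrib, Finset.mul_sum, Finset.mul_sum]
    _ ≤ 4 * N := by linarith [sum_idx_fst_le x, sum_idx_snd_le x]

/-- Sums of second order terms, by the Cauchy–Schwarz inequality over positions. -/
lemma norm_sum_le_of_entry_bound {c : Idx N → ℂ} {R V : ℝ} {x : EuclideanSpace ℂ (Fin N)}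
    (hx : ‖x‖ ≤ 1) (v : Idx N → EuclideanSpace ℂ (Fin N)) (hR : 0 ≤ R) (hV : 0 ≤ V)
    (hc : ∀ k, ‖c k‖ ≤ R * ((‖x k.1.1‖ + ‖x k.1.2‖) * (‖v k k.1.1‖ + ‖v k k.1.2‖)))
    (hv : ∑ k, (‖v k k.1.1‖ + ‖v k k.1.2‖) ^ 2 ≤ V ^ 2) :
    ‖∑ k, c k‖ ≤ R * (2 * Real.sqrt N * V) := by
  refine (norm_sum_le _ _).trans ((Finset.sum_le_sum fun k _ => hc k).trans ?_)
  rw [← Finset.mul_sum]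
  gcongr
  refine (Real.sum_mul_le_sqrt_mul_sqrt _ _ _).trans ?_
  gcongr
  · refine Real.sqrt_le_iff.2 ⟨by positivity, (sum_idx_add_sq_le x hx).trans_eq ?_⟩
    rw [mul_pow, Real.sq_sqrt (Nat.cast_nonneg N)]; norm_num
  · exact Real.sqrt_le_iff.2 ⟨hV, hv⟩

end EntryBounds

/-! ### The covariance of the noise -/

section Covariance

variable {N : ℕ}

/-- The `j`-th vector of the standard basis. -/
abbrev stdVec (j : Fin N) : EuclideanSpace ℂ (Fin N) := EuclideanSpace.single j 1

/-- The `(i, j)` entry of an operator in the standard basis. -/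
def entry (M : Op N) (i j : Fin N) : ℂ := matEl (stdVec i) (stdVec j) M

lemma norm_stdVec (j : Fin N) : ‖stdVec j‖ = 1 := by simp

lemma inner_stdVec (j : Fin N) (v : EuclideanSpace ℂ (Fin N)) : inner ℂ (stdVec j) v = v j := by
  simp [EuclideanSpace.inner_single_left]

lemma entry_eq (M : Op N) (i j : Fin N) : entry M i j = (M (stdVec j)) i := by
  simp [entry, inner_stdVec]

/-- The normalized trace of an operator. -/
def ntr (N : ℕ) : Op N →L[ℂ] ℂ := (N : ℂ)⁻¹ • ∑ i, matEl (stdVec i) (stdVec i)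

lemma ntr_apply (M : Op N) : ntr N M = (N : ℂ)⁻¹ * ∑ i, entry M i i := by
  simp [ntr, entry]

lemma norm_entry_le {M : Op N} (hM : ‖M‖ ≤ 1) (i j : Fin N) : ‖entry M i j‖ ≤ 1 := by
  unfold entry
  rw [matEl_apply]
  refine (norm_inner_le_norm _ _).trans ?_
  rw [norm_stdVec, one_mul]
  refine (M.le_opNorm _).trans ?_
  rwa [norm_stdVec, mul_one]

lemma norm_ntr_le {M : Op N} (hM : ‖M‖ ≤ 1) : ‖ntr N M‖ ≤ 1 := by
  rw [ntr_apply, norm_mul, norm_inv, Complex.norm_natCast]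
  have : ‖∑ i, entry M i i‖ ≤ N := by
    refine (norm_sum_le _ _).trans ((Finset.sum_le_sum fun i _ => norm_entry_le hM i i).trans ?_)
    simp
  rcases (Nat.cast_nonneg (α := ℝ) N).eq_or_lt with h | h
  · rw [← h]; simp
  · rw [inv_mul_le_iff₀ h]; simpa using this

lemma inner_entryOp_mul_entryOp (k : Idx N) (w : ℂ) (M : Op N) (x b : EuclideanSpace ℂ (Fin N)) :
    inner ℂ x (entryOp k w (M (entryOp k w b))) = diagWeight k ^ 2 *
      (w ^ 2 * (star (x k.1.1) * entry M k.1.2 k.1.1 * b k.1.2)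
        + w * star w * (star (x k.1.1) * entry M k.1.2 k.1.2 * b k.1.1
          + star (x k.1.2) * entry M k.1.1 k.1.1 * b k.1.2)
        + star w ^ 2 * (star (x k.1.2) * entry M k.1.1 k.1.2 * b k.1.1)) := by
  have h : ∀ j, (M (entryOp k w b)) j = diagWeight k *
      (w * (entry M j k.1.1 * b k.1.2) + star w * (entry M j k.1.2 * b k.1.1)) := by
    intro j
    have e : ∀ i, star ((star M (stdVec j)) i) = entry M j i := fun i => by
      rw [← inner_stdVec, ContinuousLinearMap.star_eq_adjoint,
        ContinuousLinearMap.adjoint_inner_right, entry, matEl_apply]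
      exact inner_conj_symm _ _
    rw [← inner_stdVec, ← ContinuousLinearMap.adjoint_inner_left,
      ← ContinuousLinearMap.star_eq_adjoint, inner_entryOp, e, e]
  rw [inner_entryOp, h, h]
  ring

lemma sum_idx_diagWeight (f : Fin N → Fin N → ℂ) :
    ∑ k : Idx N, diagWeight k * (f k.1.1 k.1.2 + f k.1.2 k.1.1) = ∑ i, ∑ j, f i j := by
  have h1 : ∑ k : Idx N, diagWeight k * (f k.1.1 k.1.2 + f k.1.2 k.1.1) =
      ∑ p : Fin N × Fin N, if p.1 ≤ p.2 then
        (if p.1 = p.2 then (1 / 2 : ℂ) else 1) * (f p.1 p.2 + f p.2 p.1) else 0 := by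
    rw [← Finset.sum_filter, Finset.sum_subtype (p := fun p : Fin N × Fin N => p.1 ≤ p.2) _
      (by simp)]
    rfl
  have h2 : ∑ p : Fin N × Fin N, (if p.2 < p.1 then f p.1 p.2 else 0) =
      ∑ p : Fin N × Fin N, if p.1 < p.2 then f p.2 p.1 else 0 := by
    rw [← (Equiv.prodComm (Fin N) (Fin N)).sum_comp]; rfl
  have h3 : ∑ i, ∑ j, f i j = ∑ p : Fin N × Fin N,
      ((if p.1 ≤ p.2 then f p.1 p.2 else 0) + if p.2 < p.1 then f p.1 p.2 else 0) := by
    rw [← Finset.sum_product', Finset.univ_product_univ]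
    refine Finset.sum_congr rfl fun p _ => ?_
    rcases le_or_gt p.1 p.2 with h | h
    · simp [h, not_lt.2 h]
    · simp [h, not_le.2 h]
  rw [h1, h3, Finset.sum_add_distrib, h2, ← Finset.sum_add_distrib]
  refine Finset.sum_congr rfl fun p _ => ?_
  rcases lt_trichotomy p.1 p.2 with h | h | h
  · simp [h, h.le, h.ne]
  · simp [h]; ring
  · simp [not_le.2 h, not_lt.2 h.le]

/-- A matrix of operator norm at most one pairs the moduli of two unit vectors to at most `√N`. -/
lemma sum_norm_mul_entry_le {M : Op N} (hM : ‖M‖ ≤ 1) {x b : EuclideanSpace ℂ (Fin N)}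
    (hx : ‖x‖ ≤ 1) (hb : ‖b‖ ≤ 1) :
    ∑ i, ∑ j, ‖x i‖ * ‖entry M j i‖ * ‖b j‖ ≤ Real.sqrt N := by
  have h1 : ∀ i, ∑ j, ‖entry M j i‖ * ‖b j‖ ≤ 1 := by
    intro i
    refine (Real.sum_mul_le_sqrt_mul_sqrt _ _ _).trans ?_
    simp_rw [entry_eq]
    rw [sum_norm_sq_eq, sum_norm_sq_eq, Real.sqrt_sq (norm_nonneg _),
      Real.sqrt_sq (norm_nonneg _)]
    refine mul_le_one₀ ((M.le_opNorm _).trans ?_) (norm_nonneg _) hb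
    rwa [norm_stdVec, mul_one]
  calc ∑ i, ∑ j, ‖x i‖ * ‖entry M j i‖ * ‖b j‖ = ∑ i, ‖x i‖ * ∑ j, ‖entry M j i‖ * ‖b j‖ := by
        simp_rw [Finset.mul_sum, mul_assoc]
    _ ≤ ∑ i, ‖x i‖ * 1 := by gcongr with i; exact h1 i
    _ ≤ Real.sqrt (∑ i, ‖x i‖ ^ 2) * Real.sqrt (∑ _i : Fin N, (1 : ℝ) ^ 2) :=
        Real.sum_mul_le_sqrt_mul_sqrt _ _ _
    _ ≤ 1 * Real.sqrt N := by
        rw [sum_norm_sq_eq, Real.sqrt_sq (norm_nonneg _)]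
        simp only [one_pow, Finset.sum_const, Finset.card_univ, Fintype.card_fin, nsmul_eq_mul,
          mul_one]
        gcongr
    _ = _ := one_mul _

lemma sum_norm_mul_norm_le {x b : EuclideanSpace ℂ (Fin N)} (hx : ‖x‖ ≤ 1) (hb : ‖b‖ ≤ 1) :
    ∑ i, ‖x i‖ * ‖b i‖ ≤ 1 := by
  refine (Real.sum_mul_le_sqrt_mul_sqrt _ _ _).trans ?_
  rw [sum_norm_sq_eq, sum_norm_sq_eq, Real.sqrt_sq (norm_nonneg _), Real.sqrt_sq (norm_nonneg _)]
  exact mul_le_one₀ hx (norm_nonneg _) hb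

variable {𝓧 : Type*} [MeasurableSpace 𝓧]

/-- Bounded random entries that are centered with off-diagonal variance `1 / N`, both up to
`μ`. -/
structure IsNearWigner (ν : Idx N → Measure 𝓧) (ξ : 𝓧 → ℂ) (r μ : ℝ) : Prop where
  measurable : Measurable ξ
  bound : ∀ x, ‖ξ x‖ ≤ r
  mean : ∀ k, ‖∫ x, ξ x ∂(ν k)‖ ≤ μ
  var : ∀ k : Idx N, k.1.1 ≠ k.1.2 → |∫ x, ‖ξ x‖ ^ 2 ∂(ν k) - (N : ℝ)⁻¹| ≤ μ
  r_nonneg : 0 ≤ r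
  μ_nonneg : 0 ≤ μ

variable {ν : Idx N → Measure 𝓧} [∀ k, IsProbabilityMeasure (ν k)] {ξ : 𝓧 → ℂ} {r μ : ℝ}

/-- Averaging `W M W` over the noise produces the normalized trace of `M`. -/
lemma norm_sum_covariance_sub_le (hW : IsNearWigner ν ξ r μ) {M : Op N} (hM : ‖M‖ ≤ 1)
    {x b : EuclideanSpace ℂ (Fin N)} (hx : ‖x‖ ≤ 1) (hb : ‖b‖ ≤ 1) :
    ‖∑ k, ∫ w, inner ℂ x (entryOp k (ξ w) (M (entryOp k (ξ w) b))) ∂(ν k)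
      - ntr N M * inner ℂ x b‖ ≤
      2 * r ^ 2 * Real.sqrt N + 2 * μ * N + r ^ 2 + (N : ℝ)⁻¹ := by
  have hr0 := hW.r_nonneg
  have hμ0 := hW.μ_nonneg
  set f : Fin N → Fin N → ℂ := fun i j => (N : ℂ)⁻¹ * (star (x i) * entry M j j * b i) with hf
  -- the target as a sum over the positions on and above the diagonal; a position `(i, j)` off the
  -- diagonal carries both orders of the indices
  have htarget : ntr N M * inner ℂ x b =
      ∑ k : Idx N, diagWeight k * (f k.1.1 k.1.2 + f k.1.2 k.1.1) := by
    rw [sum_idx_diagWeight, ntr_apply, PiLp.inner_apply, mul_assoc, Finset.sum_mul_sum,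
      Finset.mul_sum, Finset.sum_comm' (t' := Finset.univ) (s' := fun _ => Finset.univ) (by simp)]
    refine Finset.sum_congr rfl fun i _ => ?_
    rw [Finset.mul_sum]
    refine Finset.sum_congr rfl fun j _ => ?_
    simp only [hf, RCLike.inner_apply, RCLike.star_def]; ring
  rw [htarget, ← Finset.sum_sub_distrib]
  have hint1 : ∀ k, Integrable (fun w => ξ w ^ 2) (ν k) := fun k =>
    integrable_of_bdd (B := r ^ 2) (hW.measurable.pow_const 2) fun w => by
      rw [norm_pow]; exact pow_le_pow_left₀ (norm_nonneg _) (hW.bound w) 2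
  have hint2 : ∀ k, Integrable (fun w => star (ξ w) ^ 2) (ν k) := fun k =>
    integrable_of_bdd (B := r ^ 2) ((continuous_star.measurable.comp hW.measurable).pow_const 2) fun w => by
      rw [norm_pow, norm_star]; exact pow_le_pow_left₀ (norm_nonneg _) (hW.bound w) 2
  have hint3 : ∀ k, Integrable (fun w => ξ w * star (ξ w)) (ν k) := fun k =>
    integrable_of_bdd (B := r * r) (hW.measurable.mul (continuous_star.measurable.comp hW.measurable)) fun w => by
      rw [norm_mul, norm_star]
      exact mul_le_mul (hW.bound w) (hW.bound w) (norm_nonneg _) hr0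
  have hb1 : ∀ k, ‖∫ w, ξ w ^ 2 ∂(ν k)‖ ≤ r ^ 2 := fun k => norm_integral_le_of_bdd fun w => by
    rw [norm_pow]; exact pow_le_pow_left₀ (norm_nonneg _) (hW.bound w) 2
  have hb2 : ∀ k, ‖∫ w, star (ξ w) ^ 2 ∂(ν k)‖ ≤ r ^ 2 := fun k =>
    norm_integral_le_of_bdd fun w => by
      rw [norm_pow, norm_star]; exact pow_le_pow_left₀ (norm_nonneg _) (hW.bound w) 2
  have hv : ∀ k, ∫ w, ξ w * star (ξ w) ∂(ν k) = ((∫ w, ‖ξ w‖ ^ 2 ∂(ν k) : ℝ) : ℂ) := fun k => by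
    rw [← integral_complex_ofReal]
    refine integral_congr_ae (Eventually.of_forall fun w => ?_)
    have := Complex.mul_conj (ξ w)
    rw [Complex.normSq_eq_norm_sq] at this
    exact this
  have hb3 : ∀ k, ‖∫ w, ξ w * star (ξ w) ∂(ν k)‖ ≤ r ^ 2 := fun k =>
    norm_integral_le_of_bdd fun w => by
      rw [norm_mul, norm_star, sq]
      exact mul_le_mul (hW.bound w) (hW.bound w) (norm_nonneg _) hr0
  have hterm : ∀ k : Idx N,
      ‖∫ w, inner ℂ x (entryOp k (ξ w) (M (entryOp k (ξ w) b))) ∂(ν k)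
        - diagWeight k * (f k.1.1 k.1.2 + f k.1.2 k.1.1)‖ ≤
      r ^ 2 * (‖x k.1.1‖ * ‖entry M k.1.2 k.1.1‖ * ‖b k.1.2‖) +
      r ^ 2 * (‖x k.1.2‖ * ‖entry M k.1.1 k.1.2‖ * ‖b k.1.1‖) +
      μ * (‖x k.1.1‖ * ‖b k.1.1‖) + μ * (‖x k.1.2‖ * ‖b k.1.2‖) +
      (r ^ 2 + (N : ℝ)⁻¹) * (if k.1.1 = k.1.2 then ‖x k.1.1‖ * ‖b k.1.1‖ else 0) := by
    intro k
    -- `Q₁` and `Q₂` come with `E |ξ| ^ 2` and make up the trace; `P` and `R` come with `E ξ ^ 2` and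
    -- its conjugate, which need not vanish, but their sum over all positions is small
    set P := star (x k.1.1) * entry M k.1.2 k.1.1 * b k.1.2
    set Q₁ := star (x k.1.1) * entry M k.1.2 k.1.2 * b k.1.1
    set Q₂ := star (x k.1.2) * entry M k.1.1 k.1.1 * b k.1.2
    set R := star (x k.1.2) * entry M k.1.1 k.1.2 * b k.1.1
    have e1 : ∫ w, inner ℂ x (entryOp k (ξ w) (M (entryOp k (ξ w) b))) ∂(ν k) =
        diagWeight k ^ 2 * ((∫ w, ξ w ^ 2 ∂(ν k)) * P + (∫ w, ξ w * star (ξ w) ∂(ν k)) * (Q₁ + Q₂)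
          + (∫ w, star (ξ w) ^ 2 ∂(ν k)) * R) := by
      simp_rw [inner_entryOp_mul_entryOp]
      rw [integral_const_mul]
      have i1 := (hint1 k).mul_const P
      have i2 := (hint3 k).mul_const (Q₁ + Q₂)
      have i3 := (hint2 k).mul_const R
      have i12 : Integrable (fun w => ξ w ^ 2 * P + ξ w * star (ξ w) * (Q₁ + Q₂)) (ν k) :=
        i1.add i2
      rw [integral_add i12 i3, integral_add i1 i2, integral_mul_const, integral_mul_const,
        integral_mul_const]
    have e2 : f k.1.1 k.1.2 + f k.1.2 k.1.1 = (N : ℂ)⁻¹ * (Q₁ + Q₂) := by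
      simp only [hf, Q₁, Q₂]; ring
    rw [e1, e2]
    set α := ∫ w, ξ w ^ 2 ∂(ν k)
    set α' := ∫ w, star (ξ w) ^ 2 ∂(ν k)
    set v := ∫ w, ξ w * star (ξ w) ∂(ν k) with hvdef
    have e3 : diagWeight k ^ 2 * (α * P + v * (Q₁ + Q₂) + α' * R)
        - diagWeight k * ((N : ℂ)⁻¹ * (Q₁ + Q₂)) = diagWeight k ^ 2 * (α * P + α' * R)
        + (diagWeight k ^ 2 * v - diagWeight k * (N : ℂ)⁻¹) * (Q₁ + Q₂) := by ring
    rw [e3]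
    have hP : ‖P‖ = ‖x k.1.1‖ * ‖entry M k.1.2 k.1.1‖ * ‖b k.1.2‖ := by simp [P]
    have hR : ‖R‖ = ‖x k.1.2‖ * ‖entry M k.1.1 k.1.2‖ * ‖b k.1.1‖ := by simp [R]
    have hQ1 : ‖Q₁‖ ≤ ‖x k.1.1‖ * ‖b k.1.1‖ := by
      simp only [Q₁, norm_mul, norm_star]
      calc _ ≤ ‖x k.1.1‖ * 1 * ‖b k.1.1‖ := by gcongr; exact norm_entry_le hM _ _
        _ = _ := by ring
    have hQ2 : ‖Q₂‖ ≤ ‖x k.1.2‖ * ‖b k.1.2‖ := by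
      simp only [Q₂, norm_mul, norm_star]
      calc _ ≤ ‖x k.1.2‖ * 1 * ‖b k.1.2‖ := by gcongr; exact norm_entry_le hM _ _
        _ = _ := by ring
    have h1 : ‖diagWeight k ^ 2 * (α * P + α' * R)‖ ≤
        r ^ 2 * (‖x k.1.1‖ * ‖entry M k.1.2 k.1.1‖ * ‖b k.1.2‖) +
        r ^ 2 * (‖x k.1.2‖ * ‖entry M k.1.1 k.1.2‖ * ‖b k.1.1‖) := by
      rw [← hP, ← hR, norm_mul, norm_pow]
      calc _ ≤ 1 ^ 2 * (‖α * P‖ + ‖α' * R‖) := by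
            gcongr
            · exact norm_diagWeight_le k
            · exact norm_add_le _ _
        _ ≤ _ := by
            rw [norm_mul α, norm_mul α', one_pow, one_mul]
            gcongr
            · exact hb1 k
            · exact hb2 k
    have h2 : ‖(diagWeight k ^ 2 * v - diagWeight k * (N : ℂ)⁻¹) * (Q₁ + Q₂)‖ ≤
        μ * (‖x k.1.1‖ * ‖b k.1.1‖) + μ * (‖x k.1.2‖ * ‖b k.1.2‖) +
      (r ^ 2 + (N : ℝ)⁻¹) * (if k.1.1 = k.1.2 then ‖x k.1.1‖ * ‖b k.1.1‖ else 0) := by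
      rw [norm_mul]
      have hQ : ‖Q₁ + Q₂‖ ≤ ‖x k.1.1‖ * ‖b k.1.1‖ + ‖x k.1.2‖ * ‖b k.1.2‖ :=
        (norm_add_le _ _).trans (add_le_add hQ1 hQ2)
      by_cases hk : k.1.1 = k.1.2
      · simp only [hk, if_true] at hQ ⊢
        have hd : diagWeight k = 1 / 2 := by simp [diagWeight, hk]
        have : ‖diagWeight k ^ 2 * v - diagWeight k * (N : ℂ)⁻¹‖ ≤ 1 / 2 * (r ^ 2 + (N : ℝ)⁻¹) := by
          rw [hd]
          refine (norm_sub_le _ _).trans ?_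
          rw [norm_mul, norm_mul, norm_inv, Complex.norm_natCast]
          have := hb3 k
          norm_num
          nlinarith [sq_nonneg r]
        calc _ ≤ 1 / 2 * (r ^ 2 + (N : ℝ)⁻¹) *
              (‖x k.1.2‖ * ‖b k.1.2‖ + ‖x k.1.2‖ * ‖b k.1.2‖) := by gcongr
          _ = (r ^ 2 + (N : ℝ)⁻¹) * (‖x k.1.2‖ * ‖b k.1.2‖) := by ring
          _ ≤ _ := by
            have : 0 ≤ μ * (‖x k.1.2‖ * ‖b k.1.2‖) := by positivity
            linarith
      · simp only [hk, if_false, mul_zero, add_zero]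
        have hd : diagWeight k = 1 := by simp [diagWeight, hk]
        have : ‖diagWeight k ^ 2 * v - diagWeight k * (N : ℂ)⁻¹‖ ≤ μ := by
          rw [hd, hvdef, hv k]
          have := hW.var k hk
          rw [one_pow, one_mul, one_mul]
          calc _ = ‖((∫ x, ‖ξ x‖ ^ 2 ∂(ν k) - (N : ℝ)⁻¹ : ℝ) : ℂ)‖ := by push_cast; rfl
            _ ≤ μ := by rwa [Complex.norm_real]
        calc _ ≤ μ * (‖x k.1.1‖ * ‖b k.1.1‖ + ‖x k.1.2‖ * ‖b k.1.2‖) := by gcongr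
          _ = _ := by ring
    refine (norm_add_le _ _).trans ((add_le_add h1 h2).trans_eq ?_)
    ring
  refine (norm_sum_le _ _).trans ((Finset.sum_le_sum fun k _ => hterm k).trans ?_)
  simp_rw [Finset.sum_add_distrib, ← Finset.mul_sum]
  have g1 : ∑ k : Idx N, ‖x k.1.1‖ * ‖entry M k.1.2 k.1.1‖ * ‖b k.1.2‖ ≤ Real.sqrt N :=
    (sum_idx_le (g := fun i j => ‖x i‖ * ‖entry M j i‖ * ‖b j‖) fun i j => by positivity).trans
      (sum_norm_mul_entry_le hM hx hb)
  have g2 : ∑ k : Idx N, ‖x k.1.2‖ * ‖entry M k.1.1 k.1.2‖ * ‖b k.1.1‖ ≤ Real.sqrt N :=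
    (sum_idx_le (g := fun i j => ‖x j‖ * ‖entry M i j‖ * ‖b i‖) fun i j => by positivity).trans
      (by rw [Finset.sum_comm]; exact sum_norm_mul_entry_le hM hx hb)
  have hxb := sum_norm_mul_norm_le hx hb
  have g3 : ∑ k : Idx N, ‖x k.1.1‖ * ‖b k.1.1‖ ≤ N :=
    (sum_idx_le (g := fun i _ => ‖x i‖ * ‖b i‖) fun i j => by positivity).trans (by
      simp only [Finset.sum_const, Finset.card_univ, Fintype.card_fin, nsmul_eq_mul,
        ← Finset.mul_sum]
      exact mul_le_of_le_one_right (Nat.cast_nonneg N) hxb)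
  have g4 : ∑ k : Idx N, ‖x k.1.2‖ * ‖b k.1.2‖ ≤ N :=
    (sum_idx_le (g := fun _ j => ‖x j‖ * ‖b j‖) fun i j => by positivity).trans (by
      simp only [Finset.sum_const, Finset.card_univ, Fintype.card_fin, nsmul_eq_mul]
      exact mul_le_of_le_one_right (Nat.cast_nonneg N) hxb)
  have g5 : ∑ k : Idx N, (if k.1.1 = k.1.2 then ‖x k.1.1‖ * ‖b k.1.1‖ else 0) ≤ 1 :=
    (sum_idx_le (g := fun i j => if i = j then ‖x i‖ * ‖b i‖ else 0) fun i j => by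
      split_ifs <;> positivity).trans (by simpa using hxb)
  have hN : (0 : ℝ) ≤ (N : ℝ)⁻¹ := by positivity
  have r2 := sq_nonneg r
  linarith [mul_le_mul_of_nonneg_left g1 r2, mul_le_mul_of_nonneg_left g2 r2,
    mul_le_mul_of_nonneg_left g3 hμ0, mul_le_mul_of_nonneg_left g4 hμ0,
    mul_le_mul_of_nonneg_left g5 (add_nonneg r2 hN)]

end Covariance

/-! ### The averaged propagator and its evolution equation -/

section MeanProp

variable {N : ℕ} {𝓧 : Type*} [MeasurableSpace 𝓧]

/-- The averaged propagator `E e^{i t (H₀ + λ W)}`. -/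
def meanProp (ν : Idx N → Measure 𝓧) (H₀ : Op N) (lam : ℝ) (ξ : 𝓧 → ℂ) (t : ℝ) : Op N :=
  ∫ z, prop (ham H₀ lam ξ z) t ∂(Measure.pi ν)

/-- The average `E W e^{i t (H₀ + λ W)}`. -/
def meanNoise (ν : Idx N → Measure 𝓧) (H₀ : Op N) (lam : ℝ) (ξ : 𝓧 → ℂ) (t : ℝ) : Op N :=
  ∫ z, noise ξ z * prop (ham H₀ lam ξ z) t ∂(Measure.pi ν)

variable {ν : Idx N → Measure 𝓧} {ξ : 𝓧 → ℂ} {r μ : ℝ} {H₀ : Op N} (lam : ℝ)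

lemma star_meanProp (hH : IsSelfAdjoint H₀) (t : ℝ) :
    star (meanProp ν H₀ lam ξ t) = meanProp ν H₀ lam ξ (-t) := by
  unfold meanProp
  have h := ((starL' ℝ : Op N ≃L[ℝ] Op N)).integral_comp_comm
    (fun z => prop (ham H₀ lam ξ z) t) (μ := Measure.pi ν)
  simp only [starL'_apply] at h
  rw [← h]
  simp_rw [star_prop (isSelfAdjoint_ham hH lam ξ _)]

variable [∀ k, IsProbabilityMeasure (ν k)]

lemma integrable_prop_ham (hH : IsSelfAdjoint H₀) (hξ : Measurable ξ) (t : ℝ) :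
    Integrable (fun z => prop (ham H₀ lam ξ z) t) (Measure.pi ν) :=
  integrable_of_bdd (B := 1) (measurable_prop (measurable_ham hξ H₀ lam) measurable_const)
    fun z => norm_prop_le (isSelfAdjoint_ham hH lam ξ z) t

lemma measurable_noise_mul_prop (hξ : Measurable ξ) (t : ℝ) :
    Measurable fun z : Idx N → 𝓧 => noise ξ z * prop (ham H₀ lam ξ z) t :=
  (measurable_noise hξ).mul (measurable_prop (measurable_ham hξ H₀ lam) measurable_const)

lemma integrable_noise_mul_prop (hH : IsSelfAdjoint H₀) (hξ : Measurable ξ)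
    (hr : ∀ x, ‖ξ x‖ ≤ r) (t : ℝ) :
    Integrable (fun z => noise ξ z * prop (ham H₀ lam ξ z) t) (Measure.pi ν) :=
  integrable_of_bdd (measurable_noise_mul_prop lam hξ t) (norm_noise_mul_prop_le lam hH hr t)

lemma meanProp_zero : meanProp ν H₀ lam ξ 0 = 1 := by simp [meanProp]

lemma norm_meanProp_le (hH : IsSelfAdjoint H₀) (t : ℝ) : ‖meanProp ν H₀ lam ξ t‖ ≤ 1 :=
  norm_integral_le_of_bdd fun z => norm_prop_le (isSelfAdjoint_ham hH lam ξ z) t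

lemma matEl_meanProp (hH : IsSelfAdjoint H₀) (hξ : Measurable ξ) (t : ℝ)
    (L : Op N →L[ℂ] ℂ) :
    L (meanProp ν H₀ lam ξ t) = ∫ z, L (prop (ham H₀ lam ξ z) t) ∂(Measure.pi ν) :=
  (L.integral_comp_comm (integrable_prop_ham lam hH hξ t)).symm

/-- The averaged Schrödinger equation. -/
lemma hasDerivAt_meanProp (hH : IsSelfAdjoint H₀) (hξ : Measurable ξ) (hr : ∀ x, ‖ξ x‖ ≤ r)
    (t : ℝ) : HasDerivAt (meanProp ν H₀ lam ξ)
      (Complex.I • (H₀ * meanProp ν H₀ lam ξ t + (lam : ℂ) • meanNoise ν H₀ lam ξ t)) t := by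
  have hb : ∀ z t, ‖ham H₀ lam ξ z * prop (ham H₀ lam ξ z) t‖ ≤
      ‖H₀‖ + |lam| * (Fintype.card (Idx N) * (2 * r)) := by
    intro z t
    refine (norm_mul_le _ _).trans ?_
    calc _ ≤ ‖ham H₀ lam ξ z‖ * 1 := by
          gcongr; exact norm_prop_le (isSelfAdjoint_ham hH lam ξ z) t
      _ ≤ ‖H₀‖ + ‖(lam : ℂ) • noise ξ z‖ := by rw [mul_one]; exact norm_add_le _ _
      _ ≤ _ := by
          rw [norm_smul, Complex.norm_real, Real.norm_eq_abs]
          gcongr; exact norm_noise_le hr z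
  have h := hasDerivAt_integral_of_bdd (μ := Measure.pi ν)
    (f := fun s z => prop (ham H₀ lam ξ z) s)
    (f' := fun s z => Complex.I • (ham H₀ lam ξ z * prop (ham H₀ lam ξ z) s))
    (B := 1) (C := ‖H₀‖ + |lam| * (Fintype.card (Idx N) * (2 * r)))
    (fun s => measurable_prop (measurable_ham hξ H₀ lam) measurable_const)
    (fun s => ((measurable_ham hξ H₀ lam).mul
      (measurable_prop (measurable_ham hξ H₀ lam) measurable_const)).const_smul Complex.I)
    (fun s z => norm_prop_le (isSelfAdjoint_ham hH lam ξ z) s)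
    (fun s z => by rw [norm_smul, Complex.norm_I, one_mul]; exact hb z s)
    (fun s z => hasDerivAt_prop _ s) t
  refine h.congr_deriv ?_
  rw [integral_smul]
  congr 1
  have e : ∀ z, ham H₀ lam ξ z * prop (ham H₀ lam ξ z) t =
      H₀ * prop (ham H₀ lam ξ z) t + (lam : ℂ) • (noise ξ z * prop (ham H₀ lam ξ z) t) := by
    intro z
    conv_lhs => rw [show ham H₀ lam ξ z * prop (ham H₀ lam ξ z) t =
      (H₀ + (lam : ℂ) • noise ξ z) * prop (ham H₀ lam ξ z) t from rfl]
    rw [add_mul, smul_mul_assoc]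
  simp_rw [e]
  have i1 : Integrable (fun z => H₀ * prop (ham H₀ lam ξ z) t) (Measure.pi ν) :=
    (integrable_prop_ham lam hH hξ t).const_mul _
  have i2 : Integrable (fun z => (lam : ℂ) • (noise ξ z * prop (ham H₀ lam ξ z) t))
      (Measure.pi ν) := Integrable.smul (lam : ℂ) (integrable_noise_mul_prop lam hH hξ hr t)
  rw [integral_add i1 i2, integral_smul]
  congr 1
  exact (ContinuousLinearMap.mul ℂ (Op N) H₀).integral_comp_comm (integrable_prop_ham lam hH hξ t)

lemma continuous_meanProp (hH : IsSelfAdjoint H₀) (hξ : Measurable ξ) (hr : ∀ x, ‖ξ x‖ ≤ r) :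
    Continuous (meanProp ν H₀ lam ξ) :=
  continuous_iff_continuousAt.2 fun t => (hasDerivAt_meanProp lam hH hξ hr t).continuousAt

lemma continuous_meanNoise (hH : IsSelfAdjoint H₀) (hξ : Measurable ξ) (hr : ∀ x, ‖ξ x‖ ≤ r) :
    Continuous (meanNoise ν H₀ lam ξ) := by
  unfold meanNoise
  refine continuous_of_dominated (bound := fun _ => Fintype.card (Idx N) * (2 * r))
    (fun t => (measurable_noise_mul_prop lam hξ t).aestronglyMeasurable)
    (fun t => Eventually.of_forall fun z => norm_noise_mul_prop_le lam hH hr t z)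
    (integrable_const _) (Eventually.of_forall fun z => ?_)
  exact continuous_const.mul (continuous_prop_right _)

/-- The normalized trace of the averaged propagator. -/
def meanTrace (ν : Idx N → Measure 𝓧) (H₀ : Op N) (lam : ℝ) (ξ : 𝓧 → ℂ) (t : ℝ) : ℂ :=
  ntr N (meanProp ν H₀ lam ξ t)

lemma norm_meanTrace_le (hH : IsSelfAdjoint H₀) (t : ℝ) : ‖meanTrace ν H₀ lam ξ t‖ ≤ 1 :=
  norm_ntr_le (norm_meanProp_le lam hH t)

lemma continuous_meanTrace (hH : IsSelfAdjoint H₀) (hξ : Measurable ξ) (hr : ∀ x, ‖ξ x‖ ≤ r) :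
    Continuous (meanTrace ν H₀ lam ξ) :=
  (ntr N).continuous.comp (continuous_meanProp lam hH hξ hr)

/-- Trace and matrix elements decorrelate, by concentration of the latter. -/
lemma norm_integral_ntr_mul_sub_le (hH : IsSelfAdjoint H₀) (hξ : Measurable ξ)
    (hr : ∀ x, ‖ξ x‖ ≤ r) (s : ℝ) {t : ℝ} (ht : 0 ≤ t) {x y : EuclideanSpace ℂ (Fin N)}
    (hx : ‖x‖ ≤ 1) (hy : ‖y‖ ≤ 1) :
    ‖∫ z, ntr N (prop (ham H₀ lam ξ z) s) * inner ℂ x (prop (ham H₀ lam ξ z) t y) ∂(Measure.pi ν)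
      - meanTrace ν H₀ lam ξ s * inner ℂ x (meanProp ν H₀ lam ξ t y)‖ ≤
      Real.sqrt (2 * incrBound N (|lam| * t * r)) := by
  have hA := measurable_ham (N := N) hξ H₀ lam
  set X : (Idx N → 𝓧) → ℂ := fun z => ntr N (prop (ham H₀ lam ξ z) s) with hX
  set Y : (Idx N → 𝓧) → ℂ := fun z => inner ℂ x (prop (ham H₀ lam ξ z) t y) with hY
  have hXm : Measurable X := (ntr N).continuous.measurable.comp
    (measurable_prop hA measurable_const)
  have hYm : Measurable Y := measurable_inner_prop hA t x y
  have hXB : ∀ z, ‖X z‖ ≤ 1 := fun z => norm_ntr_le (norm_prop_le (isSelfAdjoint_ham hH _ _ _) s)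
  have hYB : ∀ z, ‖Y z‖ ≤ 1 := fun z =>
    (norm_inner_prop_le (isSelfAdjoint_ham hH _ _ _) t x y).trans
      (mul_le_one₀ hx (norm_nonneg _) hy)
  set m := ∫ z, Y z ∂(Measure.pi ν) with hm
  have hmB : ‖m‖ ≤ 1 := norm_integral_le_of_bdd hYB
  have e1 : meanTrace ν H₀ lam ξ s = ∫ z, X z ∂(Measure.pi ν) :=
    matEl_meanProp lam hH hξ s (ntr N)
  have e2 : inner ℂ x (meanProp ν H₀ lam ξ t y) = m := matEl_meanProp lam hH hξ t (matEl x y)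
  have hiXY : Integrable (fun z => X z * Y z) (Measure.pi ν) :=
    integrable_of_bdd (B := 1) (hXm.mul hYm) fun z => by
      rw [norm_mul]; exact mul_le_one₀ (hXB z) (norm_nonneg _) (hYB z)
  have hiX : Integrable X (Measure.pi ν) := integrable_of_bdd hXm hXB
  rw [e1, e2, ← integral_mul_const, ← integral_sub hiXY (hiX.mul_const m)]
  have hi2 : Integrable (fun z => ‖Y z - m‖ ^ 2) (Measure.pi ν) :=
    integrable_of_bdd (B := 2 ^ 2) (by fun_prop) fun z => by
      rw [norm_pow, norm_norm]
      exact pow_le_pow_left₀ (norm_nonneg _)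
        ((norm_sub_le _ _).trans (by linarith [hYB z])) 2
  have hi1 : Integrable (fun z => ‖Y z - m‖) (Measure.pi ν) :=
    integrable_of_bdd (B := 2) (by fun_prop) fun z => by
      rw [norm_norm]; exact (norm_sub_le _ _).trans (by linarith [hYB z])
  have hvar : ∫ z, ‖Y z - m‖ ^ 2 ∂(Measure.pi ν) ≤ 2 * incrBound N (|lam| * t * r) := by
    have := integral_norm_inner_prop_sub_pow_le ν hH lam hξ hr ht hx hy 1
    simp at this
    calc _ ≤ _ := this
      _ = _ := by norm_num
  refine Real.le_sqrt_of_sq_le (le_trans ?_ hvar)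
  have h1 : ‖∫ z, (X z * Y z - X z * m) ∂(Measure.pi ν)‖ ≤ ∫ z, ‖Y z - m‖ ∂(Measure.pi ν) := by
    refine (norm_integral_le_integral_norm _).trans (integral_mono_of_nonneg
      (Eventually.of_forall fun z => norm_nonneg _) hi1 (Eventually.of_forall fun z => ?_))
    simp only
    rw [← mul_sub, norm_mul]
    exact mul_le_of_le_one_left (norm_nonneg _) (hXB z)
  have h2 : (∫ z, ‖Y z - m‖ ∂(Measure.pi ν)) ^ 2 ≤ ∫ z, ‖Y z - m‖ ^ 2 ∂(Measure.pi ν) := by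
    set c := ∫ z, ‖Y z - m‖ ∂(Measure.pi ν) with hc
    have h3 : 0 ≤ ∫ z, (‖Y z - m‖ - c) ^ 2 ∂(Measure.pi ν) :=
      integral_nonneg fun z => by positivity
    have h4 : ∀ z, (‖Y z - m‖ - c) ^ 2 = ‖Y z - m‖ ^ 2 - 2 * c * ‖Y z - m‖ + c ^ 2 :=
      fun z => by ring
    simp_rw [h4] at h3
    have i1 : Integrable (fun z => 2 * c * ‖Y z - m‖) (Measure.pi ν) := hi1.const_mul _
    have i2 : Integrable (fun z => ‖Y z - m‖ ^ 2 - 2 * c * ‖Y z - m‖) (Measure.pi ν) := hi2.sub i1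
    rw [integral_add i2 (integrable_const _), integral_sub hi2 i1, integral_const_mul, ← hc] at h3
    simp at h3
    linarith
  exact (pow_le_pow_left₀ (norm_nonneg _) h1 2).trans h2

end MeanProp

/-! ### The self-consistent equation for the averaged propagator -/

section SelfConsistent

variable {N : ℕ} {𝓧 : Type*}

/-- The Hamiltonian with entry `k` of the noise set to zero. -/
def hamDel (H₀ : Op N) (lam : ℝ) (ξ : 𝓧 → ℂ) (z : Idx N → 𝓧) (k : Idx N) : Op N :=
  ham H₀ lam ξ z - (lam : ℂ) • entryOp k (ξ (z k))

/-- The second order term `⟨x, Δ M Δ M' y⟩` for a single entry of the noise. -/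
def quad (x y : EuclideanSpace ℂ (Fin N)) (k : Idx N) (w : ℂ) (M M' : Op N) : ℂ :=
  matEl x y (entryOp k w * (M * (entryOp k w * M')))

lemma isSelfAdjoint_smul_entryOp (lam : ℝ) (k : Idx N) (w : ℂ) :
    IsSelfAdjoint ((lam : ℂ) • entryOp k w) := by
  have := isSelfAdjoint_entryOp k w
  rw [isSelfAdjoint_iff, star_smul, this.star_eq]
  simp

lemma isSelfAdjoint_hamDel {H₀ : Op N} (hH : IsSelfAdjoint H₀) (lam : ℝ) (ξ : 𝓧 → ℂ)
    (z : Idx N → 𝓧) (k : Idx N) : IsSelfAdjoint (hamDel H₀ lam ξ z k) :=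
  IsSelfAdjoint.sub (R := Op N) (isSelfAdjoint_ham hH lam ξ z) (isSelfAdjoint_smul_entryOp lam k _)

lemma hamDel_update (H₀ : Op N) (lam : ℝ) (ξ : 𝓧 → ℂ) (z : Idx N → 𝓧) (k : Idx N) (w : 𝓧) :
    hamDel H₀ lam ξ (Function.update z k w) k = hamDel H₀ lam ξ z k := by
  unfold hamDel
  have := ham_update_sub H₀ lam ξ z k w
  rw [entryOp_sub, smul_sub] at this
  simp only [Function.update_self]
  rw [sub_eq_iff_eq_add.1 this]
  abel

lemma hamDel_sub_ham (H₀ : Op N) (lam : ℝ) (ξ : 𝓧 → ℂ) (z : Idx N → 𝓧) (k : Idx N) :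
    hamDel H₀ lam ξ z k - ham H₀ lam ξ z = -((lam : ℂ) • entryOp k (ξ (z k))) := by
  unfold hamDel; abel

/-- Deleting the entry at `(i, j)` changes the coordinates `i` and `j` of `e^{i t H} y` by amounts
whose squares have a sum over all positions of order `r ^ 2 N`. -/
lemma sum_sq_deletion_le {H₀ : Op N} (hH : IsSelfAdjoint H₀) (lam : ℝ) {ξ : 𝓧 → ℂ} {r : ℝ}
    (hr : ∀ x, ‖ξ x‖ ≤ r) (hr0 : 0 ≤ r) {t : ℝ} (ht : 0 ≤ t) {y : EuclideanSpace ℂ (Fin N)}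
    (hy : ‖y‖ ≤ 1) (z : Idx N → 𝓧) :
    ∑ k : Idx N,
      (‖(prop (hamDel H₀ lam ξ z k) t y - prop (ham H₀ lam ξ z) t y) k.1.1‖ +
        ‖(prop (hamDel H₀ lam ξ z k) t y - prop (ham H₀ lam ξ z) t y) k.1.2‖) ^ 2
      ≤ (4 * (|lam| * t * r) * Real.sqrt N) ^ 2 := by
  have hNs : Real.sqrt N ^ 2 = N := Real.sq_sqrt (Nat.cast_nonneg N)
  have hA := isSelfAdjoint_ham hH lam ξ z
  have hB := fun k => isSelfAdjoint_hamDel hH lam ξ z k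
  have key : ∀ j : Idx N → Fin N, ∑ k, ‖(prop (hamDel H₀ lam ξ z k) t y
      - prop (ham H₀ lam ξ z) t y) (j k)‖ ^ 2 ≤ (t * (|lam| * r * (2 * Real.sqrt N))) ^ 2 := by
    intro j
    have := sum_sq_inner_prop_sub_prop_le (A := ham H₀ lam ξ z) (B := hamDel H₀ lam ξ z) ht
      (fun k => stdVec (j k)) y (C := |lam| * r * (2 * Real.sqrt N)) (by positivity)
      (fun s hs => by
        set b := prop (ham H₀ lam ξ z) (t - s) y
        have hb : ‖b‖ ≤ 1 := by rw [norm_prop_apply hA]; exact hy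
        calc _ ≤ ∑ k : Idx N, (|lam| * r) ^ 2 * (‖b k.1.1‖ + ‖b k.1.2‖) ^ 2 := by
              refine Finset.sum_le_sum fun k _ => ?_
              rw [← mul_pow]
              gcongr
              refine (norm_inner_prop_le (hB k) _ _ _).trans ?_
              rw [norm_stdVec, one_mul, hamDel_sub_ham, neg_apply, norm_neg, _root_.smul_apply,
                norm_smul, Complex.norm_real, Real.norm_eq_abs, mul_assoc]
              gcongr
              exact (norm_entryOp_apply_le _ _ _).trans (by gcongr; exact hr _)
          _ ≤ (|lam| * r) ^ 2 * (4 * N) := by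
              rw [← Finset.mul_sum]; gcongr; exact sum_idx_add_sq_le b hb
          _ = _ := by rw [mul_pow _ (2 * _), mul_pow 2, hNs]; ring)
    simpa only [inner_stdVec] using this
  calc _ ≤ ∑ k : Idx N,
      (2 * ‖(prop (hamDel H₀ lam ξ z k) t y - prop (ham H₀ lam ξ z) t y) k.1.1‖ ^ 2 +
        2 * ‖(prop (hamDel H₀ lam ξ z k) t y - prop (ham H₀ lam ξ z) t y) k.1.2‖ ^ 2) :=
        Finset.sum_le_sum fun k _ => by
          have := sq_nonneg
            (‖(prop (hamDel H₀ lam ξ z k) t y - prop (ham H₀ lam ξ z) t y) k.1.1‖ -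
            ‖(prop (hamDel H₀ lam ξ z k) t y - prop (ham H₀ lam ξ z) t y) k.1.2‖)
          linarith
    _ ≤ 2 * (t * (|lam| * r * (2 * Real.sqrt N))) ^ 2 +
        2 * (t * (|lam| * r * (2 * Real.sqrt N))) ^ 2 := by
        rw [Finset.sum_add_distrib, ← Finset.mul_sum, ← Finset.mul_sum]
        gcongr
        · exact key fun k => k.1.1
        · exact key fun k => k.1.2
    _ = _ := by ring

lemma norm_quad_le (x y : EuclideanSpace ℂ (Fin N)) (k : Idx N) {w : ℂ} {r m : ℝ} (hr : ‖w‖ ≤ r)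
    {M : Op N} (hm : ‖M‖ ≤ m) (M' : Op N) :
    ‖quad x y k w M M'‖ ≤
      r ^ 2 * m * ((‖x k.1.1‖ + ‖x k.1.2‖) * (‖(M' y) k.1.1‖ + ‖(M' y) k.1.2‖)) :=
  norm_inner_entryOp_mul_entryOp_le k w hr hm x (M' y)

lemma quad_sub_quad (x y : EuclideanSpace ℂ (Fin N)) (k : Idx N) (w : ℂ) (M₁ M₁' M₂ M₂' : Op N) :
    quad x y k w M₁ M₁' - quad x y k w M₂ M₂' =
      quad x y k w M₁ (M₁' - M₂') + quad x y k w (M₁ - M₂) M₂' := by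
  unfold quad
  rw [← map_sub, ← map_add]
  congr 1
  simp only [mul_sub, sub_mul]
  abel

lemma norm_quad_le_const {x y : EuclideanSpace ℂ (Fin N)} (hx : ‖x‖ ≤ 1) (hy : ‖y‖ ≤ 1)
    (k : Idx N) {w : ℂ} {r : ℝ} (hr : ‖w‖ ≤ r) {M M' : Op N} (hM : ‖M‖ ≤ 1) (hM' : ‖M'‖ ≤ 1) :
    ‖quad x y k w M M'‖ ≤ 4 * r ^ 2 := by
  have h1 : ∀ i, ‖x i‖ ≤ 1 := fun i => (PiLp.norm_apply_le _ _).trans hx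
  have h2 : ∀ i, ‖(M' y) i‖ ≤ 1 := fun i => (PiLp.norm_apply_le _ _).trans
    ((M'.le_opNorm y).trans (mul_le_one₀ hM' (norm_nonneg _) hy))
  calc _ ≤ _ := norm_quad_le x y k hr hM M'
    _ ≤ r ^ 2 * 1 * ((1 + 1) * (1 + 1)) := by gcongr <;> first | exact h1 _ | exact h2 _
    _ = _ := by ring

variable [MeasurableSpace 𝓧]

lemma measurable_hamDel {ξ : 𝓧 → ℂ} (hξ : Measurable ξ) (H₀ : Op N) (lam : ℝ) (k : Idx N) :
    Measurable fun z : Idx N → 𝓧 => hamDel H₀ lam ξ z k :=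
  (measurable_ham hξ H₀ lam).sub
    (((continuous_entryOp k).measurable.comp (hξ.comp (measurable_pi_apply k))).const_smul
      (lam : ℂ))

lemma measurable_quad {α : Type*} [MeasurableSpace α] (x y : EuclideanSpace ℂ (Fin N)) (k : Idx N)
    {w : α → ℂ} {M M' : α → Op N} (hw : Measurable w) (hM : Measurable M) (hM' : Measurable M') :
    Measurable fun a => quad x y k (w a) (M a) (M' a) := by
  have he : Measurable fun a => entryOp k (w a) := (continuous_entryOp k).measurable.comp hw
  exact (matEl x y).continuous.measurable.comp (he.mul (hM.mul (he.mul hM')))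

variable {ν : Idx N → Measure 𝓧} [∀ k, IsProbabilityMeasure (ν k)] {ξ : 𝓧 → ℂ} {r μ : ℝ}
  {H₀ : Op N}

/-- The error in the averaged second order term; `q = |λ| t`. -/
def covError (N : ℕ) (r μ q : ℝ) : ℝ :=
  24 * q * r ^ 3 * N + (2 * r ^ 2 * Real.sqrt N + 2 * μ * N + r ^ 2 + (N : ℝ)⁻¹) +
    Real.sqrt (2 * incrBound N (q * r))

/-- The averaged second order term factorizes into a normalized trace and a matrix element. -/
lemma norm_integral_quad_sub_le (hW : IsNearWigner ν ξ r μ) (hH : IsSelfAdjoint H₀) (lam : ℝ)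
    {s t : ℝ} (hs : s ∈ Set.Icc 0 t) {x y : EuclideanSpace ℂ (Fin N)} (hx : ‖x‖ ≤ 1)
    (hy : ‖y‖ ≤ 1) :
    ‖∫ z, ∑ k, quad x y k (ξ (z k)) (prop (hamDel H₀ lam ξ z k) s)
        (prop (ham H₀ lam ξ z) (t - s)) ∂(Measure.pi ν)
      - meanTrace ν H₀ lam ξ s * inner ℂ x (meanProp ν H₀ lam ξ (t - s) y)‖ ≤
      covError N r μ (|lam| * t) := by
  have hr := hW.bound
  have hξ := hW.measurable
  have hr0 := hW.r_nonneg
  have hs0 := hs.1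
  have hts : 0 ≤ t - s := sub_nonneg.2 hs.2
  have hts' : t - s ≤ t := by linarith [hs.1]
  have ht : 0 ≤ t := hs.1.trans hs.2
  have hNs : Real.sqrt N ^ 2 = N := Real.sq_sqrt (Nat.cast_nonneg N)
  set π := Measure.pi ν with hπ
  have hA := fun z => isSelfAdjoint_ham hH lam ξ z
  have hB := fun z k => isSelfAdjoint_hamDel hH lam ξ z k
  set U : (Idx N → 𝓧) → ℝ → Op N := fun z t => prop (ham H₀ lam ξ z) t with hU
  set D : (Idx N → 𝓧) → Idx N → ℝ → Op N := fun z k t => prop (hamDel H₀ lam ξ z k) t with hD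
  have hUm : ∀ t, Measurable fun z => U z t := fun t =>
    measurable_prop (measurable_ham hξ H₀ lam) measurable_const
  have hDm : ∀ k t, Measurable fun z => D z k t := fun k t =>
    measurable_prop (measurable_hamDel hξ H₀ lam k) measurable_const
  have hUn : ∀ z t, ‖U z t‖ ≤ 1 := fun z t => norm_prop_le (hA z) t
  have hDn : ∀ z k t, ‖D z k t‖ ≤ 1 := fun z k t => norm_prop_le (hB z k) t
  -- `f₁` to `f₂` deletes the entry in the right propagator as well, so that in `f₃` its average can
  -- be taken with the propagators fixed; `f₄` undoes both deletions, after which the covariance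
  -- bound applies and concentration factorizes the expectation
  set f₁ : (Idx N → 𝓧) → Idx N → ℂ := fun z k => quad x y k (ξ (z k)) (D z k s) (U z (t - s))
  set f₂ : (Idx N → 𝓧) → Idx N → ℂ := fun z k => quad x y k (ξ (z k)) (D z k s) (D z k (t - s))
  set f₃ : (Idx N → 𝓧) → Idx N → ℂ := fun z k =>
    ∫ w, quad x y k (ξ w) (D z k s) (D z k (t - s)) ∂(ν k)
  set f₄ : (Idx N → 𝓧) → Idx N → ℂ := fun z k =>
    ∫ w, quad x y k (ξ w) (U z s) (U z (t - s)) ∂(ν k)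
  have hξk : ∀ k : Idx N, Measurable fun z : Idx N → 𝓧 => ξ (z k) := fun k =>
    hξ.comp (measurable_pi_apply k)
  have m1 : ∀ k, Measurable fun z => f₁ z k := fun k => measurable_quad x y k (hξk k) (hDm k s)
    (hUm _)
  have m2 : ∀ k, Measurable fun z => f₂ z k := fun k => measurable_quad x y k (hξk k) (hDm k s)
    (hDm k _)
  have m3 : ∀ k, Measurable fun z => f₃ z k := fun k => by
    refine measurable_integral_snd
      (f := fun z w => quad x y k (ξ w) (D z k s) (D z k (t - s))) ?_
    exact measurable_quad x y k (hξ.comp measurable_snd) ((hDm k s).comp measurable_fst)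
      ((hDm k _).comp measurable_fst)
  have m4 : ∀ k, Measurable fun z => f₄ z k := fun k => by
    refine measurable_integral_snd
      (f := fun z w => quad x y k (ξ w) (U z s) (U z (t - s))) ?_
    exact measurable_quad x y k (hξ.comp measurable_snd) ((hUm s).comp measurable_fst)
      ((hUm _).comp measurable_fst)
  have b1 : ∀ z k, ‖f₁ z k‖ ≤ 4 * r ^ 2 := fun z k =>
    norm_quad_le_const hx hy k (hr _) (hDn _ _ _) (hUn _ _)
  have b2 : ∀ z k, ‖f₂ z k‖ ≤ 4 * r ^ 2 := fun z k =>
    norm_quad_le_const hx hy k (hr _) (hDn _ _ _) (hDn _ _ _)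
  have b3 : ∀ z k, ‖f₃ z k‖ ≤ 4 * r ^ 2 := fun z k => norm_integral_le_of_bdd fun w =>
    norm_quad_le_const hx hy k (hr _) (hDn _ _ _) (hDn _ _ _)
  have b4 : ∀ z k, ‖f₄ z k‖ ≤ 4 * r ^ 2 := fun z k => norm_integral_le_of_bdd fun w =>
    norm_quad_le_const hx hy k (hr _) (hUn _ _) (hUn _ _)
  have hsumi : ∀ f : (Idx N → 𝓧) → Idx N → ℂ, (∀ k, Measurable fun z => f z k) →
      (∀ z k, ‖f z k‖ ≤ 4 * r ^ 2) → Integrable (fun z => ∑ k, f z k) π := fun f hm hb =>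
    integrable_finsetSum _ fun k _ => integrable_of_bdd (hm k) fun z => hb z k
  -- deleting the entry in the right propagator
  have c12 : ∀ z, ‖∑ k, f₁ z k - ∑ k, f₂ z k‖ ≤ 8 * (|lam| * t) * r ^ 3 * N := by
    intro z
    rw [← Finset.sum_sub_distrib]
    have := norm_sum_le_of_entry_bound (c := fun k => f₁ z k - f₂ z k) (R := r ^ 2)
      (V := 4 * (|lam| * (t - s) * r) * Real.sqrt N) hx
      (fun k => (D z k (t - s) - U z (t - s)) y) (by positivity) (by positivity)
      (fun k => by
        have e : f₁ z k - f₂ z k = -quad x y k (ξ (z k)) (D z k s) (D z k (t - s) - U z (t - s)) := by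
          simp only [f₁, f₂, quad, mul_sub, map_sub, neg_sub]
        rw [e, norm_neg]
        simpa using norm_quad_le x y k (hr (z k)) (hDn z k s) (D z k (t - s) - U z (t - s)))
      (sum_sq_deletion_le hH lam hr hr0 hts hy z)
    refine this.trans ?_
    calc r ^ 2 * (2 * Real.sqrt N * (4 * (|lam| * (t - s) * r) * Real.sqrt N))
        = 8 * (|lam| * (t - s)) * r ^ 3 * (Real.sqrt N ^ 2) := by ring
      _ ≤ 8 * (|lam| * t) * r ^ 3 * N := by rw [hNs]; gcongr
  -- resampling the entry independently of the propagators
  have c23 : ∫ z, ∑ k, f₂ z k ∂π = ∫ z, ∑ k, f₃ z k ∂π := by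
    rw [integral_finsetSum _ fun k _ => integrable_of_bdd (m2 k) fun z => b2 z k,
      integral_finsetSum _ fun k _ => integrable_of_bdd (m3 k) fun z => b3 z k]
    refine Finset.sum_congr rfl fun k _ => ?_
    rw [integral_pi_update ν k (m2 k) fun z => b2 z k]
    simp only [f₂, f₃, hD, hamDel_update, Function.update_self]
    rfl
  have c34 : ∀ z, ‖∑ k, f₃ z k - ∑ k, f₄ z k‖ ≤ 16 * (|lam| * t) * r ^ 3 * N := by
    intro z
    have hsplit : ∀ k, f₃ z k - f₄ z k =
        ∫ w, quad x y k (ξ w) (D z k s) (D z k (t - s) - U z (t - s)) ∂(ν k)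
        + ∫ w, quad x y k (ξ w) (D z k s - U z s) (U z (t - s)) ∂(ν k) := by
      intro k
      have i : ∀ M M' : Op N, Integrable (fun w => quad x y k (ξ w) M M') (ν k) := fun M M' =>
        integrable_of_bdd
          (B := r ^ 2 * ‖M‖ * ((‖x k.1.1‖ + ‖x k.1.2‖) * (‖(M' y) k.1.1‖ + ‖(M' y) k.1.2‖)))
          (measurable_quad x y k hξ measurable_const measurable_const)
          fun w => norm_quad_le x y k (hr w) le_rfl M'
      simp only [f₃, f₄]
      rw [← integral_sub (i _ _) (i _ _), ← integral_add (i _ _) (i _ _)]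
      simp_rw [quad_sub_quad]
    rw [← Finset.sum_sub_distrib]
    simp_rw [hsplit]
    rw [Finset.sum_add_distrib]
    have g1 := norm_sum_le_of_entry_bound
      (c := fun k => ∫ w, quad x y k (ξ w) (D z k s) (D z k (t - s) - U z (t - s)) ∂(ν k))
      (R := r ^ 2) (V := 4 * (|lam| * (t - s) * r) * Real.sqrt N) hx
      (fun k => (D z k (t - s) - U z (t - s)) y) (by positivity) (by positivity)
      (fun k => norm_integral_le_of_bdd fun w => by
        simpa using norm_quad_le x y k (hr w) (hDn z k s) (D z k (t - s) - U z (t - s)))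
      (sum_sq_deletion_le hH lam hr hr0 hts hy z)
    have g2 := norm_sum_le_of_entry_bound
      (c := fun k => ∫ w, quad x y k (ξ w) (D z k s - U z s) (U z (t - s)) ∂(ν k))
      (R := r ^ 2 * (s * (|lam| * (2 * r)))) (V := 2 * Real.sqrt N) hx
      (fun _ => U z (t - s) y) (by positivity) (by positivity)
      (fun k => norm_integral_le_of_bdd fun w => by
        refine norm_quad_le x y k (hr w) ?_ (U z (t - s))
        refine (norm_prop_sub_prop_le (hB z k) (hA z) hs.1).trans ?_
        rw [hamDel_sub_ham, norm_neg, norm_smul, Complex.norm_real, Real.norm_eq_abs]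
        gcongr
        exact (norm_entryOp_le _ _).trans (by gcongr; exact hr _))
      (by
        refine (sum_idx_add_sq_le _ ?_).trans_eq ?_
        · exact (norm_prop_apply (hA z) _ _).le.trans hy
        · rw [mul_pow, hNs]; norm_num)
    refine (norm_add_le _ _).trans ((add_le_add g1 g2).trans ?_)
    have hq : (0 : ℝ) ≤ r ^ 3 * N := by positivity
    calc r ^ 2 * (2 * Real.sqrt N * (4 * (|lam| * (t - s) * r) * Real.sqrt N))
          + r ^ 2 * (s * (|lam| * (2 * r))) * (2 * Real.sqrt N * (2 * Real.sqrt N))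
        = 8 * (|lam| * (t - s)) * (r ^ 3 * Real.sqrt N ^ 2)
          + 8 * (|lam| * s) * (r ^ 3 * Real.sqrt N ^ 2) := by ring
      _ ≤ 8 * (|lam| * t) * (r ^ 3 * N) + 8 * (|lam| * t) * (r ^ 3 * N) := by
          rw [hNs]
          gcongr
          exact hs.2
      _ = _ := by ring
  have c45 : ∀ z, ‖∑ k, f₄ z k - ntr N (U z s) * inner ℂ x (U z (t - s) y)‖ ≤
      2 * r ^ 2 * Real.sqrt N + 2 * μ * N + r ^ 2 + (N : ℝ)⁻¹ := fun z =>
    norm_sum_covariance_sub_le hW (hUn z s) hx ((norm_prop_apply (hA z) _ _).le.trans hy)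
  have c5 := norm_integral_ntr_mul_sub_le (ν := ν) lam hH hξ hr s hts hx hy
  have m5 : Measurable fun z => ntr N (U z s) * inner ℂ x (U z (t - s) y) :=
    ((ntr N).continuous.measurable.comp (hUm s)).mul
      ((matEl x y).continuous.measurable.comp (hUm (t - s)))
  have i5 : Integrable (fun z => ntr N (U z s) * inner ℂ x (U z (t - s) y)) π :=
    integrable_of_bdd (B := 1) m5 fun z => by
      rw [norm_mul]
      exact mul_le_one₀ (norm_ntr_le (hUn z s)) (norm_nonneg _)
        ((norm_inner_prop_le (hA z) _ x y).trans (mul_le_one₀ hx (norm_nonneg _) hy))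
  have i1 := hsumi f₁ m1 b1
  have i2 := hsumi f₂ m2 b2
  have i3 := hsumi f₃ m3 b3
  have i4 := hsumi f₄ m4 b4
  have d12 : ‖∫ z, ∑ k, f₁ z k ∂π - ∫ z, ∑ k, f₂ z k ∂π‖ ≤ 8 * (|lam| * t) * r ^ 3 * N := by
    rw [← integral_sub i1 i2]; exact norm_integral_le_of_bdd c12
  have d34 : ‖∫ z, ∑ k, f₃ z k ∂π - ∫ z, ∑ k, f₄ z k ∂π‖ ≤ 16 * (|lam| * t) * r ^ 3 * N := by
    rw [← integral_sub i3 i4]; exact norm_integral_le_of_bdd c34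
  have d45 : ‖∫ z, ∑ k, f₄ z k ∂π - ∫ z, ntr N (U z s) * inner ℂ x (U z (t - s) y) ∂π‖ ≤
      2 * r ^ 2 * Real.sqrt N + 2 * μ * N + r ^ 2 + (N : ℝ)⁻¹ := by
    rw [← integral_sub i4 i5]; exact norm_integral_le_of_bdd c45
  have hmono : Real.sqrt (2 * incrBound N (|lam| * (t - s) * r)) ≤
      Real.sqrt (2 * incrBound N (|lam| * t * r)) := by
    refine Real.sqrt_le_sqrt ?_
    unfold incrBound
    gcongr
  rw [← c23] at d34
  unfold covError
  have tri : ∀ a b c d e : ℂ, ‖a - e‖ ≤ ‖a - b‖ + ‖b - c‖ + ‖c - d‖ + ‖d - e‖ := by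
    intro a b c d e
    calc ‖a - e‖ = ‖(a - b) + (b - c) + (c - d) + (d - e)‖ := by congr 1; ring
      _ ≤ _ := (norm_add_le _ _).trans (by gcongr; exact norm_add₃_le)
  refine (tri _ _ _ _ _).trans ((add_le_add (add_le_add (add_le_add d12 d34) d45)
    (c5.trans hmono)).trans_eq ?_)
  ring

end SelfConsistent

section Cumulant

variable {N : ℕ} {𝓧 : Type*} [MeasurableSpace 𝓧] {ν : Idx N → Measure 𝓧}
  [∀ k, IsProbabilityMeasure (ν k)] {ξ : 𝓧 → ℂ} {r μ : ℝ} {H₀ : Op N}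

/-- Once the entry is deleted from the Hamiltonian, it is independent of the propagator, so that only
its mean contributes. -/
lemma norm_integral_entryOp_deletion_le (hW : IsNearWigner ν ξ r μ) (hH : IsSelfAdjoint H₀)
    (lam t : ℝ) {x y : EuclideanSpace ℂ (Fin N)} (hx : ‖x‖ ≤ 1) (hy : ‖y‖ ≤ 1) (k : Idx N) :
    ‖∫ z, inner ℂ x (entryOp k (ξ (z k)) (prop (hamDel H₀ lam ξ z k) t y)) ∂(Measure.pi ν)‖ ≤
      2 * μ := by
  have hξ := hW.measurable
  have hr := hW.bound
  have hD : ∀ z, ‖prop (hamDel H₀ lam ξ z k) t y‖ ≤ 1 := fun z =>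
    (norm_prop_apply (isSelfAdjoint_hamDel hH lam ξ z k) t y).le.trans hy
  have hm : Measurable fun z : Idx N → 𝓧 =>
      (inner ℂ x (entryOp k (ξ (z k)) (prop (hamDel H₀ lam ξ z k) t y)) : ℂ) := by
    have he : Measurable fun z : Idx N → 𝓧 => entryOp k (ξ (z k)) :=
      (continuous_entryOp k).measurable.comp (hξ.comp (measurable_pi_apply k))
    have hm : Measurable fun z : Idx N → 𝓧 =>
        entryOp k (ξ (z k)) * prop (hamDel H₀ lam ξ z k) t :=
      he.mul (measurable_prop (measurable_hamDel hξ H₀ lam k) measurable_const)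
    have h : Measurable fun z : Idx N → 𝓧 =>
        matEl x y (entryOp k (ξ (z k)) * prop (hamDel H₀ lam ξ z k) t) :=
      (matEl x y).continuous.measurable.comp hm
    simpa only [matEl_apply, mul_apply_eq_comp] using h
  have hb : ∀ w, ‖entryOp k (ξ w)‖ ≤ 2 * r := fun w =>
    (norm_entryOp_le _ _).trans (by gcongr; exact hr w)
  have hB : ∀ z : Idx N → 𝓧,
      ‖(inner ℂ x (entryOp k (ξ (z k)) (prop (hamDel H₀ lam ξ z k) t y)) : ℂ)‖ ≤
        1 * (2 * r * 1) := fun z =>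
    (norm_inner_le_norm _ _).trans (mul_le_mul hx (((entryOp k (ξ (z k))).le_opNorm _).trans
      (mul_le_mul (hb _) (hD z) (norm_nonneg _) ((norm_nonneg _).trans (hb (z k)))))
      (norm_nonneg _) zero_le_one)
  rw [integral_pi_update ν k hm hB]
  refine norm_integral_le_of_bdd fun z => ?_
  simp only [Function.update_self, hamDel_update, inner_entryOp]
  set v := prop (hamDel H₀ lam ξ z k) t y
  have i1 : Integrable ξ (ν k) := integrable_of_bdd hξ hr
  have i2 : Integrable (fun w => star (ξ w)) (ν k) :=
    integrable_of_bdd (B := r) (continuous_star.measurable.comp hξ) fun w => by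
      rw [norm_star]; exact hr w
  have j1 := i1.mul_const (star (x k.1.1) * v k.1.2)
  have j2 := i2.mul_const (star (x k.1.2) * v k.1.1)
  rw [integral_const_mul, integral_add j1 j2, integral_mul_const, integral_mul_const]
  have e : ∫ w, star (ξ w) ∂(ν k) = star (∫ w, ξ w ∂(ν k)) := integral_conj
  rw [e, norm_mul]
  have hx' : ∀ i, ‖x i‖ ≤ 1 := fun i => (PiLp.norm_apply_le _ _).trans hx
  have hv' : ∀ i, ‖v i‖ ≤ 1 := fun i => (PiLp.norm_apply_le _ _).trans (hD z)
  have hmu := hW.mean k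
  have hμ := hW.μ_nonneg
  calc _ ≤ 1 * (μ * (1 * 1) + μ * (1 * 1)) := by
        gcongr
        · exact norm_diagWeight_le k
        · refine (norm_add_le _ _).trans ?_
          simp only [norm_mul, norm_star]
          gcongr <;> first | exact hx' _ | exact hv' _
    _ = _ := by ring

lemma card_idx_le : (Fintype.card (Idx N) : ℝ) ≤ (N : ℝ) ^ 2 := by
  have : Fintype.card (Idx N) ≤ Fintype.card (Fin N × Fin N) := Fintype.card_subtype_le _
  rw [Fintype.card_prod, Fintype.card_fin] at this
  exact_mod_cast this.trans_eq (sq N).symm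

/-- Second order cumulant expansion of `E W e^{i t (H₀ + λ W)}`. The interpolation `U⁽ᵏ⁾_s U_{t - s}`
between the propagator with the `k`-th entry deleted and the full one expresses
`E Δ_k U_t - E Δ_k U⁽ᵏ⁾_t` as a time integral of second order terms. -/
lemma norm_meanNoise_sub_le (hW : IsNearWigner ν ξ r μ) (hH : IsSelfAdjoint H₀) (lam : ℝ)
    {t : ℝ} (ht : 0 ≤ t) {x y : EuclideanSpace ℂ (Fin N)} (hx : ‖x‖ ≤ 1) (hy : ‖y‖ ≤ 1) :
    ‖inner ℂ x (meanNoise ν H₀ lam ξ t y) - Complex.I * lam *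
        ∫ s in (0 : ℝ)..t, meanTrace ν H₀ lam ξ s * inner ℂ x (meanProp ν H₀ lam ξ (t - s) y)‖ ≤
      2 * μ * N ^ 2 + |lam| * t * covError N r μ (|lam| * t) := by
  have hξ := hW.measurable
  have hr := hW.bound
  -- `g 0` is the quantity to be computed, and `g t` only sees the means of the entries
  set g : ℝ → (Idx N → 𝓧) → ℂ := fun s z => ∑ k, matEl x y (entryOp k (ξ (z k)) *
    (prop (hamDel H₀ lam ξ z k) s * prop (ham H₀ lam ξ z) (t - s))) with hg
  set g' : ℝ → (Idx N → 𝓧) → ℂ := fun s z => (-(Complex.I * lam)) * ∑ k, quad x y k (ξ (z k))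
    (prop (hamDel H₀ lam ξ z k) s) (prop (ham H₀ lam ξ z) (t - s)) with hg'
  have hAm := fun s : ℝ => measurable_prop (measurable_ham (N := N) hξ H₀ lam)
    (measurable_const (a := s))
  have hDm := fun k s => measurable_prop (measurable_hamDel (N := N) hξ H₀ lam k)
    (measurable_const (a := s))
  have hA := fun z => isSelfAdjoint_ham hH lam ξ z
  have hB := fun z k => isSelfAdjoint_hamDel hH lam ξ z k
  have hξk : ∀ k : Idx N, Measurable fun z : Idx N → 𝓧 => ξ (z k) := fun k =>
    hξ.comp (measurable_pi_apply k)
  have hgm : ∀ s, Measurable (g s) := fun s => Finset.measurable_sum _ fun k _ =>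
    (matEl x y).continuous.measurable.comp
      (((continuous_entryOp k).measurable.comp (hξk k)).mul ((hDm k s).mul (hAm _)))
  have hg'm : ∀ s, Measurable (g' s) := fun s => (Finset.measurable_sum _ fun k _ =>
    measurable_quad x y k (hξk k) (hDm k s) (hAm _)).const_mul _
  have hgb : ∀ s z, ‖g s z‖ ≤ ∑ _k : Idx N, 1 * (2 * r * (1 * 1) * 1) := by
    intro s z
    refine (norm_sum_le _ _).trans (Finset.sum_le_sum fun k _ => ?_)
    rw [matEl_apply]
    refine (norm_inner_le_norm _ _).trans ?_
    have := hW.r_nonneg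
    gcongr
    refine (ContinuousLinearMap.le_opNorm _ _).trans ?_
    gcongr
    refine (norm_mul_le _ _).trans ?_
    gcongr
    · exact (norm_entryOp_le _ _).trans (by gcongr; exact hr _)
    · refine (norm_mul_le _ _).trans ?_
      gcongr
      · exact norm_prop_le (hB _ _) _
      · exact norm_prop_le (hA _) _
  have hg'b : ∀ s z, ‖g' s z‖ ≤ |lam| * ∑ _k : Idx N, 4 * r ^ 2 := by
    intro s z
    rw [norm_mul, norm_neg, norm_mul, Complex.norm_I, one_mul, Complex.norm_real,
      Real.norm_eq_abs]
    gcongr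
    refine (norm_sum_le _ _).trans (Finset.sum_le_sum fun k _ => ?_)
    exact norm_quad_le_const hx hy k (hr _) (norm_prop_le (hB _ _) _) (norm_prop_le (hA _) _)
  have hgd : ∀ s z, HasDerivAt (fun s => g s z) (g' s z) s := by
    intro s z
    simp only [hg', Finset.mul_sum]
    refine HasDerivAt.fun_sum fun k _ => ?_
    have h := hasDerivAt_clm (matEl x y ∘L (ContinuousLinearMap.mul ℂ (Op N) (entryOp k (ξ (z k)))))
      (hasDerivAt_prop_mul_prop (hamDel H₀ lam ξ z k) (ham H₀ lam ξ z) t s)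
    refine h.congr_deriv ?_
    rw [hamDel_sub_ham]
    unfold quad
    simp only [mul_neg, neg_mul, mul_smul_comm, smul_mul_assoc, mul_assoc, map_neg, map_smul,
      ContinuousLinearMap.comp_apply, ContinuousLinearMap.mul_apply', smul_neg, smul_eq_mul]
  have hGd := hasDerivAt_integral_of_bdd (μ := Measure.pi ν) hgm hg'm hgb hg'b hgd
  have hgi : ∀ s k, Integrable (fun z : Idx N → 𝓧 => matEl x y (entryOp k (ξ (z k)) *
    (prop (hamDel H₀ lam ξ z k) s * prop (ham H₀ lam ξ z) (t - s)))) (Measure.pi ν) := by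
    intro s k
    refine integrable_of_bdd (B := ‖matEl x y‖ * (2 * r * (1 * 1)))
      ((matEl x y).continuous.measurable.comp
      (((continuous_entryOp k).measurable.comp (hξk k)).mul ((hDm k s).mul (hAm _)))) fun z => ?_
    refine (ContinuousLinearMap.le_opNorm _ _).trans ?_
    have := hW.r_nonneg
    gcongr
    refine (norm_mul_le _ _).trans ?_
    gcongr
    · exact (norm_entryOp_le _ _).trans (by gcongr; exact hr _)
    · refine (norm_mul_le _ _).trans ?_
      gcongr
      · exact norm_prop_le (hB _ _) _
      · exact norm_prop_le (hA _) _
  set u := meanTrace ν H₀ lam ξ with hu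
  set c : ℝ → ℂ := fun s => inner ℂ x (meanProp ν H₀ lam ξ s y) with hc
  have huc : Continuous u := continuous_meanTrace lam hH hξ hr
  have hcc : Continuous c := (matEl x y).continuous.comp (continuous_meanProp lam hH hξ hr)
  have hId : ∀ s : ℝ, HasDerivAt (fun s => ∫ q in (0 : ℝ)..s, u q * c (t - q)) (u s * c (t - s)) s :=
    fun s => (huc.mul (hcc.comp (by fun_prop))).integral_hasStrictDerivAt 0 s |>.hasDerivAt
  have hT := norm_image_sub_le_of_norm_deriv_le_segment' (a := 0) (b := t)
    (f := fun s => ∫ z, g s z ∂(Measure.pi ν) +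
      Complex.I * lam * ∫ q in (0 : ℝ)..s, u q * c (t - q))
    (f' := fun s => ∫ z, g' s z ∂(Measure.pi ν) + Complex.I * lam * (u s * c (t - s)))
    (C := |lam| * covError N r μ (|lam| * t))
    (fun s _ => ((hGd s).add ((hId s).const_mul _)).hasDerivWithinAt)
    (fun s hs => by
      have := norm_integral_quad_sub_le hW hH lam (Set.Ico_subset_Icc_self hs) hx hy
      rw [hg', integral_const_mul]
      calc _ = ‖-(Complex.I * lam) * (∫ z, ∑ k, quad x y k (ξ (z k))
            (prop (hamDel H₀ lam ξ z k) s) (prop (ham H₀ lam ξ z) (t - s)) ∂(Measure.pi ν)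
            - u s * c (t - s))‖ := by congr 1; ring
        _ ≤ _ := by
          rw [norm_mul, norm_neg, norm_mul, Complex.norm_I, one_mul, Complex.norm_real,
            Real.norm_eq_abs]
          gcongr) t ⟨ht, le_rfl⟩
  have e0 : inner ℂ x (meanNoise ν H₀ lam ξ t y) = ∫ z, g 0 z ∂(Measure.pi ν) := by
    rw [← matEl_apply, meanNoise,
      ← (matEl x y).integral_comp_comm (integrable_noise_mul_prop lam hH hξ hr t)]
    refine integral_congr_ae (Eventually.of_forall fun z => ?_)
    simp only [hg, prop_zero, one_mul, sub_zero]
    rw [noise, Finset.sum_mul, map_sum]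
  have e1 : ‖∫ z, g t z ∂(Measure.pi ν)‖ ≤ 2 * μ * N ^ 2 := by
    simp only [hg]
    rw [integral_finsetSum _ fun k _ => hgi t k]
    refine (norm_sum_le _ _).trans ?_
    calc _ ≤ ∑ _k : Idx N, 2 * μ := Finset.sum_le_sum fun k _ => by
          simp only [sub_self, prop_zero, mul_one]
          exact norm_integral_entryOp_deletion_le hW hH lam t hx hy k
      _ ≤ _ := by
          rw [Finset.sum_const, Finset.card_univ, nsmul_eq_mul, mul_comm]
          have := hW.μ_nonneg
          gcongr
          exact card_idx_le
  rw [e0]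
  simp only [intervalIntegral.integral_same, mul_zero, add_zero, sub_zero] at hT
  set a := ∫ z, g 0 z ∂(Measure.pi ν)
  set b := ∫ z, g t z ∂(Measure.pi ν)
  set J := Complex.I * lam * ∫ q in (0 : ℝ)..t, u q * c (t - q)
  calc ‖a - J‖ = ‖b - (b + J - a)‖ := by congr 1; ring
    _ ≤ ‖b‖ + ‖b + J - a‖ := norm_sub_le _ _
    _ ≤ _ := add_le_add e1 (hT.trans_eq (by ring))

end Cumulant

/-! ### Short times -/

section ShortTime

/-- The error in the self-consistent equation; `q = |λ| t`. -/
def cumErr (N : ℕ) (r μ q : ℝ) : ℝ := 2 * μ * N ^ 2 + q * covError N r μ q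

lemma incrBound_mono {N : ℕ} {p q : ℝ} (hp : 0 ≤ p) (h : p ≤ q) : incrBound N p ≤ incrBound N q := by
  unfold incrBound; gcongr

lemma covError_nonneg {N : ℕ} {r μ q : ℝ} (hr : 0 ≤ r) (hμ : 0 ≤ μ) (hq : 0 ≤ q) :
    0 ≤ covError N r μ q := by
  unfold covError; positivity

lemma cumErr_nonneg {N : ℕ} {r μ q : ℝ} (hr : 0 ≤ r) (hμ : 0 ≤ μ) (hq : 0 ≤ q) :
    0 ≤ cumErr N r μ q := by
  have := covError_nonneg (N := N) hr hμ hq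
  unfold cumErr; positivity

lemma cumErr_mono {N : ℕ} {r μ p q : ℝ} (hr : 0 ≤ r) (hμ : 0 ≤ μ) (hp : 0 ≤ p) (h : p ≤ q) :
    cumErr N r μ p ≤ cumErr N r μ q := by
  have h1 : covError N r μ p ≤ covError N r μ q := by
    unfold covError
    have := incrBound_mono (N := N) (p := p * r) (q := q * r) (by positivity) (by gcongr)
    gcongr
  have := covError_nonneg (N := N) hr hμ hp
  have := hp.trans h
  unfold cumErr
  gcongr

lemma incrBound_le {N : ℕ} {r q : ℝ} (hr1 : 1 ≤ r ^ 2 * N) (hq : 0 ≤ q) :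
    incrBound N (q * r) ≤ 544 * (1 + q) ^ 4 * (r ^ 3 * N) ^ 2 := by
  have h2 : r ^ 2 ≤ r ^ 2 * (r ^ 2 * N) := le_mul_of_one_le_right (by positivity) hr1
  have h1 : r ^ 2 * (r ^ 2 * N) ≤ (r ^ 3 * N) ^ 2 := by
    calc r ^ 2 * (r ^ 2 * N) ≤ (r ^ 2 * (r ^ 2 * N)) * (r ^ 2 * N) :=
          le_mul_of_one_le_right (by positivity) hr1
      _ = _ := by ring
  have hq2 : q ^ 2 ≤ (1 + q) ^ 4 := by nlinarith [sq_nonneg (q ^ 2), pow_nonneg hq 3]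
  have hq4 : q ^ 4 ≤ (1 + q) ^ 4 := by gcongr; linarith
  calc incrBound N (q * r) = 32 * q ^ 2 * r ^ 2 + 512 * q ^ 4 * (r ^ 2 * (r ^ 2 * N)) := by
        unfold incrBound; ring
    _ ≤ 32 * (1 + q) ^ 4 * (r ^ 3 * N) ^ 2 + 512 * (1 + q) ^ 4 * (r ^ 3 * N) ^ 2 := by
        have e1 := mul_le_mul hq2 (h2.trans h1) (by positivity) (by positivity)
        have e2 := mul_le_mul hq4 h1 (by positivity) (by positivity)
        linarith
    _ = _ := by ring

/-- All errors are controlled by the single quantity `r ^ 3 N`. -/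
lemma cumErr_le {N : ℕ} {r μ q : ℝ} (hr : 0 ≤ r) (hr' : r ≤ 1) (hr1 : 1 ≤ r ^ 2 * N) (hq : 0 ≤ q)
    (hμ0 : 0 ≤ μ) (hμ : μ * N ^ 2 ≤ r ^ 3 * N) :
    cumErr N r μ q ≤ 60 * (1 + q) ^ 3 * (r ^ 3 * N) := by
  set κ := r ^ 3 * N with hκ
  have hκ0 : 0 ≤ κ := by positivity
  have hN1 : (1 : ℝ) ≤ N := by
    rcases Nat.eq_zero_or_pos N with h | h
    · subst h; norm_num at hr1
    · exact_mod_cast h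
  have hNs : Real.sqrt N ^ 2 = N := Real.sq_sqrt (Nat.cast_nonneg N)
  have h1 : r ≤ κ := by
    calc r ≤ r * (r ^ 2 * N) := le_mul_of_one_le_right hr hr1
      _ = _ := by ring
  have h2 : r ^ 2 ≤ κ := by nlinarith
  have h3 : (N : ℝ)⁻¹ ≤ κ := by
    refine le_trans ?_ h2
    rw [inv_le_iff_one_le_mul₀ (by linarith)]
    exact hr1
  have hrs : 1 ≤ r * Real.sqrt N := by
    by_contra! h
    have h0 : 0 ≤ r * Real.sqrt N := by positivity
    nlinarith
  have h4 : r ^ 2 * Real.sqrt N ≤ κ := by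
    calc r ^ 2 * Real.sqrt N ≤ (r ^ 2 * Real.sqrt N) * (r * Real.sqrt N) :=
          le_mul_of_one_le_right (by positivity) hrs
      _ = r ^ 3 * Real.sqrt N ^ 2 := by ring
      _ = κ := by rw [hNs]
  have h5 : μ * N ≤ κ := by
    refine le_trans ?_ hμ
    gcongr
    nlinarith
  have h6 : Real.sqrt (2 * incrBound N (q * r)) ≤ 34 * (1 + q) ^ 2 * κ := by
    refine Real.sqrt_le_iff.2 ⟨by positivity, ?_⟩
    have := incrBound_le hr1 hq
    rw [← hκ] at this
    nlinarith [show 0 ≤ (1 + q) ^ 4 * κ ^ 2 by positivity]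
  have h7 : covError N r μ q ≤ 24 * q * κ + 6 * κ + 34 * (1 + q) ^ 2 * κ := by
    unfold covError
    have e : 24 * q * r ^ 3 * N = 24 * q * κ := by rw [hκ]; ring
    rw [e]
    nlinarith
  calc cumErr N r μ q ≤ 2 * κ + q * (24 * q * κ + 6 * κ + 34 * (1 + q) ^ 2 * κ) := by
        unfold cumErr
        rw [mul_assoc]
        gcongr
    _ ≤ _ := by
        have e : 60 * (1 + q) ^ 3 * κ - (2 * κ + q * (24 * q * κ + 6 * κ + 34 * (1 + q) ^ 2 * κ)) =
          κ * (58 + 140 * q + 88 * q ^ 2 + 26 * q ^ 3) := by ring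
        have : 0 ≤ κ * (58 + 140 * q + 88 * q ^ 2 + 26 * q ^ 3) := by positivity
        linarith

variable {N : ℕ} {𝓧 : Type*} [MeasurableSpace 𝓧] {ν : Idx N → Measure 𝓧}
  [∀ k, IsProbabilityMeasure (ν k)] {ξ : 𝓧 → ℂ} {r μ : ℝ} {H₀ : Op N}

lemma inner_prop_left {A : Op N} (hA : IsSelfAdjoint A) (t : ℝ) (x y : EuclideanSpace ℂ (Fin N)) :
    inner ℂ (prop A t x) y = (inner ℂ x (prop A (-t) y) : ℂ) := by
  rw [← star_prop hA, ContinuousLinearMap.star_eq_adjoint, ContinuousLinearMap.adjoint_inner_right]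

/-- The averaged evolution in the interaction picture. -/
lemma hasDerivAt_interaction (hH : IsSelfAdjoint H₀) (hξ : Measurable ξ) (hr : ∀ x, ‖ξ x‖ ≤ r)
    (lam t s : ℝ) (x y : EuclideanSpace ℂ (Fin N)) :
    HasDerivAt (fun s => (inner ℂ x ((prop H₀ (t - s) * meanProp ν H₀ lam ξ s) y) : ℂ))
      (Complex.I * lam * inner ℂ (prop H₀ (s - t) x) (meanNoise ν H₀ lam ξ s y)) s := by
  have h1 : HasDerivAt (fun s => prop H₀ (t - s)) (-(Complex.I • (H₀ * prop H₀ (t - s)))) s :=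
    ((hasDerivAt_prop H₀ (t - s)).scomp s ((hasDerivAt_id s).const_sub t)).congr_deriv (by simp)
  have h := hasDerivAt_clm (matEl x y) (h1.mul (hasDerivAt_meanProp (ν := ν) lam hH hξ hr s))
  refine h.congr_deriv ?_
  rw [inner_prop_left hH, neg_sub, commute_prop]
  have e : -(Complex.I • (prop H₀ (t - s) * H₀)) * meanProp ν H₀ lam ξ s + prop H₀ (t - s) *
      Complex.I • (H₀ * meanProp ν H₀ lam ξ s + (lam : ℂ) • meanNoise ν H₀ lam ξ s) =
      (Complex.I * lam) • (prop H₀ (t - s) * meanNoise ν H₀ lam ξ s) := by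
    simp only [mul_add, smul_add, mul_smul_comm, neg_mul, smul_mul_assoc, mul_assoc, smul_smul]
    abel
  rw [e, map_smul, matEl_apply, mul_apply_eq_comp, smul_eq_mul]

/-- The averaged propagator compared with the free one, given the second order term up to `M`. -/
lemma norm_inner_meanProp_sub_le (hW : IsNearWigner ν ξ r μ) (hH : IsSelfAdjoint H₀) (lam : ℝ)
    {t : ℝ} (ht : 0 ≤ t) {x y : EuclideanSpace ℂ (Fin N)} (hx : ‖x‖ ≤ 1) (hy : ‖y‖ ≤ 1) (γ : ℝ)
    {M : ℝ} (hM : ∀ s ∈ Set.Icc 0 t, ‖(∫ q in (0 : ℝ)..s, meanTrace ν H₀ lam ξ q *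
      inner ℂ (prop H₀ (s - t) x) (meanProp ν H₀ lam ξ (s - q) y)) - γ * s‖ ≤ M) :
    ‖inner ℂ x (meanProp ν H₀ lam ξ t y) - inner ℂ x (prop H₀ t y) + lam ^ 2 * γ * t ^ 2 / 2‖ ≤
      (lam ^ 2 * M + |lam| * cumErr N r μ (|lam| * t)) * t := by
  have hq : ∀ s : ℝ, HasDerivAt (fun s : ℝ => (lam ^ 2 * γ * s ^ 2 / 2 : ℂ)) (lam ^ 2 * γ * s) s := by
    intro s
    have h := ((((hasDerivAt_id s).ofReal_comp.pow 2).const_mul ((lam : ℂ) ^ 2 * γ)).div_const 2)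
    refine h.congr_deriv ?_
    simp; ring
  have h := norm_image_sub_le_of_norm_deriv_le_segment' (a := 0) (b := t)
    (f := fun s => (inner ℂ x ((prop H₀ (t - s) * meanProp ν H₀ lam ξ s) y) : ℂ) +
      (lam ^ 2 * γ * s ^ 2 / 2 : ℂ)) (C := lam ^ 2 * M + |lam| * cumErr N r μ (|lam| * t))
    (fun s _ => ((hasDerivAt_interaction (ν := ν) hH hW.measurable hW.bound lam t s x y).add
      (hq s)).hasDerivWithinAt)
    (fun s hs => by
      have hs' := Set.Ico_subset_Icc_self hs
      have hx' : ‖prop H₀ (s - t) x‖ ≤ 1 := (norm_prop_apply hH _ _).le.trans hx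
      have h1 := norm_meanNoise_sub_le hW hH lam hs.1 hx' hy
      have h2 := hM s hs'
      set J := ∫ q in (0 : ℝ)..s, meanTrace ν H₀ lam ξ q *
        inner ℂ (prop H₀ (s - t) x) (meanProp ν H₀ lam ξ (s - q) y)
      set a : ℂ := inner ℂ (prop H₀ (s - t) x) (meanNoise ν H₀ lam ξ s y)
      have e : Complex.I * lam * a + lam ^ 2 * γ * s =
          Complex.I * lam * (a - Complex.I * lam * J) - lam ^ 2 * (J - γ * s) := by
        linear_combination ((lam : ℂ) ^ 2 * J) * Complex.I_sq
      rw [e]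
      refine (norm_sub_le _ _).trans ?_
      rw [norm_mul, norm_mul, norm_mul, Complex.norm_I, one_mul, norm_pow, Complex.norm_real,
        Real.norm_eq_abs, sq_abs, add_comm]
      gcongr
      exact h1.trans (cumErr_mono hW.r_nonneg hW.μ_nonneg (mul_nonneg (abs_nonneg _) hs.1)
        (by gcongr; exact hs'.2))) t ⟨ht, le_rfl⟩
  simp only [sub_zero, sub_self, prop_zero, one_mul, meanProp_zero, mul_one] at h
  refine le_trans (le_of_eq ?_) h
  simp only [Complex.ofReal_zero, ne_eq, OfNat.ofNat_ne_zero, not_false_eq_true, zero_pow, mul_zero,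
    zero_div, add_zero]
  congr 1
  ring

lemma norm_inner_meanProp_sub_prop_le (hW : IsNearWigner ν ξ r μ) (hH : IsSelfAdjoint H₀) (lam : ℝ)
    {t : ℝ} (ht : 0 ≤ t) {x y : EuclideanSpace ℂ (Fin N)} (hx : ‖x‖ ≤ 1) (hy : ‖y‖ ≤ 1) :
    ‖(inner ℂ x (meanProp ν H₀ lam ξ t y) - inner ℂ x (prop H₀ t y) : ℂ)‖ ≤
      (lam ^ 2 * t + |lam| * cumErr N r μ (|lam| * t)) * t := by
  have h := norm_inner_meanProp_sub_le hW hH lam ht hx hy 0 (M := t) fun s hs => by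
    rw [Complex.ofReal_zero, zero_mul, sub_zero]
    refine (intervalIntegral.norm_integral_le_of_norm_le_const (C := 1) fun q _ => ?_).trans ?_
    · rw [norm_mul]
      refine mul_le_one₀ (norm_meanTrace_le lam hH q) (norm_nonneg _) ?_
      refine (norm_inner_le_norm _ _).trans (mul_le_one₀ ((norm_prop_apply hH _ _).le.trans hx)
        (norm_nonneg _) (((meanProp ν H₀ lam ξ (s - q)).le_opNorm y).trans
          (mul_le_one₀ (norm_meanProp_le lam hH _) (norm_nonneg _) hy)))
    · rw [one_mul, sub_zero, abs_of_nonneg hs.1]; exact hs.2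
  simpa using h

lemma norm_prop_sub_one_le {A : Op N} (hA : IsSelfAdjoint A) {t : ℝ} (ht : 0 ≤ t) :
    ‖prop A t - 1‖ ≤ t * ‖A‖ := by
  have := norm_prop_sub_prop_le hA (IsSelfAdjoint.zero (Op N)) ht
  rw [sub_zero] at this
  have e : prop (0 : Op N) t = 1 := by simp [prop]
  rwa [e] at this

/-- Parabolic decay of the averaged echo amplitude. -/
lemma abs_norm_sq_inner_meanProp_sub_le (hW : IsNearWigner ν ξ r μ) (hH : IsSelfAdjoint H₀)
    (hN : 1 ≤ N) {CH : ℝ}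
    (hC : ‖H₀‖ ≤ CH) {lam t : ℝ} (ht : 0 ≤ t) (h1 : |lam| * t ≤ 1) (h2 : lam ^ 2 * t ≤ 1)
    {ψ : EuclideanSpace ℂ (Fin N)} (hψ : ‖ψ‖ = 1) :
    |‖(inner ℂ ψ (meanProp ν H₀ lam ξ t (prop H₀ (-t) ψ)) : ℂ)‖ ^ 2 - (1 - lam ^ 2 * t ^ 2)| ≤
      (4 * CH + 5) * (lam ^ 2 * t ^ 3) + 6 * cumErr N r μ 1 := by
  have hC0 : 0 ≤ CH := (norm_nonneg _).trans hC
  have hr0 := hW.r_nonneg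
  have hμ0 := hW.μ_nonneg
  set E := cumErr N r μ 1 with hE
  have hE0 : 0 ≤ E := cumErr_nonneg hr0 hμ0 zero_le_one
  have hlt : 0 ≤ |lam| * t := by positivity
  have hl2 : lam ^ 2 * t ^ 2 ≤ t := by nlinarith
  set u := meanTrace ν H₀ lam ξ with hu
  -- comparison with the free propagator at earlier times
  have hcrude : ∀ s ∈ Set.Icc 0 t, ∀ x y : EuclideanSpace ℂ (Fin N), ‖x‖ ≤ 1 → ‖y‖ ≤ 1 →
      ‖(inner ℂ x (meanProp ν H₀ lam ξ s y) - inner ℂ x (prop H₀ s y) : ℂ)‖ ≤ t + E := by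
    intro s hs x y hx hy
    refine (norm_inner_meanProp_sub_prop_le hW hH lam hs.1 hx hy).trans ?_
    have hls : |lam| * s ≤ |lam| * t := by gcongr; exact hs.2
    have h4 : cumErr N r μ (|lam| * s) ≤ E :=
      cumErr_mono hr0 hμ0 (mul_nonneg (abs_nonneg _) hs.1) (hls.trans h1)
    calc (lam ^ 2 * s + |lam| * cumErr N r μ (|lam| * s)) * s
        = lam ^ 2 * s * s + (|lam| * s) * cumErr N r μ (|lam| * s) := by ring
      _ ≤ 1 * t + 1 * E := by
          have := hs.1
          have h5 : lam ^ 2 * s ≤ 1 := le_trans (by gcongr; exact hs.2) h2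
          have h6 := cumErr_nonneg (N := N) hr0 hμ0 (mul_nonneg (abs_nonneg lam) hs.1)
          gcongr
          · exact hs.2
          · exact hls.trans h1
      _ = _ := by ring
  have hN0 : (N : ℂ) ≠ 0 := by exact_mod_cast (by omega : N ≠ 0)
  -- both factors of the second order term are close to `1`: the averaged trace
  have hutr : ∀ s ∈ Set.Icc 0 t, ‖u s - 1‖ ≤ CH * t + (t + E) := by
    intro s hs
    have e : u s - 1 = (N : ℂ)⁻¹ * ∑ i : Fin N,
        ((inner ℂ (stdVec i) (meanProp ν H₀ lam ξ s (stdVec i)) -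
          inner ℂ (stdVec i) (prop H₀ s (stdVec i))) +
        inner ℂ (stdVec i) ((prop H₀ s - 1) (stdVec i))) := by
      rw [hu, meanTrace, ntr_apply]
      have : (1 : ℂ) = (N : ℂ)⁻¹ * ∑ i : Fin N, 1 := by simp [hN0]
      conv_lhs => rw [this]
      rw [← mul_sub, ← Finset.sum_sub_distrib]
      congr 1
      refine Finset.sum_congr rfl fun i _ => ?_
      rw [sub_apply, inner_sub_right]
      simp [entry]
    rw [e, norm_mul, norm_inv, Complex.norm_natCast, inv_mul_le_iff₀ (by exact_mod_cast hN)]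
    refine (norm_sum_le _ _).trans ?_
    calc _ ≤ ∑ _i : Fin N, (CH * t + (t + E)) := by
          refine Finset.sum_le_sum fun i _ => (norm_add_le _ _).trans ?_
          rw [add_comm]
          gcongr
          · refine (norm_inner_le_norm _ _).trans ?_
            rw [norm_stdVec, one_mul]
            refine (ContinuousLinearMap.le_opNorm _ _).trans ?_
            rw [norm_stdVec, mul_one]
            refine (norm_prop_sub_one_le hH hs.1).trans ?_
            rw [mul_comm]
            have := hs.1
            gcongr
            exact hs.2
          · exact hcrude s hs _ _ (norm_stdVec _).le (norm_stdVec _).le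
      _ = _ := by simp; ring
  have hy : ‖prop H₀ (-t) ψ‖ ≤ 1 := (norm_prop_apply hH _ _).le.trans hψ.le
  have hone : (inner ℂ ψ ψ : ℂ) = 1 := by rw [inner_self_eq_norm_sq_to_K, hψ]; simp
  -- and the matrix element
  have hXtr : ∀ s ∈ Set.Icc 0 t, ∀ q ∈ Set.Icc 0 s,
      ‖(inner ℂ (prop H₀ (s - t) ψ) (meanProp ν H₀ lam ξ (s - q) (prop H₀ (-t) ψ)) : ℂ) - 1‖ ≤
        (t + E) + CH * t := by
    intro s hs q hq
    have e : (inner ℂ (prop H₀ (s - t) ψ) (prop H₀ (s - q) (prop H₀ (-t) ψ)) : ℂ) - 1 =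
        inner ℂ (prop H₀ q ψ) (((1 : Op N) - prop H₀ q) ψ) := by
      have f : ∀ a b, prop H₀ a (prop H₀ b ψ) = prop H₀ (a + b) ψ := fun a b => by
        rw [prop_add]; rfl
      rw [sub_apply, one_apply_eq_self, inner_sub_right, inner_prop_left hH, inner_prop_left hH,
        inner_prop_left hH, f, f, f, neg_add_cancel, prop_zero, one_apply_eq_self, hone]
      ring_nf
    calc _ = ‖(inner ℂ (prop H₀ (s - t) ψ) (meanProp ν H₀ lam ξ (s - q) (prop H₀ (-t) ψ)) -
          inner ℂ (prop H₀ (s - t) ψ) (prop H₀ (s - q) (prop H₀ (-t) ψ))) +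
          ((inner ℂ (prop H₀ (s - t) ψ) (prop H₀ (s - q) (prop H₀ (-t) ψ)) : ℂ) - 1)‖ := by
          congr 1; ring
      _ ≤ _ := by
          refine (norm_add_le _ _).trans (add_le_add ?_ ?_)
          · exact hcrude (s - q) ⟨sub_nonneg.2 hq.2, by linarith [hs.2, hq.1]⟩ _ _
              ((norm_prop_apply hH _ _).le.trans hψ.le) hy
          · rw [e]
            refine (norm_inner_le_norm _ _).trans ?_
            rw [norm_prop_apply hH, hψ, one_mul]
            refine (ContinuousLinearMap.le_opNorm _ _).trans ?_
            rw [hψ, mul_one, norm_sub_rev]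
            refine (norm_prop_sub_one_le hH hq.1).trans ?_
            rw [mul_comm]
            have := hq.1
            gcongr
            exact hq.2.trans hs.2
  have huc : Continuous u := continuous_meanTrace lam hH hW.measurable hW.bound
  have hcc : ∀ x y : EuclideanSpace ℂ (Fin N), Continuous fun s =>
      (inner ℂ x (meanProp ν H₀ lam ξ s y) : ℂ) := fun x y =>
    (matEl x y).continuous.comp (continuous_meanProp lam hH hW.measurable hW.bound)
  have hmain := norm_inner_meanProp_sub_le hW hH lam ht hψ.le hy 1
    (M := (2 * (CH * t + (t + E))) * t) fun s hs => by
      have e : (((1 : ℝ) : ℂ) * s) = ∫ _q in (0 : ℝ)..s, (1 : ℂ) := by simp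
      rw [e, ← intervalIntegral.integral_sub]
      · refine (intervalIntegral.norm_integral_le_of_norm_le_const
          (C := 2 * (CH * t + (t + E))) fun q hq => ?_).trans ?_
        · rw [Set.uIoc_of_le hs.1] at hq
          have hq' := Set.Ioc_subset_Icc_self hq
          have hX := hXtr s hs q hq'
          have hu1 := hutr q ⟨hq'.1, hq'.2.trans hs.2⟩
          have hub : ‖u q‖ ≤ 1 := norm_meanTrace_le lam hH q
          set X : ℂ := inner ℂ (prop H₀ (s - t) ψ) (meanProp ν H₀ lam ξ (s - q) (prop H₀ (-t) ψ))
          calc ‖u q * X - 1‖ = ‖u q * (X - 1) + (u q - 1)‖ := by congr 1; ring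
            _ ≤ ‖u q‖ * ‖X - 1‖ + ‖u q - 1‖ := (norm_add_le _ _).trans_eq (by rw [norm_mul])
            _ ≤ 1 * ((t + E) + CH * t) + (CH * t + (t + E)) := by gcongr
            _ = _ := by ring
        · rw [sub_zero, abs_of_nonneg hs.1]
          have := hs.2
          gcongr
      · exact (huc.mul ((hcc _ _).comp (by fun_prop))).intervalIntegrable _ _
      · exact continuous_const.intervalIntegrable _ _
  have hb1 : ‖(inner ℂ ψ (meanProp ν H₀ lam ξ t (prop H₀ (-t) ψ)) : ℂ)‖ ≤ 1 :=
    (norm_inner_le_norm _ _).trans (mul_le_one₀ hψ.le (norm_nonneg _)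
      (((meanProp ν H₀ lam ξ t).le_opNorm _).trans
          (mul_le_one₀ (norm_meanProp_le lam hH _) (norm_nonneg _) hy)))
  rw [← mul_apply_eq_comp (prop H₀ t), ← prop_add, add_neg_cancel, prop_zero, one_apply_eq_self,
    hone] at hmain
  set c : ℂ := inner ℂ ψ (meanProp ν H₀ lam ξ t (prop H₀ (-t) ψ))
  set a : ℝ := lam ^ 2 * t ^ 2 / 2 with ha
  have ha0 : 0 ≤ a := by positivity
  have ha1 : a ≤ 1 := by
    have : lam ^ 2 * t ^ 2 = (|lam| * t) ^ 2 := by rw [mul_pow, sq_abs]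
    nlinarith
  have hce : ‖c - ((1 - a : ℝ) : ℂ)‖ ≤ (2 * CH + 2) * (lam ^ 2 * t ^ 3) + 3 * E := by
    have e : c - ((1 - a : ℝ) : ℂ) = c - 1 + lam ^ 2 * ((1 : ℝ) : ℂ) * t ^ 2 / 2 := by
      rw [ha]; push_cast; ring
    rw [e]
    refine hmain.trans ?_
    have h4 : cumErr N r μ (|lam| * t) ≤ E := cumErr_mono hr0 hμ0 hlt h1
    have h5 : lam ^ 2 * t ^ 2 ≤ 1 := by
      have : lam ^ 2 * t ^ 2 = (|lam| * t) ^ 2 := by rw [mul_pow, sq_abs]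
      nlinarith
    calc (lam ^ 2 * (2 * (CH * t + (t + E)) * t) + |lam| * cumErr N r μ (|lam| * t)) * t
        = (2 * CH + 2) * (lam ^ 2 * t ^ 3) + 2 * (lam ^ 2 * t ^ 2) * E
          + |lam| * t * cumErr N r μ (|lam| * t) := by ring
      _ ≤ (2 * CH + 2) * (lam ^ 2 * t ^ 3) + 2 * 1 * E + 1 * E := by
          have := cumErr_nonneg (N := N) hr0 hμ0 hlt
          gcongr
      _ = _ := by ring
  set e := (2 * CH + 2) * (lam ^ 2 * t ^ 3) + 3 * E
  have hn : |‖c‖ - (1 - a)| ≤ e := by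
    have := abs_norm_sub_norm_le c ((1 - a : ℝ) : ℂ)
    rw [Complex.norm_real, Real.norm_eq_abs, abs_of_nonneg (by linarith : 0 ≤ 1 - a)] at this
    exact this.trans hce
  have hsq : |‖c‖ ^ 2 - (1 - a) ^ 2| ≤ 2 * e := by
    have e1 : ‖c‖ ^ 2 - (1 - a) ^ 2 = (‖c‖ - (1 - a)) * (‖c‖ + (1 - a)) := by ring
    have h0 : 0 ≤ ‖c‖ + (1 - a) := by have := norm_nonneg c; linarith
    have he0 : 0 ≤ e := (abs_nonneg _).trans hn
    rw [e1, abs_mul, abs_of_nonneg h0]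
    calc _ ≤ e * 2 := by gcongr; linarith
      _ = _ := by ring
  have ha2 : a ^ 2 ≤ lam ^ 2 * t ^ 3 := by
    have : a ^ 2 = (lam ^ 2 * t) * (lam ^ 2 * t ^ 3) / 4 := by rw [ha]; ring
    rw [this]
    have h6 : 0 ≤ lam ^ 2 * t ^ 3 := by positivity
    nlinarith
  calc |‖c‖ ^ 2 - (1 - lam ^ 2 * t ^ 2)| = |(‖c‖ ^ 2 - (1 - a) ^ 2) + a ^ 2| := by
        congr 1; rw [ha]; ring
    _ ≤ 2 * e + lam ^ 2 * t ^ 3 := by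
        refine (abs_add_le _ _).trans (add_le_add hsq ?_)
        rw [abs_of_nonneg (sq_nonneg a)]; exact ha2
    _ = _ := by simp only [e]; ring

end ShortTime

/-! ### Laplace transforms of bounded functions -/

section Laplace

variable {V : Type*} [NormedAddCommGroup V] [NormedSpace ℂ V]

/-- The Laplace transform `∫₀^∞ e^{-p t} F t dt`. -/
def lap (F : ℝ → V) (p : ℂ) : V := ∫ t in Set.Ioi (0 : ℝ), Complex.exp (-p * t) • F t

lemma norm_exp_neg_mul (p : ℂ) (t : ℝ) : ‖Complex.exp (-p * t)‖ = Real.exp (-p.re * t) := by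
  rw [Complex.norm_exp]; simp

lemma integrableOn_lap {F : ℝ → V} (hF : Continuous F) {B : ℝ} (hB : ∀ t, ‖F t‖ ≤ B) {p : ℂ}
    (hp : 0 < p.re) : IntegrableOn (fun t : ℝ => Complex.exp (-p * t) • F t) (Set.Ioi 0) := by
  have h := (integrableOn_exp_mul_Ioi (a := -p.re) (by linarith) 0).mul_const B
  refine Integrable.mono' h (by fun_prop) (Eventually.of_forall fun t => ?_)
  rw [norm_smul, norm_exp_neg_mul]
  gcongr
  exact hB t

lemma norm_lap_le_of_le {F : ℝ → V} {p : ℂ} {G : ℝ → ℝ} (hG : ∀ t, 0 < t → ‖F t‖ ≤ G t)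
    (hGi : IntegrableOn (fun t : ℝ => Real.exp (-p.re * t) * G t) (Set.Ioi 0)) :
    ‖lap F p‖ ≤ ∫ t in Set.Ioi (0 : ℝ), Real.exp (-p.re * t) * G t := by
  refine norm_integral_le_of_norm_le hGi
    ((ae_restrict_iff' measurableSet_Ioi).2 (Eventually.of_forall fun t ht => ?_))
  rw [norm_smul, norm_exp_neg_mul]
  gcongr
  exact hG t ht

lemma norm_lap_le {F : ℝ → V} {B : ℝ} (hB : ∀ t, ‖F t‖ ≤ B) {p : ℂ} (hp : 0 < p.re) :
    ‖lap F p‖ ≤ B / p.re := by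
  have h := integrableOn_exp_mul_Ioi (a := -p.re) (by linarith) 0
  refine (norm_lap_le_of_le (fun t _ => hB t) (h.mul_const B)).trans ?_
  rw [integral_mul_const, integral_exp_mul_Ioi (by linarith)]
  simp only [mul_zero, Real.exp_zero, neg_div_neg_eq]
  rw [one_div, inv_mul_eq_div]

lemma clm_lap [CompleteSpace V] {W : Type*} [NormedAddCommGroup W] [NormedSpace ℂ W] [CompleteSpace W]
    (L : V →L[ℂ] W) {F : ℝ → V} (hF : Continuous F) {B : ℝ}
    (hB : ∀ t, ‖F t‖ ≤ B) {p : ℂ} (hp : 0 < p.re) : L (lap F p) = lap (fun t => L (F t)) p := by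
  unfold lap
  rw [← L.integral_comp_comm (integrableOn_lap hF hB hp)]
  simp

lemma lap_add {F G : ℝ → V} (hF : Continuous F) (hG : Continuous G) {B C : ℝ}
    (hB : ∀ t, ‖F t‖ ≤ B) (hC : ∀ t, ‖G t‖ ≤ C) {p : ℂ} (hp : 0 < p.re) :
    lap (fun t => F t + G t) p = lap F p + lap G p := by
  unfold lap
  simp only [smul_add]
  exact integral_add (integrableOn_lap hF hB hp) (integrableOn_lap hG hC hp)

lemma lap_const_smul (c : ℂ) (F : ℝ → V) (p : ℂ) : lap (fun t => c • F t) p = c • lap F p := by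
  unfold lap
  rw [← integral_smul]
  simp only [smul_comm c]

/-- Integration by parts. -/
lemma smul_lap [CompleteSpace V] {F F' : ℝ → V} (hF : ∀ t, HasDerivAt F (F' t) t) (hc : Continuous F') {B C : ℝ}
    (hB : ∀ t, ‖F t‖ ≤ B) (hC : ∀ t, ‖F' t‖ ≤ C) {p : ℂ} (hp : 0 < p.re) :
    p • lap F p = F 0 + lap F' p := by
  have hFc : Continuous F := continuous_iff_continuousAt.2 fun t => (hF t).continuousAt
  have i1 := integrableOn_lap hFc hB hp
  have i2 := integrableOn_lap hc hC hp
  have hd : ∀ t : ℝ, HasDerivAt (fun t : ℝ => Complex.exp (-p * t) • F t)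
      (Complex.exp (-p * t) • F' t - p • (Complex.exp (-p * t) • F t)) t := by
    intro t
    have h1 : HasDerivAt (fun t : ℝ => Complex.exp (-p * t)) (Complex.exp (-p * t) * (-p)) t := by
      have := ((hasDerivAt_id t).ofReal_comp.const_mul (-p)).cexp
      simpa using this
    refine (h1.smul (hF t)).congr_deriv ?_
    rw [smul_smul, mul_neg, neg_smul, mul_comm p]
    abel
  have hlim : Tendsto (fun t : ℝ => Complex.exp (-p * t) • F t) atTop (𝓝 0) := by
    refine squeeze_zero_norm (a := fun t => Real.exp (-p.re * t) * B) (fun t => ?_) ?_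
    · rw [norm_smul, norm_exp_neg_mul]
      gcongr
      exact hB t
    · have : Tendsto (fun t : ℝ => Real.exp (-p.re * t)) atTop (𝓝 0) :=
        Real.tendsto_exp_atBot.comp (tendsto_id.const_mul_atTop_of_neg (by linarith))
      simpa using this.mul_const B
  have i3 : IntegrableOn (fun t : ℝ => p • Complex.exp (-p * t) • F t) (Set.Ioi 0) :=
    Integrable.smul p i1
  have h := integral_Ioi_of_hasDerivAt_of_tendsto' (a := 0) (fun t _ => hd t) (i2.sub i3) hlim
  have h2 : ∫ t in Set.Ioi (0 : ℝ), (Complex.exp (-p * t) • F' t - p • Complex.exp (-p * t) • F t) =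
      lap F' p - p • lap F p := by
    rw [integral_sub i2 i3, integral_smul]; rfl
  rw [h2] at h
  simp only [Complex.ofReal_zero, mul_zero, Complex.exp_zero, one_smul, zero_sub] at h
  have e : p • lap F p = lap F' p - (lap F' p - p • lap F p) := by abel
  rw [e, h]
  abel

/-- The Laplace transform turns convolutions into products. -/
lemma lap_convolution {u c : ℝ → ℂ} (hu : Continuous u) (hc : Continuous c) {B C : ℝ}
    (hB : ∀ t, ‖u t‖ ≤ B) (hC : ∀ t, ‖c t‖ ≤ C) {p : ℂ} (hp : 0 < p.re) :
    lap (fun t => ∫ s in (0 : ℝ)..t, u s * c (t - s)) p = lap u p * lap c p := by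
  have h := integral_posConvolution (integrableOn_lap hu hB hp) (integrableOn_lap hc hC hp)
    (ContinuousLinearMap.mul ℝ ℂ)
  simp only [ContinuousLinearMap.mul_apply', smul_eq_mul] at h
  unfold lap
  simp only [smul_eq_mul]
  rw [← h]
  refine setIntegral_congr_fun measurableSet_Ioi fun t _ => ?_
  rw [← intervalIntegral.integral_const_mul]
  refine intervalIntegral.integral_congr fun s _ => ?_
  rw [mul_mul_mul_comm, ← Complex.exp_add]
  push_cast
  ring_nf

lemma continuousOn_lap {F : ℝ → V} (hF : Continuous F) {B : ℝ} (hB : ∀ t, ‖F t‖ ≤ B) :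
    ContinuousOn (lap F) {p | 0 < p.re} := by
  intro p hp
  have hp' : 0 < p.re := hp
  refine ContinuousAt.continuousWithinAt ?_
  refine continuousAt_of_dominated (bound := fun t : ℝ => Real.exp (-(p.re / 2) * t) * B)
    (Eventually.of_forall fun q => (by fun_prop)) ?_
    ((integrableOn_exp_mul_Ioi (by linarith) 0).mul_const B)
    (Eventually.of_forall fun t => by fun_prop)
  have hn : ∀ᶠ q : ℂ in 𝓝 p, p.re / 2 < q.re :=
    Complex.continuous_re.continuousAt.eventually (lt_mem_nhds (by linarith))
  filter_upwards [hn] with q hq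
  refine (ae_restrict_iff' measurableSet_Ioi).2 (Eventually.of_forall fun t ht => ?_)
  have ht' : (0 : ℝ) < t := ht
  rw [norm_smul, norm_exp_neg_mul]
  gcongr
  exact hB t

lemma integrable_inv_sq_add_sq {η : ℝ} (hη : 0 < η) : Integrable fun E : ℝ => (η ^ 2 + E ^ 2)⁻¹ := by
  have h := (integrable_inv_one_add_sq.const_mul (1 + (η ^ 2)⁻¹))
  refine h.mono' (by fun_prop) (Eventually.of_forall fun E => ?_)
  have h1 : 0 < η ^ 2 := by positivity
  have h2 : 0 < η ^ 2 + E ^ 2 := by positivity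
  rw [Real.norm_of_nonneg (by positivity), inv_le_iff_one_le_mul₀ h2]
  have h3 : 0 < 1 + E ^ 2 := by positivity
  rw [mul_comm, ← mul_assoc, le_mul_inv_iff₀ h3]
  have : (η ^ 2 + E ^ 2) * (1 + (η ^ 2)⁻¹) = 1 + E ^ 2 + (η ^ 2 + E ^ 2 * (η ^ 2)⁻¹) := by
    field_simp; ring
  rw [this]
  have : 0 ≤ η ^ 2 + E ^ 2 * (η ^ 2)⁻¹ := by positivity
  linarith

/-- The two-sided transform of `e^{-η |t|} g t` at frequency `E`. -/
def bilap (g : ℝ → ℂ) (η E : ℝ) : ℂ :=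
  lap g (η + E * Complex.I) + lap (fun t => g (-t)) (η - E * Complex.I)

lemma integrable_damped {g : ℝ → ℂ} (hg : Continuous g) {B : ℝ} (hB : ∀ t, ‖g t‖ ≤ B) {η : ℝ}
    (hη : 0 < η) : Integrable fun t : ℝ => (Real.exp (-η * |t|) : ℂ) * g t := by
  have h1 : Integrable fun t : ℝ => Real.exp (-η * |t|) := by
    rw [← integrableOn_univ, ← Set.Iic_union_Ioi (a := (0 : ℝ))]
    refine IntegrableOn.union ?_ ?_
    · refine (integrableOn_exp_mul_Iic hη 0).congr_fun (fun t ht => ?_) measurableSet_Iic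
      simp only [abs_of_nonpos (Set.mem_Iic.1 ht)]; ring_nf
    · refine (integrableOn_exp_mul_Ioi (neg_lt_zero.2 hη) 0).congr_fun (fun t ht => ?_)
        measurableSet_Ioi
      simp only [abs_of_pos (Set.mem_Ioi.1 ht)]
  refine (h1.mul_const B).mono' (by fun_prop) (Eventually.of_forall fun t => ?_)
  rw [norm_mul, Complex.norm_real, Real.norm_of_nonneg (Real.exp_pos _).le]
  gcongr
  exact hB t

lemma integral_exp_mul_damped {g : ℝ → ℂ} (hg : Continuous g) {B : ℝ} (hB : ∀ t, ‖g t‖ ≤ B) {η : ℝ}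
    (hη : 0 < η) (E : ℝ) :
    ∫ t : ℝ, Complex.exp (-(E * Complex.I) * t) * ((Real.exp (-η * |t|) : ℂ) * g t) =
      bilap g η E := by
  have hi : Integrable fun t : ℝ =>
      Complex.exp (-(E * Complex.I) * t) * ((Real.exp (-η * |t|) : ℂ) * g t) := by
    refine (integrable_damped hg hB hη).norm.mono' (by fun_prop) (Eventually.of_forall fun t => ?_)
    rw [norm_mul, norm_exp_neg_mul]
    simp
  rw [← setIntegral_univ, ← Set.Iic_union_Ioi (a := (0 : ℝ)),
    setIntegral_union (by simp) measurableSet_Ioi hi.integrableOn hi.integrableOn,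
    add_comm]
  unfold bilap lap
  congr 1
  · refine setIntegral_congr_fun measurableSet_Ioi fun t ht => ?_
    simp only [abs_of_pos (Set.mem_Ioi.1 ht), smul_eq_mul]
    rw [← mul_assoc, Complex.ofReal_exp, ← Complex.exp_add]
    push_cast
    ring_nf
  · rw [← neg_zero, ← integral_comp_neg_Ioi, neg_zero]
    refine setIntegral_congr_fun measurableSet_Ioi fun t ht => ?_
    simp only [abs_neg, abs_of_pos (Set.mem_Ioi.1 ht), smul_eq_mul]
    rw [← mul_assoc, Complex.ofReal_exp, ← Complex.exp_add]
    push_cast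
    ring_nf

/-- Inversion of the two-sided transform, for functions with two bounded derivatives. -/
lemma bilap_inversion {g g' g'' : ℝ → ℂ} (h1 : ∀ t, HasDerivAt g (g' t) t)
    (h2 : ∀ t, HasDerivAt g' (g'' t) t) (hc : Continuous g'') {B : ℝ} (hB : ∀ t, ‖g t‖ ≤ B)
    (hB' : ∀ t, ‖g' t‖ ≤ B) (hB'' : ∀ t, ‖g'' t‖ ≤ B) {η : ℝ} (hη : 0 < η) :
    Integrable (bilap g η) ∧ ∀ t : ℝ,
      ∫ E : ℝ, Complex.exp (E * t * Complex.I) * bilap g η E =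
        2 * Real.pi * Real.exp (-η * |t|) * g t := by
  have hgc : Continuous g := continuous_iff_continuousAt.2 fun t => (h1 t).continuousAt
  have hgc' : Continuous g' := continuous_iff_continuousAt.2 fun t => (h2 t).continuousAt
  set f : ℝ → ℂ := fun t => (Real.exp (-η * |t|) : ℂ) * g t with hf
  have hfi : Integrable f := integrable_damped hgc hB hη
  have hfc : Continuous f := by fun_prop
  have hF : ∀ w : ℝ, FourierTransform.fourier f w = bilap g η (2 * Real.pi * w) := by
    intro w
    rw [Real.fourier_eq', ← integral_exp_mul_damped hgc hB hη]
    refine integral_congr_ae (Eventually.of_forall fun t => ?_)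
    simp only [RCLike.inner_apply, conj_trivial, smul_eq_mul]
    congr 2
    push_cast
    ring
  have hpi : (2 * Real.pi) ≠ 0 := by positivity
  have hbc : Continuous (bilap g η) := by
    have : Continuous (FourierTransform.fourier f) :=
      VectorFourier.fourierIntegral_continuous Real.continuous_fourierChar (by fun_prop) hfi
    have e : bilap g η = fun E => FourierTransform.fourier f (E / (2 * Real.pi)) := by
      funext E; rw [hF]; congr 1; field_simp
    rw [e]; fun_prop
  have hB0 : 0 ≤ B := (norm_nonneg _).trans (hB 0)
  -- integrating by parts twice on each half line gives decay of order `E ^ (-2)`, since the boundary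
  -- terms of first order of the two halves add up to `g 0 * 2 * η / (p * p')`
  have hbi : Integrable (bilap g η) := by
    have hint := (integrable_inv_sq_add_sq hη).const_mul (2 * η * B + 2 * (B + B / η))
    refine hint.mono' hbc.aestronglyMeasurable (Eventually.of_forall fun E => ?_)
    set p : ℂ := η + E * Complex.I with hp
    set p' : ℂ := η - E * Complex.I with hp'
    have hre : p.re = η := by simp [hp]
    have hre' : p'.re = η := by simp [hp']
    have hp0 : 0 < p.re := by rw [hre]; exact hη
    have hp0' : 0 < p'.re := by rw [hre']; exact hη
    have hpne : p ≠ 0 := fun h => by rw [h] at hp0; simp at hp0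
    have hpne' : p' ≠ 0 := fun h => by rw [h] at hp0'; simp at hp0'
    have a1 := smul_lap h1 hgc' hB hB' hp0
    have a2 := smul_lap h2 hc hB' hB'' hp0
    have b1 := smul_lap (F := fun t => g (-t)) (F' := fun t => -g' (-t))
      (fun t => ((h1 (-t)).scomp t (hasDerivAt_neg t)).congr_deriv (by simp)) (by fun_prop)
      (fun t => hB (-t)) (fun t => by rw [norm_neg]; exact hB' (-t)) hp0'
    have b2 := smul_lap (F := fun t => -g' (-t)) (F' := fun t => g'' (-t))
      (fun t => ((h2 (-t)).scomp t (hasDerivAt_neg t)).neg.congr_deriv (by simp)) (by fun_prop)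
      (fun t => by rw [norm_neg]; exact hB' (-t)) (fun t => hB'' (-t)) hp0'
    simp only [neg_zero, smul_eq_mul] at a1 a2 b1 b2
    have hpp : p * p' = ((η ^ 2 + E ^ 2 : ℝ) : ℂ) := by
      rw [hp, hp']; push_cast; linear_combination (-(E : ℂ) ^ 2) * Complex.I_sq
    have hs : p + p' = 2 * η := by rw [hp, hp']; ring
    have key : bilap g η E = g 0 * (2 * η) / (p * p') + (g' 0 + lap g'' p) / p ^ 2 +
        (-g' 0 + lap (fun t => g'' (-t)) p') / p' ^ 2 := by
      have e1 : lap g p = (g 0 + (g' 0 + lap g'' p) / p) / p := by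
        rw [eq_div_iff hpne, ← a2, mul_comm, a1]; field_simp
      have e2 : lap (fun t => g (-t)) p' =
          (g 0 + (-g' 0 + lap (fun t => g'' (-t)) p') / p') / p' := by
        rw [eq_div_iff hpne', ← b2, mul_comm, b1]; field_simp
      unfold bilap
      rw [← hp, ← hp', e1, e2, ← hs]
      field_simp
      ring
    have hn2 : ∀ q : ℂ, q.re = η → q.im ^ 2 = E ^ 2 → ‖q‖ ^ 2 = η ^ 2 + E ^ 2 := by
      intro q h3 h4
      rw [Complex.sq_norm, Complex.normSq_apply, h3, ← h4]; ring
    have hnp : ‖p‖ ^ 2 = η ^ 2 + E ^ 2 := hn2 p hre (by simp [hp])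
    have hnp' : ‖p'‖ ^ 2 = η ^ 2 + E ^ 2 := hn2 p' hre' (by simp [hp'])
    have l1 : ‖lap g'' p‖ ≤ B / η := hre ▸ norm_lap_le hB'' hp0
    have l2 : ‖lap (fun t => g'' (-t)) p'‖ ≤ B / η := hre' ▸ norm_lap_le (fun t => hB'' (-t)) hp0'
    rw [key]
    refine norm_add₃_le.trans ?_
    rw [norm_div, norm_div, norm_div, norm_pow, norm_pow, hnp, hnp', hpp, Complex.norm_real,
      Real.norm_of_nonneg (by positivity : 0 ≤ η ^ 2 + E ^ 2), norm_mul, norm_mul,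
      Complex.norm_real, Real.norm_of_nonneg hη.le, ← add_div, ← add_div, div_eq_mul_inv]
    refine mul_le_mul_of_nonneg_right ?_ (by positivity)
    have t1 := hB 0
    have t2 := norm_add_le (g' 0) (lap g'' p)
    have t3 := norm_add_le (-g' 0) (lap (fun t => g'' (-t)) p')
    rw [norm_neg] at t3
    have t4 := hB' 0
    have t5 : ‖(2 : ℂ)‖ = 2 := by simp
    rw [t5]
    nlinarith
  refine ⟨hbi, fun t => ?_⟩
  have hFi : Integrable (FourierTransform.fourier f) := by
    rw [show FourierTransform.fourier f = fun w => bilap g η (2 * Real.pi * w) from funext hF]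
    exact hbi.comp_mul_left' hpi
  have hinv := congrFun (hfc.fourierInv_fourier_eq hfi hFi) t
  rw [Real.fourierInv_eq'] at hinv
  have hsub := Measure.integral_comp_mul_left
    (fun E : ℝ => Complex.exp (E * t * Complex.I) * bilap g η E) (2 * Real.pi)
  have e : ∫ w : ℝ, Complex.exp (((2 * Real.pi * inner ℝ w t : ℝ) : ℂ) * Complex.I) •
      FourierTransform.fourier f w = ∫ w : ℝ, Complex.exp (((2 * Real.pi * w : ℝ) : ℂ) * t *
        Complex.I) * bilap g η (2 * Real.pi * w) := by
    refine integral_congr_ae (Eventually.of_forall fun w => ?_)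
    simp only [hF, smul_eq_mul, RCLike.inner_apply, conj_trivial]
    congr 2
    push_cast
    ring
  rw [e, hsub] at hinv
  rw [abs_of_pos (by positivity)] at hinv
  have hpc : (Real.pi : ℂ) ≠ 0 := by exact_mod_cast Real.pi_ne_zero
  rw [Complex.real_smul] at hinv
  simp only [hf] at hinv
  push_cast at hinv ⊢
  field_simp at hinv
  rw [neg_mul]
  linear_combination hinv

end Laplace

/-! ### Resolvents -/

section Resolvent

variable {N : ℕ}

/-- The resolvent `(q - i A)⁻¹`, as the Laplace transform of the propagator. -/
def resol (A : Op N) (q : ℂ) : Op N := lap (prop A) q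

lemma norm_resol_le {A : Op N} (hA : IsSelfAdjoint A) {q : ℂ} (hq : 0 < q.re) :
    ‖resol A q‖ ≤ 1 / q.re := norm_lap_le (norm_prop_le hA) hq

lemma smul_resol {A : Op N} (hA : IsSelfAdjoint A) {q : ℂ} (hq : 0 < q.re) :
    q • resol A q = 1 + Complex.I • (A * resol A q) := by
  have hb : ∀ t, ‖A * prop A t‖ ≤ ‖A‖ * 1 := fun t =>
    (norm_mul_le _ _).trans (by gcongr; exact norm_prop_le hA t)
  have hc := continuous_prop_right A
  have h := smul_lap (hasDerivAt_prop A) (by fun_prop) (norm_prop_le hA)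
    (C := ‖A‖ * 1) (fun t => by rw [norm_smul, Complex.norm_I, one_mul]; exact hb t) hq
  rw [prop_zero, lap_const_smul] at h
  have h2 := clm_lap (ContinuousLinearMap.mul ℂ (Op N) A) hc (norm_prop_le hA) hq
  unfold resol
  rw [h]
  simp only [ContinuousLinearMap.mul_apply'] at h2
  rw [h2]

lemma sub_mul_resol {A : Op N} (hA : IsSelfAdjoint A) {q : ℂ} (hq : 0 < q.re) :
    (q • (1 : Op N) - Complex.I • A) * resol A q = 1 := by
  rw [sub_mul, smul_mul_assoc, one_mul, smul_mul_assoc, smul_resol hA hq]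
  abel

lemma commute_resol {A : Op N} (hA : IsSelfAdjoint A) {q : ℂ} (hq : 0 < q.re) :
    A * resol A q = resol A q * A := by
  have hc := continuous_prop_right A
  have h1 := clm_lap (ContinuousLinearMap.mul ℂ (Op N) A) hc (norm_prop_le hA) hq
  have h2 := clm_lap ((ContinuousLinearMap.mul ℂ (Op N)).flip A) hc (norm_prop_le hA) hq
  simp only [ContinuousLinearMap.mul_apply', ContinuousLinearMap.flip_apply] at h1 h2
  unfold resol
  rw [h1, h2]
  simp only [commute_prop A]

lemma resol_mul_sub {A : Op N} (hA : IsSelfAdjoint A) {q : ℂ} (hq : 0 < q.re) :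
    resol A q * (q • (1 : Op N) - Complex.I • A) = 1 := by
  conv_rhs => rw [← sub_mul_resol hA hq]
  rw [mul_sub, sub_mul]
  simp only [smul_mul_assoc, mul_smul_comm, one_mul, mul_one, commute_resol hA hq]

lemma re_inner_resol {A : Op N} (hA : IsSelfAdjoint A) {q : ℂ} (hq : 0 < q.re)
    (x : EuclideanSpace ℂ (Fin N)) :
    (inner ℂ x (resol A q x) : ℂ).re = q.re * ‖resol A q x‖ ^ 2 := by
  have h : x = q • resol A q x - Complex.I • A (resol A q x) := by
    have := congrArg (fun T : Op N => T x) (sub_mul_resol hA hq)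
    simpa using this.symm
  set v := resol A q x
  have hv : (inner ℂ v v : ℂ) = ((‖v‖ ^ 2 : ℝ) : ℂ) := by
    rw [inner_self_eq_norm_sq_to_K]; norm_cast
  have hr : (inner ℂ (A v) v : ℂ).im = 0 := by
    have h1 : (inner ℂ (A v) v : ℂ) = inner ℂ v (A v) := by
      conv_lhs => rw [← hA.star_eq]
      rw [ContinuousLinearMap.star_eq_adjoint, ContinuousLinearMap.adjoint_inner_left]
    have h2 : star (inner ℂ (A v) v : ℂ) = inner ℂ (A v) v := by
      rw [← starRingEnd_apply, inner_conj_symm, ← h1]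
    have := congrArg Complex.im h2
    rw [Complex.star_def, Complex.conj_im] at this
    linarith
  rw [h, inner_sub_left, inner_smul_left, inner_smul_left, hv]
  simp only [Complex.sub_re, Complex.mul_re, Complex.conj_re, Complex.conj_im, Complex.ofReal_re,
    Complex.ofReal_im, Complex.I_re, Complex.I_im, hr]
  ring

variable {𝓧 : Type*} [MeasurableSpace 𝓧] {ν : Idx N → Measure 𝓧}
  {ξ : 𝓧 → ℂ} {r μ : ℝ} {H₀ : Op N}

/-- The averaged resolvent. -/
def meanResol (ν : Idx N → Measure 𝓧) (H₀ : Op N) (lam : ℝ) (ξ : 𝓧 → ℂ) (p : ℂ) : Op N :=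
  lap (meanProp ν H₀ lam ξ) p

variable [∀ k, IsProbabilityMeasure (ν k)]

lemma norm_meanResol_le (hH : IsSelfAdjoint H₀) (lam : ℝ) {p : ℂ} (hp : 0 < p.re) :
    ‖meanResol ν H₀ lam ξ p‖ ≤ 1 / p.re := norm_lap_le (norm_meanProp_le lam hH) hp

lemma inner_meanResol (hW : IsNearWigner ν ξ r μ) (hH : IsSelfAdjoint H₀) (lam : ℝ) {p : ℂ}
    (hp : 0 < p.re) (x y : EuclideanSpace ℂ (Fin N)) :
    inner ℂ x (meanResol ν H₀ lam ξ p y) = lap (fun t => inner ℂ x (meanProp ν H₀ lam ξ t y)) p :=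
  clm_lap (matEl x y) (continuous_meanProp lam hH hW.measurable hW.bound)
    (norm_meanProp_le lam hH) hp

/-- The averaged resolvent has nonnegative real part, by Fubini's theorem. -/
lemma re_inner_meanResol_nonneg (hW : IsNearWigner ν ξ r μ) (hH : IsSelfAdjoint H₀) (lam : ℝ) {p : ℂ}
    (hp : 0 < p.re) (x : EuclideanSpace ℂ (Fin N)) :
    0 ≤ (inner ℂ x (meanResol ν H₀ lam ξ p x) : ℂ).re := by
  have hA := fun z => isSelfAdjoint_ham hH lam ξ (N := N) z
  have hm : Measurable fun q : ℝ × (Idx N → 𝓧) => Complex.exp (-p * q.1) •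
      (inner ℂ x (prop (ham H₀ lam ξ q.2) q.1 x) : ℂ) := by
    have h1 : Measurable fun q : ℝ × (Idx N → 𝓧) => prop (ham H₀ lam ξ q.2) q.1 :=
      measurable_prop ((measurable_ham hW.measurable H₀ lam).comp measurable_snd) measurable_fst
    have h2 : Measurable fun q : ℝ × (Idx N → 𝓧) => matEl x x (prop (ham H₀ lam ξ q.2) q.1) :=
      (matEl x x).continuous.measurable.comp h1
    have h3 : Measurable fun q : ℝ × (Idx N → 𝓧) => Complex.exp (-p * q.1) := by fun_prop
    exact h3.smul h2
  have hi : Integrable (fun q : ℝ × (Idx N → 𝓧) => Complex.exp (-p * q.1) •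
      (inner ℂ x (prop (ham H₀ lam ξ q.2) q.1 x) : ℂ))
      ((volume.restrict (Set.Ioi 0)).prod (Measure.pi ν)) := by
    have h0 := (integrableOn_exp_mul_Ioi (a := -p.re) (by linarith) 0).mul_const (‖x‖ * ‖x‖)
    have h1 := Integrable.comp_fst (μ := volume.restrict (Set.Ioi (0 : ℝ))) h0 (Measure.pi ν)
    refine h1.mono' hm.aestronglyMeasurable (Eventually.of_forall fun q => ?_)
    rw [norm_smul, norm_exp_neg_mul]
    gcongr
    exact norm_inner_prop_le (hA _) _ _ _
  have e : inner ℂ x (meanResol ν H₀ lam ξ p x) =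
      ∫ z, inner ℂ x (resol (ham H₀ lam ξ z) p x) ∂(Measure.pi ν) := by
    rw [inner_meanResol hW hH lam hp, lap]
    have e1 : ∀ t, inner ℂ x (meanProp ν H₀ lam ξ t x) =
        ∫ z, (inner ℂ x (prop (ham H₀ lam ξ z) t x) : ℂ) ∂(Measure.pi ν) := fun t =>
      matEl_meanProp lam hH hW.measurable t (matEl x x)
    have e2 : ∀ z, (inner ℂ x (resol (ham H₀ lam ξ z) p x) : ℂ) =
        ∫ t in Set.Ioi (0 : ℝ), Complex.exp (-p * t) • (inner ℂ x (prop (ham H₀ lam ξ z) t x) : ℂ) :=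
      fun z => clm_lap (matEl x x) (continuous_prop_right _) (norm_prop_le (hA z)) hp
    simp_rw [e1, e2, ← integral_smul]
    exact integral_integral_swap hi
  have hmr : Integrable (fun z => (inner ℂ x (resol (ham H₀ lam ξ z) p x) : ℂ)) (Measure.pi ν) := by
    have e2 : ∀ z, (inner ℂ x (resol (ham H₀ lam ξ z) p x) : ℂ) =
        ∫ t in Set.Ioi (0 : ℝ), Complex.exp (-p * t) • (inner ℂ x (prop (ham H₀ lam ξ z) t x) : ℂ) :=
      fun z => clm_lap (matEl x x) (continuous_prop_right _) (norm_prop_le (hA z)) hp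
    simp_rw [e2]
    exact hi.integral_prod_right
  rw [e, ← Complex.reCLM_apply, ← Complex.reCLM.integral_comp_comm hmr]
  refine integral_nonneg fun z => ?_
  rw [Complex.reCLM_apply, re_inner_resol (hA z) hp]
  positivity

/-- The normalized trace of the averaged resolvent. -/
def meanStieltjes (ν : Idx N → Measure 𝓧) (H₀ : Op N) (lam : ℝ) (ξ : 𝓧 → ℂ) (p : ℂ) : ℂ :=
  ntr N (meanResol ν H₀ lam ξ p)

lemma re_ntr_nonneg {M : Op N} (h : ∀ x, 0 ≤ (inner ℂ x (M x) : ℂ).re) : 0 ≤ (ntr N M).re := by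
  rw [ntr_apply, ← Complex.ofReal_natCast, ← Complex.ofReal_inv, Complex.re_ofReal_mul,
    Complex.re_sum]
  refine mul_nonneg (by positivity) (Finset.sum_nonneg fun i _ => ?_)
  exact h (stdVec i)

lemma norm_ntr_le_norm (M : Op N) : ‖ntr N M‖ ≤ ‖M‖ := by
  rcases eq_or_ne M 0 with rfl | h
  · simp
  have h0 : 0 < ‖M‖ := norm_pos_iff.2 h
  have h1 := norm_ntr_le (M := ((‖M‖⁻¹ : ℝ) : ℂ) • M) (by
    rw [norm_smul, Complex.norm_real, norm_inv, norm_norm, inv_mul_cancel₀ h0.ne'])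
  rw [map_smul, norm_smul, Complex.norm_real, norm_inv, norm_norm,
    inv_mul_le_iff₀ h0, mul_one] at h1
  exact h1

lemma re_meanStieltjes_nonneg (hW : IsNearWigner ν ξ r μ) (hH : IsSelfAdjoint H₀) (lam : ℝ) {p : ℂ}
    (hp : 0 < p.re) : 0 ≤ (meanStieltjes ν H₀ lam ξ p).re :=
  re_ntr_nonneg fun x => re_inner_meanResol_nonneg hW hH lam hp x

lemma norm_meanStieltjes_le (hH : IsSelfAdjoint H₀) (lam : ℝ) {p : ℂ} (hp : 0 < p.re) :
    ‖meanStieltjes ν H₀ lam ξ p‖ ≤ 1 / p.re :=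
  (norm_ntr_le_norm _).trans (norm_meanResol_le hH lam hp)

lemma meanStieltjes_eq_lap (hW : IsNearWigner ν ξ r μ) (hH : IsSelfAdjoint H₀) (lam : ℝ) {p : ℂ}
    (hp : 0 < p.re) : meanStieltjes ν H₀ lam ξ p = lap (meanTrace ν H₀ lam ξ) p :=
  clm_lap (ntr N) (continuous_meanProp lam hH hW.measurable hW.bound) (norm_meanProp_le lam hH) hp

lemma continuousOn_meanStieltjes (hW : IsNearWigner ν ξ r μ) (hH : IsSelfAdjoint H₀) (lam : ℝ) :
    ContinuousOn (meanStieltjes ν H₀ lam ξ) {p | 0 < p.re} :=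
  (ntr N).continuous.comp_continuousOn (continuousOn_lap
    (continuous_meanProp lam hH hW.measurable hW.bound) (norm_meanProp_le lam hH))

/-- The constant `∫₀^∞ e^{-η t} (1 + |λ| t)³ dt`. -/
def cubicMoment (lam η : ℝ) : ℝ := ∫ t in Set.Ioi (0 : ℝ), Real.exp (-η * t) * (1 + |lam| * t) ^ 3

lemma integrableOn_cubicMoment (lam : ℝ) {η : ℝ} (hη : 0 < η) :
    IntegrableOn (fun t => Real.exp (-η * t) * (1 + |lam| * t) ^ 3) (Set.Ioi 0) := by
  set c := η / 2 with hc
  have hc0 : 0 < c := by positivity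
  have h0 := (integrableOn_exp_mul_Ioi (a := -c) (by linarith) 0).mul_const
    ((1 + |lam|) ^ 3 * (6 / c ^ 3 * Real.exp c))
  refine Integrable.mono' h0 (by fun_prop)
    ((ae_restrict_iff' measurableSet_Ioi).2 (Eventually.of_forall fun t ht => ?_))
  have ht' : (0 : ℝ) < t := ht
  rw [Real.norm_of_nonneg (by positivity)]
  have h1 : (c * (1 + t)) ^ 3 / 6 ≤ Real.exp (c * (1 + t)) := by
    have := Real.pow_div_factorial_le_exp (x := c * (1 + t)) (by positivity) 3
    simpa [Nat.factorial] using this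
  have h2 : 1 + |lam| * t ≤ (1 + |lam|) * (1 + t) := by nlinarith [abs_nonneg lam]
  have h3 : (1 + t) ^ 3 ≤ 6 / c ^ 3 * Real.exp (c * (1 + t)) := by
    rw [div_mul_eq_mul_div, le_div_iff₀ (by positivity)]
    rw [mul_pow] at h1
    linarith
  have h4 : Real.exp (-η * t) * Real.exp (c * (1 + t)) = Real.exp (-c * t) * Real.exp c := by
    rw [← Real.exp_add, ← Real.exp_add]; congr 1; rw [hc]; ring
  calc Real.exp (-η * t) * (1 + |lam| * t) ^ 3
      ≤ Real.exp (-η * t) * ((1 + |lam|) * (1 + t)) ^ 3 := by gcongr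
    _ = Real.exp (-η * t) * ((1 + |lam|) ^ 3 * (1 + t) ^ 3) := by rw [mul_pow]
    _ ≤ Real.exp (-η * t) * ((1 + |lam|) ^ 3 * (6 / c ^ 3 * Real.exp (c * (1 + t)))) := by gcongr
    _ = (Real.exp (-η * t) * Real.exp (c * (1 + t))) * ((1 + |lam|) ^ 3 * (6 / c ^ 3)) := by ring
    _ = _ := by rw [h4]; ring

lemma cubicMoment_nonneg (lam η : ℝ) : 0 ≤ cubicMoment lam η :=
  setIntegral_nonneg measurableSet_Ioi fun t ht => by
    have ht' : (0 : ℝ) < t := ht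
    positivity

lemma cubicMoment_anti (lam : ℝ) {η η' : ℝ} (hη : 0 < η) (h : η ≤ η') :
    cubicMoment lam η' ≤ cubicMoment lam η :=
  setIntegral_mono_on (integrableOn_cubicMoment lam (hη.trans_le h))
    (integrableOn_cubicMoment lam hη) measurableSet_Ioi fun t ht => by
      have ht' : (0 : ℝ) < t := ht
      gcongr

/-- The averaged resolvent is an approximate solution of the self-consistent equation. -/
lemma norm_sub_mul_meanResol_le (hW : IsNearWigner ν ξ r μ) (hH : IsSelfAdjoint H₀) (lam : ℝ)
    {κ : ℝ} (hκ : ∀ q, 0 ≤ q → cumErr N r μ q ≤ κ * (1 + q) ^ 3) {p : ℂ} (hp : 0 < p.re) :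
    ‖((p + lam ^ 2 * meanStieltjes ν H₀ lam ξ p) • (1 : Op N) - Complex.I • H₀) *
      meanResol ν H₀ lam ξ p - 1‖ ≤ |lam| * (κ * cubicMoment lam p.re) := by
  have hr := hW.bound
  have hξ := hW.measurable
  have hκ0 : 0 ≤ κ := by
    have := hκ 0 le_rfl
    have h1 := cumErr_nonneg (N := N) hW.r_nonneg hW.μ_nonneg (q := 0) le_rfl
    linarith
  have hm0 := cubicMoment_nonneg lam p.re
  have hUc := continuous_meanProp (ν := ν) (lam := lam) hH hξ hr
  have hUb := norm_meanProp_le (ν := ν) (ξ := ξ) lam hH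
  have hMc := continuous_meanNoise (ν := ν) (lam := lam) hH hξ hr
  have hMb : ∀ t, ‖meanNoise ν H₀ lam ξ t‖ ≤ Fintype.card (Idx N) * (2 * r) := fun t =>
    norm_integral_le_of_bdd fun z => norm_noise_mul_prop_le lam hH hr t z
  set L := meanResol ν H₀ lam ξ p with hL
  set w := meanStieltjes ν H₀ lam ξ p with hw
  have hHU : ∀ t, ‖H₀ * meanProp ν H₀ lam ξ t‖ ≤ ‖H₀‖ * 1 := fun t =>
    (norm_mul_le _ _).trans (by gcongr; exact hUb t)
  have hlM : ∀ t, ‖(lam : ℂ) • meanNoise ν H₀ lam ξ t‖ ≤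
      |lam| * (Fintype.card (Idx N) * (2 * r)) := fun t => by
    rw [norm_smul, Complex.norm_real, Real.norm_eq_abs]; gcongr; exact hMb t
  have h1 := smul_lap (hasDerivAt_meanProp (ν := ν) lam hH hξ hr) (by fun_prop) hUb
    (C := ‖H₀‖ * 1 + |lam| * (Fintype.card (Idx N) * (2 * r)))
    (fun t => by
      rw [norm_smul, Complex.norm_I, one_mul]
      exact (norm_add_le _ _).trans (add_le_add (hHU t) (hlM t))) hp
  rw [meanProp_zero, lap_const_smul, lap_add (by fun_prop) (by fun_prop) hHU hlM hp,
    lap_const_smul] at h1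
  have h2 := clm_lap (ContinuousLinearMap.mul ℂ (Op N) H₀) hUc hUb hp
  simp only [ContinuousLinearMap.mul_apply'] at h2
  rw [← h2] at h1
  have e : ((p + lam ^ 2 * w) • (1 : Op N) - Complex.I • H₀) * L - 1 =
      Complex.I • (lam : ℂ) • lap (meanNoise ν H₀ lam ξ) p + ((lam : ℂ) ^ 2 * w) • L := by
    have h4 : (p + lam ^ 2 * w) • L = p • L + ((lam : ℂ) ^ 2 * w) • L :=
      add_smul p ((lam : ℂ) ^ 2 * w) L
    have h3 : p • L = 1 + Complex.I • (H₀ * L + (lam : ℂ) • lap (meanNoise ν H₀ lam ξ) p) := h1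
    rw [sub_mul, smul_mul_assoc, one_mul, h4, smul_mul_assoc, h3, smul_add]
    abel
  rw [e]
  -- a matrix element of the remainder is the Laplace transform of the cumulant error
  have key : ∀ x y : EuclideanSpace ℂ (Fin N), ‖x‖ ≤ 1 → ‖y‖ ≤ 1 →
      ‖(inner ℂ x ((Complex.I • (lam : ℂ) • lap (meanNoise ν H₀ lam ξ) p
        + ((lam : ℂ) ^ 2 * w) • L) y) : ℂ)‖ ≤ |lam| * (κ * cubicMoment lam p.re) := by
    intro x y hx hy
    set c : ℝ → ℂ := fun s => inner ℂ x (meanProp ν H₀ lam ξ s y) with hc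
    set u := meanTrace ν H₀ lam ξ with hu
    have huc : Continuous u := continuous_meanTrace lam hH hξ hr
    have hub : ∀ t, ‖u t‖ ≤ 1 := norm_meanTrace_le lam hH
    have hcc : Continuous c := (matEl x y).continuous.comp hUc
    have hcb : ∀ t, ‖c t‖ ≤ 1 := fun t => (norm_inner_le_norm _ _).trans
      (mul_le_one₀ hx (norm_nonneg _) (((meanProp ν H₀ lam ξ t).le_opNorm y).trans
        (mul_le_one₀ (hUb t) (norm_nonneg _) hy)))
    set n : ℝ → ℂ := fun t => inner ℂ x (meanNoise ν H₀ lam ξ t y) with hn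
    set J : ℝ → ℂ := fun t => ∫ s in (0 : ℝ)..t, u s * c (t - s) with hJ
    have a1 : inner ℂ x (lap (meanNoise ν H₀ lam ξ) p y) = lap n p :=
      clm_lap (matEl x y) hMc hMb hp
    have a2 : inner ℂ x (L y) = lap c p := inner_meanResol hW hH lam hp x y
    have a3 : lap J p = w * lap c p := by
      rw [hw, meanStieltjes_eq_lap hW hH lam hp]
      exact lap_convolution huc hcc hub hcb hp
    have i1 : IntegrableOn (fun t : ℝ => Complex.exp (-p * t) • n t) (Set.Ioi 0) :=
      integrableOn_lap ((matEl x y).continuous.comp hMc)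
        (B := ‖matEl x y‖ * (Fintype.card (Idx N) * (2 * r)))
        (fun t => ((matEl x y).le_opNorm _).trans (by gcongr; exact hMb t)) hp
    have i2 : IntegrableOn (fun t : ℝ => Complex.exp (-p * t) • J t) (Set.Ioi 0) := by
      have := (integrable_posConvolution (integrableOn_lap huc hub hp) (integrableOn_lap hcc hcb hp)
        (ContinuousLinearMap.mul ℝ ℂ)).integrableOn (s := Set.Ioi 0)
      refine this.congr_fun (fun t ht => ?_) measurableSet_Ioi
      rw [posConvolution, Set.indicator_of_mem ht]
      simp only [ContinuousLinearMap.mul_apply', smul_eq_mul, hJ]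
      rw [← intervalIntegral.integral_const_mul]
      refine intervalIntegral.integral_congr fun s _ => ?_
      rw [mul_mul_mul_comm, ← Complex.exp_add]
      push_cast
      ring_nf
    have i3 : IntegrableOn (fun t : ℝ => (Complex.I * lam) • Complex.exp (-p * t) • J t)
      (Set.Ioi 0) := Integrable.smul (Complex.I * (lam : ℂ)) i2
    have e2 : (inner ℂ x ((Complex.I • (lam : ℂ) • lap (meanNoise ν H₀ lam ξ) p
        + ((lam : ℂ) ^ 2 * w) • L) y) : ℂ) =
        Complex.I * lam * lap (fun t => n t - Complex.I * lam * J t) p := by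
      have b : lap (fun t => n t - Complex.I * lam * J t) p =
          lap n p - Complex.I * lam * lap J p := by
        unfold lap
        rw [← smul_eq_mul (Complex.I * (lam : ℂ)) (∫ t in Set.Ioi (0 : ℝ), _), ← integral_smul,
          ← integral_sub i1 i3]
        refine integral_congr_ae (Eventually.of_forall fun t => ?_)
        simp only [smul_eq_mul]; ring
      rw [_root_.add_apply, _root_.smul_apply, _root_.smul_apply, _root_.smul_apply,
        inner_add_right, inner_smul_right, inner_smul_right, inner_smul_right, a1, a2, b, a3]
      linear_combination ((lam : ℂ) ^ 2 * w * lap c p) * Complex.I_sq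
    rw [e2, norm_mul, norm_mul, Complex.norm_I, one_mul, Complex.norm_real, Real.norm_eq_abs]
    gcongr
    have hG := (integrableOn_cubicMoment lam hp).const_mul κ
    have e3 : ∀ t : ℝ, κ * (Real.exp (-p.re * t) * (1 + |lam| * t) ^ 3) =
      Real.exp (-p.re * t) * (κ * (1 + |lam| * t) ^ 3) := fun t => by ring
    simp only [e3] at hG
    refine (norm_lap_le_of_le (fun t ht => ?_) hG).trans_eq ?_
    · exact (norm_meanNoise_sub_le hW hH lam ht.le hx hy).trans (hκ _ (by positivity))
    · rw [cubicMoment, ← integral_const_mul]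
      simp only [e3]
  set T := Complex.I • (lam : ℂ) • lap (meanNoise ν H₀ lam ξ) p + ((lam : ℂ) ^ 2 * w) • L
  have hb0 : 0 ≤ |lam| * (κ * cubicMoment lam p.re) := by positivity
  refine ContinuousLinearMap.opNorm_le_of_unit_norm hb0 fun y hy => ?_
  rcases eq_or_ne (T y) 0 with h0 | h0
  · rw [h0, norm_zero]; exact hb0
  have hpos : 0 < ‖T y‖ := norm_pos_iff.2 h0
  have h3 := key (((‖T y‖⁻¹ : ℝ) : ℂ) • T y) y (by
    rw [norm_smul, Complex.norm_real, norm_inv, norm_norm, inv_mul_cancel₀ hpos.ne']) hy.le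
  rw [inner_smul_left, Complex.conj_ofReal, norm_mul, Complex.norm_real, norm_inv, norm_norm,
    inner_self_eq_norm_sq_to_K] at h3
  have h4 : ‖((‖T y‖ : ℂ)) ^ 2‖ = ‖T y‖ ^ 2 := by
    rw [norm_pow, Complex.norm_real, norm_norm]
  erw [h4] at h3
  calc ‖T y‖ = ‖T y‖⁻¹ * ‖T y‖ ^ 2 := by field_simp
    _ ≤ _ := h3

/-- The averaged resolvent is the free resolvent at the shifted spectral parameter. -/
lemma norm_meanResol_sub_resol_le (hW : IsNearWigner ν ξ r μ) (hH : IsSelfAdjoint H₀) (lam : ℝ)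
    {κ : ℝ} (hκ : ∀ q, 0 ≤ q → cumErr N r μ q ≤ κ * (1 + q) ^ 3) {p : ℂ} (hp : 0 < p.re) :
    ‖meanResol ν H₀ lam ξ p - resol H₀ (p + lam ^ 2 * meanStieltjes ν H₀ lam ξ p)‖ ≤
      |lam| * (κ * cubicMoment lam p.re) / p.re := by
  have h := norm_sub_mul_meanResol_le hW hH lam hκ hp
  have hw := re_meanStieltjes_nonneg hW hH lam hp
  set w := meanStieltjes ν H₀ lam ξ p
  set q := p + lam ^ 2 * w with hq
  have hre : p.re ≤ q.re := by
    have : q.re = p.re + lam ^ 2 * w.re := by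
      rw [hq, Complex.add_re, ← Complex.ofReal_pow, Complex.re_ofReal_mul]
    rw [this]
    have : 0 ≤ lam ^ 2 * w.re := by positivity
    linarith
  have hq0 : 0 < q.re := hp.trans_le hre
  set L := meanResol ν H₀ lam ξ p
  have e : L - resol H₀ q = resol H₀ q * ((q • (1 : Op N) - Complex.I • H₀) * L - 1) := by
    rw [mul_sub, ← mul_assoc, resol_mul_sub hH hq0, one_mul, mul_one]
  rw [e]
  refine (norm_mul_le _ _).trans ?_
  rw [div_eq_inv_mul]
  have h2 := norm_resol_le hH hq0
  have h3 : 1 / q.re ≤ (p.re)⁻¹ := by rw [one_div]; gcongr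
  exact mul_le_mul (h2.trans h3) h (norm_nonneg _) (by positivity)

end Resolvent

/-! ### The limiting Stieltjes transform near the energy shell -/

section Stieltjes

/-- The limiting resolvent trace `∫ ρ y / (q - i y) dy`, on the right half plane. -/
def freeSt (ρ : ℝ → ℝ) (q : ℂ) : ℂ := ∫ y : ℝ, (ρ y : ℂ) / (q - Complex.I * y)

/-- The regularity of a density near `E₀`: on `[E₀ - κ, E₀ + κ]` it is at least `c`, and it has
a derivative `ρ'`, both bounded by `M`, with `ρ'` Lipschitz with constant `M`. -/
structure IsRegularNear (ρ ρ' : ℝ → ℝ) (E₀ κ c M : ℝ) : Prop where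
  density : IsDensity ρ
  pos_κ : 0 < κ
  pos_c : 0 < c
  lower : ∀ y, |y - E₀| ≤ κ → c ≤ ρ y
  bound : ∀ y, |y - E₀| ≤ κ → |ρ y| ≤ M
  deriv : ∀ y, |y - E₀| < κ → HasDerivAt ρ (ρ' y) y
  deriv_bound : ∀ y, |y - E₀| ≤ κ → |ρ' y| ≤ M
  lipschitz : ∀ y z, |y - E₀| ≤ κ → |z - E₀| ≤ κ → |ρ' y - ρ' z| ≤ M * |y - z|

lemma abs_sub_le_norm_sub (q : ℂ) (y : ℝ) : |y - q.im| ≤ ‖q - Complex.I * y‖ := by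
  have := Complex.abs_im_le_norm (q - Complex.I * y)
  simp at this
  rwa [abs_sub_comm] at this

lemma re_le_norm_sub (q : ℂ) (y : ℝ) : q.re ≤ ‖q - Complex.I * y‖ := by
  have := Complex.re_le_norm (q - Complex.I * y)
  simpa using this

lemma sub_ne_zero_of_re_pos {q : ℂ} (hq : 0 < q.re) (y : ℝ) : q - Complex.I * y ≠ 0 :=
  norm_pos_iff.1 (hq.trans_le (re_le_norm_sub q y))

lemma hasDerivAt_arctan_div {e : ℝ} (he : 0 < e) (x y : ℝ) :
    HasDerivAt (fun y => Real.arctan ((y - x) / e)) (e / (e ^ 2 + (y - x) ^ 2)) y := by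
  have h := (((hasDerivAt_id y).sub_const x).div_const e).arctan
  refine h.congr_deriv ?_
  simp only [id]
  field_simp

lemma hasDerivAt_log_div {e : ℝ} (he : 0 < e) (x y : ℝ) :
    HasDerivAt (fun y => Real.log (e ^ 2 + (y - x) ^ 2) / 2)
      ((y - x) / (e ^ 2 + (y - x) ^ 2)) y := by
  have h0 : e ^ 2 + (y - x) ^ 2 ≠ 0 := by positivity
  have h := (((((hasDerivAt_id y).sub_const x).pow 2).const_add (e ^ 2)).log (by simpa using h0)).div_const 2
  refine h.congr_deriv ?_
  simp
  field_simp

lemma inv_sub_I_mul {q : ℂ} (hq : 0 < q.re) (y : ℝ) : (q - Complex.I * y)⁻¹ =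
    ((q.re / (q.re ^ 2 + (y - q.im) ^ 2) : ℝ) : ℂ) +
      ((y - q.im) / (q.re ^ 2 + (y - q.im) ^ 2) : ℝ) * Complex.I := by
  have h0 : q.re ^ 2 + (y - q.im) ^ 2 ≠ 0 := by positivity
  have h1 : ((q.re ^ 2 + (y - q.im) ^ 2 : ℝ) : ℂ) ≠ 0 := by exact_mod_cast h0
  refine inv_eq_of_mul_eq_one_right ?_
  have e : q = q.re + q.im * Complex.I := (Complex.re_add_im q).symm
  have h2 : (q - Complex.I * y) * ((q.re : ℂ) + ((y - q.im : ℝ) : ℂ) * Complex.I) =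
      ((q.re ^ 2 + (y - q.im) ^ 2 : ℝ) : ℂ) := by
    conv_lhs => rw [e]
    simp only [Complex.add_re, Complex.ofReal_re, Complex.mul_re, Complex.ofReal_im, Complex.I_re,
      Complex.I_im, Complex.add_im, Complex.mul_im, mul_zero, mul_one, add_zero, sub_zero,
      zero_add]
    push_cast
    linear_combination (-((y : ℂ) - q.im) ^ 2) * Complex.I_sq
  rw [Complex.ofReal_div, Complex.ofReal_div, div_mul_eq_mul_div, ← add_div, mul_div_assoc', h2,
    div_self h1]

lemma continuous_inv_sub {q : ℂ} (hq : 0 < q.re) :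
    Continuous fun y : ℝ => (q - Complex.I * y)⁻¹ :=
  Continuous.inv₀ (by fun_prop) fun y => sub_ne_zero_of_re_pos hq y

lemma integral_inv_sub {q : ℂ} (hq : 0 < q.re) (b : ℝ) :
    ∫ y in (q.im - b)..(q.im + b), (q - Complex.I * y)⁻¹ = (2 * Real.arctan (b / q.re) : ℝ) := by
  have h : ∀ y : ℝ, HasDerivAt (fun y : ℝ => ((Real.arctan ((y - q.im) / q.re) : ℝ) : ℂ) +
      ((Real.log (q.re ^ 2 + (y - q.im) ^ 2) / 2 : ℝ) : ℂ) * Complex.I)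
      ((q - Complex.I * y)⁻¹) y := by
    intro y
    rw [inv_sub_I_mul hq]
    exact (hasDerivAt_arctan_div hq _ y).ofReal_comp.add
      ((hasDerivAt_log_div hq _ y).ofReal_comp.mul_const _)
  rw [intervalIntegral.integral_eq_sub_of_hasDerivAt (fun y _ => h y)
    ((continuous_inv_sub hq).intervalIntegrable _ _)]
  have e1 : q.im + b - q.im = b := by ring
  have e2 : q.im - b - q.im = -b := by ring
  rw [e1, e2, neg_div, Real.arctan_neg, neg_sq]
  push_cast
  ring

/-- A truncated Cauchy integral of a Lipschitz function is bounded up to the boundary. -/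
lemma norm_integral_div_sub_le {q : ℂ} (hq : 0 < q.re) {b M : ℝ} (hb : 0 ≤ b) {g : ℝ → ℝ}
    (hg : ∀ y, |y - q.im| ≤ b → |g y| ≤ M)
    (hL : ∀ y z, |y - q.im| ≤ b → |z - q.im| ≤ b → |g y - g z| ≤ M * |y - z|) :
    IntervalIntegrable (fun y : ℝ => (g y : ℂ) / (q - Complex.I * y)) volume (q.im - b) (q.im + b) ∧
    ‖∫ y in (q.im - b)..(q.im + b), (g y : ℂ) / (q - Complex.I * y)‖ ≤ Real.pi * M + 2 * b * M := by
  have hM : 0 ≤ M := (abs_nonneg _).trans (hg q.im (by simpa using hb))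
  have hI : ∀ y, y ∈ Set.uIcc (q.im - b) (q.im + b) → |y - q.im| ≤ b := by
    intro y hy
    rw [Set.uIcc_of_le (by linarith)] at hy
    rw [abs_le]; constructor <;> linarith [hy.1, hy.2]
  have hgc : ContinuousOn g (Set.uIcc (q.im - b) (q.im + b)) := by
    have : LipschitzOnWith (Real.toNNReal M) g (Set.uIcc (q.im - b) (q.im + b)) :=
      LipschitzOnWith.of_dist_le_mul fun y hy z hz => by
        rw [Real.dist_eq, Real.dist_eq, Real.coe_toNNReal _ hM]
        exact hL y z (hI y hy) (hI z hz)
    exact this.continuousOn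
  have hic := continuous_inv_sub hq
  have hgc' : ContinuousOn (fun y : ℝ => (g y : ℂ)) (Set.uIcc (q.im - b) (q.im + b)) :=
    Complex.continuous_ofReal.comp_continuousOn hgc
  have i1 : IntervalIntegrable (fun y : ℝ => (g y : ℂ) / (q - Complex.I * y)) volume
      (q.im - b) (q.im + b) := by
    simp only [div_eq_mul_inv]
    exact (hgc'.mul hic.continuousOn).intervalIntegrable
  refine ⟨i1, ?_⟩
  have i2 : IntervalIntegrable (fun y : ℝ => (g q.im : ℂ) * (q - Complex.I * y)⁻¹) volume
      (q.im - b) (q.im + b) := (hic.const_mul _).intervalIntegrable _ _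
  have e : ∫ y in (q.im - b)..(q.im + b), (g y : ℂ) / (q - Complex.I * y) =
      (∫ y in (q.im - b)..(q.im + b), ((g y : ℂ) / (q - Complex.I * y) -
        (g q.im : ℂ) * (q - Complex.I * y)⁻¹)) +
      ∫ y in (q.im - b)..(q.im + b), (g q.im : ℂ) * (q - Complex.I * y)⁻¹ := by
    rw [intervalIntegral.integral_sub i1 i2]; ring
  have h0 : |q.im - q.im| ≤ b := by simpa using hb
  rw [e]
  refine (norm_add_le _ _).trans ?_
  rw [add_comm]
  gcongr
  · rw [intervalIntegral.integral_const_mul, integral_inv_sub hq, norm_mul, Complex.norm_real,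
      Complex.norm_real, Real.norm_eq_abs, Real.norm_eq_abs, mul_comm]
    have h1 := Real.arctan_lt_pi_div_two (b / q.re)
    have h2 : 0 ≤ Real.arctan (b / q.re) := Real.arctan_nonneg.2 (by positivity)
    have h3 : |2 * Real.arctan (b / q.re)| ≤ Real.pi := by
      rw [abs_of_nonneg (by linarith)]; linarith
    exact mul_le_mul h3 (hg _ h0) (abs_nonneg _) Real.pi_pos.le
  · refine (intervalIntegral.norm_integral_le_of_norm_le_const (C := M) fun y hy => ?_).trans ?_
    · have hy' := hI y (Set.uIoc_subset_uIcc hy)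
      have hn := abs_sub_le_norm_sub q y
      have hpos : 0 < ‖q - Complex.I * y‖ := hq.trans_le (re_le_norm_sub q y)
      rw [div_eq_mul_inv, ← sub_mul, norm_mul, norm_inv, ← Complex.ofReal_sub, Complex.norm_real,
        Real.norm_eq_abs, ← div_eq_mul_inv, div_le_iff₀ hpos]
      exact (hL y _ hy' h0).trans (by gcongr)
    · rw [show q.im + b - (q.im - b) = 2 * b by ring, abs_of_nonneg (by positivity)]
      linarith

variable {ρ ρ' : ℝ → ℝ} {E₀ κ c M : ℝ}

lemma IsDensity.integrable (h : IsDensity ρ) : Integrable ρ := by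
  by_contra hn
  have := integral_undef hn
  rw [h.total] at this
  norm_num at this

lemma integrable_div_sub_pow (h : IsDensity ρ) {q : ℂ} (hq : 0 < q.re) (n : ℕ) :
    Integrable fun y : ℝ => (ρ y : ℂ) / (q - Complex.I * y) ^ n := by
  have hm := h.measurable
  refine (h.integrable.mul_const ((q.re ^ n)⁻¹)).mono'
    (Measurable.div (by fun_prop) (by fun_prop)).aestronglyMeasurable
    (Eventually.of_forall fun y => ?_)
  rw [norm_div, norm_pow, Complex.norm_real, Real.norm_of_nonneg (h.nonneg y), div_eq_mul_inv]
  have := h.nonneg y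
  gcongr
  exact re_le_norm_sub q y

lemma hasDerivAt_freeSt (h : IsDensity ρ) {q : ℂ} (hq : 0 < q.re) :
    HasDerivAt (freeSt ρ) (-∫ y : ℝ, (ρ y : ℂ) / (q - Complex.I * y) ^ 2) q := by
  have hm := h.measurable
  rw [← integral_neg]
  refine (hasDerivAt_integral_of_dominated_loc_of_deriv_le
    (F := fun (q : ℂ) (y : ℝ) => (ρ y : ℂ) / (q - Complex.I * y))
    (s := {w : ℂ | q.re / 2 < w.re}) (F' := fun (q : ℂ) (y : ℝ) => -((ρ y : ℂ) / (q - Complex.I * y) ^ 2))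
    (bound := fun y => ρ y * ((q.re / 2) ^ 2)⁻¹) ?_
    (Eventually.of_forall fun w =>
      (Measurable.div (by fun_prop) (by fun_prop)).aestronglyMeasurable) ?_ ?_ ?_
    (h.integrable.mul_const _) ?_).2
  · exact (isOpen_lt continuous_const Complex.continuous_re).mem_nhds (by simp; linarith)
  · simpa using integrable_div_sub_pow h hq 1
  · exact (Measurable.div (by fun_prop) (by fun_prop)).neg.aestronglyMeasurable
  · refine Eventually.of_forall fun y w hw => ?_
    have hw' : q.re / 2 < w.re := hw
    have := h.nonneg y
    rw [norm_neg, norm_div, norm_pow, Complex.norm_real, Real.norm_of_nonneg (h.nonneg y),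
      div_eq_mul_inv]
    gcongr
    exact hw'.le.trans (re_le_norm_sub w y)
  · refine Eventually.of_forall fun y w hw => ?_
    have hw' : q.re / 2 < w.re := hw
    have h0 := sub_ne_zero_of_re_pos (q := w) (by linarith) y
    have := ((hasDerivAt_id w).sub_const (Complex.I * y)).inv h0 |>.const_mul (ρ y : ℂ)
    refine (this.congr_deriv ?_).congr_of_eventuallyEq ?_
    · simp only [id]; ring
    · exact Eventually.of_forall fun w => by simp [div_eq_mul_inv]

/-- The bound on `freeSt` and its Lipschitz constant near the energy `E₀`. -/
def stBound (κ M : ℝ) : ℝ :=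
  1 / (κ / 16) ^ 2 + 1 / (κ / 16) + 2 * M / (κ / 16) + (Real.pi * M + 2 * (κ / 16) * M) + 1

lemma IsRegularNear.nonneg_M (h : IsRegularNear ρ ρ' E₀ κ c M) : 0 ≤ M :=
  (abs_nonneg _).trans (h.bound E₀ (by simpa using h.pos_κ.le))

lemma one_le_stBound (hκ : 0 < κ) (hM : 0 ≤ M) : 1 ≤ stBound κ M := by
  have := Real.pi_pos
  unfold stBound
  have : 0 ≤ 1 / (κ / 16) ^ 2 + 1 / (κ / 16) + 2 * M / (κ / 16) +
    (Real.pi * M + 2 * (κ / 16) * M) := by positivity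
  linarith

lemma norm_integral_div_sub_pow_le (h : IsDensity ρ) {q : ℂ} (hq : 0 < q.re) {b : ℝ} (hb : 0 < b)
    (n : ℕ) : ‖∫ y : ℝ, (ρ y : ℂ) / (q - Complex.I * y) ^ n‖ ≤
      ‖∫ y in (q.im - b)..(q.im + b), (ρ y : ℂ) / (q - Complex.I * y) ^ n‖ + 1 / b ^ n := by
  have hi := integrable_div_sub_pow h hq n
  rw [← integral_add_compl (measurableSet_Ioc (a := q.im - b) (b := q.im + b)) hi,
    intervalIntegral.integral_of_le (by linarith)]
  refine (norm_add_le _ _).trans ?_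
  gcongr
  have h1 : IntegrableOn (fun y => ρ y * (1 / b ^ n)) (Set.Ioc (q.im - b) (q.im + b))ᶜ :=
    (h.integrable.mul_const _).integrableOn
  refine (norm_integral_le_of_norm_le h1 ((ae_restrict_iff' measurableSet_Ioc.compl).2
    (Eventually.of_forall fun y hy => ?_))).trans ?_
  · have hby : b ≤ |y - q.im| := by
      by_contra! hlt
      rw [abs_lt] at hlt
      exact hy ⟨by linarith [hlt.1], by linarith [hlt.2]⟩
    have := h.nonneg y
    rw [norm_div, norm_pow, Complex.norm_real, Real.norm_of_nonneg (h.nonneg y), div_eq_mul_one_div]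
    gcongr
    exact hby.trans (abs_sub_le_norm_sub q y)
  · rw [integral_mul_const]
    have h2 : ∫ y in (Set.Ioc (q.im - b) (q.im + b))ᶜ, ρ y ≤ 1 := by
      rw [← h.total]
      exact setIntegral_le_integral h.integrable (Eventually.of_forall h.nonneg)
    have : 0 ≤ 1 / b ^ n := by positivity
    nlinarith

lemma abs_sub_lt_of_near (hκ : 0 < κ) {x y : ℝ} (hx : |x - E₀| ≤ 7 / 8 * κ)
    (hy : |y - x| ≤ κ / 16) : |y - E₀| < κ := by
  have := abs_add_le (y - x) (x - E₀)
  rw [sub_add_sub_cancel] at this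
  linarith

lemma IsRegularNear.lipschitz_density (h : IsRegularNear ρ ρ' E₀ κ c M) {y z : ℝ}
    (hy : |y - E₀| < κ) (hz : |z - E₀| < κ) : |ρ y - ρ z| ≤ M * |y - z| := by
  have hconv : Convex ℝ {y : ℝ | |y - E₀| < κ} := by
    have : {y : ℝ | |y - E₀| < κ} = Metric.ball E₀ κ := by
      ext y; simp [Real.dist_eq]
    rw [this]; exact convex_ball _ _
  have := hconv.norm_image_sub_le_of_norm_hasDerivWithin_le (f := ρ) (f' := ρ') (C := M)
    (fun y hy => (h.deriv y hy).hasDerivWithinAt) (fun y hy => h.deriv_bound y (le_of_lt hy)) hz hy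
  simpa [Real.norm_eq_abs] using this

/-- The limiting resolvent trace is bounded up to the imaginary axis near the energy `E₀`: the part of
the density away from the energy is trivial, the part nearby is Lipschitz. -/
lemma IsRegularNear.norm_freeSt_le (h : IsRegularNear ρ ρ' E₀ κ c M) {q : ℂ} (hq : 0 < q.re)
    (hE : |q.im - E₀| ≤ 7 / 8 * κ) : ‖freeSt ρ q‖ ≤ stBound κ M - 1 := by
  have hκ := h.pos_κ
  have hM := h.nonneg_M
  have h1 := norm_integral_div_sub_pow_le h.density hq (b := κ / 16) (by positivity) 1
  have h2 := (norm_integral_div_sub_le hq (b := κ / 16) (M := M) (by positivity) (g := ρ)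
    (fun y hy => h.bound y (abs_sub_lt_of_near hκ hE hy).le)
    (fun y z hy hz => h.lipschitz_density (abs_sub_lt_of_near hκ hE hy)
      (abs_sub_lt_of_near hκ hE hz))).2
  simp only [pow_one] at h1
  have h3 : 0 ≤ 1 / (κ / 16) ^ 2 := by positivity
  have h4 : 0 ≤ 2 * M / (κ / 16) := by positivity
  unfold freeSt stBound
  linarith

/-- The derivative is bounded too: an integration by parts moves it onto the density, which has a
Lipschitz derivative nearby. -/
lemma IsRegularNear.norm_deriv_freeSt_le (h : IsRegularNear ρ ρ' E₀ κ c M) {q : ℂ} (hq : 0 < q.re)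
    (hE : |q.im - E₀| ≤ 7 / 8 * κ) :
    ‖∫ y : ℝ, (ρ y : ℂ) / (q - Complex.I * y) ^ 2‖ ≤ stBound κ M := by
  have hκ := h.pos_κ
  have hM := h.nonneg_M
  set b := κ / 16 with hb
  have hb0 : 0 < b := by positivity
  have h1 := norm_integral_div_sub_pow_le h.density hq hb0 2
  obtain ⟨i2, h2⟩ := norm_integral_div_sub_le hq (b := b) (M := M) hb0.le (g := ρ')
    (fun y hy => h.deriv_bound y (abs_sub_lt_of_near hκ hE hy).le)
    (fun y z hy hz => h.lipschitz y z (abs_sub_lt_of_near hκ hE hy).le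
      (abs_sub_lt_of_near hκ hE hz).le)
  have hI : ∀ y, y ∈ Set.uIcc (q.im - b) (q.im + b) → |y - q.im| ≤ b := by
    intro y hy
    rw [Set.uIcc_of_le (by linarith)] at hy
    rw [abs_le]; constructor <;> linarith [hy.1, hy.2]
  have i1 : IntervalIntegrable (fun y : ℝ => (ρ y : ℂ) / (q - Complex.I * y) ^ 2) volume
      (q.im - b) (q.im + b) := (integrable_div_sub_pow h.density hq 2).intervalIntegrable
  -- integration by parts moves one derivative of the kernel onto the density
  have hd : ∀ y ∈ Set.uIcc (q.im - b) (q.im + b),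
      HasDerivAt (fun y : ℝ => (ρ y : ℂ) / (q - Complex.I * y))
        ((ρ' y : ℂ) / (q - Complex.I * y) + Complex.I * ((ρ y : ℂ) / (q - Complex.I * y) ^ 2)) y := by
    intro y hy
    have h0 := sub_ne_zero_of_re_pos hq y
    have d1 := (h.deriv y (abs_sub_lt_of_near hκ hE (hI y hy))).ofReal_comp
    have d2 : HasDerivAt (fun y : ℝ => q - Complex.I * (y : ℂ)) (-Complex.I) y := by
      have := ((hasDerivAt_id y).ofReal_comp.const_mul Complex.I).const_sub q
      simpa using this
    refine (d1.div d2 h0).congr_deriv ?_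
    field_simp
    ring
  have hIBP := intervalIntegral.integral_eq_sub_of_hasDerivAt hd (i2.add (i1.const_mul _))
  have i3 : IntervalIntegrable (fun y : ℝ => Complex.I * ((ρ y : ℂ) / (q - Complex.I * y) ^ 2))
    volume (q.im - b) (q.im + b) := i1.const_mul _
  rw [intervalIntegral.integral_add i2 i3, intervalIntegral.integral_const_mul] at hIBP
  have hend : ∀ y, |y - q.im| = b → ‖(ρ y : ℂ) / (q - Complex.I * y)‖ ≤ M / b := by
    intro y hy
    rw [norm_div, Complex.norm_real, Real.norm_eq_abs]
    gcongr
    · exact h.bound y (abs_sub_lt_of_near hκ hE hy.le).le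
    · rw [← hy]; exact abs_sub_le_norm_sub q y
  have e1 := hend (q.im + b) (by rw [add_sub_cancel_left, abs_of_pos hb0])
  have e2 := hend (q.im - b) (by rw [sub_sub_cancel_left, abs_neg, abs_of_pos hb0])
  set X := ∫ y in (q.im - b)..(q.im + b), (ρ y : ℂ) / (q - Complex.I * y) ^ 2
  set Y := ∫ y in (q.im - b)..(q.im + b), (ρ' y : ℂ) / (q - Complex.I * y)
  set A := (ρ (q.im + b) : ℂ) / (q - Complex.I * (q.im + b : ℝ))
  set B := (ρ (q.im - b) : ℂ) / (q - Complex.I * (q.im - b : ℝ))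
  have hX : ‖X‖ ≤ 2 * M / b + (Real.pi * M + 2 * b * M) := by
    have e : Complex.I * X = A - B - Y := by rw [← hIBP]; ring
    have e' : ‖X‖ = ‖A - B - Y‖ := by rw [← e, norm_mul, Complex.norm_I, one_mul]
    rw [e']
    calc _ ≤ ‖A‖ + ‖B‖ + ‖Y‖ := (norm_sub_le _ _).trans (by gcongr; exact norm_sub_le _ _)
      _ ≤ M / b + M / b + (Real.pi * M + 2 * b * M) := by gcongr
      _ = _ := by ring
  have h4 : 0 ≤ 1 / b := by positivity
  unfold stBound
  rw [← hb]
  linarith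

/-- The limiting resolvent trace is Lipschitz up to the imaginary axis near the energy `E₀`. -/
lemma IsRegularNear.norm_freeSt_sub_le (h : IsRegularNear ρ ρ' E₀ κ c M) {q q' : ℂ} (hq : 0 < q.re)
    (hq' : 0 < q'.re) (hE : |q.im - E₀| ≤ 7 / 8 * κ) (hE' : |q'.im - E₀| ≤ 7 / 8 * κ) :
    ‖freeSt ρ q - freeSt ρ q'‖ ≤ stBound κ M * ‖q - q'‖ := by
  have hconv : Convex ℝ {w : ℂ | 0 < w.re ∧ w.im ∈ Set.Icc (E₀ - 7 / 8 * κ) (E₀ + 7 / 8 * κ)} :=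
    (convex_halfSpace_re_gt 0).inter ((convex_Icc (E₀ - 7 / 8 * κ) (E₀ + 7 / 8 * κ)).linear_preimage
      (Complex.imLm))
  have hmem : ∀ w : ℂ, |w.im - E₀| ≤ 7 / 8 * κ ↔
      w.im ∈ Set.Icc (E₀ - 7 / 8 * κ) (E₀ + 7 / 8 * κ) := by
    intro w
    rw [abs_le, Set.mem_Icc]
    constructor <;> rintro ⟨h1, h2⟩ <;> constructor <;> linarith
  exact hconv.norm_image_sub_le_of_norm_hasDerivWithin_le (f := freeSt ρ)
    (fun w hw => (hasDerivAt_freeSt h.density hw.1).hasDerivWithinAt)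
    (fun w hw => by
      rw [norm_neg]; exact h.norm_deriv_freeSt_le hw.1 ((hmem w).2 hw.2))
    ⟨hq', (hmem _).1 hE'⟩ ⟨hq, (hmem _).1 hE⟩

lemma re_freeSt (h : IsDensity ρ) {q : ℂ} (hq : 0 < q.re) :
    Integrable (fun y => ρ y * (q.re / (q.re ^ 2 + (y - q.im) ^ 2))) ∧
    (freeSt ρ q).re = ∫ y, ρ y * (q.re / (q.re ^ 2 + (y - q.im) ^ 2)) := by
  have hi := integrable_div_sub_pow h hq 1
  simp only [pow_one] at hi
  have e : ∀ y : ℝ, ((ρ y : ℂ) / (q - Complex.I * y)).re =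
      ρ y * (q.re / (q.re ^ 2 + (y - q.im) ^ 2)) := by
    intro y
    rw [div_eq_mul_inv, inv_sub_I_mul hq, Complex.re_ofReal_mul, Complex.add_re,
      Complex.ofReal_re, Complex.re_ofReal_mul, Complex.I_re, mul_zero, add_zero]
  have hi' := hi.re
  simp only [RCLike.re_to_complex, e] at hi'
  refine ⟨hi', ?_⟩
  unfold freeSt
  rw [← Complex.reCLM_apply, ← Complex.reCLM.integral_comp_comm hi]
  simp only [Complex.reCLM_apply, e]

lemma integral_poisson {e : ℝ} (he : 0 < e) (x b : ℝ) :
    ∫ y in (x - b)..(x + b), e / (e ^ 2 + (y - x) ^ 2) = 2 * Real.arctan (b / e) := by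
  rw [intervalIntegral.integral_eq_sub_of_hasDerivAt (fun y _ => hasDerivAt_arctan_div he x y)]
  · rw [add_sub_cancel_left, sub_sub_cancel_left, neg_div, Real.arctan_neg]; ring
  · refine Continuous.intervalIntegrable ?_ _ _
    exact continuous_const.div (by fun_prop) fun y => by positivity

/-- The density of states is bounded below near the energy `E₀`. -/
lemma IsRegularNear.le_re_freeSt (h : IsRegularNear ρ ρ' E₀ κ c M) {q : ℂ} (hq : 0 < q.re)
    (hq' : q.re ≤ κ / 2) (hE : |q.im - E₀| ≤ κ / 2) : c * Real.pi / 2 ≤ (freeSt ρ q).re := by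
  obtain ⟨hi, e⟩ := re_freeSt h.density hq
  have hκ := h.pos_κ
  have hP : ∀ y, 0 ≤ q.re / (q.re ^ 2 + (y - q.im) ^ 2) := fun y => by positivity
  have hPc : Continuous fun y => q.re / (q.re ^ 2 + (y - q.im) ^ 2) :=
    continuous_const.div (by fun_prop) fun y => by positivity
  rw [e]
  calc c * Real.pi / 2 ≤ c * (2 * Real.arctan (κ / 2 / q.re)) := by
        have : Real.pi / 4 ≤ Real.arctan (κ / 2 / q.re) := by
          rw [← Real.arctan_one]
          exact Real.arctan_mono (by rw [le_div_iff₀ hq]; linarith)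
        have := h.pos_c
        nlinarith
    _ = ∫ y in (q.im - κ / 2)..(q.im + κ / 2), c * (q.re / (q.re ^ 2 + (y - q.im) ^ 2)) := by
        rw [intervalIntegral.integral_const_mul, integral_poisson hq]
    _ ≤ ∫ y in (q.im - κ / 2)..(q.im + κ / 2), ρ y * (q.re / (q.re ^ 2 + (y - q.im) ^ 2)) := by
        refine intervalIntegral.integral_mono_on (by linarith)
          ((hPc.const_mul c).intervalIntegrable _ _) hi.intervalIntegrable fun y hy => ?_
        refine mul_le_mul_of_nonneg_right (h.lower y ?_) (hP y)
        have h1 : |y - q.im| ≤ κ / 2 := by rw [abs_le]; constructor <;> linarith [hy.1, hy.2]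
        have := abs_add_le (y - q.im) (q.im - E₀)
        rw [sub_add_sub_cancel] at this
        linarith
    _ ≤ _ := by
        rw [intervalIntegral.integral_of_le (by linarith)]
        exact setIntegral_le_integral hi
          (Eventually.of_forall fun y => mul_nonneg (h.density.nonneg y) (hP y))

/-- The Poisson integral of the density converges linearly, by second order Taylor expansion. -/
lemma IsRegularNear.abs_re_freeSt_sub_le (h : IsRegularNear ρ ρ' E₀ κ c M) {e : ℝ} (he : 0 < e) :
    |(freeSt ρ (e + E₀ * Complex.I)).re - Real.pi * ρ E₀| ≤ stBound κ M * e := by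
  set q : ℂ := e + E₀ * Complex.I with hq
  have hre : q.re = e := by simp [hq]
  have him : q.im = E₀ := by simp [hq]
  obtain ⟨hi, e1⟩ := re_freeSt h.density (q := q) (by rw [hre]; exact he)
  rw [hre, him] at hi e1
  have hκ := h.pos_κ
  have hM := h.nonneg_M
  set b := κ / 16 with hb
  have hb0 : 0 < b := by positivity
  set P : ℝ → ℝ := fun y => e / (e ^ 2 + (y - E₀) ^ 2) with hP
  have hP0 : ∀ y, 0 ≤ P y := fun y => by positivity
  have hPc : Continuous P := continuous_const.div (by fun_prop) fun y => by positivity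
  have hPs : ∀ y, P y * (y - E₀) ^ 2 ≤ e := by
    intro y
    simp only [hP]
    rw [div_mul_eq_mul_div, div_le_iff₀ (by positivity)]
    nlinarith [sq_nonneg e]
  have hnear : ∀ y, |y - E₀| ≤ b → |y - E₀| < κ := fun y hy => by linarith
  -- the far part
  have hfar : 0 ≤ ∫ y in (Set.Ioc (E₀ - b) (E₀ + b))ᶜ, ρ y * P y ∧
      ∫ y in (Set.Ioc (E₀ - b) (E₀ + b))ᶜ, ρ y * P y ≤ e / b ^ 2 := by
    refine ⟨setIntegral_nonneg measurableSet_Ioc.compl fun y _ =>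
      mul_nonneg (h.density.nonneg y) (hP0 y), ?_⟩
    calc _ ≤ ∫ y in (Set.Ioc (E₀ - b) (E₀ + b))ᶜ, ρ y * (e / b ^ 2) := by
          refine setIntegral_mono_on hi.integrableOn (h.density.integrable.mul_const _).integrableOn
            measurableSet_Ioc.compl fun y hy => ?_
          refine mul_le_mul_of_nonneg_left ?_ (h.density.nonneg y)
          have hby : b ≤ |y - E₀| := by
            by_contra! hlt
            rw [abs_lt] at hlt
            exact hy ⟨by linarith [hlt.1], by linarith [hlt.2]⟩
          have h1 : b ^ 2 ≤ (y - E₀) ^ 2 := by rw [← sq_abs (y - E₀)]; gcongr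
          simp only [hP]
          gcongr
          nlinarith [sq_nonneg e]
      _ ≤ e / b ^ 2 := by
          rw [integral_mul_const]
          have h2 : ∫ y in (Set.Ioc (E₀ - b) (E₀ + b))ᶜ, ρ y ≤ 1 := by
            rw [← h.density.total]
            exact setIntegral_le_integral h.density.integrable
              (Eventually.of_forall h.density.nonneg)
          have : 0 ≤ e / b ^ 2 := by positivity
          nlinarith
  -- the affine part of the near part
  have haff : ∫ y in (E₀ - b)..(E₀ + b), (ρ E₀ + ρ' E₀ * (y - E₀)) * P y =
      ρ E₀ * (2 * Real.arctan (b / e)) := by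
    have hd : ∀ y, HasDerivAt (fun y => ρ E₀ * Real.arctan ((y - E₀) / e) +
        ρ' E₀ * (e * (Real.log (e ^ 2 + (y - E₀) ^ 2) / 2)))
        ((ρ E₀ + ρ' E₀ * (y - E₀)) * P y) y := by
      intro y
      refine (((hasDerivAt_arctan_div he E₀ y).const_mul (ρ E₀)).add
        (((hasDerivAt_log_div he E₀ y).const_mul e).const_mul (ρ' E₀))).congr_deriv ?_
      simp only [hP]; ring
    rw [intervalIntegral.integral_eq_sub_of_hasDerivAt (fun y _ => hd y)
      (Continuous.intervalIntegrable (by fun_prop) _ _), add_sub_cancel_left, sub_sub_cancel_left,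
      neg_div, Real.arctan_neg, neg_sq]
    ring
  have hR : ∀ y, |y - E₀| ≤ b → |ρ y - (ρ E₀ + ρ' E₀ * (y - E₀))| ≤ M * (y - E₀) ^ 2 := by
    intro y hy
    have hseg : ∀ x ∈ Set.uIcc E₀ y, |x - E₀| ≤ |y - E₀| := fun x hx => by
      have := Set.abs_sub_left_of_mem_uIcc hx
      simpa [abs_sub_comm] using this
    have := (convex_uIcc E₀ y).norm_image_sub_le_of_norm_hasDerivWithin_le
      (f := fun x => ρ x - ρ' E₀ * (x - E₀)) (f' := fun x => ρ' x - ρ' E₀) (C := M * |y - E₀|)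
      (fun x hx => by
        have d := (h.deriv x (hnear x ((hseg x hx).trans hy))).sub
          (((hasDerivAt_id x).sub_const E₀).const_mul (ρ' E₀))
        simp only [mul_one] at d
        exact d.hasDerivWithinAt)
      (fun x hx => (h.lipschitz x E₀ (hnear x ((hseg x hx).trans hy)).le
        (by simpa using hκ.le)).trans (mul_le_mul_of_nonneg_left (hseg x hx) hM))
      Set.left_mem_uIcc Set.right_mem_uIcc
    simp only [Real.norm_eq_abs, sub_self, mul_zero, sub_zero] at this
    calc _ = |ρ y - ρ' E₀ * (y - E₀) - ρ E₀| := by congr 1; ring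
      _ ≤ _ := this
      _ = _ := by rw [mul_assoc, ← sq, sq_abs]
  have i1 : IntervalIntegrable (fun y => ρ y * P y) volume (E₀ - b) (E₀ + b) :=
    hi.intervalIntegrable
  have i2 : IntervalIntegrable (fun y => (ρ E₀ + ρ' E₀ * (y - E₀)) * P y) volume (E₀ - b) (E₀ + b) :=
    Continuous.intervalIntegrable (by fun_prop) _ _
  have hrem : |(∫ y in (E₀ - b)..(E₀ + b), ρ y * P y) - ρ E₀ * (2 * Real.arctan (b / e))| ≤
      M * e * (2 * b) := by
    rw [← haff, ← intervalIntegral.integral_sub i1 i2, ← Real.norm_eq_abs]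
    refine (intervalIntegral.norm_integral_le_of_norm_le_const (C := M * e) fun y hy => ?_).trans ?_
    · rw [Set.uIoc_of_le (by linarith)] at hy
      have hy' : |y - E₀| ≤ b := by rw [abs_le]; constructor <;> linarith [hy.1, hy.2]
      rw [← sub_mul, Real.norm_eq_abs, abs_mul, abs_of_nonneg (hP0 y)]
      calc _ ≤ M * (y - E₀) ^ 2 * P y := mul_le_mul_of_nonneg_right (hR y hy') (hP0 y)
        _ = M * (P y * (y - E₀) ^ 2) := by ring
        _ ≤ M * e := by gcongr; exact hPs y
    · rw [show E₀ + b - (E₀ - b) = 2 * b by ring, abs_of_pos (by positivity)]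
  have hatan : |ρ E₀ * (2 * Real.arctan (b / e)) - Real.pi * ρ E₀| ≤ M * (2 * e / b) := by
    have h1 : Real.arctan (b / e) = Real.pi / 2 - Real.arctan (e / b) := by
      have := Real.arctan_inv_of_pos (x := e / b) (by positivity)
      rwa [inv_div] at this
    have h2 : 0 ≤ Real.arctan (e / b) := Real.arctan_nonneg.2 (by positivity)
    have h3 : Real.arctan (e / b) ≤ e / b := by
      have := Real.le_tan h2 (Real.arctan_lt_pi_div_two _)
      rwa [Real.tan_arctan] at this
    rw [h1, show ρ E₀ * (2 * (Real.pi / 2 - Real.arctan (e / b))) - Real.pi * ρ E₀ =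
      -(ρ E₀ * (2 * Real.arctan (e / b))) by ring, abs_neg, abs_mul,
      abs_of_nonneg (by positivity : 0 ≤ 2 * Real.arctan (e / b)), mul_div_assoc]
    gcongr
    exact h.bound E₀ (by simpa using hκ.le)
  have hsplit : (freeSt ρ q).re = (∫ y in (E₀ - b)..(E₀ + b), ρ y * P y) +
      ∫ y in (Set.Ioc (E₀ - b) (E₀ + b))ᶜ, ρ y * P y := by
    rw [e1, ← integral_add_compl (measurableSet_Ioc (a := E₀ - b) (b := E₀ + b)) hi,
      intervalIntegral.integral_of_le (by linarith)]
  rw [hsplit]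
  obtain ⟨f1, f2⟩ := hfar
  set F := ∫ y in (Set.Ioc (E₀ - b) (E₀ + b))ᶜ, ρ y * P y
  set G := ∫ y in (E₀ - b)..(E₀ + b), ρ y * P y
  calc |G + F - Real.pi * ρ E₀| = |(G - ρ E₀ * (2 * Real.arctan (b / e))) +
        (ρ E₀ * (2 * Real.arctan (b / e)) - Real.pi * ρ E₀) + F| := by congr 1; ring
    _ ≤ M * e * (2 * b) + M * (2 * e / b) + e / b ^ 2 := by
        refine (abs_add_three _ _ _).trans ?_
        rw [abs_of_nonneg f1]
        gcongr
    _ = (2 * b * M + 2 * M / b + 1 / b ^ 2) * e := by ring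
    _ ≤ stBound κ M * e := by
        unfold stBound
        rw [← hb]
        refine mul_le_mul_of_nonneg_right ?_ he.le
        have : 0 ≤ Real.pi * M := mul_nonneg Real.pi_pos.le hM
        have : 0 ≤ 1 / b := by positivity
        linarith

end Stieltjes

/-! ### Lorentzians and spectral weights -/

section Lorentz

/-- The Lorentzian of width `α` centered at `β`, of total mass `2 π`. -/
def lorentz (α β E : ℝ) : ℝ := 2 * α / (α ^ 2 + (E - β) ^ 2)

lemma lorentz_nonneg {α : ℝ} (hα : 0 ≤ α) (β E : ℝ) : 0 ≤ lorentz α β E := by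
  unfold lorentz; positivity

lemma lap_exp {p : ℂ} (hp : 0 < p.re) (β : ℝ) :
    lap (fun t : ℝ => Complex.exp (β * Complex.I * t)) p = (p - Complex.I * β)⁻¹ := by
  have hre : (-(p - Complex.I * β)).re < 0 := by simp [hp]
  have h := integral_exp_mul_complex_Ioi hre 0
  have hne := sub_ne_zero_of_re_pos hp β
  unfold lap
  have e : ∀ t : ℝ, Complex.exp (-p * t) • Complex.exp (β * Complex.I * t) =
      Complex.exp (-(p - Complex.I * β) * t) := fun t => by
    rw [smul_eq_mul, ← Complex.exp_add]; congr 1; ring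
  simp only [e, h]
  simp only [Complex.ofReal_zero, mul_zero, Complex.exp_zero]
  field_simp

lemma inv_add_conj_inv {s : ℂ} : s⁻¹ + (starRingEnd ℂ) s⁻¹ =
    ((2 * s.re / (s.re ^ 2 + s.im ^ 2) : ℝ) : ℂ) := by
  rw [Complex.add_conj, Complex.inv_re, Complex.normSq_apply]
  congr 1
  ring

lemma bilap_exp {α : ℝ} (hα : 0 < α) (β E : ℝ) :
    bilap (fun t : ℝ => Complex.exp (β * Complex.I * t)) α E = lorentz α β E := by
  have e : (fun t : ℝ => Complex.exp (β * Complex.I * (-t : ℝ))) =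
      fun t : ℝ => Complex.exp ((-β : ℝ) * Complex.I * t) := by
    funext t; congr 1; push_cast; ring
  unfold bilap
  rw [e, lap_exp (by simpa using hα), lap_exp (by simpa using hα)]
  have h2 : ((α : ℂ) - E * Complex.I - Complex.I * ((-β : ℝ) : ℂ)) =
      (starRingEnd ℂ) ((α : ℂ) + E * Complex.I - Complex.I * β) := by
    simp; ring
  rw [h2, ← map_inv₀, inv_add_conj_inv]
  unfold lorentz
  simp

lemma integral_lorentz {α : ℝ} (hα : 0 < α) (β : ℝ) : Integrable (lorentz α β) ∧
    (∀ t : ℝ, ∫ E : ℝ, Complex.exp (E * t * Complex.I) * (lorentz α β E : ℂ) =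
      2 * Real.pi * Real.exp (-α * |t|) * Complex.exp (β * Complex.I * t)) ∧
    ∫ E : ℝ, lorentz α β E = 2 * Real.pi := by
  have hd : ∀ (z : ℂ) (t : ℝ), HasDerivAt (fun t : ℝ => z * Complex.exp (β * Complex.I * t))
      (z * (β * Complex.I) * Complex.exp (β * Complex.I * t)) t := by
    intro z t
    have h := (((hasDerivAt_id t).ofReal_comp.const_mul ((β : ℂ) * Complex.I)).cexp).const_mul z
    refine h.congr_deriv ?_
    simp only [id, mul_one, Complex.ofReal_one]; ring
  have hn : ∀ t : ℝ, ‖Complex.exp (β * Complex.I * t)‖ = 1 := fun t => by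
    rw [Complex.norm_exp]; simp
  have h1 := bilap_inversion (g := fun t : ℝ => Complex.exp (β * Complex.I * t))
    (g' := fun t : ℝ => (β * Complex.I) * Complex.exp (β * Complex.I * t))
    (g'' := fun t : ℝ => (β * Complex.I) * (β * Complex.I) * Complex.exp (β * Complex.I * t))
    (fun t => by simpa using hd 1 t) (fun t => hd _ t) (by fun_prop) (B := 1 + |β| + |β| * |β|)
    (fun t => by rw [hn]; linarith [abs_nonneg β, mul_nonneg (abs_nonneg β) (abs_nonneg β)])
    (fun t => by
      rw [norm_mul, hn, norm_mul, Complex.norm_I, Complex.norm_real, Real.norm_eq_abs]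
      linarith [mul_nonneg (abs_nonneg β) (abs_nonneg β)])
    (fun t => by
      rw [norm_mul, hn, norm_mul, norm_mul, Complex.norm_I, Complex.norm_real, Real.norm_eq_abs]
      linarith [abs_nonneg β]) hα
  have e : bilap (fun t : ℝ => Complex.exp (β * Complex.I * t)) α =
    fun E => (lorentz α β E : ℂ) := funext (bilap_exp hα β)
  rw [e] at h1
  have hi : Integrable (lorentz α β) := by
    have := h1.1.re
    simpa using this
  refine ⟨hi, h1.2, ?_⟩
  have h0 := h1.2 0
  simp only [Complex.ofReal_zero, mul_zero, zero_mul, Complex.exp_zero, one_mul, abs_zero,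
    Real.exp_zero, mul_one, Complex.ofReal_one] at h0
  rw [integral_complex_ofReal] at h0
  exact_mod_cast h0

lemma lorentz_le {α b β E : ℝ} (hα : 0 ≤ α) (hb : 0 < b) (h : b ≤ |E - β|) :
    lorentz α β E ≤ 2 * α / b * lorentz b β E := by
  have h1 : b ^ 2 ≤ (E - β) ^ 2 := by rw [← sq_abs (E - β)]; gcongr
  have h2 : 0 < (E - β) ^ 2 := by nlinarith
  have e : 2 * α / b * lorentz b β E = 4 * α / (b ^ 2 + (E - β) ^ 2) := by
    unfold lorentz; field_simp; ring
  rw [e]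
  unfold lorentz
  rw [div_le_div_iff₀ (by positivity) (by positivity)]
  nlinarith [mul_nonneg hα (sq_nonneg α), mul_nonneg hα (sub_nonneg.2 h1)]

end Lorentz

section Weights

variable {N : ℕ} {H₀ : Op N}

lemma prop_eigenvector (A : Op N) {x : ℝ} {v : EuclideanSpace ℂ (Fin N)}
    (h : A v = (x : ℂ) • v) (t : ℝ) : prop A t v = Complex.exp (Complex.I * t * x) • v := by
  have hd : ∀ t : ℝ, HasDerivAt (fun t : ℝ => Complex.exp (-(Complex.I * x) * t) • prop A t v)
      0 t := by
    intro t
    have h1 : HasDerivAt (fun t : ℝ => Complex.exp (-(Complex.I * x) * t))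
        (Complex.exp (-(Complex.I * x) * t) * (-(Complex.I * x))) t := by
      have := ((hasDerivAt_id t).ofReal_comp.const_mul (-(Complex.I * (x : ℂ)))).cexp
      simpa using this
    have h2 := hasDerivAt_clm (ContinuousLinearMap.apply ℂ (EuclideanSpace ℂ (Fin N)) v)
      (hasDerivAt_prop A t)
    simp only [ContinuousLinearMap.apply_apply] at h2
    refine (h1.smul h2).congr_deriv ?_
    rw [commute_prop, _root_.smul_apply, mul_apply_eq_comp, h, map_smul]
    simp only [smul_smul, ← add_smul]
    convert zero_smul ℂ _ using 2
    ring
  have hc := is_const_of_deriv_eq_zero (fun t => (hd t).differentiableAt) (fun t => (hd t).deriv) t 0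
  simp only [Complex.ofReal_zero, mul_zero, Complex.exp_zero, prop_zero, one_smul,
    one_apply_eq_self] at hc
  conv_rhs => rw [← hc]
  rw [smul_smul, ← Complex.exp_add]
  have : Complex.I * t * x + -(Complex.I * x) * t = 0 := by ring
  rw [this, Complex.exp_zero, one_smul]

lemma resol_eigenvector (hH : IsSelfAdjoint H₀) {q : ℂ} (hq : 0 < q.re) {x : ℝ}
    {v : EuclideanSpace ℂ (Fin N)} (h : H₀ v = (x : ℂ) • v) :
    resol H₀ q v = (q - Complex.I * x)⁻¹ • v := by
  have h1 := congrArg (fun T : Op N => T v) (resol_mul_sub hH hq)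
  simp only [mul_apply_eq_comp, sub_apply, _root_.smul_apply, one_apply_eq_self, h, smul_smul,
    ← sub_smul, map_smul] at h1
  rw [eq_comm, inv_smul_eq_iff₀ (sub_ne_zero_of_re_pos hq x), h1]

variable (e : OrthonormalBasis (Fin N) ℂ (EuclideanSpace ℂ (Fin N)))

/-- The spectral weight of `ψ` at the `j`-th eigenvector. -/
def weight (ψ : EuclideanSpace ℂ (Fin N)) (j : Fin N) : ℝ := ‖(inner ℂ (e j) ψ : ℂ)‖ ^ 2

lemma weight_nonneg (ψ : EuclideanSpace ℂ (Fin N)) (j : Fin N) : 0 ≤ weight e ψ j := by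
  unfold weight; positivity

lemma sum_weight {ψ : EuclideanSpace ℂ (Fin N)} (hψ : ‖ψ‖ = 1) : ∑ j, weight e ψ j = 1 := by
  have := e.sum_sq_norm_inner_right ψ
  rw [hψ, one_pow] at this
  exact this

variable {x : Fin N → ℝ}

/-- Matrix elements of the free resolvent between freely evolved copies of `ψ`. -/
lemma inner_resol_prop (hH : IsSelfAdjoint H₀) (he : ∀ j, H₀ (e j) = (x j : ℂ) • e j) {q : ℂ}
    (hq : 0 < q.re) (ψ : EuclideanSpace ℂ (Fin N)) (s t : ℝ) :
    inner ℂ (prop H₀ (-s) ψ) (resol H₀ q (prop H₀ (-t) ψ)) =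
      ∑ j, (weight e ψ j : ℂ) * Complex.exp (Complex.I * (s - t) * x j) *
        (q - Complex.I * x j)⁻¹ := by
  have hc : ∀ (t : ℝ) j, inner ℂ (e j) (prop H₀ (-t) ψ) =
      Complex.exp (-(Complex.I * t * x j)) * inner ℂ (e j) ψ := by
    intro t j
    rw [← inner_prop_left hH, prop_eigenvector H₀ (he j), inner_smul_left, ← Complex.exp_conj]
    congr 2
    simp
  have hexp : resol H₀ q (prop H₀ (-t) ψ) = ∑ j, (inner ℂ (e j) (prop H₀ (-t) ψ) *
      (q - Complex.I * x j)⁻¹) • e j := by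
    conv_lhs => rw [← e.sum_repr' (prop H₀ (-t) ψ), map_sum]
    refine Finset.sum_congr rfl fun j _ => ?_
    rw [map_smul, resol_eigenvector hH hq (he j), smul_smul]
  rw [hexp, inner_sum]
  refine Finset.sum_congr rfl fun j _ => ?_
  rw [inner_smul_right, ← inner_conj_symm (prop H₀ (-s) ψ), hc, hc, map_mul, ← Complex.exp_conj, weight]
  have h1 : ((‖(inner ℂ (e j) ψ : ℂ)‖ ^ 2 : ℝ) : ℂ) =
      inner ℂ (e j) ψ * (starRingEnd ℂ) (inner ℂ (e j) ψ) := by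
    rw [Complex.mul_conj, Complex.normSq_eq_norm_sq]
  have h2 : Complex.exp (Complex.I * (s - t) * x j) = Complex.exp (-(Complex.I * t * x j)) *
      Complex.exp ((starRingEnd ℂ) (-(Complex.I * s * x j))) := by
    rw [← Complex.exp_add]; congr 1; simp; ring
  rw [h1, h2]
  ring

end Weights

section Positivity

variable {N : ℕ} {𝓧 : Type*} [MeasurableSpace 𝓧] {ν : Idx N → Measure 𝓧}
  [∀ k, IsProbabilityMeasure (ν k)] {ξ : 𝓧 → ℂ} {r μ : ℝ} {H₀ : Op N}

/-- The averaged, smoothed density of states at energy `E`, as a sesquilinear form. -/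
def specForm (ν : Idx N → Measure 𝓧) (H₀ : Op N) (lam : ℝ) (ξ : 𝓧 → ℂ) (η : ℝ)
    (x y : EuclideanSpace ℂ (Fin N)) (E : ℝ) : ℂ :=
  inner ℂ x (meanResol ν H₀ lam ξ (η + E * Complex.I) y) +
    (starRingEnd ℂ) (inner ℂ y (meanResol ν H₀ lam ξ (η + E * Complex.I) x))

lemma specForm_eq_bilap (hW : IsNearWigner ν ξ r μ) (hH : IsSelfAdjoint H₀) (lam : ℝ) {η : ℝ}
    (hη : 0 < η) (x y : EuclideanSpace ℂ (Fin N)) (E : ℝ) :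
    specForm ν H₀ lam ξ η x y E = bilap (fun t => inner ℂ x (meanProp ν H₀ lam ξ t y)) η E := by
  have hp : 0 < ((η : ℂ) + E * Complex.I).re := by simpa using hη
  unfold specForm bilap
  rw [inner_meanResol hW hH lam hp, inner_meanResol hW hH lam hp]
  congr 1
  unfold lap
  rw [← integral_conj]
  refine setIntegral_congr_fun measurableSet_Ioi fun t _ => ?_
  simp only [smul_eq_mul, map_mul, ← Complex.exp_conj]
  congr 1
  · congr 1
    simp
    left; ring
  · rw [inner_conj_symm, ← star_meanProp lam hH, ContinuousLinearMap.star_eq_adjoint,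
      ContinuousLinearMap.adjoint_inner_right]

/-- Positivity: on the diagonal the density of states is twice the real part of the resolvent. -/
lemma re_specForm_self_nonneg (hW : IsNearWigner ν ξ r μ) (hH : IsSelfAdjoint H₀) (lam : ℝ) {η : ℝ}
    (hη : 0 < η) (x : EuclideanSpace ℂ (Fin N)) (E : ℝ) :
    0 ≤ (specForm ν H₀ lam ξ η x x E).re := by
  have hp : 0 < ((η : ℂ) + E * Complex.I).re := by simpa using hη
  have := re_inner_meanResol_nonneg hW hH lam hp x
  unfold specForm
  rw [Complex.add_re, Complex.conj_re]
  linarith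

/-- The averaged density of states is a nonnegative form, so the Cauchy–Schwarz inequality holds, here
in the form with the arithmetic mean. -/
lemma norm_specForm_le (hW : IsNearWigner ν ξ r μ) (hH : IsSelfAdjoint H₀) (lam : ℝ) {η : ℝ}
    (hη : 0 < η) (x y : EuclideanSpace ℂ (Fin N)) (E : ℝ) :
    ‖specForm ν H₀ lam ξ η x y E‖ ≤
      ((specForm ν H₀ lam ξ η x x E).re + (specForm ν H₀ lam ξ η y y E).re) / 2 := by
  set L := meanResol ν H₀ lam ξ (η + E * Complex.I) with hL
  set b := specForm ν H₀ lam ξ η x y E with hb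
  have hx := re_specForm_self_nonneg hW hH lam hη x E
  have hy := re_specForm_self_nonneg hW hH lam hη y E
  rcases eq_or_ne b 0 with h0 | h0
  · rw [h0, norm_zero]; positivity
  -- rotate `y` so that the cross term becomes `-‖b‖`
  set a : ℂ := -((starRingEnd ℂ) b / ‖b‖) with ha
  have hnb : (‖b‖ : ℂ) ≠ 0 := by exact_mod_cast (norm_pos_iff.2 h0).ne'
  have hab : a * b = -‖b‖ := by
    rw [ha, neg_mul, div_mul_eq_mul_div, mul_comm, Complex.mul_conj, Complex.normSq_eq_norm_sq]
    push_cast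
    field_simp
  have haa : (starRingEnd ℂ) a * a = 1 := by
    rw [ha]
    simp only [map_neg, map_div₀, Complex.conj_conj, Complex.conj_ofReal, neg_mul_neg]
    rw [div_mul_div_comm, Complex.mul_conj, Complex.normSq_eq_norm_sq]
    push_cast
    field_simp
  have hpos := re_specForm_self_nonneg hW hH lam hη (x + a • y) E
  have key : (specForm ν H₀ lam ξ η (x + a • y) (x + a • y) E).re =
      (specForm ν H₀ lam ξ η x x E).re + (specForm ν H₀ lam ξ η y y E).re + 2 * (a * b).re := by
    have e1 : specForm ν H₀ lam ξ η (x + a • y) (x + a • y) E =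
        specForm ν H₀ lam ξ η x x E + (starRingEnd ℂ) a * a * specForm ν H₀ lam ξ η y y E +
        (a * b + (starRingEnd ℂ) (a * b)) := by
      rw [hb]
      unfold specForm
      rw [← hL]
      simp only [map_add, map_smul, inner_add_left, inner_add_right, inner_smul_left,
        inner_smul_right, map_mul, Complex.conj_conj]
      ring
    rw [e1, haa, one_mul, Complex.add_re, Complex.add_re, Complex.add_re, Complex.conj_re]
    ring
  rw [key, hab, Complex.neg_re, Complex.ofReal_re] at hpos
  linarith

/-- The Fourier transform of the averaged density of states is the damped averaged propagator. -/
lemma integral_specForm (hW : IsNearWigner ν ξ r μ) (hH : IsSelfAdjoint H₀) (lam : ℝ) {η : ℝ}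
    (hη : 0 < η) (x y : EuclideanSpace ℂ (Fin N)) :
    Integrable (specForm ν H₀ lam ξ η x y) ∧ ∀ t : ℝ,
      ∫ E : ℝ, Complex.exp (E * t * Complex.I) * specForm ν H₀ lam ξ η x y E =
        2 * Real.pi * Real.exp (-η * |t|) * inner ℂ x (meanProp ν H₀ lam ξ t y) := by
  have e : specForm ν H₀ lam ξ η x y = bilap (fun t => inner ℂ x (meanProp ν H₀ lam ξ t y)) η :=
    funext fun E => specForm_eq_bilap hW hH lam hη x y E
  have hξ := hW.measurable
  have hA := fun z => isSelfAdjoint_ham hH lam ξ (N := N) z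
  have hAm := measurable_ham (N := N) hξ H₀ lam
  set h := ‖H₀‖ + |lam| * (Fintype.card (Idx N) * (2 * r)) with hh
  have hAn : ∀ z : Idx N → 𝓧, ‖ham H₀ lam ξ z‖ ≤ h := by
    intro z
    refine (norm_add_le _ _).trans ?_
    rw [norm_smul, Complex.norm_real, Real.norm_eq_abs, hh]
    gcongr; exact norm_noise_le hW.bound z
  have hh0 : 0 ≤ h := by have := hW.r_nonneg; positivity
  have hPm : ∀ s : ℝ, Measurable fun z : Idx N → 𝓧 => prop (ham H₀ lam ξ z) s := fun s =>
    measurable_prop hAm measurable_const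
  have hPn : ∀ (s : ℝ) z, ‖prop (ham H₀ lam ξ z) s‖ ≤ 1 := fun s z => norm_prop_le (hA z) s
  set G : ℕ → ℝ → (Idx N → 𝓧) → ℂ := fun n s z => Complex.I ^ n *
    matEl x y (ham H₀ lam ξ z ^ n * prop (ham H₀ lam ξ z) s) with hG
  have hGm : ∀ n s, Measurable (G n s) := fun n s =>
    ((matEl x y).continuous.measurable.comp ((hAm.pow_const n).mul (hPm s))).const_mul _
  have hGb : ∀ n s z, ‖G n s z‖ ≤ ‖matEl x y‖ * h ^ n := fun n s z => by
    rw [norm_mul, norm_pow, Complex.norm_I, one_pow, one_mul]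
    refine ((matEl x y).le_opNorm _).trans ?_
    gcongr
    calc _ ≤ ‖ham H₀ lam ξ z ^ n‖ * ‖prop (ham H₀ lam ξ z) s‖ := norm_mul_le _ _
      _ ≤ h ^ n * 1 := by
          gcongr
          · rcases Nat.eq_zero_or_pos n with rfl | hn
            · simp only [pow_zero]
              exact ContinuousLinearMap.norm_id_le
            · exact (norm_pow_le' _ hn).trans (by gcongr; exact hAn z)
          · exact hPn s z
      _ = h ^ n := mul_one _
  have hGd : ∀ n s z, HasDerivAt (fun s => G n s z) (G (n + 1) s z) s := fun n s z => by
    have h1 := (hasDerivAt_clm (matEl x y ∘L ContinuousLinearMap.mul ℂ (Op N) (ham H₀ lam ξ z ^ n))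
      (hasDerivAt_prop (ham H₀ lam ξ z) s)).const_mul (Complex.I ^ n)
    refine h1.congr_deriv ?_
    simp only [hG, ContinuousLinearMap.comp_apply, ContinuousLinearMap.mul_apply', map_smul,
      smul_eq_mul, pow_succ, mul_assoc]
  have hD : ∀ n s, HasDerivAt (fun s => ∫ z, G n s z ∂(Measure.pi ν))
      (∫ z, G (n + 1) s z ∂(Measure.pi ν)) s := fun n s =>
    hasDerivAt_integral_of_bdd (hGm n) (hGm (n + 1)) (hGb n) (hGb (n + 1)) (hGd n) s
  have hb : ∀ n s, ‖∫ z, G n s z ∂(Measure.pi ν)‖ ≤ ‖matEl x y‖ * h ^ n := fun n s =>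
    norm_integral_le_of_bdd (hGb n s)
  have e0 : (fun t => (inner ℂ x (meanProp ν H₀ lam ξ t y) : ℂ)) =
      fun t => ∫ z, G 0 t z ∂(Measure.pi ν) := by
    funext t
    have := matEl_meanProp (ν := ν) lam hH hξ t (matEl x y)
    rw [matEl_apply] at this
    rw [this]
    simp [hG]
  rw [e, e0]
  have hB0 : ∀ n, 0 ≤ ‖matEl x y‖ * h ^ n := fun n => by positivity
  have := bilap_inversion (hD 0) (hD 1)
    (continuous_iff_continuousAt.2 fun t => (hD 2 t).continuousAt)
    (B := ‖matEl x y‖ * h ^ 0 + ‖matEl x y‖ * h ^ 1 + ‖matEl x y‖ * h ^ 2)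
    (fun t => (hb 0 t).trans (by linarith [hB0 1, hB0 2]))
    (fun t => (hb 1 t).trans (by linarith [hB0 0, hB0 2]))
    (fun t => (hb 2 t).trans (by linarith [hB0 1, hB0 0])) hη
  refine ⟨this.1, fun t => ?_⟩
  rw [this.2 t]
  congr 1
  exact (congrFun e0 t).symm

end Positivity

/-! ### The averaged resolvent near the energy shell -/

section Bootstrap

variable {N : ℕ} {𝓧 : Type*} [MeasurableSpace 𝓧] {ν : Idx N → Measure 𝓧}
  [∀ k, IsProbabilityMeasure (ν k)] {ξ : 𝓧 → ℂ} {r μ : ℝ} {H₀ : Op N}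
  {ρ ρ' : ℝ → ℝ} {E₀ κ c M : ℝ} {lam η δ : ℝ}

/-- The errors for finite `N` are at most `δ` at distance at least `η` from the spectrum: in the
free resolvent trace, and in the self-consistent equation for the averaged resolvent. -/
structure IsCloseTo (ν : Idx N → Measure 𝓧) (H₀ : Op N) (ξ : 𝓧 → ℂ) (ρ : ℝ → ℝ) (lam η δ : ℝ) :
    Prop where
  pos : 0 < η
  free : ∀ q : ℂ, η ≤ q.re → ‖ntr N (resol H₀ q) - freeSt ρ q‖ ≤ δ
  mean : ∀ p : ℂ, η ≤ p.re → ‖meanResol ν H₀ lam ξ p -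
    resol H₀ (p + lam ^ 2 * meanStieltjes ν H₀ lam ξ p)‖ ≤ δ

lemma re_add_sq_mul (p w : ℂ) (lam : ℝ) : (p + lam ^ 2 * w).re = p.re + lam ^ 2 * w.re := by
  rw [Complex.add_re, ← Complex.ofReal_pow, Complex.re_ofReal_mul]

lemma im_add_sq_mul (p w : ℂ) (lam : ℝ) : (p + lam ^ 2 * w).im = p.im + lam ^ 2 * w.im := by
  rw [Complex.add_im, ← Complex.ofReal_pow, Complex.im_ofReal_mul]

lemma norm_sq_mul (w : ℂ) (lam : ℝ) : ‖(lam : ℂ) ^ 2 * w‖ = lam ^ 2 * ‖w‖ := by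
  rw [norm_mul, norm_pow, Complex.norm_real, Real.norm_eq_abs, sq_abs]

lemma IsCloseTo.norm_meanStieltjes_sub_le (hW : IsNearWigner ν ξ r μ) (hH : IsSelfAdjoint H₀)
    (hcl : IsCloseTo ν H₀ ξ ρ lam η δ) {p : ℂ} (hp : η ≤ p.re) :
    ‖meanStieltjes ν H₀ lam ξ p - freeSt ρ (p + lam ^ 2 * meanStieltjes ν H₀ lam ξ p)‖ ≤ 2 * δ := by
  have hw := re_meanStieltjes_nonneg hW hH lam (hcl.pos.trans_le hp)
  have h1 := hcl.mean p hp
  set w := meanStieltjes ν H₀ lam ξ p with hw'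
  have h2 := hcl.free (p + lam ^ 2 * w) (by
    rw [re_add_sq_mul]
    have : 0 ≤ lam ^ 2 * w.re := by positivity
    linarith)
  have h3 := (norm_ntr_le_norm (meanResol ν H₀ lam ξ p - resol H₀ (p + lam ^ 2 * w))).trans h1
  rw [map_sub] at h3
  have e : w - freeSt ρ (p + lam ^ 2 * w) =
      (ntr N (meanResol ν H₀ lam ξ p) - ntr N (resol H₀ (p + lam ^ 2 * w))) +
      (ntr N (resol H₀ (p + lam ^ 2 * w)) - freeSt ρ (p + lam ^ 2 * w)) := by
    rw [hw', meanStieltjes]; ring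
  rw [e]
  exact (norm_add_le _ _).trans (by linarith)

lemma abs_im_shift_le (hκ : lam ^ 2 * stBound κ M ≤ κ / 8) {p w : ℂ} (hw : ‖w‖ ≤ stBound κ M)
    (hE : |p.im - E₀| ≤ 3 / 4 * κ) : |(p + lam ^ 2 * w).im - E₀| ≤ 7 / 8 * κ := by
  rw [im_add_sq_mul]
  have h1 : |lam ^ 2 * w.im| ≤ κ / 8 := by
    rw [abs_mul, abs_of_nonneg (sq_nonneg lam)]
    refine le_trans ?_ hκ
    gcongr
    exact (Complex.abs_im_le_norm w).trans hw
  have := abs_add_le (p.im - E₀) (lam ^ 2 * w.im)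
  rw [show p.im - E₀ + lam ^ 2 * w.im = p.im + lam ^ 2 * w.im - E₀ by ring] at this
  linarith

/-- The a priori bound on the averaged resolvent trace. By continuity in the imaginary part, the
weak bound propagates from `η = 2` since on it the self-consistent equation implies a stronger one. -/
lemma IsCloseTo.norm_meanStieltjes_le (hW : IsNearWigner ν ξ r μ) (hH : IsSelfAdjoint H₀)
    (h : IsRegularNear ρ ρ' E₀ κ c M) (hcl : IsCloseTo ν H₀ ξ ρ lam η δ) (hη2 : η ≤ 2)
    (hδ : 2 * δ ≤ 1 / 2) (hκ : lam ^ 2 * stBound κ M ≤ κ / 8) {E : ℝ}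
    (hE : |E - E₀| ≤ 3 / 4 * κ) :
    ‖meanStieltjes ν H₀ lam ξ (η + E * Complex.I)‖ ≤ stBound κ M := by
  set K := stBound κ M
  have hK : 1 ≤ K := one_le_stBound h.pos_κ h.nonneg_M
  set g : ℝ → ℝ := fun s => ‖meanStieltjes ν H₀ lam ξ (s + E * Complex.I)‖ with hg
  have hgc : ContinuousOn g (Set.Icc η 2) := by
    refine ContinuousOn.norm ?_
    refine (continuousOn_meanStieltjes hW hH lam).comp (by fun_prop) fun s hs => ?_
    have : 0 < s := hcl.pos.trans_le hs.1
    simpa using this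
  have hstrong : ∀ s, η ≤ s → g s ≤ K → g s ≤ K - 1 / 2 := by
    intro s hs hgs
    have hre : ((s : ℂ) + E * Complex.I).re = s := by simp
    have him : ((s : ℂ) + E * Complex.I).im = E := by simp
    have h1 := hcl.norm_meanStieltjes_sub_le hW hH (p := s + E * Complex.I) (by rw [hre]; exact hs)
    have h2 := re_meanStieltjes_nonneg hW hH lam (p := s + E * Complex.I)
      (by rw [hre]; exact hcl.pos.trans_le hs)
    have h3 := h.norm_freeSt_le (q := s + E * Complex.I + lam ^ 2 *
      meanStieltjes ν H₀ lam ξ (s + E * Complex.I))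
      (by
        rw [re_add_sq_mul, hre]
        have : 0 < s := hcl.pos.trans_le hs
        positivity)
      (abs_im_shift_le hκ hgs (by rw [him]; exact hE))
    have h4 := norm_sub_norm_le (meanStieltjes ν H₀ lam ξ (s + E * Complex.I))
      (freeSt ρ (s + E * Complex.I + lam ^ 2 * meanStieltjes ν H₀ lam ξ (s + E * Complex.I)))
    simp only [hg]
    linarith
  have hg2 : g 2 ≤ K - 1 / 2 := by
    refine hstrong 2 hη2 ?_
    have := Echo.norm_meanStieltjes_le (ν := ν) (ξ := ξ) hH lam (p := (2 : ℝ) + E * Complex.I)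
      (by simp)
    have h2 : (((2 : ℝ) : ℂ) + E * Complex.I).re = 2 := by simp
    rw [h2] at this
    simp only [hg]
    linarith
  by_contra! hlt
  obtain ⟨s, hs, hgs⟩ := intermediate_value_Icc' hη2 hgc (show K ∈ Set.Icc (g 2) (g η) from
    ⟨by linarith, hlt.le⟩)
  have := hstrong s hs.1 hgs.le
  linarith

end Bootstrap

section Comparison

/-- The constant in the comparison of resolvents near the energy shell. -/
def compConst (a K : ℝ) : ℝ := (1 + 2 * K ^ 2) / a + K

/-- The energy-dependent self energy may be frozen at the eigenvalue `x`, with an error that is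
controlled by the Lorentzian itself. -/
lemma norm_inv_sub_inv_le {lam η a K E x : ℝ} {w Φ : ℂ} (hlam : lam ≠ 0)
    (hη : 0 < η) (ha : 0 < a) (hK : 0 ≤ K) (hwK : ‖w‖ ≤ K) (hΦK : ‖Φ‖ ≤ K) (hΦ : a ≤ Φ.re)
    (hsub : ‖w - Φ‖ ≤ lam ^ 2 + K * ‖(η + E * Complex.I + lam ^ 2 * w) - (η + x * Complex.I)‖)
    (hsmall : lam ^ 2 * compConst a K ≤ 1 / 2) :
    ‖((η + E * Complex.I + lam ^ 2 * w) - Complex.I * x)⁻¹ -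
      ((η + lam ^ 2 * Φ.re : ℝ) + (E - (x - lam ^ 2 * Φ.im) : ℝ) * Complex.I)⁻¹‖ ≤
      compConst a K * |lam| * (1 + lorentz (η + lam ^ 2 * Φ.re) (x - lam ^ 2 * Φ.im) E / (2 * a)) := by
  set K₃ := compConst a K with hK₃
  set α := η + lam ^ 2 * Φ.re with hα
  set β := x - lam ^ 2 * Φ.im with hβ
  set s : ℂ := (η + E * Complex.I + lam ^ 2 * w) - Complex.I * x with hs
  set s' : ℂ := (α : ℝ) + (E - β : ℝ) * Complex.I with hs'
  have hl2 : 0 < lam ^ 2 := by positivity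
  have hα0 : lam ^ 2 * a ≤ α := by rw [hα]; nlinarith
  have hαpos : 0 < α := lt_of_lt_of_le (by positivity) hα0
  have hre : s'.re = α := by simp [hs']
  have him : s'.im = E - β := by simp [hs']
  have hn1 : lam ^ 2 * a ≤ ‖s'‖ := hα0.trans (hre ▸ Complex.re_le_norm s')
  have hspos : 0 < ‖s'‖ := lt_of_lt_of_le (by positivity) hn1
  have hn2 : |E - x| ≤ ‖s'‖ + lam ^ 2 * K := by
    have h1 := Complex.abs_im_le_norm s'
    rw [him, hβ] at h1
    have h2 := abs_sub_abs_le_abs_sub (E - x) (-(lam ^ 2 * Φ.im))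
    have h3 : |-(lam ^ 2 * Φ.im)| ≤ lam ^ 2 * K := by
      rw [abs_neg, abs_mul, abs_of_pos hl2]
      gcongr
      exact (Complex.abs_im_le_norm Φ).trans hΦK
    rw [show E - x - -(lam ^ 2 * Φ.im) = E - (x - lam ^ 2 * Φ.im) by ring] at h2
    linarith
  have hdist : ‖((η : ℂ) + E * Complex.I + lam ^ 2 * w) - (η + x * Complex.I)‖ ≤
      ‖s'‖ + 2 * (lam ^ 2 * K) := by
    have e : ((η : ℂ) + E * Complex.I + lam ^ 2 * w) - (η + x * Complex.I) =
      ((E - x : ℝ) : ℂ) * Complex.I + lam ^ 2 * w := by push_cast; ring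
    rw [e]
    refine (norm_add_le _ _).trans ?_
    rw [norm_mul, Complex.norm_I, mul_one, Complex.norm_real, Real.norm_eq_abs, norm_sq_mul]
    have : lam ^ 2 * ‖w‖ ≤ lam ^ 2 * K := by gcongr
    linarith
  have hds : ‖s' - s‖ ≤ lam ^ 2 * K₃ * ‖s'‖ := by
    have e : s' - s = (lam : ℂ) ^ 2 * (Φ - w) := by
      rw [hs', hs, hα, hβ]
      push_cast
      conv_rhs => rw [← Complex.re_add_im Φ]
      ring
    rw [e, norm_sq_mul, norm_sub_rev, mul_assoc]
    gcongr
    refine hsub.trans ?_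
    have h1 : lam ^ 2 ≤ ‖s'‖ / a := by rw [le_div_iff₀ ha]; exact hn1
    calc lam ^ 2 + K * ‖((η : ℂ) + E * Complex.I + lam ^ 2 * w) - (η + x * Complex.I)‖
        ≤ lam ^ 2 + K * (‖s'‖ + 2 * (lam ^ 2 * K)) := by gcongr
      _ = (1 + 2 * K ^ 2) * lam ^ 2 + K * ‖s'‖ := by ring
      _ ≤ (1 + 2 * K ^ 2) * (‖s'‖ / a) + K * ‖s'‖ := by gcongr
      _ = K₃ * ‖s'‖ := by rw [hK₃, compConst]; ring
  have hs2 : ‖s'‖ / 2 ≤ ‖s‖ := by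
    have h1 := norm_sub_norm_le s' s
    have h2 : lam ^ 2 * K₃ * ‖s'‖ ≤ 1 / 2 * ‖s'‖ := by gcongr
    linarith
  have hs0 : 0 < ‖s‖ := by linarith
  have hK₃0 : 0 ≤ K₃ := by rw [hK₃, compConst]; positivity
  have hsq : ‖s'‖ ^ 2 = α ^ 2 + (E - β) ^ 2 := by
    rw [Complex.sq_norm, Complex.normSq_apply, hre, him]; ring
  have hlor : lorentz α β E / (2 * a) = α / a / ‖s'‖ ^ 2 := by
    rw [hsq, lorentz]
    field_simp
  rw [inv_sub_inv (norm_pos_iff.1 hs0) (norm_pos_iff.1 hspos), norm_div, norm_mul, hlor]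
  have h5 : lam ^ 2 / ‖s'‖ ^ 2 ≤ α / a / ‖s'‖ ^ 2 := by
    gcongr
    rw [le_div_iff₀ ha]; exact hα0
  calc ‖s' - s‖ / (‖s‖ * ‖s'‖) ≤ (lam ^ 2 * K₃ * ‖s'‖) / (‖s'‖ / 2 * ‖s'‖) := by gcongr
    _ = K₃ * |lam| * (2 * (|lam| / ‖s'‖)) := by
        field_simp
        rw [sq_abs]
        ring
    _ ≤ K₃ * |lam| * (1 + (|lam| / ‖s'‖) ^ 2) := by
        gcongr
        nlinarith [sq_nonneg (|lam| / ‖s'‖ - 1)]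
    _ = K₃ * |lam| * (1 + lam ^ 2 / ‖s'‖ ^ 2) := by rw [div_pow, sq_abs]
    _ ≤ _ := by gcongr

end Comparison

/-! ### Exponential decay of the averaged amplitude -/

section FourierComparison

/-- A positivity argument: if the spectral densities `f` and `g` agree up to `R` on `I`, so do the
diagonal densities `d₁`, `d₂` and `d₀` that dominate them, and all of these have the same mass,
then the mass of `f` off `I` is small if that of `g` is. -/
lemma norm_integral_mul_sub_le {I : Set ℝ} (hI : MeasurableSet I) {f g u : ℝ → ℂ}
    {d₀ d₁ d₂ R : ℝ → ℝ} (hf : Integrable f) (hg : Integrable g) (hu : Continuous u)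
    (hu1 : ∀ E, ‖u E‖ = 1) (h₀ : Integrable d₀) (h₁ : Integrable d₁) (h₂ : Integrable d₂)
    (hR : IntegrableOn R I) (hfg : ∀ E ∈ I, ‖f E - g E‖ ≤ R E)
    (hd₁ : ∀ E ∈ I, d₀ E - R E ≤ d₁ E) (hd₂ : ∀ E ∈ I, d₀ E - R E ≤ d₂ E)
    (hfd : ∀ E, ‖f E‖ ≤ (d₁ E + d₂ E) / 2) (hgd : ∀ E, ‖g E‖ ≤ d₀ E)
    (m₁ : ∫ E, d₁ E = ∫ E, d₀ E) (m₂ : ∫ E, d₂ E = ∫ E, d₀ E) :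
    ‖(∫ E, u E * f E) - ∫ E, u E * g E‖ ≤ 2 * (∫ E in I, R E) + 2 * ∫ E in Iᶜ, d₀ E := by
  have huf : Integrable fun E => u E * f E :=
    hf.bdd_mul hu.aestronglyMeasurable (Eventually.of_forall fun E => (hu1 E).le)
  have hug : Integrable fun E => u E * g E :=
    hg.bdd_mul hu.aestronglyMeasurable (Eventually.of_forall fun E => (hu1 E).le)
  have hfar : ∀ d : ℝ → ℝ, Integrable d → (∀ E ∈ I, d₀ E - R E ≤ d E) →
      ∫ E, d E = ∫ E, d₀ E → ∫ E in Iᶜ, d E ≤ (∫ E in Iᶜ, d₀ E) + ∫ E in I, R E := by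
    intro d hd h hm
    have e1 := integral_add_compl hI hd
    have e2 := integral_add_compl hI h₀
    have h3 : ∫ E in I, (d₀ E - R E) ≤ ∫ E in I, d E :=
      setIntegral_mono_on (h₀.integrableOn.sub hR) hd.integrableOn hI h
    rw [integral_sub (h₀.integrableOn) hR] at h3
    linarith
  have k1 := hfar d₁ h₁ hd₁ m₁
  have k2 := hfar d₂ h₂ hd₂ m₂
  have hnorm : ∀ E, ‖u E * f E - u E * g E‖ = ‖f E - g E‖ := fun E => by
    rw [← mul_sub, norm_mul, hu1, one_mul]
  rw [← integral_sub huf hug, ← integral_add_compl (f := fun E => u E * f E - u E * g E) hI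
    (huf.sub hug)]
  refine (norm_add_le _ _).trans ?_
  have k3 : ‖∫ E in I, (u E * f E - u E * g E)‖ ≤ ∫ E in I, R E := by
    refine norm_integral_le_of_norm_le hR ((ae_restrict_iff' hI).2 (Eventually.of_forall ?_))
    intro E hE
    rw [hnorm]; exact hfg E hE
  have h12 : Integrable fun E => (d₁ E + d₂ E) / 2 := (h₁.add h₂).div_const 2
  have k4 : ‖∫ E in Iᶜ, (u E * f E - u E * g E)‖ ≤ ∫ E in Iᶜ, ((d₁ E + d₂ E) / 2 + d₀ E) := by
    refine norm_integral_le_of_norm_le (h12.add h₀).integrableOn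
      (Eventually.of_forall fun E => ?_)
    rw [hnorm]
    exact (norm_sub_le _ _).trans (add_le_add (hfd E) (hgd E))
  rw [integral_add h12.integrableOn h₀.integrableOn, integral_div,
    integral_add h₁.integrableOn h₂.integrableOn] at k4
  linarith

end FourierComparison

section Shell

variable {N : ℕ} {𝓧 : Type*} [MeasurableSpace 𝓧] {ν : Idx N → Measure 𝓧}
  [∀ k, IsProbabilityMeasure (ν k)] {ξ : 𝓧 → ℂ} {r μ : ℝ} {H₀ : Op N}
  {ρ ρ' : ℝ → ℝ} {E₀ κ c M : ℝ} {lam η δ : ℝ}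

/-- The coupling `lam` is weak, and the regularization `η` and the error `δ` are small compared
to it. -/
structure IsWeak (κ c M lam η δ : ℝ) : Prop where
  ne : lam ≠ 0
  le_one : |lam| ≤ 1
  shift : lam ^ 2 * stBound κ M ≤ κ / 8
  comp : lam ^ 2 * compConst (c * Real.pi / 2) (stBound κ M) ≤ 1 / 2
  η_le : η ≤ |lam|
  η_le' : η ≤ κ / 2
  δ_le : 2 * δ ≤ lam ^ 2
  δ_le' : 2 * δ ≤ 1 / 2

/-- The decay rate of the Lorentzian at the unperturbed energy `x`. -/
def width (ρ : ℝ → ℝ) (lam η x : ℝ) : ℝ := η + lam ^ 2 * (freeSt ρ (η + x * Complex.I)).re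

/-- The center of the Lorentzian at the unperturbed energy `x`. -/
def center (ρ : ℝ → ℝ) (lam η x : ℝ) : ℝ := x - lam ^ 2 * (freeSt ρ (η + x * Complex.I)).im

lemma re_freeSt_nonneg (h : IsDensity ρ) {q : ℂ} (hq : 0 < q.re) : 0 ≤ (freeSt ρ q).re := by
  rw [(re_freeSt h hq).2]
  exact integral_nonneg fun y => by
    have := h.nonneg y
    positivity

lemma width_pos (h : IsDensity ρ) (hη : 0 < η) (lam x : ℝ) : 0 < width ρ lam η x := by
  have := re_freeSt_nonneg h (q := η + x * Complex.I) (by simpa using hη)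
  unfold width
  positivity

lemma IsRegularNear.norm_freeSt_shell_le (h : IsRegularNear ρ ρ' E₀ κ c M) (hη : 0 < η) {x : ℝ}
    (hx : |x - E₀| ≤ κ / 2) : ‖freeSt ρ (η + x * Complex.I)‖ ≤ stBound κ M := by
  have := h.norm_freeSt_le (q := η + x * Complex.I) (by simpa using hη) (by
    have := h.pos_κ
    simp only [Complex.add_im, Complex.ofReal_im, Complex.mul_im, Complex.ofReal_re, Complex.I_im,
      Complex.I_re, mul_one, mul_zero, zero_add, add_zero]
    linarith)
  linarith

/-- Near the energy shell the shifted resolvent denominators may be replaced by those of Lorentzians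
whose width and center are fixed by the limiting resolvent trace at the eigenvalue `x`. -/
lemma IsCloseTo.norm_inv_sub_inv_le (hW : IsNearWigner ν ξ r μ) (hH : IsSelfAdjoint H₀)
    (h : IsRegularNear ρ ρ' E₀ κ c M) (hcl : IsCloseTo ν H₀ ξ ρ lam η δ)
    (hw : IsWeak κ c M lam η δ) {E x : ℝ} (hE : |E - E₀| ≤ 3 / 4 * κ) (hx : |x - E₀| ≤ κ / 2) :
    ‖((η + E * Complex.I + lam ^ 2 * meanStieltjes ν H₀ lam ξ (η + E * Complex.I)) -
        Complex.I * x)⁻¹ -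
      ((width ρ lam η x : ℂ) + (E - center ρ lam η x : ℝ) * Complex.I)⁻¹‖ ≤
      compConst (c * Real.pi / 2) (stBound κ M) * |lam| *
        (1 + lorentz (width ρ lam η x) (center ρ lam η x) E / (2 * (c * Real.pi / 2))) := by
  have hη := hcl.pos
  have hκ := h.pos_κ
  have hK := one_le_stBound h.pos_κ h.nonneg_M
  have hre : ∀ E : ℝ, ((η : ℂ) + E * Complex.I).re = η := fun E => by simp
  have him : ∀ E : ℝ, ((η : ℂ) + E * Complex.I).im = E := fun E => by simp
  have hwK := hcl.norm_meanStieltjes_le hW hH h (hw.η_le.trans (hw.le_one.trans (by norm_num)))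
    hw.δ_le' hw.shift hE
  have hpos := re_meanStieltjes_nonneg hW hH lam (p := η + E * Complex.I) (by rw [hre]; exact hη)
  have h1 := hcl.norm_meanStieltjes_sub_le hW hH (p := η + E * Complex.I) (by rw [hre])
  have hq : 0 < ((η : ℂ) + E * Complex.I +
      lam ^ 2 * meanStieltjes ν H₀ lam ξ (η + E * Complex.I)).re := by
    rw [re_add_sq_mul, hre]; positivity
  have h2 := h.norm_freeSt_sub_le (q' := η + x * Complex.I) hq (by rw [hre]; exact hη)
    (abs_im_shift_le hw.shift hwK (by rw [him]; exact hE)) (by rw [him]; linarith)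
  refine Echo.norm_inv_sub_inv_le hw.ne hη (by have := h.pos_c; positivity) (by linarith) hwK
    (h.norm_freeSt_shell_le hη hx)
    (h.le_re_freeSt (by rw [hre]; exact hη) (by rw [hre]; exact hw.η_le') (by rw [him]; exact hx))
    ?_ hw.comp
  have h3 := norm_sub_le_norm_sub_add_norm_sub (meanStieltjes ν H₀ lam ξ (η + E * Complex.I))
    (freeSt ρ (η + E * Complex.I + lam ^ 2 * meanStieltjes ν H₀ lam ξ (η + E * Complex.I)))
    (freeSt ρ (η + x * Complex.I))
  have := hw.δ_le
  linarith

variable (e : OrthonormalBasis (Fin N) ℂ (EuclideanSpace ℂ (Fin N))) {x : Fin N → ℝ}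

/-- The superposition of Lorentzians that approximates the averaged density of states between
`prop H₀ (-s) ψ` and `prop H₀ (-t) ψ`. -/
def lorentzForm (ρ : ℝ → ℝ) (lam η : ℝ) (x : Fin N → ℝ) (ψ : EuclideanSpace ℂ (Fin N))
    (s t E : ℝ) : ℂ :=
  ∑ j, (weight e ψ j : ℂ) * Complex.exp (Complex.I * (s - t) * x j) *
    (lorentz (width ρ lam η (x j)) (center ρ lam η (x j)) E : ℂ)

/-- The diagonal of `lorentzForm`. -/
def lorentzMix (ρ : ℝ → ℝ) (lam η : ℝ) (x : Fin N → ℝ) (ψ : EuclideanSpace ℂ (Fin N))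
    (E : ℝ) : ℝ :=
  ∑ j, weight e ψ j * lorentz (width ρ lam η (x j)) (center ρ lam η (x j)) E

lemma norm_exp_I_mul_sub (s t y : ℝ) : ‖Complex.exp (Complex.I * (s - t) * y)‖ = 1 := by
  rw [Complex.norm_exp]; simp

lemma lorentzForm_self (ψ : EuclideanSpace ℂ (Fin N)) (s E : ℝ) :
    lorentzForm e ρ lam η x ψ s s E = lorentzMix e ρ lam η x ψ E := by
  simp [lorentzForm, lorentzMix]

lemma norm_lorentzForm_le (h : IsDensity ρ) (hη : 0 < η) (ψ : EuclideanSpace ℂ (Fin N))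
    (s t E : ℝ) : ‖lorentzForm e ρ lam η x ψ s t E‖ ≤ lorentzMix e ρ lam η x ψ E := by
  refine (norm_sum_le _ _).trans_eq (Finset.sum_congr rfl fun j _ => ?_)
  rw [norm_mul, norm_mul, norm_exp_I_mul_sub, Complex.norm_real, Complex.norm_real,
    Real.norm_of_nonneg (weight_nonneg e ψ j),
    Real.norm_of_nonneg (lorentz_nonneg (width_pos h hη _ _).le _ _), mul_one]

lemma integral_lorentzMix (h : IsDensity ρ) (hη : 0 < η) {ψ : EuclideanSpace ℂ (Fin N)}
    (hψ : ‖ψ‖ = 1) : Integrable (lorentzMix e ρ lam η x ψ) ∧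
      ∫ E, lorentzMix e ρ lam η x ψ E = 2 * Real.pi := by
  have hi : ∀ j, Integrable fun E =>
      weight e ψ j * lorentz (width ρ lam η (x j)) (center ρ lam η (x j)) E := fun j =>
    (integral_lorentz (width_pos h hη lam (x j)) _).1.const_mul _
  refine ⟨integrable_finsetSum _ fun j _ => hi j, ?_⟩
  unfold lorentzMix
  rw [integral_finsetSum _ fun j _ => hi j]
  simp only [integral_const_mul, (integral_lorentz (width_pos h hη lam _) _).2.2]
  rw [← Finset.sum_mul, sum_weight e hψ, one_mul]

lemma integral_lorentzForm (h : IsDensity ρ) (hη : 0 < η) (ψ : EuclideanSpace ℂ (Fin N)) {t : ℝ}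
    (ht : 0 ≤ t) : Integrable (lorentzForm e ρ lam η x ψ 0 t) ∧
      ∫ E : ℝ, Complex.exp (E * t * Complex.I) * lorentzForm e ρ lam η x ψ 0 t E =
        2 * Real.pi * Real.exp (-η * t) * ∑ j, (weight e ψ j : ℂ) *
          Complex.exp (-(lam ^ 2 * t) * freeSt ρ (η + x j * Complex.I)) := by
  have hL := fun j => integral_lorentz (width_pos h hη lam (x j)) (center ρ lam η (x j))
  have hi : ∀ j, Integrable fun E => (weight e ψ j : ℂ) *
      Complex.exp (Complex.I * ((0 : ℝ) - t) * x j) *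
      (lorentz (width ρ lam η (x j)) (center ρ lam η (x j)) E : ℂ) := fun j =>
    (hL j).1.ofReal.const_mul _
  refine ⟨integrable_finsetSum _ fun j _ => hi j, ?_⟩
  have hbdd : ∀ j, Integrable fun E : ℝ => Complex.exp (E * t * Complex.I) *
      ((weight e ψ j : ℂ) * Complex.exp (Complex.I * ((0 : ℝ) - t) * x j) *
      (lorentz (width ρ lam η (x j)) (center ρ lam η (x j)) E : ℂ)) := fun j =>
    (hi j).bdd_mul (c := 1) (by fun_prop) (Eventually.of_forall fun E => by
      rw [Complex.norm_exp]; simp)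
  unfold lorentzForm
  simp only [Finset.mul_sum]
  rw [integral_finsetSum _ fun j _ => hbdd j]
  refine Finset.sum_congr rfl fun j _ => ?_
  have e1 : ∀ E : ℝ, Complex.exp (E * t * Complex.I) *
      ((weight e ψ j : ℂ) * Complex.exp (Complex.I * ((0 : ℝ) - t) * x j) *
      (lorentz (width ρ lam η (x j)) (center ρ lam η (x j)) E : ℂ)) =
      ((weight e ψ j : ℂ) * Complex.exp (Complex.I * ((0 : ℝ) - t) * x j)) *
      (Complex.exp (E * t * Complex.I) *
        (lorentz (width ρ lam η (x j)) (center ρ lam η (x j)) E : ℂ)) := fun E => by ring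
  simp only [e1]
  rw [integral_const_mul, (hL j).2.1 t, abs_of_nonneg ht]
  have e2 : Complex.exp (Complex.I * ((0 : ℝ) - t) * x j) *
      (Real.exp (-width ρ lam η (x j) * t) *
        Complex.exp (center ρ lam η (x j) * Complex.I * t)) =
      Real.exp (-η * t) * Complex.exp (-(lam ^ 2 * t) * freeSt ρ (η + x j * Complex.I)) := by
    rw [Complex.ofReal_exp, Complex.ofReal_exp, ← Complex.exp_add, ← Complex.exp_add,
      ← Complex.exp_add]
    congr 1
    unfold width center
    conv_rhs => rw [← Complex.re_add_im (freeSt ρ (η + x j * Complex.I))]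
    push_cast
    ring
  linear_combination (weight e ψ j : ℂ) * (2 * Real.pi) * e2

/-- Near the energy shell the averaged density of states is the superposition of Lorentzians. The
error is of order `|lam|` relative to the Lorentzians, so that it is small after integration although
these have height of order `lam ^ (-2)`. -/
lemma norm_specForm_sub_lorentzForm_le (hW : IsNearWigner ν ξ r μ) (hH : IsSelfAdjoint H₀)
    (h : IsRegularNear ρ ρ' E₀ κ c M) (hcl : IsCloseTo ν H₀ ξ ρ lam η δ)
    (hw : IsWeak κ c M lam η δ) (he : ∀ j, H₀ (e j) = (x j : ℂ) • e j)
    {ψ : EuclideanSpace ℂ (Fin N)} (hψ : ‖ψ‖ = 1)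
    (hx : ∀ j, weight e ψ j ≠ 0 → |x j - E₀| ≤ κ / 2) (s t : ℝ) {E : ℝ}
    (hE : |E - E₀| ≤ 3 / 4 * κ) :
    ‖specForm ν H₀ lam ξ η (prop H₀ (-s) ψ) (prop H₀ (-t) ψ) E -
      lorentzForm e ρ lam η x ψ s t E‖ ≤
      2 * δ + 2 * (compConst (c * Real.pi / 2) (stBound κ M) * |lam| *
        (1 + lorentzMix e ρ lam η x ψ E / (2 * (c * Real.pi / 2)))) := by
  have hη := hcl.pos
  have hre : ((η : ℂ) + E * Complex.I).re = η := by simp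
  set p : ℂ := η + E * Complex.I with hp
  set q : ℂ := p + lam ^ 2 * meanStieltjes ν H₀ lam ξ p with hq
  have hpos := re_meanStieltjes_nonneg hW hH lam (p := p) (by rw [hre]; exact hη)
  have hq0 : 0 < q.re := by rw [hq, re_add_sq_mul, hre]; positivity
  set G := meanResol ν H₀ lam ξ p with hG
  have hmean : ‖G - resol H₀ q‖ ≤ δ := hcl.mean p hre.ge
  have hn : ∀ s, ‖prop H₀ (-s) ψ‖ = 1 := fun s => by rw [norm_prop_apply hH, hψ]
  have h1 : ∀ s t, ‖inner ℂ (prop H₀ (-s) ψ) (G (prop H₀ (-t) ψ)) -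
      inner ℂ (prop H₀ (-s) ψ) (resol H₀ q (prop H₀ (-t) ψ))‖ ≤ δ := fun s t => by
    rw [← inner_sub_right, ← sub_apply]
    refine (norm_inner_le_norm _ _).trans ?_
    rw [hn, one_mul]
    refine ((G - resol H₀ q).le_opNorm _).trans ?_
    rw [hn, mul_one]
    exact hmean
  set a : ℝ := c * Real.pi / 2
  set K₃ := compConst a (stBound κ M)
  set S : Fin N → ℂ := fun j =>
    (width ρ lam η (x j) : ℂ) + (E - center ρ lam η (x j) : ℝ) * Complex.I with hS
  have h2 : ∀ j, weight e ψ j ≠ 0 → ‖(q - Complex.I * x j)⁻¹ - (S j)⁻¹‖ ≤ K₃ * |lam| *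
      (1 + lorentz (width ρ lam η (x j)) (center ρ lam η (x j)) E / (2 * a)) := fun j hj =>
    hcl.norm_inv_sub_inv_le hW hH h hw hE (hx j hj)
  have h3 : ∀ s t : ℝ, ‖inner ℂ (prop H₀ (-s) ψ) (resol H₀ q (prop H₀ (-t) ψ)) -
      ∑ j, (weight e ψ j : ℂ) * Complex.exp (Complex.I * (s - t) * x j) * (S j)⁻¹‖ ≤
      K₃ * |lam| * (1 + lorentzMix e ρ lam η x ψ E / (2 * a)) := fun s t => by
    rw [inner_resol_prop e hH he hq0, ← Finset.sum_sub_distrib]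
    refine (norm_sum_le _ _).trans ?_
    have e1 : K₃ * |lam| * (1 + lorentzMix e ρ lam η x ψ E / (2 * a)) =
        ∑ j, weight e ψ j * (K₃ * |lam| *
          (1 + lorentz (width ρ lam η (x j)) (center ρ lam η (x j)) E / (2 * a))) := by
      have : ∀ j, weight e ψ j * (K₃ * |lam| *
          (1 + lorentz (width ρ lam η (x j)) (center ρ lam η (x j)) E / (2 * a))) =
          K₃ * |lam| * (weight e ψ j + weight e ψ j *
            lorentz (width ρ lam η (x j)) (center ρ lam η (x j)) E / (2 * a)) := fun j => by ring
      simp only [this]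
      rw [← Finset.mul_sum, Finset.sum_add_distrib, sum_weight e hψ, lorentzMix, Finset.sum_div]
    rw [e1]
    refine Finset.sum_le_sum fun j _ => ?_
    rw [← mul_sub, norm_mul, norm_mul, norm_exp_I_mul_sub, Complex.norm_real,
      Real.norm_of_nonneg (weight_nonneg e ψ j), mul_one]
    rcases eq_or_ne (weight e ψ j) 0 with h0 | h0
    · rw [h0, zero_mul, zero_mul]
    · exact mul_le_mul_of_nonneg_left (h2 j h0) (weight_nonneg e ψ j)
  have h4 : lorentzForm e ρ lam η x ψ s t E =
      ∑ j, (weight e ψ j : ℂ) * Complex.exp (Complex.I * (s - t) * x j) * (S j)⁻¹ +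
      (starRingEnd ℂ) (∑ j, (weight e ψ j : ℂ) * Complex.exp (Complex.I * (t - s) * x j) *
        (S j)⁻¹) := by
    rw [map_sum, ← Finset.sum_add_distrib]
    refine Finset.sum_congr rfl fun j _ => ?_
    have e2 : (starRingEnd ℂ) (Complex.exp (Complex.I * (t - s) * x j)) =
        Complex.exp (Complex.I * (s - t) * x j) := by
      rw [← Complex.exp_conj]
      congr 1
      simp; ring
    have e3 : (lorentz (width ρ lam η (x j)) (center ρ lam η (x j)) E : ℂ) =
        (S j)⁻¹ + (starRingEnd ℂ) (S j)⁻¹ := by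
      rw [inv_add_conj_inv]
      simp [hS, lorentz]
    rw [e3, map_mul, map_mul, e2, Complex.conj_ofReal]
    ring
  have h5 : ∀ s t : ℝ, ‖inner ℂ (prop H₀ (-s) ψ) (G (prop H₀ (-t) ψ)) -
      ∑ j, (weight e ψ j : ℂ) * Complex.exp (Complex.I * (s - t) * x j) * (S j)⁻¹‖ ≤
      δ + K₃ * |lam| * (1 + lorentzMix e ρ lam η x ψ E / (2 * a)) := fun s t =>
    (norm_sub_le_norm_sub_add_norm_sub _ _ _).trans (add_le_add (h1 s t) (h3 s t))
  rw [h4]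
  unfold specForm
  rw [← hp, ← hG]
  rw [add_sub_add_comm, ← map_sub]
  refine (norm_add_le _ _).trans ?_
  rw [RCLike.norm_conj]
  linarith [h5 s t, h5 t s]

end Shell

section Amplitude

variable {N : ℕ} {𝓧 : Type*} [MeasurableSpace 𝓧] {ν : Idx N → Measure 𝓧}
  [∀ k, IsProbabilityMeasure (ν k)] {ξ : 𝓧 → ℂ} {r μ : ℝ} {H₀ : Op N}
  {ρ ρ' : ℝ → ℝ} {E₀ κ c M : ℝ} {lam η δ : ℝ}
  (e : OrthonormalBasis (Fin N) ℂ (EuclideanSpace ℂ (Fin N))) {x : Fin N → ℝ}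

/-- The constant in the approximation of the averaged amplitude. -/
def ampConst (κ c M : ℝ) : ℝ :=
  3 * κ * (1 + 2 * compConst (c * Real.pi / 2) (stBound κ M)) +
    4 * (compConst (c * Real.pi / 2) (stBound κ M) * Real.pi / (c * Real.pi / 2)) +
    64 * Real.pi * (1 + stBound κ M) / κ

lemma compConst_nonneg {a K : ℝ} (ha : 0 < a) (hK : 0 ≤ K) : 0 ≤ compConst a K := by
  unfold compConst; positivity

lemma ampConst_nonneg (hκ : 0 < κ) (hc : 0 < c) (hM : 0 ≤ M) : 0 ≤ ampConst κ c M := by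
  have h1 := one_le_stBound hκ hM
  have hp := Real.pi_pos
  have h2 := compConst_nonneg (a := c * Real.pi / 2) (K := stBound κ M) (by positivity) (by linarith)
  unfold ampConst
  positivity

/-- The mass of the Lorentzians away from the energy shell. -/
lemma setIntegral_lorentzMix_le (h : IsRegularNear ρ ρ' E₀ κ c M) (hη : 0 < η)
    (hw : IsWeak κ c M lam η δ) {ψ : EuclideanSpace ℂ (Fin N)} (hψ : ‖ψ‖ = 1)
    (hx : ∀ j, weight e ψ j ≠ 0 → |x j - E₀| ≤ κ / 2) :
    ∫ E in {E : ℝ | |E - E₀| ≤ 3 / 4 * κ}ᶜ, lorentzMix e ρ lam η x ψ E ≤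
      32 * Real.pi * (η + lam ^ 2 * stBound κ M) / κ := by
  have hκ := h.pos_κ
  set b := κ / 8 with hb
  have hb0 : 0 < b := by positivity
  set A := η + lam ^ 2 * stBound κ M with hA
  have hd := h.density
  have hms : MeasurableSet {E : ℝ | |E - E₀| ≤ 3 / 4 * κ}ᶜ :=
    (measurableSet_le (by fun_prop) measurable_const).compl
  have hA0 : 0 ≤ A := by
    have := one_le_stBound h.pos_κ h.nonneg_M
    positivity
  have hi : ∀ j, Integrable fun E => weight e ψ j *
      (2 * A / b * lorentz b (center ρ lam η (x j)) E) := fun j =>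
    ((integral_lorentz hb0 _).1.const_mul _).const_mul _
  have hpt : ∀ E ∈ {E : ℝ | |E - E₀| ≤ 3 / 4 * κ}ᶜ, lorentzMix e ρ lam η x ψ E ≤
      ∑ j, weight e ψ j * (2 * A / b * lorentz b (center ρ lam η (x j)) E) := by
    intro E hE
    have hE' : 3 / 4 * κ < |E - E₀| := not_le.1 hE
    refine Finset.sum_le_sum fun j _ => ?_
    rcases eq_or_ne (weight e ψ j) 0 with h0 | h0
    · rw [h0, zero_mul, zero_mul]
    refine mul_le_mul_of_nonneg_left ?_ (weight_nonneg e ψ j)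
    have hxj := hx j h0
    have hΦ := h.norm_freeSt_shell_le hη hxj
    have hsh : |lam ^ 2 * (freeSt ρ (η + x j * Complex.I)).im| ≤ κ / 8 := by
      rw [abs_mul, abs_of_nonneg (sq_nonneg lam)]
      refine le_trans ?_ hw.shift
      gcongr
      exact (Complex.abs_im_le_norm _).trans hΦ
    have hdist : b ≤ |E - center ρ lam η (x j)| := by
      have h1 := abs_sub_le E (center ρ lam η (x j)) E₀
      have h2 : |center ρ lam η (x j) - E₀| ≤ κ / 2 + κ / 8 := by
        unfold center
        have := abs_sub (x j - E₀) (lam ^ 2 * (freeSt ρ (η + x j * Complex.I)).im)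
        rw [show x j - E₀ - lam ^ 2 * (freeSt ρ (η + x j * Complex.I)).im =
          x j - lam ^ 2 * (freeSt ρ (η + x j * Complex.I)).im - E₀ by ring] at this
        linarith
      linarith
    refine (lorentz_le (width_pos hd hη _ _).le hb0 hdist).trans ?_
    have h3 := lorentz_nonneg hb0.le (center ρ lam η (x j)) E
    have h4 : width ρ lam η (x j) ≤ A := by
      unfold width
      rw [hA]
      gcongr
      exact (Complex.re_le_norm _).trans hΦ
    gcongr
  have hR0 : ∀ E, 0 ≤ ∑ j, weight e ψ j * (2 * A / b * lorentz b (center ρ lam η (x j)) E) :=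
    fun E => Finset.sum_nonneg fun j _ => mul_nonneg (weight_nonneg e ψ j)
      (mul_nonneg (by positivity) (lorentz_nonneg hb0.le _ _))
  calc _ ≤ ∫ E in {E : ℝ | |E - E₀| ≤ 3 / 4 * κ}ᶜ,
        ∑ j, weight e ψ j * (2 * A / b * lorentz b (center ρ lam η (x j)) E) :=
        setIntegral_mono_on (integral_lorentzMix e hd hη hψ).1.integrableOn
          (integrable_finsetSum _ fun j _ => hi j).integrableOn hms hpt
    _ ≤ ∫ E, ∑ j, weight e ψ j * (2 * A / b * lorentz b (center ρ lam η (x j)) E) :=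
        setIntegral_le_integral (integrable_finsetSum _ fun j _ => hi j)
          (Eventually.of_forall hR0)
    _ = 32 * Real.pi * A / κ := by
        rw [integral_finsetSum _ fun j _ => hi j]
        simp only [integral_const_mul, (integral_lorentz hb0 _).2.2]
        rw [← Finset.sum_mul, sum_weight e hψ, hb]
        field_simp
        ring

/-- The averaged amplitude is the superposition of the decaying exponentials with the rates of the
self energy at the unperturbed energies. -/
theorem norm_inner_meanProp_sub_sum_le (hW : IsNearWigner ν ξ r μ) (hH : IsSelfAdjoint H₀)
    (h : IsRegularNear ρ ρ' E₀ κ c M) (hcl : IsCloseTo ν H₀ ξ ρ lam η δ)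
    (hw : IsWeak κ c M lam η δ) (he : ∀ j, H₀ (e j) = (x j : ℂ) • e j)
    {ψ : EuclideanSpace ℂ (Fin N)} (hψ : ‖ψ‖ = 1)
    (hx : ∀ j, weight e ψ j ≠ 0 → |x j - E₀| ≤ κ / 2) {t : ℝ} (ht : 0 ≤ t) (hηt : η * t ≤ 1) :
    ‖inner ℂ ψ (meanProp ν H₀ lam ξ t (prop H₀ (-t) ψ)) - ∑ j, (weight e ψ j : ℂ) *
      Complex.exp (-(lam ^ 2 * t) * freeSt ρ (η + x j * Complex.I))‖ ≤ ampConst κ c M * |lam| := by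
  have hκ := h.pos_κ
  have hη := hcl.pos
  have hd := h.density
  have hK := one_le_stBound hκ h.nonneg_M
  have hπ := Real.pi_pos
  have ha : 0 < c * Real.pi / 2 := by have := h.pos_c; positivity
  set a : ℝ := c * Real.pi / 2 with ha'
  set K := stBound κ M with hK'
  set K₃ := compConst a K with hK₃
  have hK₃0 : 0 ≤ K₃ := compConst_nonneg ha (by linarith)
  set I : Set ℝ := {E : ℝ | |E - E₀| ≤ 3 / 4 * κ} with hI
  have hIe : I = Set.Icc (E₀ - 3 / 4 * κ) (E₀ + 3 / 4 * κ) := by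
    ext E
    change |E - E₀| ≤ 3 / 4 * κ ↔ _
    rw [abs_le, Set.mem_Icc]
    constructor <;> rintro ⟨_, _⟩ <;> constructor <;> linarith
  have hIm : MeasurableSet I := hIe ▸ measurableSet_Icc
  have hIv : volume.real I = 3 / 2 * κ := by
    rw [hIe, Real.volume_real_Icc_of_le (by linarith)]; ring
  have hIf : IsFiniteMeasure (volume.restrict I) := by
    rw [hIe]; infer_instance
  obtain ⟨hmi, hmass⟩ := integral_lorentzMix (x := x) e hd (lam := lam) hη hψ
  obtain ⟨hli, hlt⟩ := integral_lorentzForm (x := x) e hd (lam := lam) hη ψ ht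
  set d₀ := lorentzMix e ρ lam η x ψ with hd₀
  set R : ℝ → ℝ := fun E => 2 * δ + 2 * (K₃ * |lam| * (1 + d₀ E / (2 * a))) with hR
  have hRi : IntegrableOn R I :=
    (integrable_const _).add ((((integrable_const _).add
      (hmi.integrableOn.div_const _)).const_mul _).const_mul _)
  have hRint : ∫ E in I, R E ≤ 3 / 2 * κ * (2 * δ + 2 * (K₃ * |lam|)) +
      2 * (K₃ * |lam|) * (Real.pi / a) := by
    have e1 : R = fun E => (2 * δ + 2 * (K₃ * |lam|)) + (2 * (K₃ * |lam|) / (2 * a)) * d₀ E := by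
      funext E; rw [hR]; ring
    rw [e1, integral_add (integrable_const _) (hmi.integrableOn.const_mul _), setIntegral_const,
      hIv, integral_const_mul, smul_eq_mul]
    have h1 : ∫ E in I, d₀ E ≤ 2 * Real.pi := by
      rw [← hmass]
      exact setIntegral_le_integral hmi (Eventually.of_forall fun E => Finset.sum_nonneg fun j _ =>
        mul_nonneg (weight_nonneg e ψ j) (lorentz_nonneg (width_pos hd hη _ _).le _ _))
    have h2 : 2 * (K₃ * |lam|) / (2 * a) * ∫ E in I, d₀ E ≤
        2 * (K₃ * |lam|) / (2 * a) * (2 * Real.pi) := by gcongr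
    have h3 : 2 * (K₃ * |lam|) / (2 * a) * (2 * Real.pi) = 2 * (K₃ * |lam|) * (Real.pi / a) := by
      field_simp
    linarith
  have hfar := setIntegral_lorentzMix_le e h hη hw hψ hx
  -- the density of a unit vector has the same total mass as the Lorentzians, so that what is known on
  -- `I` bounds its mass off `I`
  have hdiag : ∀ y : EuclideanSpace ℂ (Fin N), ‖y‖ = 1 →
      Integrable (fun E => (specForm ν H₀ lam ξ η y y E).re) ∧
      ∫ E, (specForm ν H₀ lam ξ η y y E).re = ∫ E, d₀ E := by
    intro y hy
    obtain ⟨h1, h2⟩ := integral_specForm hW hH lam hη y y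
    refine ⟨h1.re, ?_⟩
    have h3 := h2 0
    simp only [Complex.ofReal_zero, mul_zero, zero_mul, Complex.exp_zero, one_mul, abs_zero,
      Real.exp_zero, Complex.ofReal_one, mul_one, meanProp_zero, one_apply_eq_self,
      inner_self_eq_norm_sq_to_K, hy] at h3
    have h4 : ∫ E, (specForm ν H₀ lam ξ η y y E).re =
        (∫ E, specForm ν H₀ lam ξ η y y E).re := integral_re h1
    rw [h4, h3, hmass]
    simp
  have hnφ : ∀ s, ‖prop H₀ (-s) ψ‖ = 1 := fun s => by rw [norm_prop_apply hH, hψ]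
  have hclose : ∀ s s' E, E ∈ I → ‖specForm ν H₀ lam ξ η (prop H₀ (-s) ψ) (prop H₀ (-s') ψ) E -
      lorentzForm e ρ lam η x ψ s s' E‖ ≤ R E := fun s s' E hE =>
    norm_specForm_sub_lorentzForm_le e hW hH h hcl hw he hψ hx s s' hE
  have hclose' : ∀ s E, E ∈ I →
      d₀ E - R E ≤ (specForm ν H₀ lam ξ η (prop H₀ (-s) ψ) (prop H₀ (-s) ψ) E).re := by
    intro s E hE
    have h1 := (Complex.abs_re_le_norm _).trans (hclose s s E hE)
    rw [lorentzForm_self, Complex.sub_re, Complex.ofReal_re] at h1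
    linarith [(abs_le.1 h1).1]
  obtain ⟨hfi, hft⟩ := integral_specForm hW hH lam hη (prop H₀ (-0) ψ) (prop H₀ (-t) ψ)
  have key := norm_integral_mul_sub_le hIm hfi hli
    (u := fun E : ℝ => Complex.exp (E * t * Complex.I)) (by fun_prop)
    (fun E => by rw [Complex.norm_exp]; simp) hmi (hdiag _ (hnφ 0)).1 (hdiag _ (hnφ t)).1 hRi
    (hclose 0 t) (hclose' 0) (hclose' t) (fun E => norm_specForm_le hW hH lam hη _ _ E)
    (fun E => norm_lorentzForm_le e hd hη ψ 0 t E) (hdiag _ (hnφ 0)).2 (hdiag _ (hnφ t)).2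
  rw [hft t, hlt, abs_of_nonneg ht, ← mul_sub, neg_zero, prop_zero, one_apply_eq_self, norm_mul,
    norm_mul, norm_mul, Complex.norm_real, Complex.norm_real, Complex.norm_ofNat,
    Real.norm_of_nonneg hπ.le, Real.norm_of_nonneg (Real.exp_pos _).le] at key
  set X := ‖inner ℂ ψ (meanProp ν H₀ lam ξ t (prop H₀ (-t) ψ)) - ∑ j, (weight e ψ j : ℂ) *
      Complex.exp (-(lam ^ 2 * t) * freeSt ρ (η + x j * Complex.I))‖ with hX
  -- the damping factor is harmless: `2 * π * exp (-η * t) ≥ 2 * π / e ≥ 1`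
  have hexp : 1 ≤ 2 * Real.pi * Real.exp (-η * t) := by
    have h1 : Real.exp (-1) ≤ Real.exp (-η * t) := Real.exp_le_exp.2 (by linarith)
    have h2 : Real.exp 1 < 2.7182818286 := Real.exp_one_lt_d9
    have h3 : Real.exp (-1) * Real.exp 1 = 1 := by rw [← Real.exp_add]; simp
    have h4 := Real.pi_gt_three
    have h5 := Real.exp_pos (-1)
    nlinarith
  have hX0 : X ≤ 2 * Real.pi * Real.exp (-η * t) * X :=
    le_mul_of_one_le_left (norm_nonneg _) hexp
  refine hX0.trans (key.trans ?_)
  have hl2 : lam ^ 2 ≤ |lam| := by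
    rw [← sq_abs, sq]; exact mul_le_of_le_one_left (abs_nonneg _) hw.le_one
  have hδ : 2 * δ ≤ |lam| := hw.δ_le.trans hl2
  have hA : η + lam ^ 2 * K ≤ |lam| * (1 + K) := by
    have : lam ^ 2 * K ≤ |lam| * K := by gcongr
    linarith [hw.η_le]
  calc _ ≤ 2 * (3 / 2 * κ * (|lam| + 2 * (K₃ * |lam|)) + 2 * (K₃ * |lam|) * (Real.pi / a)) +
        2 * (32 * Real.pi * (|lam| * (1 + K)) / κ) := by
        have h1 : 3 / 2 * κ * (2 * δ + 2 * (K₃ * |lam|)) ≤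
          3 / 2 * κ * (|lam| + 2 * (K₃ * |lam|)) := by gcongr
        have h2 : 32 * Real.pi * (η + lam ^ 2 * K) / κ ≤
          32 * Real.pi * (|lam| * (1 + K)) / κ := by gcongr
        linarith
    _ = ampConst κ c M * |lam| := by
        rw [ampConst, ← ha', ← hK', ← hK₃]; ring

/-- Fermi's golden rule for the averaged amplitude. -/
theorem abs_norm_sq_inner_meanProp_sub_exp_le (hW : IsNearWigner ν ξ r μ) (hH : IsSelfAdjoint H₀)
    (h : IsRegularNear ρ ρ' E₀ κ c M) (hcl : IsCloseTo ν H₀ ξ ρ lam η δ)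
    (hw : IsWeak κ c M lam η δ) (he : ∀ j, H₀ (e j) = (x j : ℂ) • e j)
    {ψ : EuclideanSpace ℂ (Fin N)} (hψ : ‖ψ‖ = 1) {Δ : ℝ} (hΔ : Δ ≤ κ / 2)
    (hx : ∀ j, weight e ψ j ≠ 0 → |x j - E₀| ≤ Δ) {t : ℝ} (ht : 0 ≤ t) (hηt : η * t ≤ 1) :
    |‖(inner ℂ ψ (meanProp ν H₀ lam ξ t (prop H₀ (-t) ψ)) : ℂ)‖ ^ 2 -
      Real.exp (-(2 * Real.pi * ρ E₀ * lam ^ 2 * t))| ≤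
      2 * (ampConst κ c M + stBound κ M) * (lam ^ 2 * t * Δ + |lam| * (1 + lam ^ 2 * t)) := by
  have hκ := h.pos_κ
  have hη := hcl.pos
  have hd := h.density
  have hK := one_le_stBound hκ h.nonneg_M
  have hA := ampConst_nonneg hκ h.pos_c h.nonneg_M
  set K := stBound κ M
  set τ := lam ^ 2 * t with hτ
  have hτ0 : 0 ≤ τ := by positivity
  have h1 := norm_inner_meanProp_sub_sum_le e hW hH h hcl hw he hψ
    (fun j hj => (hx j hj).trans hΔ) ht hηt
  set A : ℂ := inner ℂ ψ (meanProp ν H₀ lam ξ t (prop H₀ (-t) ψ)) with hA'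
  have hA1 : ‖A‖ ≤ 1 := by
    refine (norm_inner_le_norm _ _).trans ?_
    rw [hψ, one_mul]
    refine ((meanProp ν H₀ lam ξ t).le_opNorm _).trans ?_
    rw [norm_prop_apply hH, hψ, mul_one]
    exact norm_meanProp_le lam hH t
  have hre : ∀ y : ℝ, ((η : ℂ) + y * Complex.I).re = η := fun y => by simp
  have him : ∀ y : ℝ, ((η : ℂ) + y * Complex.I).im = y := fun y => by simp
  set Φ : ℝ → ℂ := fun y => freeSt ρ (η + y * Complex.I) with hΦ
  have hΦ0 : ∀ y, 0 ≤ (Φ y).re := fun y => re_freeSt_nonneg hd (by rw [hre]; exact hη)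
  set B : ℂ := Complex.exp (-(lam ^ 2 * t) * Φ E₀) with hB
  have hBn : ‖B‖ = Real.exp (-τ * (Φ E₀).re) := by
    have e1 : -((lam : ℂ) ^ 2 * t) * Φ E₀ = ((-τ : ℝ) : ℂ) * Φ E₀ := by rw [hτ]; push_cast; ring
    rw [hB, Complex.norm_exp, e1, Complex.re_ofReal_mul]
  have hB1 : ‖B‖ ≤ 1 := by
    rw [hBn, Real.exp_le_one_iff]
    nlinarith [mul_nonneg hτ0 (hΦ0 E₀)]
  have hΔ0 : 0 ≤ Δ := by
    obtain ⟨j, hj⟩ : ∃ j, weight e ψ j ≠ 0 := by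
      by_contra! h0
      have := sum_weight e hψ
      simp [h0] at this
    exact (abs_nonneg _).trans (hx j hj)
  -- on the left half plane the exponential is a contraction
  have hexp : ∀ z w : ℂ, 0 ≤ z.re → 0 ≤ w.re →
      ‖Complex.exp (-(lam ^ 2 * t) * z) - Complex.exp (-(lam ^ 2 * t) * w)‖ ≤ τ * ‖z - w‖ := by
    intro z w hz hw'
    have hconv : Convex ℝ {z : ℂ | 0 ≤ z.re} := convex_halfSpace_re_ge 0
    refine hconv.norm_image_sub_le_of_norm_hasDerivWithin_le (𝕜 := ℂ)
      (f := fun z => Complex.exp (-(lam ^ 2 * t) * z))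
      (f' := fun z => Complex.exp (-(lam ^ 2 * t) * z) * (-(lam ^ 2 * t)))
      (fun z _ => ?_) (fun z hz => ?_) hw' hz
    · have := ((hasDerivAt_id z).const_mul (-((lam : ℂ) ^ 2 * t))).cexp
      simp only [id, mul_one] at this
      exact this.hasDerivWithinAt
    · have e1 : -((lam : ℂ) ^ 2 * t) = ((-τ : ℝ) : ℂ) := by rw [hτ]; push_cast; ring
      have hz' : 0 ≤ z.re := hz
      rw [norm_mul, e1, Complex.norm_exp, Complex.re_ofReal_mul, Complex.norm_real, norm_neg,
        Real.norm_of_nonneg hτ0]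
      refine mul_le_of_le_one_left hτ0 ?_
      rw [Real.exp_le_one_iff]
      nlinarith [mul_nonneg hτ0 hz']
  -- all relevant eigenvalues are within `Δ` of `E₀`, where the self energy is Lipschitz
  have h2 : ‖(∑ j, (weight e ψ j : ℂ) * Complex.exp (-(lam ^ 2 * t) * Φ (x j))) - B‖ ≤
      τ * (K * Δ) := by
    have e1 : B = ∑ j, (weight e ψ j : ℂ) * B := by
      rw [← Finset.sum_mul, ← Complex.ofReal_sum, sum_weight e hψ, Complex.ofReal_one, one_mul]
    have e2 : τ * (K * Δ) = ∑ j, weight e ψ j * (τ * (K * Δ)) := by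
      rw [← Finset.sum_mul, sum_weight e hψ, one_mul]
    rw [e1, ← Finset.sum_sub_distrib, e2]
    refine (norm_sum_le _ _).trans (Finset.sum_le_sum fun j _ => ?_)
    rw [← mul_sub, norm_mul, Complex.norm_real, Real.norm_of_nonneg (weight_nonneg e ψ j)]
    rcases eq_or_ne (weight e ψ j) 0 with h0 | h0
    · rw [h0, zero_mul, zero_mul]
    refine mul_le_mul_of_nonneg_left ?_ (weight_nonneg e ψ j)
    refine (hexp _ _ (hΦ0 _) (hΦ0 _)).trans (mul_le_mul_of_nonneg_left ?_ hτ0)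
    have hxj := hx j h0
    have h3 := h.norm_freeSt_sub_le (q := η + x j * Complex.I) (q' := η + E₀ * Complex.I)
      (by rw [hre]; exact hη) (by rw [hre]; exact hη) (by rw [him]; linarith)
      (by rw [him, sub_self, abs_zero]; positivity)
    refine h3.trans (mul_le_mul_of_nonneg_left ?_ (by linarith))
    rw [show (η : ℂ) + x j * Complex.I - (η + E₀ * Complex.I) =
      ((x j - E₀ : ℝ) : ℂ) * Complex.I by push_cast; ring, norm_mul, Complex.norm_I, mul_one,
      Complex.norm_real, Real.norm_eq_abs]
    exact hxj
  have h3 : ‖A - B‖ ≤ ampConst κ c M * |lam| + τ * (K * Δ) :=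
    (norm_sub_le_norm_sub_add_norm_sub _ _ _).trans (add_le_add h1 h2)
  have h4 : |‖A‖ ^ 2 - ‖B‖ ^ 2| ≤ 2 * ‖A - B‖ := by
    rw [show ‖A‖ ^ 2 - ‖B‖ ^ 2 = (‖A‖ + ‖B‖) * (‖A‖ - ‖B‖) by ring, abs_mul,
      abs_of_nonneg (by positivity)]
    have := abs_norm_sub_norm_le A B
    gcongr
    linarith
  -- the rate at `E₀` is `π * ρ E₀` up to the regularization `η ≤ |lam|`
  have h5 : |‖B‖ ^ 2 - Real.exp (-(2 * Real.pi * ρ E₀ * lam ^ 2 * t))| ≤ 2 * τ * (K * |lam|) := by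
    have h6 := hexp (Φ E₀).re (Real.pi * ρ E₀ : ℝ) (by simpa using hΦ0 E₀)
      (by
        have := hd.nonneg E₀
        have := Real.pi_pos
        rw [Complex.ofReal_re]
        positivity)
    have h7 := h.abs_re_freeSt_sub_le hη
    have e1 : ∀ y : ℝ, Complex.exp (-((lam : ℂ) ^ 2 * t) * y) = (Real.exp (-τ * y) : ℝ) := by
      intro y; rw [hτ]; push_cast; congr 1
    rw [e1, e1, ← Complex.ofReal_sub, Complex.norm_real, Real.norm_eq_abs, ← Complex.ofReal_sub,
      Complex.norm_real, Real.norm_eq_abs] at h6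
    have e2 : Real.exp (-(2 * Real.pi * ρ E₀ * lam ^ 2 * t)) =
        Real.exp (-τ * (Real.pi * ρ E₀)) ^ 2 := by
      rw [← Real.exp_nat_mul]
      congr 1
      rw [hτ]; push_cast; ring
    have hb : Real.exp (-τ * (Real.pi * ρ E₀)) ≤ 1 := by
      rw [Real.exp_le_one_iff]
      have := mul_nonneg hτ0 (mul_nonneg Real.pi_pos.le (hd.nonneg E₀))
      linarith
    have hb0 := Real.exp_pos (-τ * (Real.pi * ρ E₀))
    rw [e2, hBn] at *
    set u := Real.exp (-τ * (Φ E₀).re)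
    set v := Real.exp (-τ * (Real.pi * ρ E₀))
    have hu0 : 0 ≤ u := (Real.exp_pos _).le
    rw [show u ^ 2 - v ^ 2 = (u + v) * (u - v) by ring, abs_mul, abs_of_nonneg (by positivity)]
    calc (u + v) * |u - v| ≤ 2 * (τ * (K * η)) := by
          gcongr
          · linarith
          · exact h6.trans (mul_le_mul_of_nonneg_left h7 hτ0)
      _ ≤ 2 * (τ * (K * |lam|)) := by
          have := hw.η_le
          gcongr
      _ = _ := by ring
  have h6 := abs_sub_le (‖A‖ ^ 2) (‖B‖ ^ 2) (Real.exp (-(2 * Real.pi * ρ E₀ * lam ^ 2 * t)))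
  have hl := abs_nonneg lam
  have i1 : 0 ≤ ampConst κ c M * (τ * Δ) := by positivity
  have i2 : 0 ≤ ampConst κ c M * (|lam| * τ) := by positivity
  have i3 : 0 ≤ K * |lam| := by positivity
  nlinarith

end Amplitude

/-! ### From matrices to operators -/

section Matrices

variable {N : ℕ} {H : Matrix (Fin N) (Fin N) ℂ}

lemma isSelfAdjoint_toEuclideanCLM (hH : H.IsHermitian) :
    IsSelfAdjoint (Matrix.toEuclideanCLM (𝕜 := ℂ) H) := by
  rw [isSelfAdjoint_iff, ← map_star, Matrix.star_eq_conjTranspose, hH.eq]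

lemma toEuclideanCLM_exp (A : Matrix (Fin N) (Fin N) ℂ) :
    Matrix.toEuclideanCLM (𝕜 := ℂ) (NormedSpace.exp A) =
      NormedSpace.exp (Matrix.toEuclideanCLM (𝕜 := ℂ) A) := by
  let _ : NormedRing (Matrix (Fin N) (Fin N) ℂ) := Matrix.linftyOpNormedRing
  let _ : NormedAlgebra ℂ (Matrix (Fin N) (Fin N) ℂ) := Matrix.linftyOpNormedAlgebra
  let _ : NormedAlgebra ℚ (Matrix (Fin N) (Fin N) ℂ) := NormedAlgebra.restrictScalars ℚ ℂ _
  let _ : NormedAlgebra ℚ (Op N) := NormedAlgebra.restrictScalars ℚ ℂ _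
  exact NormedSpace.map_exp (Matrix.toEuclideanCLM (𝕜 := ℂ) (n := Fin N))
    ((Matrix.toEuclideanCLM (𝕜 := ℂ) (n := Fin N)).toAlgEquiv.toLinearMap.continuous_of_finiteDimensional)
    A

lemma echo_eq (H₁ H₂ : Matrix (Fin N) (Fin N) ℂ) (ψ : EuclideanSpace ℂ (Fin N)) (t : ℝ) :
    echo H₁ H₂ ψ t = ‖(inner ℂ ψ (prop (Matrix.toEuclideanCLM (𝕜 := ℂ) H₂) t
      (prop (Matrix.toEuclideanCLM (𝕜 := ℂ) H₁) (-t) ψ)) : ℂ)‖ ^ 2 := by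
  unfold echo prop
  rw [map_mul, toEuclideanCLM_exp, toEuclideanCLM_exp, map_smul, map_smul, mul_apply_eq_comp]
  push_cast
  rw [mul_neg]

lemma toEuclideanCLM_eigenvectorBasis (hH : H.IsHermitian) (j : Fin N) :
    Matrix.toEuclideanCLM (𝕜 := ℂ) H (hH.eigenvectorBasis j) =
      (hH.eigenvalues j : ℂ) • hH.eigenvectorBasis j := by
  ext i
  rw [Matrix.ofLp_toEuclideanCLM, hH.mulVec_eigenvectorBasis]
  simp

lemma specProj_eigenvectorBasis (hH : H.IsHermitian) (I : Set ℝ) (j : Fin N) :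
    Matrix.toEuclideanCLM (𝕜 := ℂ) (specProj H I) (hH.eigenvectorBasis j) =
      ((I.indicator (fun _ => (1 : ℝ)) (hH.eigenvalues j) : ℝ) : ℂ) • hH.eigenvectorBasis j := by
  ext i
  rw [Matrix.ofLp_toEuclideanCLM, specProj, hH.cfc_eq, Matrix.IsHermitian.cfc,
    Unitary.conjStarAlgAut_apply, ← Matrix.mulVec_mulVec, ← Matrix.mulVec_mulVec]
  erw [hH.star_eigenvectorUnitary_mulVec]
  rw [Matrix.diagonal_mulVec_single, mul_one, ← mul_one ((RCLike.ofReal ∘ _) j), ← smul_eq_mul,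
    Pi.single_smul', Matrix.mulVec_smul, hH.eigenvectorUnitary_mulVec]
  simp

/-- A state that is localized in energy is a superposition of eigenvectors of such energies. -/
lemma IsLocalState.abs_sub_le {E₀ Δ : ℝ} {ψ : EuclideanSpace ℂ (Fin N)}
    (hψ : IsLocalState H E₀ Δ ψ) (hH : H.IsHermitian) (j : Fin N)
    (hj : weight hH.eigenvectorBasis ψ j ≠ 0) : |hH.eigenvalues j - E₀| ≤ Δ := by
  by_contra hout
  have hnot : hH.eigenvalues j ∉ Set.Icc (E₀ - Δ) (E₀ + Δ) := fun hmem => hout (by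
    rw [abs_le]; constructor <;> linarith [hmem.1, hmem.2])
  apply hj
  have h1 := specProj_eigenvectorBasis hH (Set.Icc (E₀ - Δ) (E₀ + Δ)) j
  rw [Set.indicator_of_notMem hnot, Complex.ofReal_zero, zero_smul] at h1
  have hsa : IsSelfAdjoint (Matrix.toEuclideanCLM (𝕜 := ℂ)
      (specProj H (Set.Icc (E₀ - Δ) (E₀ + Δ)))) :=
    isSelfAdjoint_toEuclideanCLM (cfc_predicate (R := ℝ) _ H)
  have h2 : inner ℂ (hH.eigenvectorBasis j) ψ = (0 : ℂ) := by
    rw [← hψ.localized, ← ContinuousLinearMap.adjoint_inner_left,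
      ← ContinuousLinearMap.star_eq_adjoint, hsa.star_eq, h1, inner_zero_left]
  rw [weight, h2]; simp

lemma ntr_toEuclideanCLM (M : Matrix (Fin N) (Fin N) ℂ) :
    ntr N (Matrix.toEuclideanCLM (𝕜 := ℂ) M) = ntrace M := by
  rw [ntr_apply, ntrace, Matrix.trace]
  congr 1
  refine Finset.sum_congr rfl fun i _ => ?_
  rw [entry_eq, Matrix.ofLp_toEuclideanCLM]
  simp

/-- The rotation of the spectral parameter to the right half plane. -/
lemma ntr_resol_eq (hH : H.IsHermitian) {q : ℂ} (hq : 0 < q.re) :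
    ntr N (resol (Matrix.toEuclideanCLM (𝕜 := ℂ) H) q) = Complex.I *
      ntrace ((H - (-(Complex.I * q)) • (1 : Matrix (Fin N) (Fin N) ℂ))⁻¹) := by
  set T := Matrix.toEuclideanCLM (𝕜 := ℂ) (n := Fin N) with hT
  set M := T.symm (resol (T H) q) with hM
  have h1 : M * (q • 1 - Complex.I • H) = 1 := by
    apply T.injective
    change T (M * (q • 1 - Complex.I • H)) = T 1
    rw [map_mul, hM, StarAlgEquiv.apply_symm_apply, map_sub, map_smul, map_smul, map_one]
    exact resol_mul_sub (isSelfAdjoint_toEuclideanCLM hH) hq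
  have h2 : (H - (-(Complex.I * q)) • (1 : Matrix (Fin N) (Fin N) ℂ))⁻¹ = (-Complex.I) • M := by
    refine Matrix.inv_eq_left_inv ?_
    have e : H - (-(Complex.I * q)) • (1 : Matrix (Fin N) (Fin N) ℂ) =
        Complex.I • (q • 1 - Complex.I • H) := by
      rw [smul_sub, smul_smul, smul_smul, Complex.I_mul_I, neg_smul, neg_smul, one_smul]
      abel
    rw [e, smul_mul_smul_comm, h1, neg_mul, Complex.I_mul_I, neg_neg, one_smul]
  have h3 : resol (T H) q = T M := by rw [hM, StarAlgEquiv.apply_symm_apply]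
  rw [h2, h3, ntr_toEuclideanCLM, ntrace, ntrace, Matrix.trace_smul, smul_eq_mul]
  linear_combination ((N : ℂ)⁻¹ * M.trace) * Complex.I_mul_I

lemma freeSt_eq (ρ : ℝ → ℝ) (q : ℂ) :
    freeSt ρ q = Complex.I * stieltjes ρ (-(Complex.I * q)) := by
  unfold freeSt stieltjes
  rw [← integral_const_mul]
  congr 1
  funext y
  have e : q - Complex.I * y = -Complex.I * (y - -(Complex.I * q)) := by
    linear_combination q * Complex.I_mul_I
  rw [e, div_mul_eq_div_div, div_neg, Complex.div_I, neg_neg]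
  ring

end Matrices

section Density

variable {ρ : ℝ → ℝ} {E₀ κ c : ℝ}

lemma abs_le_of_enorm_le {a b : ℝ} (hb : 0 ≤ b) (h : ‖a‖ₑ ≤ ENNReal.ofReal b) : |a| ≤ b := by
  rw [Real.enorm_eq_ofReal_abs] at h
  exact (ENNReal.ofReal_le_ofReal_iff hb).1 h

/-- A bound on the `C^{1,1}` norm yields the pointwise bounds on the density and its derivative. -/
lemma isRegularNear_of_admissible (hρ : IsDensity ρ) (hκ : 0 < κ) (hc : 0 < c)
    (hE : E₀ ∈ admissible ρ κ c) :
    IsRegularNear ρ (derivWithin ρ (Set.Icc (E₀ - κ) (E₀ + κ))) E₀ κ c (1 / c) := by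
  obtain ⟨-, hinf, hdiff, hnorm⟩ := hE
  set J := Set.Icc (E₀ - κ) (E₀ + κ) with hJ
  have hmem : ∀ {y}, |y - E₀| ≤ κ → y ∈ J := fun {y} hy => by
    rw [abs_le] at hy
    constructor <;> linarith [hy.1, hy.2]
  have hc' : 0 ≤ 1 / c := by positivity
  unfold c11Norm at hnorm
  refine ⟨hρ, hκ, hc, fun y hy => ?_, fun y hy => ?_, fun y hy => ?_, fun y hy => ?_,
    fun y z hy hz => ?_⟩
  · refine hinf.le.trans (csInf_le ⟨0, ?_⟩ ⟨y, hmem hy, rfl⟩)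
    rintro _ ⟨z, -, rfl⟩
    exact hρ.nonneg z
  · refine abs_le_of_enorm_le hc' (le_trans ?_ hnorm)
    refine le_trans ?_ (le_self_add.trans le_self_add)
    exact le_iSup₂ (f := fun x (_ : x ∈ J) => ‖ρ x‖ₑ) y (hmem hy)
  · rw [abs_lt] at hy
    have hnhds : J ∈ 𝓝 y := Icc_mem_nhds (by linarith) (by linarith)
    exact ((hdiff.differentiableOn one_ne_zero y (mem_of_mem_nhds hnhds)).hasDerivWithinAt).hasDerivAt
      hnhds
  · refine abs_le_of_enorm_le hc' (le_trans ?_ hnorm)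
    refine le_trans ?_ (le_add_self.trans le_self_add)
    exact le_iSup₂ (f := fun x (_ : x ∈ J) => ‖derivWithin ρ J x‖ₑ) y (hmem hy)
  · rcases eq_or_ne y z with rfl | hne
    · simp
    have h1 : ‖derivWithin ρ J y - derivWithin ρ J z‖ₑ / ‖y - z‖ₑ ≤ ENNReal.ofReal (1 / c) := by
      refine le_trans (le_trans ?_ le_add_self) hnorm
      refine le_trans ?_ (le_iSup₂ (f := fun x (_ : x ∈ J) => ⨆ y ∈ J, ⨆ _ : x ≠ y,
        ‖derivWithin ρ J x - derivWithin ρ J y‖ₑ / ‖x - y‖ₑ) y (hmem hy))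
      refine le_trans ?_ (le_iSup₂ (f := fun w (_ : w ∈ J) => ⨆ _ : y ≠ w,
        ‖derivWithin ρ J y - derivWithin ρ J w‖ₑ / ‖y - w‖ₑ) z (hmem hz))
      exact le_iSup (f := fun _ : y ≠ z =>
        ‖derivWithin ρ J y - derivWithin ρ J z‖ₑ / ‖y - z‖ₑ) hne
    have h0 : ‖y - z‖ₑ ≠ 0 := by simpa [sub_eq_zero] using hne
    rw [ENNReal.div_le_iff h0 enorm_ne_top, Real.enorm_eq_ofReal_abs (y - z),
      ← ENNReal.ofReal_mul hc'] at h1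
    exact abs_le_of_enorm_le (by positivity) h1

end Density

section Closeness

variable {N : ℕ} {𝓧 : Type*} [MeasurableSpace 𝓧] {ν : Idx N → Measure 𝓧}
  [∀ k, IsProbabilityMeasure (ν k)] {ξ : 𝓧 → ℂ} {r μ : ℝ}

/-- The two error sources for finite `N`: the local law assumed for the unperturbed matrix, and the
self-consistent equation, whose error `γ * (1 + |lam| * t) ^ 3` becomes a cubic moment under the
Laplace transform. -/
lemma isCloseTo_of_approx (hW : IsNearWigner ν ξ r μ) {H : Matrix (Fin N) (Fin N) ℂ}
    (hH : H.IsHermitian) {ρ : ℝ → ℝ} {lam η δ γ : ℝ} (hη : 0 < η)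
    (hfree : ∀ z : ℂ, η ≤ |z.im| →
      ‖ntrace ((H - z • (1 : Matrix (Fin N) (Fin N) ℂ))⁻¹) - stieltjes ρ z‖ ≤ δ)
    (hγ : ∀ q, 0 ≤ q → cumErr N r μ q ≤ γ * (1 + q) ^ 3)
    (hδ : |lam| * (γ * cubicMoment lam η) / η ≤ δ) :
    IsCloseTo ν (Matrix.toEuclideanCLM (𝕜 := ℂ) H) ξ ρ lam η δ := by
  have hγ0 : 0 ≤ γ := by
    have h1 := hγ 0 le_rfl
    have h2 := cumErr_nonneg (N := N) hW.r_nonneg hW.μ_nonneg (q := 0) le_rfl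
    linarith
  refine ⟨hη, fun q hq => ?_, fun p hp => ?_⟩
  · rw [ntr_resol_eq hH (hη.trans_le hq), freeSt_eq, ← mul_sub, norm_mul, Complex.norm_I, one_mul]
    refine hfree _ ?_
    simpa using hq.trans (le_abs_self _)
  · refine (norm_meanResol_sub_resol_le hW (isSelfAdjoint_toEuclideanCLM hH) lam hγ
      (hη.trans_le hp)).trans (le_trans ?_ hδ)
    have := cubicMoment_anti lam hη hp
    have h0 := cubicMoment_nonneg lam η
    gcongr

end Closeness

/-! ### Truncation of the entries -/

section Clamp

/-- The truncation of a complex number at modulus `r`. -/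
def clamp (r : ℝ) (w : ℂ) : ℂ := if ‖w‖ ≤ r then w else 0

lemma measurable_clamp (r : ℝ) : Measurable (clamp r) :=
  Measurable.ite (measurableSet_le measurable_norm measurable_const) measurable_id measurable_const

lemma norm_clamp_le {r : ℝ} (hr : 0 ≤ r) (w : ℂ) : ‖clamp r w‖ ≤ r := by
  unfold clamp
  split_ifs with h
  · exact h
  · simpa using hr

lemma norm_clamp_sub_le {r : ℝ} (hr : 0 < r) (hr1 : r ≤ 1) (n : ℕ) (w : ℂ) :
    ‖clamp r w - w‖ ≤ ‖w‖ ^ (n + 2) / r ^ (n + 2) := by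
  unfold clamp
  split_ifs with h
  · rw [sub_self, norm_zero]; positivity
  · have h' : r ≤ ‖w‖ := (not_le.1 h).le
    rw [zero_sub, norm_neg, le_div_iff₀ (by positivity)]
    calc ‖w‖ * r ^ (n + 2) = ‖w‖ * (r * r ^ (n + 1)) := by ring
      _ ≤ ‖w‖ * (1 * ‖w‖ ^ (n + 1)) := by gcongr
      _ = _ := by ring

lemma abs_norm_clamp_sq_sub_le {r : ℝ} (hr : 0 < r) (hr1 : r ≤ 1) (n : ℕ) (w : ℂ) :
    |‖clamp r w‖ ^ 2 - ‖w‖ ^ 2| ≤ ‖w‖ ^ (n + 2) / r ^ (n + 2) := by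
  unfold clamp
  split_ifs with h
  · rw [sub_self, abs_zero]; positivity
  · have h' : r ≤ ‖w‖ := (not_le.1 h).le
    rw [norm_zero, zero_pow two_ne_zero, zero_sub, abs_neg, abs_of_nonneg (by positivity),
      le_div_iff₀ (by positivity)]
    calc ‖w‖ ^ 2 * r ^ (n + 2) = ‖w‖ ^ 2 * (r ^ n * r ^ 2) := by ring
      _ ≤ ‖w‖ ^ 2 * (‖w‖ ^ n * 1 ^ 2) := by gcongr
      _ = _ := by ring

variable {N : ℕ} {ν : Idx N → Measure ℂ} [∀ k, IsProbabilityMeasure (ν k)]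

/-- Truncation changes the first two moments only slightly if a high moment is small. -/
lemma isNearWigner_clamp {r m : ℝ} (hr : 0 < r) (hr1 : r ≤ 1) (n : ℕ)
    (hi : ∀ k (p : ℕ), Integrable (fun w : ℂ => ‖w‖ ^ p) (ν k))
    (hm : ∀ k, ∫ w, ‖w‖ ^ (n + 2) ∂(ν k) ≤ m) (hm0 : 0 ≤ m)
    (h1 : ∀ k, ∫ w, w ∂(ν k) = 0)
    (h2 : ∀ k : Idx N, k.1.1 ≠ k.1.2 → ∫ w, ‖w‖ ^ 2 ∂(ν k) = (N : ℝ)⁻¹) :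
    IsNearWigner ν (clamp r) r (m / r ^ (n + 2)) := by
  have hc := measurable_clamp r
  have hmom : ∀ k, ∫ w, ‖w‖ ^ (n + 2) / r ^ (n + 2) ∂(ν k) ≤ m / r ^ (n + 2) := fun k => by
    rw [integral_div]
    gcongr
    exact hm k
  have hid : ∀ k, Integrable (fun w : ℂ => w) (ν k) := fun k => by
    have := hi k 1
    simp only [pow_one] at this
    exact (integrable_norm_iff (by fun_prop)).1 this
  refine ⟨hc, norm_clamp_le hr.le, fun k => ?_, fun k hk => ?_, hr.le, by positivity⟩
  · have hci : Integrable (clamp r) (ν k) :=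
      integrable_of_bdd hc (norm_clamp_le hr.le)
    have e : ∫ w, clamp r w ∂(ν k) = ∫ w, (clamp r w - w) ∂(ν k) := by
      rw [integral_sub hci (hid k), h1, sub_zero]
    rw [e]
    exact (norm_integral_le_of_norm_le ((hi k _).div_const _)
      (Eventually.of_forall (norm_clamp_sub_le hr hr1 n))).trans (hmom k)
  · have hci : Integrable (fun w => ‖clamp r w‖ ^ 2) (ν k) :=
      integrable_of_bdd (B := r ^ 2) (by fun_prop) fun w => by
        rw [norm_pow, norm_norm]
        gcongr
        exact norm_clamp_le hr.le w
    rw [← h2 k hk, ← integral_sub hci (hi k 2), ← Real.norm_eq_abs]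
    exact (norm_integral_le_of_norm_le ((hi k _).div_const _)
      (Eventually.of_forall (abs_norm_clamp_sq_sub_le hr hr1 n))).trans (hmom k)

end Clamp

section Wigner

variable {N : ℕ} {Ω : Type*} [MeasurableSpace Ω] {μod : Measure ℂ} {μd : Measure ℝ}
  {P : Measure Ω} {W : Ω → Matrix (Fin N) (Fin N) ℂ} {Cp : ℕ → ℝ}

/-- The laws of the entries of a random matrix on and above the diagonal. -/
def entryLaw (P : Measure Ω) (W : Ω → Matrix (Fin N) (Fin N) ℂ) (k : Idx N) : Measure ℂ :=
  P.map fun ω => W ω k.1.1 k.1.2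

/-- The law of an entry is that of `N ^ (-1/2)` times a random variable with the given moments. -/
lemma IsWigner.entryLaw_eq (hW : IsWigner μod μd P W) (k : Idx N) :
    (k.1.1 ≠ k.1.2 ∧ entryLaw P W k = μod.map fun z : ℂ => ((Real.sqrt N)⁻¹ : ℂ) * z) ∨
    (k.1.1 = k.1.2 ∧ entryLaw P W k = μd.map fun x : ℝ => ((Real.sqrt N)⁻¹ : ℂ) * (x : ℂ)) := by
  rcases k.2.lt_or_eq with h | h
  · exact Or.inl ⟨h.ne, hW.law_od _ _ h⟩
  · refine Or.inr ⟨h, ?_⟩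
    rw [← hW.law_d k.1.1, entryLaw, ← h]

lemma norm_inv_sqrt_mul (z : ℂ) :
    ‖((Real.sqrt N)⁻¹ : ℂ) * z‖ = (Real.sqrt N)⁻¹ * ‖z‖ := by
  rw [norm_mul, norm_inv, Complex.norm_real, Real.norm_of_nonneg (Real.sqrt_nonneg _)]

lemma IsWigner.integrable_pow (hW : IsWigner μod μd P W) (hμ : IsEntryLaw Cp μod μd) (k : Idx N)
    (p : ℕ) : Integrable (fun w : ℂ => ‖w‖ ^ p) (entryLaw P W k) := by
  rcases hW.entryLaw_eq k with ⟨-, h⟩ | ⟨-, h⟩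
  · rw [h, integrable_map_measure (by fun_prop) (by fun_prop)]
    refine ((hμ.integrable_od p).const_mul ((Real.sqrt N)⁻¹ ^ p)).congr
      (Eventually.of_forall fun z => ?_)
    simp only [Function.comp_apply]
    rw [norm_inv_sqrt_mul, mul_pow]
  · rw [h, integrable_map_measure (by fun_prop) (by fun_prop)]
    refine ((hμ.integrable_d p).const_mul ((Real.sqrt N)⁻¹ ^ p)).congr
      (Eventually.of_forall fun z => ?_)
    simp only [Function.comp_apply]
    rw [norm_inv_sqrt_mul, mul_pow, Complex.norm_real, Real.norm_eq_abs]

lemma IsWigner.integral_pow_le (hW : IsWigner μod μd P W) (hμ : IsEntryLaw Cp μod μd) (k : Idx N)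
    {p : ℕ} (hp : 1 ≤ p) :
    ∫ w, ‖w‖ ^ p ∂(entryLaw P W k) ≤ (Real.sqrt N)⁻¹ ^ p * Cp p := by
  have h0 := hμ.moments p hp
  have hd : 0 ≤ ∫ x, |x| ^ p ∂μd := integral_nonneg fun x => by positivity
  have hod : 0 ≤ ∫ z, ‖z‖ ^ p ∂μod := integral_nonneg fun x => by positivity
  rcases hW.entryLaw_eq k with ⟨-, h⟩ | ⟨-, h⟩
  · rw [h, integral_map (by fun_prop) (by fun_prop)]
    simp only [norm_inv_sqrt_mul, mul_pow]
    rw [integral_const_mul]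
    gcongr
    linarith
  · rw [h, integral_map (by fun_prop) (by fun_prop)]
    simp only [norm_inv_sqrt_mul, mul_pow, Complex.norm_real, Real.norm_eq_abs]
    rw [integral_const_mul]
    gcongr
    linarith

lemma IsWigner.integral_eq_zero (hW : IsWigner μod μd P W) (hμ : IsEntryLaw Cp μod μd)
    (k : Idx N) : ∫ w, w ∂(entryLaw P W k) = 0 := by
  rcases hW.entryLaw_eq k with ⟨-, h⟩ | ⟨-, h⟩
  · rw [h, integral_map (by fun_prop) (by fun_prop), integral_const_mul, hμ.mean_od, mul_zero]
  · rw [h, integral_map (by fun_prop) (by fun_prop), integral_const_mul, integral_complex_ofReal,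
      hμ.mean_d, Complex.ofReal_zero, mul_zero]

lemma IsWigner.integral_sq (hW : IsWigner μod μd P W) (hμ : IsEntryLaw Cp μod μd)
    (k : Idx N) (hk : k.1.1 ≠ k.1.2) : ∫ w, ‖w‖ ^ 2 ∂(entryLaw P W k) = (N : ℝ)⁻¹ := by
  rcases hW.entryLaw_eq k with ⟨-, h⟩ | ⟨h, -⟩
  · rw [h, integral_map (by fun_prop) (by fun_prop)]
    simp only [norm_inv_sqrt_mul, mul_pow]
    rw [integral_const_mul, hμ.var_od, mul_one, inv_pow, Real.sq_sqrt (Nat.cast_nonneg N)]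
  · exact absurd h hk

/-- The entries of `W` on and above the diagonal. -/
def entries (M : Matrix (Fin N) (Fin N) ℂ) (k : Idx N) : ℂ := M k.1.1 k.1.2

lemma IsWigner.measurable_entries (hW : IsWigner μod μd P W) :
    Measurable fun ω => entries (W ω) :=
  measurable_pi_lambda _ fun _ => hW.measurable _ _

variable [IsProbabilityMeasure P]

lemma IsWigner.isProbabilityMeasure_entryLaw (hW : IsWigner μod μd P W) (k : Idx N) :
    IsProbabilityMeasure (entryLaw P W k) :=
  Measure.isProbabilityMeasure_map (hW.measurable _ _).aemeasurable

lemma IsWigner.map_entries (hW : IsWigner μod μd P W) :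
    P.map (fun ω => entries (W ω)) = Measure.pi (entryLaw P W) :=
  (iIndepFun_iff_map_fun_eq_pi_map fun _ => (hW.measurable _ _).aemeasurable).1 hW.indep

/-- As long as no entry exceeds the cutoff, the truncation is invisible. -/
lemma ham_clamp_entries {H M : Matrix (Fin N) (Fin N) ℂ} (hM : M.IsHermitian) (lam : ℝ) {r : ℝ}
    (h : ∀ k : Idx N, ‖entries M k‖ ≤ r) :
    ham (Matrix.toEuclideanCLM (𝕜 := ℂ) H) lam (clamp r) (entries M) =
      Matrix.toEuclideanCLM (𝕜 := ℂ) (H + (lam : ℂ) • M) := by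
  rw [map_add, map_smul, ← sum_entryOp hM, ham, noise]
  congr 2
  refine Finset.sum_congr rfl fun k _ => ?_
  rw [clamp, if_pos (h k), entries]

lemma IsWigner.measureReal_exists_lt_le (hW : IsWigner μod μd P W) (hμ : IsEntryLaw Cp μod μd)
    {r : ℝ} (hr : 0 < r) {p : ℕ} (hp : 1 ≤ p) :
    P.real {ω | ∃ k : Idx N, r < ‖entries (W ω) k‖} ≤
      N ^ 2 * ((Real.sqrt N)⁻¹ ^ p * Cp p / r ^ p) := by
  have hk : ∀ k : Idx N, P.real {ω | r < ‖entries (W ω) k‖} ≤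
      (Real.sqrt N)⁻¹ ^ p * Cp p / r ^ p := by
    intro k
    have h1 := mul_meas_ge_le_integral_of_nonneg (μ := entryLaw P W k)
      (f := fun w : ℂ => ‖w‖ ^ p) (Eventually.of_forall fun w => by positivity)
      (hW.integrable_pow hμ k p) (r ^ p)
    rw [le_div_iff₀ (by positivity), mul_comm]
    refine le_trans ?_ (h1.trans (hW.integral_pow_le hμ k hp))
    gcongr
    rw [entryLaw, measureReal_def, measureReal_def, Measure.map_apply (hW.measurable _ _)
      (measurableSet_le measurable_const (by fun_prop))]
    refine ENNReal.toReal_mono (measure_ne_top _ _) (measure_mono fun ω hω => ?_)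
    have hω' : r < ‖W ω k.1.1 k.1.2‖ := hω
    change r ^ p ≤ ‖W ω k.1.1 k.1.2‖ ^ p
    gcongr
  have h0 : 0 ≤ (Real.sqrt N)⁻¹ ^ p * Cp p / r ^ p := by
    have := (integral_nonneg fun x => by positivity : 0 ≤ ∫ x, |x| ^ p ∂μd)
    have := (integral_nonneg fun x => by positivity : 0 ≤ ∫ z, ‖z‖ ^ p ∂μod)
    have := hμ.moments p hp
    have : 0 ≤ Cp p := by linarith
    positivity
  have e : {ω | ∃ k : Idx N, r < ‖entries (W ω) k‖} =
      ⋃ k : Idx N, {ω | r < ‖entries (W ω) k‖} := by ext ω; simp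
  rw [e]
  refine (measureReal_iUnion_fintype_le _).trans ((Finset.sum_le_sum fun k _ => hk k).trans ?_)
  rw [Finset.sum_const, nsmul_eq_mul]
  gcongr
  exact card_idx_le

end Wigner

section Cutoff

/-- The cutoff `N ^ (-1/2 + s)` for the entries. -/
def cutoff (N : ℕ) (s : ℝ) : ℝ := (N : ℝ) ^ (-(1 / 2) + s)

variable {N : ℕ} {s : ℝ}

lemma cutoff_pos (hN : 1 ≤ N) : 0 < cutoff N s := by
  have : (0 : ℝ) < N := by exact_mod_cast hN
  unfold cutoff; positivity

lemma cutoff_le_one (hN : 1 ≤ N) (hs : s ≤ 1 / 2) : cutoff N s ≤ 1 :=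
  Real.rpow_le_one_of_one_le_of_nonpos (by exact_mod_cast hN) (by linarith)

lemma cutoff_sq_mul (hN : 1 ≤ N) : cutoff N s ^ 2 * N = (N : ℝ) ^ (2 * s) := by
  have h : (0 : ℝ) < N := by exact_mod_cast hN
  rw [cutoff, ← Real.rpow_natCast, ← Real.rpow_mul h.le]
  nth_rw 2 [← Real.rpow_one (N : ℝ)]
  rw [← Real.rpow_add h]
  congr 1
  push_cast; ring

lemma cutoff_cube_mul (hN : 1 ≤ N) : cutoff N s ^ 3 * N = (N : ℝ) ^ (-(1 / 2) + 3 * s) := by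
  have h : (0 : ℝ) < N := by exact_mod_cast hN
  rw [cutoff, ← Real.rpow_natCast, ← Real.rpow_mul h.le]
  nth_rw 2 [← Real.rpow_one (N : ℝ)]
  rw [← Real.rpow_add h]
  congr 1
  push_cast; ring

lemma one_le_cutoff_sq_mul (hN : 1 ≤ N) (hs : 0 ≤ s) : 1 ≤ cutoff N s ^ 2 * N := by
  rw [cutoff_sq_mul hN]
  exact Real.one_le_rpow (by exact_mod_cast hN) (by linarith)

lemma inv_sqrt_pow_div_cutoff_pow (hN : 1 ≤ N) (p : ℕ) (a : ℝ) :
    (Real.sqrt N)⁻¹ ^ p * a / cutoff N s ^ p = a * (N : ℝ) ^ (-(s * p)) := by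
  have h : (0 : ℝ) < N := by exact_mod_cast hN
  have e : (N : ℝ) ^ (-(s * p)) = ((Real.sqrt N)⁻¹ / cutoff N s) ^ p := by
    rw [Real.sqrt_eq_rpow, ← Real.rpow_neg h.le, cutoff, ← Real.rpow_sub h, ← Real.rpow_natCast,
      ← Real.rpow_mul h.le]
    congr 1
    ring
  rw [e, div_pow]
  ring

/-- A fixed constant is eventually absorbed by a power of `N`. -/
lemma exists_forall_le_rpow (a : ℝ) {b : ℝ} (hb : 0 < b) : ∃ n : ℕ, 1 ≤ n ∧ ∀ N : ℕ, n ≤ N →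
    a ≤ (N : ℝ) ^ b := by
  have h := ((tendsto_rpow_atTop hb).comp tendsto_natCast_atTop_atTop).eventually_ge_atTop a
  obtain ⟨n, hn⟩ := eventually_atTop.1 h
  exact ⟨max n 1, le_max_right _ _, fun N hN => hn N (le_trans (le_max_left _ _) hN)⟩

end Cutoff

section Transfer

/-- With high probability a Wigner matrix agrees with its truncation, whose entries satisfy
`IsNearWigner`. The threshold depends only on the moments. -/
lemma exists_isNearWigner (Cp : ℕ → ℝ) {s D : ℝ} (hs : 0 < s) (hs' : s ≤ 1 / 12) (hD : 0 < D) :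
    ∃ n : ℕ, 1 ≤ n ∧ ∀ N : ℕ, n ≤ N → ∀ {Ω : Type*} [MeasurableSpace Ω] {μod : Measure ℂ}
      {μd : Measure ℝ} {P : Measure Ω} [IsProbabilityMeasure P]
      {W : Ω → Matrix (Fin N) (Fin N) ℂ}, IsEntryLaw Cp μod μd → IsWigner μod μd P W →
      (∃ μ, IsNearWigner (entryLaw P W) (clamp (cutoff N s)) (cutoff N s) μ ∧
        μ * N ^ 2 ≤ cutoff N s ^ 3 * N) ∧
      P.real {ω | ∃ k : Idx N, cutoff N s < ‖entries (W ω) k‖} ≤ (N : ℝ) ^ (-D) / 2 := by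
  -- the moment of order `p` gives the probability `N ^ (-s * p)` per entry; this is to beat `N ^ (-D)`
  -- together with the number `N ^ 2` of entries and the constants
  obtain ⟨m, hm⟩ := exists_nat_ge ((D + 4) / s)
  set p := m + 2 with hp
  have hsp : D + 4 ≤ s * p := by
    rw [div_le_iff₀ hs] at hm
    have : (m : ℝ) ≤ p := by rw [hp]; push_cast; linarith
    nlinarith
  obtain ⟨n, hn1, hn⟩ := exists_forall_le_rpow (2 * Cp p) one_pos
  refine ⟨n, hn1, fun N hN Ω _ μod μd P _ W hμ hW => ?_⟩
  have hN1 : 1 ≤ N := hn1.trans hN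
  have hNpos : (0 : ℝ) < N := by exact_mod_cast hN1
  have hN1' : (1 : ℝ) ≤ N := by exact_mod_cast hN1
  have hNC := hn N hN
  rw [Real.rpow_one] at hNC
  have hc := cutoff_pos (s := s) hN1
  have hc1 : cutoff N s ≤ 1 := cutoff_le_one hN1 (by linarith)
  have hp1 : 1 ≤ p := by omega
  have hCp : 0 ≤ Cp p := by
    have h1 : 0 ≤ ∫ x, |x| ^ p ∂μd := integral_nonneg fun x => by positivity
    have h2 : 0 ≤ ∫ z, ‖z‖ ^ p ∂μod := integral_nonneg fun x => by positivity
    have := hμ.moments p hp1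
    linarith
  have hsmall : N ^ 2 * ((Real.sqrt N)⁻¹ ^ p * Cp p / cutoff N s ^ p) ≤
      (N : ℝ) ^ (-D - 1) / 2 := by
    rw [inv_sqrt_pow_div_cutoff_pow hN1]
    have h1 : (N : ℝ) ^ (-(s * p)) ≤ (N : ℝ) ^ (-D - 4) :=
      Real.rpow_le_rpow_of_exponent_le hN1' (by linarith)
    calc (N : ℝ) ^ 2 * (Cp p * (N : ℝ) ^ (-(s * p))) ≤
          (N : ℝ) ^ 2 * (N / 2 * (N : ℝ) ^ (-D - 4)) := by gcongr; linarith
      _ = (N : ℝ) ^ (-D - 1) / 2 := by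
          have e : (N : ℝ) ^ (-D - 1) = N ^ 2 * N * (N : ℝ) ^ (-D - 4) := by
            rw [← pow_succ, ← Real.rpow_natCast, ← Real.rpow_add hNpos]
            congr 1; push_cast; ring
          rw [e]; ring
  have := hW.isProbabilityMeasure_entryLaw
  refine ⟨⟨_, isNearWigner_clamp hc hc1 m (hW.integrable_pow hμ)
    (fun k => hW.integral_pow_le hμ k hp1) (by positivity) (hW.integral_eq_zero hμ)
    (hW.integral_sq hμ), ?_⟩, ?_⟩
  · rw [cutoff_cube_mul hN1, mul_comm]
    refine hsmall.trans ?_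
    have h1 : (N : ℝ) ^ (-D - 1) ≤ (N : ℝ) ^ (-(1 / 2) + 3 * s) :=
      Real.rpow_le_rpow_of_exponent_le hN1' (by linarith)
    have h2 : 0 ≤ (N : ℝ) ^ (-D - 1) := by positivity
    linarith
  · refine (hW.measureReal_exists_lt_le hμ hc hp1).trans (hsmall.trans ?_)
    have h1 : (N : ℝ) ^ (-D - 1) ≤ (N : ℝ) ^ (-D) :=
      Real.rpow_le_rpow_of_exponent_le hN1' (by linarith)
    linarith

/-- Concentration of the amplitude around its average. -/
lemma exists_concentration {s D : ℝ} (hs : 0 < s) :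
    ∃ n : ℕ, 1 ≤ n ∧ ∀ N : ℕ, n ≤ N → ∀ {𝓧 : Type*} [MeasurableSpace 𝓧] {ν : Idx N → Measure 𝓧}
      [∀ k, IsProbabilityMeasure (ν k)] {ξ : 𝓧 → ℂ} {H₀ : Op N} {lam t : ℝ}
      {x y : EuclideanSpace ℂ (Fin N)}, Measurable ξ → (∀ w, ‖ξ w‖ ≤ cutoff N s) →
      IsSelfAdjoint H₀ → 0 ≤ t → ‖x‖ ≤ 1 → ‖y‖ ≤ 1 →
      (Measure.pi ν).real {z | (1 + |lam| * t) ^ 2 * (N : ℝ) ^ (-(1 / 2) + 4 * s) ≤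
        ‖inner ℂ x (prop (ham H₀ lam ξ z) t y) - inner ℂ x (meanProp ν H₀ lam ξ t y)‖} ≤
        (N : ℝ) ^ (-D) / 2 := by
  -- the moment of order `2 * p` gives the probability `N ^ (-2 * s * p)`, which beats `N ^ (-D)` with a
  -- power of `N` left to absorb the constants
  obtain ⟨p, hp⟩ := exists_nat_ge ((D + 1) / (2 * s))
  rw [div_le_iff₀ (by positivity)] at hp
  set A : ℝ := ∏ k ∈ Finset.range p, (((k : ℝ) + 1) ^ 2 + 1) with hA
  have hA0 : 0 ≤ A := Finset.prod_nonneg fun k _ => by positivity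
  obtain ⟨n, hn1, hn⟩ := exists_forall_le_rpow (2 * (A * 544 ^ p)) one_pos
  refine ⟨n, hn1, fun N hN 𝓧 _ ν _ ξ H₀ lam t x y hξ hr hH ht hx hy => ?_⟩
  have hN1 : 1 ≤ N := hn1.trans hN
  have hNpos : (0 : ℝ) < N := by exact_mod_cast hN1
  have hN1' : (1 : ℝ) ≤ N := by exact_mod_cast hN1
  have hNC := hn N hN
  rw [Real.rpow_one] at hNC
  have e1 : inner ℂ x (meanProp ν H₀ lam ξ t y) =
      ∫ z, inner ℂ x (prop (ham H₀ lam ξ z) t y) ∂(Measure.pi ν) := by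
    have := matEl_meanProp (ν := ν) lam hH hξ t (matEl x y)
    rwa [matEl_apply] at this
  have hmom := integral_norm_inner_prop_sub_pow_le ν hH lam hξ hr ht hx hy p
  rw [← e1] at hmom
  set c : ℂ := inner ℂ x (meanProp ν H₀ lam ξ t y) with hc
  set a : ℝ := 1 + |lam| * t with ha
  have ha0 : 0 < a := by positivity
  set ε : ℝ := a ^ 2 * (N : ℝ) ^ (-(1 / 2) + 4 * s) with hε
  have hε0 : 0 < ε := by positivity
  have hm : Measurable fun z : Idx N → 𝓧 => (inner ℂ x (prop (ham H₀ lam ξ z) t y) : ℂ) :=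
    measurable_inner_prop (measurable_ham hξ H₀ lam) t x y
  have hb : ∀ z, ‖(inner ℂ x (prop (ham H₀ lam ξ z) t y) : ℂ)‖ ≤ 1 := fun z =>
    (norm_inner_prop_le (isSelfAdjoint_ham hH _ _ _) t x y).trans (mul_le_one₀ hx (norm_nonneg _) hy)
  have hi : Integrable (fun z => ‖(inner ℂ x (prop (ham H₀ lam ξ z) t y) : ℂ) - c‖ ^ (2 * p))
      (Measure.pi ν) :=
    integrable_of_bdd (B := (1 + ‖c‖) ^ (2 * p)) (by fun_prop) fun z => by
      rw [norm_pow, norm_norm]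
      have := (norm_sub_le (inner ℂ x (prop (ham H₀ lam ξ z) t y) : ℂ) c).trans
        (add_le_add_left (hb z) _)
      gcongr
  have hmarkov := mul_meas_ge_le_integral_of_nonneg (μ := Measure.pi ν)
    (Eventually.of_forall fun z => by positivity) hi (ε ^ (2 * p))
  have hsub : (Measure.pi ν).real {z | ε ≤ ‖inner ℂ x (prop (ham H₀ lam ξ z) t y) - c‖} ≤
      (Measure.pi ν).real
        {z | ε ^ (2 * p) ≤ ‖(inner ℂ x (prop (ham H₀ lam ξ z) t y) : ℂ) - c‖ ^ (2 * p)} := by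
    refine measureReal_mono (fun z hz => ?_)
    have hz' : ε ≤ ‖inner ℂ x (prop (ham H₀ lam ξ z) t y) - c‖ := hz
    change ε ^ (2 * p) ≤ _
    gcongr
  have hinc := incrBound_le (N := N) (q := |lam| * t) (one_le_cutoff_sq_mul hN1 hs.le)
    (by positivity)
  rw [cutoff_cube_mul hN1, ← ha] at hinc
  have hinc0 : 0 ≤ incrBound N (|lam| * t * cutoff N s) := by
    have := (cutoff_pos (s := s) hN1).le
    unfold incrBound; positivity
  -- the moment bound exceeds `ε ^ (2 * p)` only by the factor `N ^ (-2 * s * p)`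
  have hε2 : 544 * a ^ 4 * ((N : ℝ) ^ (-(1 / 2) + 3 * s)) ^ 2 =
      544 * (N : ℝ) ^ (-(2 * s)) * ε ^ 2 := by
    have e : (N : ℝ) ^ (-(1 / 2) + 3 * s) = (N : ℝ) ^ (-s) * (N : ℝ) ^ (-(1 / 2) + 4 * s) := by
      rw [← Real.rpow_add hNpos]; congr 1; ring
    have e' : (N : ℝ) ^ (-(2 * s)) = ((N : ℝ) ^ (-s)) ^ 2 := by
      rw [← Real.rpow_natCast, ← Real.rpow_mul hNpos.le]; congr 1; push_cast; ring
    rw [e, e', hε]; ring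
  have hfin : ε ^ (2 * p) * (Measure.pi ν).real
      {z | ε ^ (2 * p) ≤ ‖(inner ℂ x (prop (ham H₀ lam ξ z) t y) : ℂ) - c‖ ^ (2 * p)} ≤
      ε ^ (2 * p) * (A * 544 ^ p * (N : ℝ) ^ (-(2 * s * p))) := by
    refine hmarkov.trans (hmom.trans ?_)
    calc A * incrBound N (|lam| * t * cutoff N s) ^ p
        ≤ A * (544 * (N : ℝ) ^ (-(2 * s)) * ε ^ 2) ^ p := by
          rw [← hε2]; gcongr
      _ = _ := by
          have e : (N : ℝ) ^ (-(2 * s * p)) = ((N : ℝ) ^ (-(2 * s))) ^ p := by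
            rw [← Real.rpow_natCast, ← Real.rpow_mul hNpos.le]; congr 1; ring
          rw [e, mul_pow, mul_pow, pow_mul]
          ring
  refine hsub.trans ((le_of_mul_le_mul_left hfin (by positivity)).trans ?_)
  have h3 : (N : ℝ) ^ (-(2 * s * p)) ≤ (N : ℝ) ^ (-D - 1) :=
    Real.rpow_le_rpow_of_exponent_le hN1' (by linarith)
  calc A * 544 ^ p * (N : ℝ) ^ (-(2 * s * p)) ≤ N / 2 * (N : ℝ) ^ (-D - 1) := by
        gcongr; linarith
    _ = (N : ℝ) ^ (-D) / 2 := by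
        have e : (N : ℝ) ^ (-D) = N * (N : ℝ) ^ (-D - 1) := by
          nth_rw 2 [← Real.rpow_one (N : ℝ)]
          rw [← Real.rpow_add hNpos]; congr 1; ring
        rw [e]; ring

/-- The echo is close to the square of the averaged amplitude of the truncated matrix. -/
lemma exists_echo_concentration (Cp : ℕ → ℝ) {s D : ℝ} (hs : 0 < s) (hs' : s ≤ 1 / 12)
    (hD : 0 < D) :
    ∃ n : ℕ, 1 ≤ n ∧ ∀ N : ℕ, n ≤ N → ∀ {Ω : Type*} [MeasurableSpace Ω] {μod : Measure ℂ}
      {μd : Measure ℝ} {P : Measure Ω} [IsProbabilityMeasure P]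
      {W : Ω → Matrix (Fin N) (Fin N) ℂ}, IsEntryLaw Cp μod μd → IsWigner μod μd P W →
      (∃ μ, IsNearWigner (entryLaw P W) (clamp (cutoff N s)) (cutoff N s) μ ∧
        μ * N ^ 2 ≤ cutoff N s ^ 3 * N) ∧
      ∀ {H : Matrix (Fin N) (Fin N) ℂ}, H.IsHermitian → ∀ (lam : ℝ) {t : ℝ}, 0 ≤ t →
      ∀ {ψ : EuclideanSpace ℂ (Fin N)}, ‖ψ‖ = 1 →
      P.real {ω | 2 * ((1 + |lam| * t) ^ 2 * (N : ℝ) ^ (-(1 / 2) + 4 * s)) <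
        |echo H (H + (lam : ℂ) • W ω) ψ t - ‖(inner ℂ ψ
          (meanProp (entryLaw P W) (Matrix.toEuclideanCLM (𝕜 := ℂ) H) lam (clamp (cutoff N s)) t
            (prop (Matrix.toEuclideanCLM (𝕜 := ℂ) H) (-t) ψ)) : ℂ)‖ ^ 2|} ≤ (N : ℝ) ^ (-D) := by
  obtain ⟨n₁, hn₁, h₁⟩ := exists_isNearWigner Cp hs hs' hD
  obtain ⟨n₂, hn₂, h₂⟩ := exists_concentration (D := D) hs
  refine ⟨max n₁ n₂, hn₁.trans (le_max_left _ _), fun N hN Ω _ μod μd P _ W hμ hW => ?_⟩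
  obtain ⟨hW', htail⟩ := h₁ N ((le_max_left _ _).trans hN) hμ hW
  refine ⟨hW', fun {H} hH lam {t} ht {ψ} hψ => ?_⟩
  have hN1 : 1 ≤ N := hn₁.trans ((le_max_left _ _).trans hN)
  have := hW.isProbabilityMeasure_entryLaw
  have hsa := isSelfAdjoint_toEuclideanCLM hH
  have hφ : ‖prop (Matrix.toEuclideanCLM (𝕜 := ℂ) H) (-t) ψ‖ = 1 := by
    rw [norm_prop_apply hsa, hψ]
  have hclamp := norm_clamp_le (cutoff_pos (s := s) hN1).le
  have hconc := h₂ N ((le_max_right _ _).trans hN) (ν := entryLaw P W) (lam := lam)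
    (measurable_clamp (cutoff N s)) hclamp hsa ht hψ.le hφ.le
  rw [← hW.map_entries] at hconc
  set φ := prop (Matrix.toEuclideanCLM (𝕜 := ℂ) H) (-t) ψ
  set c : ℂ := inner ℂ ψ (meanProp (entryLaw P W) (Matrix.toEuclideanCLM (𝕜 := ℂ) H) lam
    (clamp (cutoff N s)) t φ) with hc
  have hc1 : ‖c‖ ≤ 1 := by
    refine (norm_inner_le_norm _ _).trans ?_
    rw [hψ, one_mul]
    refine (ContinuousLinearMap.le_opNorm _ _).trans ?_
    rw [hφ, mul_one]
    exact norm_meanProp_le lam hsa t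
  set ε := (1 + |lam| * t) ^ 2 * (N : ℝ) ^ (-(1 / 2) + 4 * s)
  set S : Set (Idx N → ℂ) := {z | ε ≤ ‖inner ℂ ψ (prop (ham (Matrix.toEuclideanCLM (𝕜 := ℂ) H) lam
    (clamp (cutoff N s)) z) t φ) - c‖} with hS
  have hSm : MeasurableSet S := by
    have hm : Measurable fun z : Idx N → ℂ => (inner ℂ ψ (prop (ham (Matrix.toEuclideanCLM (𝕜 := ℂ) H)
        lam (clamp (cutoff N s)) z) t φ) : ℂ) :=
      measurable_inner_prop (measurable_ham (measurable_clamp _) _ lam) t ψ φ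
    exact measurableSet_le measurable_const (by fun_prop)
  rw [map_measureReal_apply hW.measurable_entries hSm] at hconc
  have hsub : {ω | 2 * ε < |echo H (H + (lam : ℂ) • W ω) ψ t - ‖c‖ ^ 2|} ⊆
      {ω | ∃ k : Idx N, cutoff N s < ‖entries (W ω) k‖} ∪ (fun ω => entries (W ω)) ⁻¹' S := by
    intro ω hω
    by_contra hout
    rw [Set.mem_union, not_or] at hout
    obtain ⟨ho1, ho2⟩ := hout
    have ho1' : ∀ k : Idx N, ‖entries (W ω) k‖ ≤ cutoff N s := fun k =>
      not_lt.1 fun hk => ho1 ⟨k, hk⟩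
    have ho2' : ‖inner ℂ ψ (prop (ham (Matrix.toEuclideanCLM (𝕜 := ℂ) H) lam
        (clamp (cutoff N s)) (entries (W ω))) t φ) - c‖ < ε := not_le.1 ho2
    rw [ham_clamp_entries (hW.hermitian ω) lam ho1'] at ho2'
    have hω' : 2 * ε < |echo H (H + (lam : ℂ) • W ω) ψ t - ‖c‖ ^ 2| := hω
    have hsa2 := isSelfAdjoint_ham hsa lam (clamp (cutoff N s)) (entries (W ω))
    rw [ham_clamp_entries (hW.hermitian ω) lam ho1'] at hsa2
    rw [echo_eq] at hω'
    set F : ℂ := inner ℂ ψ (prop (Matrix.toEuclideanCLM (𝕜 := ℂ) (H + (lam : ℂ) • W ω)) t φ)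
    have hF1 : ‖F‖ ≤ 1 := by
      refine (norm_inner_prop_le hsa2 t ψ φ).trans ?_
      rw [hψ, hφ, one_mul]
    have h4 : |‖F‖ ^ 2 - ‖c‖ ^ 2| ≤ 2 * ‖F - c‖ := by
      rw [show ‖F‖ ^ 2 - ‖c‖ ^ 2 = (‖F‖ + ‖c‖) * (‖F‖ - ‖c‖) by ring, abs_mul,
        abs_of_nonneg (by positivity)]
      have := abs_norm_sub_norm_le F c
      gcongr
      linarith
    linarith
  refine (measureReal_mono hsub).trans ((measureReal_union_le _ _).trans ?_)
  linarith

end Transfer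

/-! ### Decay of the echo -/

section ShortTime

lemma echo_zero_coupling {N : ℕ} {H W : Matrix (Fin N) (Fin N) ℂ} {ψ : EuclideanSpace ℂ (Fin N)}
    (hψ : ‖ψ‖ = 1) (t : ℝ) : echo H (H + ((0 : ℝ) : ℂ) • W) ψ t = 1 := by
  rw [echo_eq, Complex.ofReal_zero, zero_smul, add_zero, ← mul_apply_eq_comp, ← prop_add,
    add_neg_cancel, prop_zero, one_apply_eq_self, inner_self_eq_norm_sq_to_K, hψ]
  simp

lemma echo_nonneg {N : ℕ} (H₁ H₂ : Matrix (Fin N) (Fin N) ℂ) (ψ : EuclideanSpace ℂ (Fin N))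
    (t : ℝ) : 0 ≤ echo H₁ H₂ ψ t := by unfold echo; positivity

lemma echo_le_one {N : ℕ} {H W : Matrix (Fin N) (Fin N) ℂ} (hH : H.IsHermitian)
    (hW : W.IsHermitian) (lam : ℝ) {ψ : EuclideanSpace ℂ (Fin N)}
    (hψ : ‖ψ‖ = 1) (t : ℝ) : echo H (H + (lam : ℂ) • W) ψ t ≤ 1 := by
  rw [echo_eq]
  have h2 : (H + (lam : ℂ) • W).IsHermitian := by
    refine hH.add ?_
    rw [Matrix.IsHermitian, Matrix.conjTranspose_smul, hW.eq]
    simp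
  refine pow_le_one₀ (norm_nonneg _) ((norm_inner_prop_le (isSelfAdjoint_toEuclideanCLM h2) _ _
    _).trans ?_)
  rw [norm_prop_apply (isSelfAdjoint_toEuclideanCLM hH), hψ, one_mul]

/-- Powers of `N` at hand: `N ^ ξ / √N` dominates `a * N ^ (-1/2 + 4 * s)`. -/
lemma mul_rpow_le_rpow_div_sqrt {N : ℕ} (hN : 1 ≤ N) {s ξ a : ℝ} (hsξ : 5 * s ≤ ξ)
    (ha : a ≤ (N : ℝ) ^ s) :
    a * (N : ℝ) ^ (-(1 / 2) + 4 * s) ≤ (N : ℝ) ^ ξ * (1 / Real.sqrt N) := by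
  have h0 : (0 : ℝ) < N := by exact_mod_cast hN
  have e : (N : ℝ) ^ ξ * (1 / Real.sqrt N) = (N : ℝ) ^ (-(1 / 2) + ξ) := by
    rw [Real.sqrt_eq_rpow, one_div, ← Real.rpow_neg h0.le, ← Real.rpow_add h0]
    congr 1; ring
  rw [e]
  calc a * (N : ℝ) ^ (-(1 / 2) + 4 * s) ≤ (N : ℝ) ^ s * (N : ℝ) ^ (-(1 / 2) + 4 * s) := by gcongr
    _ = (N : ℝ) ^ (-(1 / 2) + 5 * s) := by rw [← Real.rpow_add h0]; congr 1; ring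
    _ ≤ _ := Real.rpow_le_rpow_of_exponent_le (by exact_mod_cast hN) (by linarith)

/-- The tail bound for short times, with a threshold that depends only on the moments. -/
lemma exists_short_time (Cp : ℕ → ℝ) (CH : ℝ) {ξ D : ℝ} (hξ : 0 < ξ) (hD : 0 < D) :
    ∃ n : ℕ, ∀ N : ℕ, n ≤ N → ∀ {Ω : Type*} [MeasurableSpace Ω] {μod : Measure ℂ}
      {μd : Measure ℝ} {P : Measure Ω} [IsProbabilityMeasure P]
      {W : Ω → Matrix (Fin N) (Fin N) ℂ}, IsEntryLaw Cp μod μd → IsWigner μod μd P W →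
      ∀ {H : Matrix (Fin N) (Fin N) ℂ}, H.IsHermitian →
      ‖Matrix.toEuclideanCLM (𝕜 := ℂ) H‖ ≤ CH → ∀ (lam : ℝ) {t : ℝ}, 0 ≤ t →
      |lam| * t ≤ 1 → lam ^ 2 * t ≤ 1 → ∀ {ψ : EuclideanSpace ℂ (Fin N)}, ‖ψ‖ = 1 →
      P {ω | (N : ℝ) ^ ξ * (1 / Real.sqrt N) <
        max 0 (|echo H (H + (lam : ℂ) • W ω) ψ t - (1 - lam ^ 2 * t ^ 2)| -
          (4 * CH + 5) * (lam ^ 2 * t ^ 3))} ≤ ENNReal.ofReal ((N : ℝ) ^ (-D)) := by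
  set s := min (ξ / 5) (1 / 12) with hs
  have hs0 : 0 < s := lt_min (by positivity) (by norm_num)
  have hs1 : s ≤ 1 / 12 := min_le_right _ _
  have hsξ : 5 * s ≤ ξ := by have := min_le_left (ξ / 5) (1 / 12 : ℝ); rw [← hs] at this; linarith
  obtain ⟨n₁, hn₁, h₁⟩ := exists_echo_concentration Cp hs0 hs1 hD
  obtain ⟨n₂, -, h₂⟩ := exists_forall_le_rpow 2888 hs0
  refine ⟨max n₁ n₂, fun N hN Ω _ μod μd P _ W hμ hW H hH hC lam t ht hl1 hl2 ψ hψ => ?_⟩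
  have hN1 : 1 ≤ N := hn₁.trans ((le_max_left _ _).trans hN)
  have hNpos : (0 : ℝ) < N := by exact_mod_cast hN1
  obtain ⟨⟨μ, hnear, hμN⟩, hP⟩ := h₁ N ((le_max_left _ _).trans hN) hμ hW
  have hP := hP hH lam ht hψ
  have hbig := mul_rpow_le_rpow_div_sqrt hN1 hsξ (h₂ N ((le_max_right _ _).trans hN))
  have := hW.isProbabilityMeasure_entryLaw
  have hdet := abs_norm_sq_inner_meanProp_sub_le hnear (isSelfAdjoint_toEuclideanCLM hH) hN1 hC ht
    hl1 hl2 hψ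
  set c : ℂ := inner ℂ ψ (meanProp (entryLaw P W) (Matrix.toEuclideanCLM (𝕜 := ℂ) H) lam
    (clamp (cutoff N s)) t (prop (Matrix.toEuclideanCLM (𝕜 := ℂ) H) (-t) ψ))
  have hcum := cumErr_le (cutoff_pos (s := s) hN1).le (cutoff_le_one hN1 (by linarith))
    (one_le_cutoff_sq_mul hN1 hs0.le) zero_le_one hnear.μ_nonneg hμN
  rw [cutoff_cube_mul hN1] at hcum
  have h34 : (N : ℝ) ^ (-(1 / 2) + 3 * s) ≤ (N : ℝ) ^ (-(1 / 2) + 4 * s) :=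
    Real.rpow_le_rpow_of_exponent_le (by exact_mod_cast hN1) (by linarith)
  have hX0 : 0 ≤ (N : ℝ) ^ (-(1 / 2) + 4 * s) := by positivity
  have hone : (1 + |lam| * t) ^ 2 ≤ 4 := by
    have : 0 ≤ |lam| * t := by positivity
    nlinarith
  rw [ENNReal.le_ofReal_iff_toReal_le (measure_ne_top _ _) (by positivity)]
  refine le_trans (measureReal_mono fun ω hω => ?_) hP
  have hω' : (N : ℝ) ^ ξ * (1 / Real.sqrt N) <
      max 0 (|echo H (H + (lam : ℂ) • W ω) ψ t - (1 - lam ^ 2 * t ^ 2)| -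
        (4 * CH + 5) * (lam ^ 2 * t ^ 3)) := hω
  rcases lt_max_iff.1 hω' with h | h
  · exact absurd h (not_lt.2 (by positivity))
  change 2 * ((1 + |lam| * t) ^ 2 * (N : ℝ) ^ (-(1 / 2) + 4 * s)) <
    |echo H (H + (lam : ℂ) • W ω) ψ t - ‖c‖ ^ 2|
  have htri := abs_sub_le (echo H (H + (lam : ℂ) • W ω) ψ t) (‖c‖ ^ 2) (1 - lam ^ 2 * t ^ 2)
  have : (1 + |lam| * t) ^ 2 * (N : ℝ) ^ (-(1 / 2) + 4 * s) ≤
      4 * (N : ℝ) ^ (-(1 / 2) + 4 * s) := by gcongr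
  linarith

end ShortTime

section GoldenRule

/-- Couplings below this threshold are treated as weak. -/
def weakThreshold (κ c M : ℝ) : ℝ :=
  (2 + 8 * stBound κ M / κ + 2 * compConst (c * Real.pi / 2) (stBound κ M) + 2 / κ)⁻¹

lemma weakThreshold_pos {κ c M : ℝ} (hκ : 0 < κ) (hc : 0 < c) (hM : 0 ≤ M) :
    0 < weakThreshold κ c M := by
  have h1 := one_le_stBound hκ hM
  have hp := Real.pi_pos
  have h2 := compConst_nonneg (a := c * Real.pi / 2) (K := stBound κ M) (by positivity) (by linarith)
  unfold weakThreshold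
  positivity

lemma isWeak_of_le {κ c M lam : ℝ} (hκ : 0 < κ) (hc : 0 < c) (hM : 0 ≤ M) (h0 : lam ≠ 0)
    (h : |lam| ≤ weakThreshold κ c M) : IsWeak κ c M lam (|lam| ^ 3) (lam ^ 2 / 2) := by
  have h1 := one_le_stBound hκ hM
  have hp := Real.pi_pos
  have h2 := compConst_nonneg (a := c * Real.pi / 2) (K := stBound κ M) (by positivity) (by linarith)
  set K := stBound κ M
  set K₃ := compConst (c * Real.pi / 2) K
  have hl := abs_pos.2 h0
  have hkey : |lam| * 2 + |lam| * (8 * K / κ) + |lam| * (2 * K₃) + |lam| * (2 / κ) ≤ 1 := by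
    have hpos : 0 < 2 + 8 * K / κ + 2 * K₃ + 2 / κ := by positivity
    have := mul_le_mul_of_nonneg_right h hpos.le
    rw [weakThreshold, inv_mul_cancel₀ hpos.ne'] at this
    linarith
  have i1 : 0 ≤ |lam| * (8 * K / κ) := by positivity
  have i2 : 0 ≤ |lam| * (2 * K₃) := by positivity
  have i3 : 0 ≤ |lam| * (2 / κ) := by positivity
  have hl1 : |lam| ≤ 1 / 2 := by linarith
  have hsq : lam ^ 2 ≤ |lam| := by rw [← sq_abs]; nlinarith
  have hcu : |lam| ^ 3 ≤ |lam| := by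
    calc |lam| ^ 3 ≤ |lam| ^ 1 := pow_le_pow_of_le_one hl.le (by linarith) (by norm_num)
      _ = |lam| := pow_one _
  have hdiv : ∀ b : ℝ, |lam| * (b / κ) ≤ 1 → |lam| * b ≤ κ := fun b hb => by
    rwa [← mul_div_assoc, div_le_one hκ] at hb
  refine ⟨h0, by linarith, ?_, ?_, hcu, ?_, by linarith, by linarith⟩
  · have := hdiv (8 * K) (by linarith)
    nlinarith
  · nlinarith
  · have := hdiv 2 (by linarith)
    linarith

/-- The constant in front of the error term of the intermediate-time asymptotics. -/
def goldenConst (κ c : ℝ) : ℝ :=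
  2 * (ampConst κ c (1 / c) + stBound κ (1 / c)) + 1 / weakThreshold κ c (1 / c) + 1

lemma goldenConst_pos {κ c : ℝ} (hκ : 0 < κ) (hc : 0 < c) : 0 < goldenConst κ c := by
  have hM : 0 ≤ 1 / c := by positivity
  have h1 := one_le_stBound hκ hM
  have h2 := ampConst_nonneg hκ hc hM
  have h3 := weakThreshold_pos hκ hc hM
  unfold goldenConst
  positivity

/-- The tail bound for intermediate times. The threshold may depend on `lam`, so that any fixed
regularization is eventually far above the scale on which the resolvent trace is known; it does not
depend on the time, since the claim is trivial once `|lam| ^ 3 * t ≥ 1`. -/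
lemma exists_intermediate_time (Cp : ℕ → ℝ) {CH κ c : ℝ} (hκ : 0 < κ) (hc : 0 < c) {ρ : ℝ → ℝ}
    (hρ : IsDensity ρ) (A : ℝ) {ε₀ η₀ : ℕ → ℝ} (hε₀ : IsErrorSeq ε₀) (hη₀ : IsErrorSeq η₀)
    {E₀ : ℝ} (hE₀ : E₀ ∈ admissible ρ κ c) {Δ : ℝ} (hΔ : Δ ∈ Set.Ioo 0 (κ / 2)) (lam : ℝ)
    {ξ D : ℝ} (hξ : 0 < ξ) (hD : 0 < D) :
    ∃ n : ℕ, ∀ N : ℕ, n ≤ N → ∀ {Ω : Type*} [MeasurableSpace Ω] {μod : Measure ℂ}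
      {μd : Measure ℝ} {P : Measure Ω} [IsProbabilityMeasure P]
      {W : Ω → Matrix (Fin N) (Fin N) ℂ}, IsEntryLaw Cp μod μd → IsWigner μod μd P W →
      ∀ {H₀ : ∀ N, Matrix (Fin N) (Fin N) ℂ}, HasLimitingDensity CH ρ A ε₀ η₀ H₀ →
      ∀ {t : ℝ}, 0 ≤ t → ∀ {ψ : EuclideanSpace ℂ (Fin N)}, IsLocalState (H₀ N) E₀ Δ ψ →
      P {ω | (N : ℝ) ^ ξ * ((1 + |lam| * |t|) ^ 2 / Real.sqrt N) <
        max 0 (|echo (H₀ N) (H₀ N + (lam : ℂ) • W ω) ψ t -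
            Real.exp (-(2 * Real.pi * ρ E₀ * lam ^ 2 * t))| -
          goldenConst κ c * errorTerm lam t Δ (ε₀ N))} ≤ ENNReal.ofReal ((N : ℝ) ^ (-D)) := by
  have hreg := isRegularNear_of_admissible hρ hκ hc hE₀
  have hM := hreg.nonneg_M
  set M := 1 / c with hM'
  have hK := one_le_stBound hκ hM
  have hamp := ampConst_nonneg hκ hc hM
  have hthr := weakThreshold_pos hκ hc hM
  have hthr' : 0 < 1 / weakThreshold κ c M := by positivity
  have hΔ0 : 0 < Δ := hΔ.1
  have hG1 : 1 ≤ goldenConst κ c := by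
    unfold goldenConst; rw [← hM']; linarith
  -- the error term dominates each of its contributions
  have herr : ∀ {t : ℝ} (N : ℕ), 0 ≤ t →
      lam ^ 2 * t * Δ + |lam| * (1 + lam ^ 2 * t) ≤ errorTerm lam t Δ (ε₀ N) := by
    intro t N ht
    have := hε₀.pos N
    have h1 : 0 ≤ |lam| / Δ * (1 + |lam| / Δ) := by positivity
    have h2 : 0 ≤ lam ^ 2 * t * ε₀ N := by positivity
    unfold errorTerm
    linarith
  -- a pointwise bound makes the event empty
  have htriv : ∀ {N : ℕ} {Ω : Type _} [MeasurableSpace Ω] {P : Measure Ω} {t : ℝ} {f : Ω → ℝ},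
      (∀ ω, f ω ≤ goldenConst κ c * errorTerm lam t Δ (ε₀ N)) →
      P {ω | (N : ℝ) ^ ξ * ((1 + |lam| * |t|) ^ 2 / Real.sqrt N) <
        max 0 (f ω - goldenConst κ c * errorTerm lam t Δ (ε₀ N))} ≤
        ENNReal.ofReal ((N : ℝ) ^ (-D)) := by
    intro N Ω _ P t f hf
    have e : {ω | (N : ℝ) ^ ξ * ((1 + |lam| * |t|) ^ 2 / Real.sqrt N) <
        max 0 (f ω - goldenConst κ c * errorTerm lam t Δ (ε₀ N))} = ∅ := by
      refine Set.eq_empty_iff_forall_notMem.2 fun ω hω => ?_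
      have hω' : (N : ℝ) ^ ξ * ((1 + |lam| * |t|) ^ 2 / Real.sqrt N) <
        max 0 (f ω - goldenConst κ c * errorTerm lam t Δ (ε₀ N)) := hω
      rw [max_eq_left (by linarith [hf ω])] at hω'
      exact absurd hω' (not_lt.2 (by positivity))
    rw [e, measure_empty]
    exact zero_le
  have hexp1 : ∀ {t : ℝ}, 0 ≤ t → Real.exp (-(2 * Real.pi * ρ E₀ * lam ^ 2 * t)) ≤ 1 := by
    intro t ht
    rw [Real.exp_le_one_iff]
    have := hρ.nonneg E₀
    have := Real.pi_pos
    have : 0 ≤ 2 * Real.pi * ρ E₀ * lam ^ 2 * t := by positivity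
    linarith
  have habs : ∀ {a b : ℝ}, 0 ≤ a → a ≤ 1 → 0 ≤ b → b ≤ 1 → |a - b| ≤ 1 := fun h1 h2 h3 h4 => by
    rw [abs_le]; constructor <;> linarith
  rcases eq_or_ne lam 0 with h0 | h0
  · refine ⟨0, fun N _ Ω _ μod μd P _ W hμ hW H₀ hH t ht ψ hψ => htriv fun ω => ?_⟩
    have h1 := herr N ht
    rw [h0] at h1 ⊢
    rw [echo_zero_coupling hψ.normalized]
    have h2 : 0 ≤ errorTerm 0 t Δ (ε₀ N) := by simpa using h1
    simpa using mul_nonneg (zero_le_one.trans hG1) h2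
  have hl := abs_pos.2 h0
  -- for couplings that are not weak, the error term exceeds a constant and the claim is trivial
  rcases le_total (weakThreshold κ c M) |lam| with hbig | hsmall
  · refine ⟨0, fun N _ Ω _ μod μd P _ W hμ hW H₀ hH t ht ψ hψ => htriv fun ω => ?_⟩
    refine (habs (echo_nonneg _ _ _ _)
      (echo_le_one (hH.hermitian N) (hW.hermitian ω) lam hψ.normalized t) (Real.exp_pos _).le
      (hexp1 ht)).trans ?_
    have h1 : |lam| ≤ errorTerm lam t Δ (ε₀ N) := by
      have h2 : 0 ≤ lam ^ 2 * t * Δ := by positivity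
      have h3 : 0 ≤ |lam| * (lam ^ 2 * t) := by positivity
      linarith [herr N ht]
    have h4 : 1 ≤ 1 / weakThreshold κ c M * |lam| := by
      rw [one_div, inv_mul_eq_div, le_div_iff₀ hthr, one_mul]; exact hbig
    refine h4.trans (mul_le_mul ?_ h1 hl.le (zero_le_one.trans hG1))
    unfold goldenConst; rw [← hM']; linarith
  -- weak coupling: regularize at the scale `η = |lam| ^ 3`
  set η := |lam| ^ 3 with hη
  set δ := lam ^ 2 / 2 with hδ
  have hη0 : 0 < η := by positivity
  have hδ0 : 0 < δ := by positivity
  have hweak := isWeak_of_le hκ hc hM h0 hsmall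
  rw [← hη, ← hδ] at hweak
  set s := min (ξ / 5) (1 / 12) with hs
  have hs0 : 0 < s := lt_min (by positivity) (by norm_num)
  have hs1 : s ≤ 1 / 12 := min_le_right _ _
  have hsξ : 5 * s ≤ ξ := by have := min_le_left (ξ / 5) (1 / 12 : ℝ); rw [← hs] at this; linarith
  obtain ⟨n₁, hn₁, h₁⟩ := exists_echo_concentration Cp hs0 hs1 hD
  obtain ⟨n₂, -, h₂⟩ := exists_forall_le_rpow 2 hs0
  obtain ⟨n₃, -, h₃⟩ := exists_forall_le_rpow (|lam| * (60 * cubicMoment lam η) / η / δ)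
    (show 0 < 1 / 2 - 3 * s by linarith)
  obtain ⟨n₄, h₄⟩ := eventually_atTop.1 (hη₀.tendsto.eventually_le_const hη0)
  obtain ⟨n₅, h₅⟩ := eventually_atTop.1
    ((hε₀.tendsto.const_mul A).eventually_le_const (by rwa [mul_zero] : A * 0 < δ))
  refine ⟨max n₁ (max n₂ (max n₃ (max n₄ n₅))),
    fun N hN Ω _ μod μd P _ W hμ hW H₀ hH t ht ψ hψ => ?_⟩
  simp only [max_le_iff] at hN
  obtain ⟨hN₁, hN₂, hN₃, hN₄, hN₅⟩ := hN
  -- at times with `η * t ≥ 1` the error term is at least `|lam| * (lam ^ 2 * t) = η * t ≥ 1`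
  rcases le_total (η * t) 1 with hηt | hηt
  swap
  · refine htriv fun ω => ?_
    refine (habs (echo_nonneg _ _ _ _)
      (echo_le_one (hH.hermitian N) (hW.hermitian ω) lam hψ.normalized t) (Real.exp_pos _).le
      (hexp1 ht)).trans ?_
    have h1 : 1 ≤ errorTerm lam t Δ (ε₀ N) := by
      have h2 : 0 ≤ lam ^ 2 * t * Δ := by positivity
      have h3 : |lam| * (lam ^ 2 * t) = η * t := by rw [hη, ← sq_abs]; ring
      linarith [herr N ht]
    nlinarith
  have hN1 : 1 ≤ N := hn₁.trans hN₁
  have hNpos : (0 : ℝ) < N := by exact_mod_cast hN1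
  obtain ⟨⟨μ, hnear, hμN⟩, hP⟩ := h₁ N hN₁ hμ hW
  have hherm := hH.hermitian N
  have hP := hP hherm lam ht hψ.normalized
  have := hW.isProbabilityMeasure_entryLaw
  have hcl : IsCloseTo (entryLaw P W) (Matrix.toEuclideanCLM (𝕜 := ℂ) (H₀ N)) (clamp (cutoff N s)) ρ
      lam η δ := by
    refine isCloseTo_of_approx hnear hherm (γ := 60 * (N : ℝ) ^ (-(1 / 2) + 3 * s)) hη0
      (fun z hz => (hH.approx N hN1 z ((h₄ N hN₄).trans hz)).trans (h₅ N hN₅)) (fun q hq => ?_) ?_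
    · refine (cumErr_le (cutoff_pos (s := s) hN1).le (cutoff_le_one hN1 (by linarith))
        (one_le_cutoff_sq_mul hN1 hs0.le) hq hnear.μ_nonneg hμN).trans_eq ?_
      rw [cutoff_cube_mul hN1]; ring
    · have h1 := h₃ N hN₃
      rw [div_le_iff₀ hδ0] at h1
      have h2 : (N : ℝ) ^ (-(1 / 2) + 3 * s) * (N : ℝ) ^ (1 / 2 - 3 * s) = 1 := by
        rw [← Real.rpow_add hNpos]; simp
      calc |lam| * (60 * (N : ℝ) ^ (-(1 / 2) + 3 * s) * cubicMoment lam η) / η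
          = (N : ℝ) ^ (-(1 / 2) + 3 * s) * (|lam| * (60 * cubicMoment lam η) / η) := by ring
        _ ≤ (N : ℝ) ^ (-(1 / 2) + 3 * s) * ((N : ℝ) ^ (1 / 2 - 3 * s) * δ) := by gcongr
        _ = δ := by rw [← mul_assoc, h2, one_mul]
  have hdet := abs_norm_sq_inner_meanProp_sub_exp_le hherm.eigenvectorBasis hnear
    (isSelfAdjoint_toEuclideanCLM hherm) hreg hcl hweak (toEuclideanCLM_eigenvectorBasis hherm)
    hψ.normalized hΔ.2.le (hψ.abs_sub_le hherm) ht hηt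
  have hbig := mul_rpow_le_rpow_div_sqrt hN1 hsξ (h₂ N hN₂)
  set c' : ℂ := inner ℂ ψ (meanProp (entryLaw P W) (Matrix.toEuclideanCLM (𝕜 := ℂ) (H₀ N)) lam
    (clamp (cutoff N s)) t (prop (Matrix.toEuclideanCLM (𝕜 := ℂ) (H₀ N)) (-t) ψ))
  rw [ENNReal.le_ofReal_iff_toReal_le (measure_ne_top _ _) (by positivity)]
  refine le_trans (measureReal_mono fun ω hω => ?_) hP
  have hω' : (N : ℝ) ^ ξ * ((1 + |lam| * |t|) ^ 2 / Real.sqrt N) <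
      max 0 (|echo (H₀ N) (H₀ N + (lam : ℂ) • W ω) ψ t -
        Real.exp (-(2 * Real.pi * ρ E₀ * lam ^ 2 * t))| -
        goldenConst κ c * errorTerm lam t Δ (ε₀ N)) := hω
  rw [abs_of_nonneg ht] at hω'
  rcases lt_max_iff.1 hω' with h | h
  · exact absurd h (not_lt.2 (by positivity))
  change 2 * ((1 + |lam| * t) ^ 2 * (N : ℝ) ^ (-(1 / 2) + 4 * s)) <
    |echo (H₀ N) (H₀ N + (lam : ℂ) • W ω) ψ t - ‖c'‖ ^ 2|
  have htri := abs_sub_le (echo (H₀ N) (H₀ N + (lam : ℂ) • W ω) ψ t) (‖c'‖ ^ 2)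
    (Real.exp (-(2 * Real.pi * ρ E₀ * lam ^ 2 * t)))
  have hgold : 2 * (ampConst κ c M + stBound κ M) *
      (lam ^ 2 * t * Δ + |lam| * (1 + lam ^ 2 * t)) ≤
      goldenConst κ c * errorTerm lam t Δ (ε₀ N) := by
    refine mul_le_mul ?_ (herr N ht) (by positivity) (zero_le_one.trans hG1)
    unfold goldenConst; rw [← hM']; linarith
  have hscale : 2 * ((1 + |lam| * t) ^ 2 * (N : ℝ) ^ (-(1 / 2) + 4 * s)) ≤
      (N : ℝ) ^ ξ * ((1 + |lam| * t) ^ 2 / Real.sqrt N) := by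
    calc _ = (1 + |lam| * t) ^ 2 * (2 * (N : ℝ) ^ (-(1 / 2) + 4 * s)) := by ring
      _ ≤ (1 + |lam| * t) ^ 2 * ((N : ℝ) ^ ξ * (1 / Real.sqrt N)) := by gcongr
      _ = _ := by ring
  linarith

end GoldenRule

section ErrorTerm

/-- The error term vanishes in the iterated limit. -/
lemma eventually_abs_errorTerm_lt {ε₀ : ℕ → ℝ} (hε₀ : IsErrorSeq ε₀) {T : ℝ} (hT : 0 < T) {ε : ℝ}
    (hε : 0 < ε) : ∀ᶠ Δ : ℝ in 𝓝[>] 0,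
      ∀ᶠ p : ℝ × ℝ in (atTop ×ˢ 𝓝[≠] 0) ⊓ 𝓟 {p : ℝ × ℝ | p.2 ^ 2 * p.1 ≤ T},
        ∀ᶠ N : ℕ in atTop, |errorTerm p.2 p.1 Δ (ε₀ N)| < ε := by
  filter_upwards [Ioo_mem_nhdsGT (show 0 < ε / (4 * T) by positivity)] with Δ hΔ
  obtain ⟨hΔ0, hΔ1⟩ := hΔ
  rw [lt_div_iff₀ (by positivity)] at hΔ1
  rw [eventually_inf_principal]
  have hcont : Continuous fun l : ℝ => |l| * (1 + T) + |l| / Δ * (1 + |l| / Δ) := by fun_prop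
  have hlam : ∀ᶠ l : ℝ in 𝓝[≠] 0, |l| * (1 + T) + |l| / Δ * (1 + |l| / Δ) < ε / 4 :=
    (hcont.tendsto 0).mono_left nhdsWithin_le_nhds |>.eventually_lt_const (by simpa using hε)
  filter_upwards [(eventually_ge_atTop (0 : ℝ)).prod_mk hlam] with p hp hpT
  obtain ⟨ht, hl⟩ := hp
  have hpT' : p.2 ^ 2 * p.1 ≤ T := hpT
  have hN : ∀ᶠ N : ℕ in atTop, T * ε₀ N < ε / 4 :=
    (hε₀.tendsto.const_mul T).eventually_lt_const (by simpa using hε)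
  filter_upwards [hN] with N hN
  have he := hε₀.pos N
  set τ := p.2 ^ 2 * p.1 with hτ
  have hτ0 : 0 ≤ τ := mul_nonneg (sq_nonneg _) ht
  have h0 := abs_nonneg p.2
  have h1 : τ * Δ ≤ T * Δ := by gcongr
  have h2 : |p.2| * (1 + τ) ≤ |p.2| * (1 + T) := by gcongr
  have h3 : τ * ε₀ N ≤ T * ε₀ N := by gcongr
  unfold errorTerm
  rw [← hτ, abs_of_nonneg (by positivity)]
  linarith

end ErrorTerm

end Echo

end

theorem mainTheorem5 :
    -- the constant `C(t, λ)`, depending only on its arguments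
    ∃ C : ℝ → ℝ → ℝ, (∀ t lam, 0 < C t lam) ∧
    ∀ (CH : ℝ) (_ : 0 < CH) (Cp : ℕ → ℝ),
      -- (i) short-time parabolic decay
      (∃ (K : ℝ) (N₀ : ℝ → ℝ → ℕ), 0 < K ∧ ∀ L : ℝ, 0 < L → ∃ t₀ : ℝ, 0 < t₀ ∧
        ∀ (κ₀ c₀ : ℝ) (_ : 0 < κ₀) (_ : 0 < c₀)
          (ρ₀ : ℝ → ℝ) (_ : Echo.IsDensity ρ₀)
          (A : ℝ) (ε₀ η₀ : ℕ → ℝ) (_ : Echo.IsErrorSeq ε₀) (_ : Echo.IsErrorSeq η₀)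
          (E₀ : ℝ) (_ : E₀ ∈ Echo.admissible ρ₀ κ₀ c₀) (Δ : ℝ) (_ : Δ ∈ Set.Ioo 0 (κ₀ / 2))
          (H₀ : ∀ N, Matrix (Fin N) (Fin N) ℂ) (_ : Echo.HasLimitingDensity CH ρ₀ A ε₀ η₀ H₀)
          (μod : Measure ℂ) (μd : Measure ℝ) (_ : Echo.IsEntryLaw Cp μod μd)
          (Ω : ℕ → Type*) [∀ N, MeasurableSpace (Ω N)]
          (P : ∀ N, Measure (Ω N)) [∀ N, IsProbabilityMeasure (P N)]
          (W : ∀ N, Ω N → Matrix (Fin N) (Fin N) ℂ) (_ : ∀ N, Echo.IsWigner μod μd (P N) (W N))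
          (lam t : ℝ), |lam| ≤ L → 0 ≤ t → t ≤ t₀ →
          Echo.StochDom N₀ P (fun N => {ψ | Echo.IsLocalState (H₀ N) E₀ Δ ψ})
            (fun N ψ ω =>
              max 0 (|Echo.echo (H₀ N) (H₀ N + (lam : ℂ) • W N ω) ψ t - (1 - lam ^ 2 * t ^ 2)|
                - K * (lam ^ 2 * t ^ 3)))
            (fun N _ _ => 1 / Real.sqrt N)) ∧
      -- (ii) intermediate-time asymptotic decay
      (∀ (κ₀ c₀ : ℝ) (_ : 0 < κ₀) (_ : 0 < c₀), ∃ K : ℝ, 0 < K ∧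
        ∀ (ρ₀ : ℝ → ℝ) (_ : Echo.IsDensity ρ₀)
          (A : ℝ) (ε₀ η₀ : ℕ → ℝ) (_ : Echo.IsErrorSeq ε₀) (_ : Echo.IsErrorSeq η₀)
          (E₀ : ℝ) (_ : E₀ ∈ Echo.admissible ρ₀ κ₀ c₀) (Δ : ℝ) (_ : Δ ∈ Set.Ioo 0 (κ₀ / 2))
          (lam : ℝ), ∃ N₀ : ℝ → ℝ → ℕ,
        ∀ (H₀ : ∀ N, Matrix (Fin N) (Fin N) ℂ) (_ : Echo.HasLimitingDensity CH ρ₀ A ε₀ η₀ H₀)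
          (μod : Measure ℂ) (μd : Measure ℝ) (_ : Echo.IsEntryLaw Cp μod μd)
          (Ω : ℕ → Type*) [∀ N, MeasurableSpace (Ω N)]
          (P : ∀ N, Measure (Ω N)) [∀ N, IsProbabilityMeasure (P N)]
          (W : ∀ N, Ω N → Matrix (Fin N) (Fin N) ℂ) (_ : ∀ N, Echo.IsWigner μod μd (P N) (W N))
          (t : ℝ), 0 ≤ t →
          Echo.StochDom N₀ P (fun N => {ψ | Echo.IsLocalState (H₀ N) E₀ Δ ψ})
            (fun N ψ ω =>
              max 0 (|Echo.echo (H₀ N) (H₀ N + (lam : ℂ) • W N ω) ψ t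
                  - Real.exp (-(2 * Real.pi * ρ₀ E₀ * lam ^ 2 * t))|
                - K * Echo.errorTerm lam t Δ (ε₀ N)))
            (fun N _ _ => C t lam / Real.sqrt N)) ∧
      -- the error term vanishes in the iterated limit `Δ → 0` after `t → ∞, λ → 0, λ² t ≤ T`
      -- after `N → ∞`
      (∀ ε₀ : ℕ → ℝ, Echo.IsErrorSeq ε₀ → ∀ T : ℝ, 0 < T → ∀ ε : ℝ, 0 < ε →
        ∀ᶠ Δ : ℝ in 𝓝[>] 0,
          ∀ᶠ p : ℝ × ℝ in (atTop ×ˢ 𝓝[≠] 0) ⊓ 𝓟 {p : ℝ × ℝ | p.2 ^ 2 * p.1 ≤ T},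
            ∀ᶠ N : ℕ in atTop, |Echo.errorTerm p.2 p.1 Δ (ε₀ N)| < ε) := by
  refine ⟨fun t lam => (1 + |lam| * |t|) ^ 2, fun t lam => by positivity,
    fun CH hCH Cp => ⟨?_, ?_, ?_⟩⟩
  · have key : ∀ ξ D : ℝ, ∃ n : ℕ, 0 < ξ → 0 < D → _ := fun ξ D => by
      by_cases h : 0 < ξ ∧ 0 < D
      · obtain ⟨n, hn⟩ := Echo.exists_short_time Cp CH h.1 h.2
        exact ⟨n, fun _ _ => hn⟩
      · exact ⟨0, fun h1 h2 => absurd ⟨h1, h2⟩ h⟩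
    choose N₀ hN₀ using key
    refine ⟨4 * CH + 5, N₀, by positivity, fun L hL => ⟨((1 + L) ^ 2)⁻¹, by positivity, ?_⟩⟩
    intro κ₀ c₀ _ _ ρ₀ _ A ε₀ η₀ _ _ E₀ _ Δ _ H₀ hH₀ μod μd hμ Ω _ P _ W hW lam t hlam ht ht₀
      ξ hξ D hD N hN ψ hψ
    -- on this time scale both `|lam| * t` and `lam ^ 2 * t` are at most one
    have hL2 : (1 + L) ^ 2 * t ≤ 1 := by
      rwa [inv_eq_one_div, le_div_iff₀' (by positivity)] at ht₀
    have h0 := abs_nonneg lam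
    have h1 : |lam| * t ≤ (1 + L) ^ 2 * t := by gcongr; nlinarith
    have h2 : lam ^ 2 * t ≤ (1 + L) ^ 2 * t := by
      rw [← sq_abs lam]; gcongr; linarith
    exact hN₀ ξ D hξ hD N hN hμ (hW N) (hH₀.hermitian N) (hH₀.bounded N) lam ht (h1.trans hL2)
      (h2.trans hL2) hψ.normalized
  · intro κ₀ c₀ hκ₀ hc₀
    refine ⟨Echo.goldenConst κ₀ c₀, Echo.goldenConst_pos hκ₀ hc₀, ?_⟩
    intro ρ₀ hρ₀ A ε₀ η₀ hε₀ hη₀ E₀ hE₀ Δ hΔ lam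
    have key : ∀ ξ D : ℝ, ∃ n : ℕ, 0 < ξ → 0 < D → _ := fun ξ D => by
      by_cases h : 0 < ξ ∧ 0 < D
      · obtain ⟨n, hn⟩ := Echo.exists_intermediate_time Cp (CH := CH) hκ₀ hc₀ hρ₀ A hε₀ hη₀ hE₀ hΔ
          lam h.1 h.2
        exact ⟨n, fun _ _ => hn⟩
      · exact ⟨0, fun h1 h2 => absurd ⟨h1, h2⟩ h⟩
    choose N₀ hN₀ using key
    refine ⟨N₀, ?_⟩
    intro H₀ hH₀ μod μd hμ Ω _ P _ W hW t ht ξ hξ D hD N hN ψ hψ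
    exact hN₀ ξ D hξ hD N hN hμ (hW N) hH₀ ht hψ
  · exact fun ε₀ hε₀ T hT ε hε => Echo.eventually_abs_errorTerm_lt hε₀ hT hε
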